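/- Let $M$ be a smooth real manifold of dimension $n$ (Hausdorff, $\sigma$-compact, without boundary), and let $\Omega^{\bullet}(M)$ denote its complex-valued smooth differential forms. Vector bundles are smooth complex vector bundles of finite constant rank. For a connection $\nabla$ on $E$ put $$\mathrm{ch}(\nabla)=\mathrm{Tr}\exp\Big(-\tfrac1{2\pi i}\nabla^2\Big)\in\Omega^{\rm even}(M),$$ and for two connections $\nabla_0,\nabla_1$ on $E$, with $\nabla_t=(1-t)\nabla_0+t\nabla_1$, let $$\widetilde{\mathrm{ch}}(\nabla_0,\nabla_1)=-\frac1{2\pi i}\int_0^1\mathrm{Tr}\Big((\nabla_1-\nabla_0)\exp\Big(-\tfrac1{2\pi i}\nabla_t^2\Big)\Big)dt ,$$ considered in $\Omega^{\rm odd}(M)/d\Omega^{\rm even}(M)$. For a smooth hermitian metric $h$ on $E$, the adjoint transpose $\nabla^*$ of $\nabla$ is the connection with $h(\nabla^*_v\sigma,\theta)=v.h(\sigma,\theta)-h(\sigma,\nabla_v\theta)$. Let $\widehat K_{\rm ch}(M)$ (free multiplicative $K$-theory) be the quotient of the free abelian group on triples $(E,\nabla,\alpha)$, with $\alpha\in\Omega^{\rm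 odd}(M)/d\Omega^{\rm even}(M)$, by the relations $(E_1,\nabla_1,\alpha_1)=(E_2,\nabla_2,\alpha_2)$ whenever there is a smooth isomorphism $f\colon E_1\to E_2$ with $\alpha_2=\alpha_1+\widetilde{\mathrm{ch}}(\nabla_1,f^*\nabla_2)$, and $(E_1\oplus E_2,\nabla_1\oplus\nabla_2,\alpha_1+\alpha_2)=(E_1,\nabla_1,\alpha_1)+(E_2,\nabla_2,\alpha_2)$. Then: 1. Every $E$ has a hermitian metric, every connection has an adjoint transpose with respect to every hermitian metric, and the class of $\widetilde{\mathrm{ch}}(\nabla^*,\nabla)$ in $\Omega^{\rm odd}(M)/d\Omega^{\rm even}(M)$ does not depend on the hermitian metric used to define $\nabla^*$. 2. There is a unique group morphism $\widehat{\mathrm{ch}}$ from $\widehat K_{\rm ch}(M)$ to differential forms with $\widehat{\mathrm{ch}}(E,\nabla,\alpha)=\mathrm{ch}(\nabla)-d\alpha$ for all triples; its values lie in $\Omega^{\rm even}(M)$. Let $MK^0(M)=\widehat{\mathrm{ch}}^{-1}(\mathbb Z)$, where $\mathbb Z\subset\Omega^0(M)$ are the integer constants. 3. There is a unique group morphism $\mathfrak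 B$ from $\widehat K_{\rm ch}(M)$ to forms modulo $d\Omega^{\rm even}(M)$ with $$\mathfrak B(E,\nabla,\alpha)=\widetilde{\mathrm{ch}}(\nabla^*,\nabla)-\alpha+\overline\alpha$$ for all triples and all hermitian metrics. Its values are classes of purely imaginary forms in $\Omega^{\rm odd}(M)/d\Omega^{\rm even}(M)$. 4. $d\,\mathfrak B(x)=2i\,\mathrm{Im}\,\widehat{\mathrm{ch}}(x)$, as an equality of differential forms, for every $x\in\widehat K_{\rm ch}(M)$. 5. $\mathfrak B$ sends $MK^0(M)$ into $iH^{\rm odd}(M,\mathbb R)$, that is, into the classes $[i\beta]$ with $\beta$ a closed real odd form. 6. Let $\nabla$ be a flat connection on $E$. Then $(E,\nabla,0)\in MK^0(M)$. For a hermitian metric and $\theta=\nabla^*-\nabla$, the Bismut–Lott forms $$c_{2j+1}(E)=(2\pi i)^{-j}\,2^{-(2j+1)}\,\mathrm{Tr}\big(\theta^{2j+1}\big),\qquad j\ge 0,$$ are real closed forms of degree $2j+1$, whose classes modulo exact forms do not depend on the metric, and $$\mathfrak B(E,\nabla,0)=\frac1{i\pi}\sum_{j\ge0}\frac{2^{2j}\,j!}{(2j+1)!}\,[c_{2j+1}(E)]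 .$$ -/

import Mathlib

open scoped TensorProduct Manifold ContDiff Bundle

noncomputable section

/-! ### Complex exterior forms on a real vector space -/

/-- The algebra `ℂ ⊗ Λ^• T*` of complex valued exterior forms on the real vector space `T`;
its multiplication is the wedge product. -/
abbrev CForms (T : Type*) [AddCommGroup T] [Module ℝ T] : Type _ :=
  ℂ ⊗[ℝ] ExteriorAlgebra ℝ (Module.Dual ℝ T)

namespace CForms

section Algebraic

variable {T T' : Type*} [AddCommGroup T] [Module ℝ T] [AddCommGroup T'] [Module ℝ T']

/-- A real linear form, as a complex exterior form of degree one. -/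
def ofReal (φ : Module.Dual ℝ T) : CForms T :=
  (1 : ℂ) ⊗ₜ[ℝ] ExteriorAlgebra.ι ℝ φ

/-- The complex valued linear form `φ + i ψ`, as a complex exterior form of degree one. -/
def ofReIm (φ ψ : Module.Dual ℝ T) : CForms T :=
  ofReal φ + Complex.I • ofReal ψ

/-- Pullback of exterior forms by a linear map. -/
def pull (L : T →ₗ[ℝ] T') : CForms T' →ₐ[ℂ] CForms T :=
  Algebra.TensorProduct.map (AlgHom.id ℂ ℂ) (ExteriorAlgebra.map L.dualMap)

/-- Complex conjugation of exterior forms. -/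
def conj : CForms T →ₛₗ[starRingEnd ℂ] CForms T where
  toFun := Algebra.TensorProduct.map (Complex.conjAe : ℂ →ₐ[ℝ] ℂ)
    (AlgHom.id ℝ (ExteriorAlgebra ℝ (Module.Dual ℝ T)))
  map_add' := map_add _
  map_smul' c z := by
    induction z using TensorProduct.induction_on with
    | zero => simp
    | tmul a b => simp [TensorProduct.smul_tmul']
    | add a b ha hb => simp only [smul_add, map_add, ha, hb]

/-- The exterior forms of degree `k`. -/
def degree (T : Type*) [AddCommGroup T] [Module ℝ T] (k : ℕ) : Submodule ℂ (CForms T) :=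
  (⋀[ℝ]^k (Module.Dual ℝ T)).baseChange ℂ

/-- The exterior forms of even degree. -/
def even (T : Type*) [AddCommGroup T] [Module ℝ T] : Submodule ℂ (CForms T) :=
  ⨆ j : ℕ, degree T (2 * j)

/-- The exterior forms of odd degree. -/
def odd (T : Type*) [AddCommGroup T] [Module ℝ T] : Submodule ℂ (CForms T) :=
  ⨆ j : ℕ, degree T (2 * j + 1)

theorem conj_tmul (a : ℂ) (b : ExteriorAlgebra ℝ (Module.Dual ℝ T)) :
    conj (a ⊗ₜ[ℝ] b : CForms T) = (starRingEnd ℂ a) ⊗ₜ[ℝ] b := rfl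

theorem conj_mul (z w : CForms T) : conj (z * w) = conj z * conj w :=
  map_mul (Algebra.TensorProduct.map (Complex.conjAe : ℂ →ₐ[ℝ] ℂ)
    (AlgHom.id ℝ (ExteriorAlgebra ℝ (Module.Dual ℝ T)))) z w

theorem conj_ofReal (φ : Module.Dual ℝ T) : conj (ofReal φ) = ofReal φ := by
  simp [ofReal, conj_tmul]

theorem pull_conj (L : T →ₗ[ℝ] T') (z : CForms T') : pull L (conj z) = conj (pull L z) := by
  induction z using TensorProduct.induction_on with
  | zero => simp
  | tmul a b => simp [pull, conj_tmul]
  | add a b ha hb => simp only [map_add, ha, hb]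

theorem conj_mem_degree {k : ℕ} {z : CForms T} (hz : z ∈ degree T k) : conj z ∈ degree T k := by
  rw [degree, Submodule.baseChange_eq_span] at hz ⊢
  induction hz using Submodule.span_induction with
  | mem w hw =>
    obtain ⟨b, hb, rfl⟩ := hw
    refine Submodule.subset_span ⟨b, hb, ?_⟩
    simp [conj_tmul]
  | zero => simp
  | add a b _ _ ha hb => rw [map_add]; exact Submodule.add_mem _ ha hb
  | smul c a _ ha => rw [map_smulₛₗ]; exact Submodule.smul_mem _ _ ha

theorem conj_mem_even {z : CForms T} (hz : z ∈ even T) : conj z ∈ even T := by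
  unfold even at hz ⊢
  refine Submodule.iSup_induction _ (motive := fun w ↦ conj w ∈ ⨆ j : ℕ, degree T (2 * j)) hz
    (fun j w hw ↦ Submodule.mem_iSup_of_mem j (conj_mem_degree hw)) (by simp)
    (fun a b ha hb ↦ by rw [map_add]; exact Submodule.add_mem _ ha hb)

theorem conj_mem_odd {z : CForms T} (hz : z ∈ odd T) : conj z ∈ odd T := by
  unfold odd at hz ⊢
  refine Submodule.iSup_induction _ (motive := fun w ↦ conj w ∈ ⨆ j : ℕ, degree T (2 * j + 1)) hz
    (fun j w hw ↦ Submodule.mem_iSup_of_mem j (conj_mem_degree hw)) (by simp)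
    (fun a b ha hb ↦ by rw [map_add]; exact Submodule.add_mem _ ha hb)

end Algebraic

section Normed

variable (T : Type*) [AddCommGroup T] [Module ℝ T] [FiniteDimensional ℝ T]

instance : Module.Finite ℝ (ExteriorAlgebra ℝ (Module.Dual ℝ T)) :=
  Module.Finite.of_basis (Module.finBasis ℝ (Module.Dual ℝ T)).ExteriorAlgebra

/-- A norm on the finite dimensional space of exterior forms (any two norms are equivalent). -/
instance : NormedAddCommGroup (CForms T) :=
  NormedAddCommGroup.induced (CForms T) (Fin (Module.finrank ℝ (CForms T)) → ℝ)
    (Module.finBasis ℝ (CForms T)).equivFun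
    (Module.finBasis ℝ (CForms T)).equivFun.injective

instance : NormedSpace ℝ (CForms T) :=
  NormedSpace.induced ℝ (CForms T) (Fin (Module.finrank ℝ (CForms T)) → ℝ)
    (Module.finBasis ℝ (CForms T)).equivFun

end Normed

end CForms

/-! ### Complex differential forms on a manifold -/

section Forms

variable (n : ℕ) (M : Type*) [TopologicalSpace M] [ChartedSpace (EuclideanSpace ℝ (Fin n)) M]

instance (x : M) : FiniteDimensional ℝ (TangentSpace (𝓡 n) x) :=
  inferInstanceAs (FiniteDimensional ℝ (EuclideanSpace ℝ (Fin n)))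

/-- Fields of complex exterior forms (of mixed degree) on `M`, without any regularity. -/
abbrev FormField : Type _ := ∀ x : M, CForms (TangentSpace (𝓡 n) x)

variable {n M}

/-- The derivative at `y` of the inverse of the chart at `p`. -/
def chartSymmDeriv (p : M) (y : EuclideanSpace ℝ (Fin n)) :
    EuclideanSpace ℝ (Fin n) →L[ℝ] TangentSpace (𝓡 n) ((extChartAt (𝓡 n) p).symm y) :=
  (mfderiv 𝓘(ℝ, EuclideanSpace ℝ (Fin n)) (𝓡 n) (extChartAt (𝓡 n) p).symm y).comp
    (NormedSpace.fromTangentSpace y).symm.toContinuousLinearMap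

/-- The derivative at `p` of the chart at `p`. -/
def chartDeriv (p : M) : TangentSpace (𝓡 n) p →L[ℝ] EuclideanSpace ℝ (Fin n) :=
  mvfderiv (𝓡 n) (extChartAt (𝓡 n) p) p

/-- The expression of a field of exterior forms in the chart at `p`. -/
def FormField.inChart (α : FormField n M) (p : M) (y : EuclideanSpace ℝ (Fin n)) :
    CForms (EuclideanSpace ℝ (Fin n)) :=
  CForms.pull (chartSymmDeriv p y).toLinearMap (α ((extChartAt (𝓡 n) p).symm y))

/-- Smoothness of a differential form. -/
def FormField.IsSmooth (α : FormField n M) : Prop :=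
  ∀ p : M, ContDiffOn ℝ ∞ (α.inChart p) (extChartAt (𝓡 n) p).target

/-- The exterior derivative `∑ᵢ dxⁱ ∧ ∂ᵢ α` on Euclidean space. -/
def euclideanExtDeriv (α : EuclideanSpace ℝ (Fin n) → CForms (EuclideanSpace ℝ (Fin n)))
    (y : EuclideanSpace ℝ (Fin n)) : CForms (EuclideanSpace ℝ (Fin n)) :=
  ∑ i : Fin n, CForms.ofReal ((EuclideanSpace.basisFun (Fin n) ℝ).toBasis.coord i) *
    fderiv ℝ α y (EuclideanSpace.single i 1)

/-- The exterior derivative on `M`: at `p` it is computed in the chart at `p`. -/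
def FormField.extD (α : FormField n M) : FormField n M := fun p ↦
  CForms.pull (chartDeriv p).toLinearMap
    (euclideanExtDeriv (α.inChart p) (extChartAt (𝓡 n) p p))

/-- Complex conjugation of differential forms. -/
def FormField.conj : FormField n M →ₛₗ[starRingEnd ℂ] FormField n M where
  toFun α x := CForms.conj (α x)
  map_add' α η := by ext x; simp
  map_smul' c α := by ext x; simp

/-- The imaginary part `(α - ᾱ) / 2i`. -/
def FormField.im (α : FormField n M) : FormField n M :=
  (1 / (2 * Complex.I)) • (α - FormField.conj α)

theorem FormField.inChart_add (α η : FormField n M) (p : M) :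
    (α + η).inChart p = α.inChart p + η.inChart p := by
  funext y; exact map_add (CForms.pull (chartSymmDeriv p y).toLinearMap) _ _

theorem FormField.inChart_smul (c : ℂ) (α : FormField n M) (p : M) :
    (c • α).inChart p = fun y ↦ c • α.inChart p y := by
  funext y
  exact map_smul (CForms.pull (chartSymmDeriv p y).toLinearMap) c
    (α ((extChartAt (𝓡 n) p).symm y))

theorem FormField.inChart_conj (α : FormField n M) (p : M) :
    (FormField.conj α).inChart p = fun y ↦ CForms.conj (α.inChart p y) := by
  ext y; exact CForms.pull_conj _ _

/-- Multiplication by a complex number, as a continuous real linear map. -/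
def CForms.smulL (c : ℂ) : CForms (EuclideanSpace ℝ (Fin n)) →L[ℝ]
    CForms (EuclideanSpace ℝ (Fin n)) :=
  LinearMap.toContinuousLinearMap
    { toFun := fun z ↦ c • z
      map_add' := smul_add c
      map_smul' := fun r z ↦ (smul_comm r c z).symm }

/-- Conjugation, as a continuous real linear map. -/
def CForms.conjL : CForms (EuclideanSpace ℝ (Fin n)) →L[ℝ] CForms (EuclideanSpace ℝ (Fin n)) :=
  LinearMap.toContinuousLinearMap
    (Algebra.TensorProduct.map (Complex.conjAe : ℂ →ₐ[ℝ] ℂ)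
      (AlgHom.id ℝ (ExteriorAlgebra ℝ (Module.Dual ℝ (EuclideanSpace ℝ (Fin n)))))).toLinearMap

theorem FormField.IsSmooth.add {α η : FormField n M} (hα : α.IsSmooth) (hη : η.IsSmooth) :
    (α + η).IsSmooth := fun p ↦ by
  rw [FormField.inChart_add]; exact (hα p).add (hη p)

theorem FormField.IsSmooth.smul (c : ℂ) {α : FormField n M} (hα : α.IsSmooth) :
    (c • α).IsSmooth := fun p ↦ by
  rw [FormField.inChart_smul]
  exact (CForms.smulL c).contDiff.comp_contDiffOn (hα p)

theorem FormField.IsSmooth.conj {α : FormField n M} (hα : α.IsSmooth) :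
    (FormField.conj α).IsSmooth := fun p ↦ by
  rw [FormField.inChart_conj]
  exact CForms.conjL.contDiff.comp_contDiffOn (hα p)

theorem FormField.isSmooth_zero : (0 : FormField n M).IsSmooth := fun p ↦ by
  have : (0 : FormField n M).inChart p = fun _ ↦ 0 := by
    funext y; exact map_zero (CForms.pull (chartSymmDeriv p y).toLinearMap)
  rw [this]; exact contDiffOn_const

theorem FormField.IsSmooth.differentiableAt {α : FormField n M} (hα : α.IsSmooth) (p : M) :
    DifferentiableAt ℝ (α.inChart p) (extChartAt (𝓡 n) p p) :=
  ((hα p).differentiableOn (by simp)).differentiableAt (extChartAt_target_mem_nhds p)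

theorem FormField.extD_add {α η : FormField n M} (hα : α.IsSmooth) (hη : η.IsSmooth) :
    (α + η).extD = α.extD + η.extD := by
  funext p
  simp only [FormField.extD, Pi.add_apply, ← map_add]
  congr 1
  simp only [euclideanExtDeriv, FormField.inChart_add,
    fderiv_add (hα.differentiableAt p) (hη.differentiableAt p), add_apply,
    mul_add, Finset.sum_add_distrib]

theorem FormField.extD_smul (c : ℂ) {α : FormField n M} (hα : α.IsSmooth) :
    (c • α).extD = c • α.extD := by
  funext p
  simp only [FormField.extD, Pi.smul_apply, ← map_smul]
  congr 1
  have h : fderiv ℝ (fun y ↦ c • α.inChart p y) (extChartAt (𝓡 n) p p) =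
      (CForms.smulL c).comp (fderiv ℝ (α.inChart p) (extChartAt (𝓡 n) p p)) :=
    ((CForms.smulL c).hasFDerivAt.comp _ (hα.differentiableAt p).hasFDerivAt).fderiv
  simp only [euclideanExtDeriv, FormField.inChart_smul, h, Finset.smul_sum]
  refine Finset.sum_congr rfl fun i _ ↦ ?_
  rw [← mul_smul_comm]; rfl

theorem FormField.extD_zero : (0 : FormField n M).extD = 0 := by
  simpa using FormField.extD_smul (0 : ℂ) (FormField.isSmooth_zero (n := n) (M := M))

theorem FormField.extD_conj {α : FormField n M} (hα : α.IsSmooth) :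
    (FormField.conj α).extD = FormField.conj α.extD := by
  funext p
  change CForms.pull _ _ = CForms.conj (CForms.pull _ _)
  rw [← CForms.pull_conj]
  congr 1
  have h : fderiv ℝ (fun y ↦ CForms.conj (α.inChart p y)) (extChartAt (𝓡 n) p p) =
      CForms.conjL.comp (fderiv ℝ (α.inChart p) (extChartAt (𝓡 n) p p)) :=
    (CForms.conjL.hasFDerivAt.comp _ (hα.differentiableAt p).hasFDerivAt).fderiv
  simp only [euclideanExtDeriv, FormField.inChart_conj, h, map_sum, CForms.conj_mul,
    CForms.conj_ofReal]
  rfl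

variable (n M)

/-- `Ω^even(M, ℂ)`. -/
def evenForms : Submodule ℂ (FormField n M) where
  carrier := {α | α.IsSmooth ∧ ∀ x, α x ∈ CForms.even (TangentSpace (𝓡 n) x)}
  add_mem' h h' := ⟨h.1.add h'.1, fun x ↦ Submodule.add_mem _ (h.2 x) (h'.2 x)⟩
  zero_mem' := ⟨FormField.isSmooth_zero, fun _ ↦ Submodule.zero_mem _⟩
  smul_mem' c _ h := ⟨h.1.smul c, fun x ↦ Submodule.smul_mem _ c (h.2 x)⟩

/-- `Ω^odd(M, ℂ)`. -/
def oddForms : Submodule ℂ (FormField n M) where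
  carrier := {α | α.IsSmooth ∧ ∀ x, α x ∈ CForms.odd (TangentSpace (𝓡 n) x)}
  add_mem' h h' := ⟨h.1.add h'.1, fun x ↦ Submodule.add_mem _ (h.2 x) (h'.2 x)⟩
  zero_mem' := ⟨FormField.isSmooth_zero, fun _ ↦ Submodule.zero_mem _⟩
  smul_mem' c _ h := ⟨h.1.smul c, fun x ↦ Submodule.smul_mem _ c (h.2 x)⟩

/-- `d Ω^even(M, ℂ)`, the exact odd forms. -/
def exactOddForms : Submodule ℂ (FormField n M) where
  carrier := {α | ∃ η ∈ evenForms n M, FormField.extD η = α}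
  add_mem' := by
    rintro _ _ ⟨η, hη, rfl⟩ ⟨θ, hθ, rfl⟩
    exact ⟨η + θ, Submodule.add_mem _ hη hθ, FormField.extD_add hη.1 hθ.1⟩
  zero_mem' := ⟨0, Submodule.zero_mem _, FormField.extD_zero⟩
  smul_mem' := by
    rintro c _ ⟨η, hη, rfl⟩
    exact ⟨c • η, Submodule.smul_mem _ c hη, FormField.extD_smul c hη.1⟩

/-- All fields of forms modulo `d Ω^even(M, ℂ)`. It contains `Ω^odd / d Ω^even`. -/
abbrev FormsModExact : Type _ := FormField n M ⧸ exactOddForms n M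

variable {n M}

/-- The class of a form modulo `d Ω^even(M, ℂ)`. -/
def formClass : FormField n M →ₗ[ℂ] FormsModExact n M := (exactOddForms n M).mkQ

/-- Complex conjugation modulo exact forms. -/
def FormsModExact.conj : FormsModExact n M →ₛₗ[starRingEnd ℂ] FormsModExact n M :=
  Submodule.mapQ _ _ FormField.conj (by
    rintro _ ⟨η, hη, rfl⟩
    exact ⟨FormField.conj η, ⟨hη.1.conj, fun x ↦ CForms.conj_mem_even (hη.2 x)⟩,
      FormField.extD_conj hη.1⟩)

variable (n M)

/-- `Ω^odd(M, ℂ) / d Ω^even(M, ℂ)`. -/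
def oddClasses : Submodule ℂ (FormsModExact n M) := (oddForms n M).map formClass

/-- The real odd forms. -/
def realOddForms : AddSubgroup (FormField n M) where
  carrier := {β | β ∈ oddForms n M ∧ FormField.conj β = β}
  add_mem' h h' := ⟨Submodule.add_mem _ h.1 h'.1, by rw [map_add, h.2, h'.2]⟩
  zero_mem' := ⟨Submodule.zero_mem _, map_zero _⟩
  neg_mem' h := ⟨Submodule.neg_mem _ h.1, by rw [map_neg, h.2]⟩

/-- The closed real odd forms. -/
def closedRealOddForms : AddSubgroup (FormField n M) where
  carrier := {β | β ∈ realOddForms n M ∧ β.extD = 0}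
  add_mem' h h' := ⟨AddSubgroup.add_mem _ h.1 h'.1, by
    rw [FormField.extD_add h.1.1.1 h'.1.1.1, h.2, h'.2, add_zero]⟩
  zero_mem' := ⟨AddSubgroup.zero_mem _, FormField.extD_zero⟩
  neg_mem' {β} h := ⟨AddSubgroup.neg_mem _ h.1, by
    have := FormField.extD_smul (-1 : ℂ) h.1.1.1
    rw [h.2] at this
    simpa using this⟩

/-- The additive map sending a form `β` to the class of `i β`. -/
def iFormClass : FormField n M →+ FormsModExact n M :=
  (Complex.I • (formClass : FormField n M →ₗ[ℂ] FormsModExact n M)).toAddMonoidHom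

/-- The purely imaginary odd forms modulo exact forms. -/
def imaginaryOddClasses : AddSubgroup (FormsModExact n M) :=
  (realOddForms n M).map (iFormClass n M)

/-- `i H^odd(M, ℝ)`, inside the odd forms modulo exact forms. -/
def iRealOddCohomology : AddSubgroup (FormsModExact n M) :=
  (closedRealOddForms n M).map (iFormClass n M)

end Forms

/-! ### Complex vector bundles, connections, metrics -/

/-- A smooth complex vector bundle of finite (constant) rank on the real manifold `M`, with typical
fibre `F` and fibres `V x`. Its local trivialisations are fibrewise `ℂ`-linear, and the changes of
trivialisation are smooth over `ℝ`. (Every such bundle on `M` is isomorphic to one whose fibres live in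
`Type`.) -/
structure CBundle (n : ℕ) (M : Type*) [TopologicalSpace M]
    [ChartedSpace (EuclideanSpace ℝ (Fin n)) M] where
  F : Type
  V : M → Type
  [normedF : NormedAddCommGroup F]
  [spaceF : NormedSpace ℂ F]
  [finF : FiniteDimensional ℂ F]
  [topTotal : TopologicalSpace (Bundle.TotalSpace F V)]
  [addV : ∀ x, AddCommGroup (V x)]
  [modV : ∀ x, Module ℂ (V x)]
  [topV : ∀ x, TopologicalSpace (V x)]
  [topAddV : ∀ x, IsTopologicalAddGroup (V x)]
  [contSMulV : ∀ x, ContinuousSMul ℂ (V x)]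
  [fiberBundle : FiberBundle F V]
  [vectorBundle : VectorBundle ℂ F V]
  [realVectorBundle : VectorBundle ℝ F V]
  [smoothBundle : ContMDiffVectorBundle ∞ F V (𝓡 n)]

attribute [instance] CBundle.normedF CBundle.spaceF CBundle.finF CBundle.topTotal CBundle.addV
  CBundle.modV CBundle.topV CBundle.topAddV CBundle.contSMulV CBundle.fiberBundle
  CBundle.vectorBundle CBundle.realVectorBundle CBundle.smoothBundle

section Bundles

variable {n : ℕ} {M : Type*} [TopologicalSpace M] [ChartedSpace (EuclideanSpace ℝ (Fin n)) M]

instance (E : CBundle n M) (x : M) : ContinuousSMul ℝ (E.V x) := IsScalarTower.continuousSMul ℂ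

/-- The rank. -/
def CBundle.rank (E : CBundle n M) : ℕ := Module.finrank ℂ E.F

/-- The total space map of a section. -/
abbrev CBundle.toTotal (E : CBundle n M) (σ : ∀ x, E.V x) (x : M) : Bundle.TotalSpace E.F E.V :=
  Bundle.TotalSpace.mk' E.F x (σ x)

/-- Smoothness of a section on a set. -/
abbrev CBundle.SmoothOn (E : CBundle n M) (σ : ∀ x, E.V x) (U : Set M) : Prop :=
  ContMDiffOn (𝓡 n) ((𝓡 n).prod 𝓘(ℝ, E.F)) ∞ (E.toTotal σ) U

/-- Differentiability of a section at a point. -/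
abbrev CBundle.DiffAt (E : CBundle n M) (σ : ∀ x, E.V x) (x : M) : Prop :=
  MDifferentiableAt (𝓡 n) ((𝓡 n).prod 𝓘(ℝ, E.F)) (E.toTotal σ) x

/-- The type of the operators `σ ↦ ∇ σ`. -/
abbrev CBundle.Op (E : CBundle n M) : Type _ :=
  (∀ x, E.V x) → ∀ x, TangentSpace (𝓡 n) x →L[ℝ] E.V x

/-- The direct sum of vector bundles. -/
def CBundle.sum [IsManifold (𝓡 n) ∞ M] (E E' : CBundle n M) : CBundle n M where
  F := E.F × E'.F
  V := E.V ×ᵇ E'.V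

/-- A smooth isomorphism of vector bundles. -/
structure CBundle.Iso (E E' : CBundle n M) where
  equiv : ∀ x, E.V x ≃L[ℂ] E'.V x
  smooth : ContMDiff ((𝓡 n).prod 𝓘(ℝ, E.F)) ((𝓡 n).prod 𝓘(ℝ, E'.F)) ∞
    (fun p : Bundle.TotalSpace E.F E.V ↦ Bundle.TotalSpace.mk' E'.F p.1 (equiv p.1 p.2))
  smooth_symm : ContMDiff ((𝓡 n).prod 𝓘(ℝ, E'.F)) ((𝓡 n).prod 𝓘(ℝ, E.F)) ∞
    (fun p : Bundle.TotalSpace E'.F E'.V ↦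
      Bundle.TotalSpace.mk' E.F p.1 ((equiv p.1).symm p.2))

/-- The pullback `f^* ∇ = f⁻¹ ∘ ∇ ∘ f` of a connection by an isomorphism of vector bundles. -/
def CBundle.Iso.pullOp {E E' : CBundle n M} (f : E.Iso E') (D : E'.Op) : E.Op := fun σ x ↦
  (((f.equiv x).symm : E'.V x →L[ℂ] E.V x).restrictScalars ℝ).comp
    (D (fun y ↦ f.equiv y (σ y)) x)

/-- A smooth hermitian metric, linear in the first and antilinear in the second variable. -/
structure HermitianMetric (E : CBundle n M) where
  form : ∀ x, E.V x →ₗ[ℂ] E.V x →ₗ⋆[ℂ] ℂ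
  conj_symm : ∀ x u v, form x v u = starRingEnd ℂ (form x u v)
  pos : ∀ x u, u ≠ 0 → 0 < (form x u u).re
  smooth : ∀ (U : Set M) (σ τ : ∀ x, E.V x), IsOpen U → E.SmoothOn σ U → E.SmoothOn τ U →
    ContMDiffOn (𝓡 n) 𝓘(ℝ, ℂ) ∞ (fun x ↦ form x (σ x) (τ x)) U

variable [IsManifold (𝓡 n) ∞ M]

/-- A smooth connection on a complex vector bundle: a smooth covariant derivative which is
linear over the complex numbers. -/
structure Connection (E : CBundle n M) extends CovariantDerivative (𝓡 n) E.F E.V where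
  map_smul : ∀ (c : ℂ) (σ : ∀ x, E.V x) (x : M) (v : TangentSpace (𝓡 n) x), E.DiffAt σ x →
    toFun (fun y ↦ c • σ y) x v = c • toFun σ x v
  smooth : CovariantDerivative.ContMDiffCovariantDerivative toCovariantDerivative ∞

/-- `D'` is the adjoint transpose of `D` with respect to `h`:
`h(D'_v σ, θ) = v.h(σ, θ) - h(σ, D_v θ)`. -/
def IsAdjointConnection {E : CBundle n M} (h : HermitianMetric E) (D D' : Connection E) : Prop :=
  ∀ (x : M) (σ θ : ∀ x, E.V x) (v : TangentSpace (𝓡 n) x), E.DiffAt σ x → E.DiffAt θ x →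
    h.form x (D'.toFun σ x v) (θ x) =
      mvfderiv (𝓡 n) (fun y ↦ h.form y (σ y) (θ y)) x v - h.form x (σ x) (D.toFun θ x v)

theorem CBundle.DiffAt.fst {E E' : CBundle n M} {σ : ∀ x, (E.sum E').V x} {x : M}
    (h : (E.sum E').DiffAt σ x) : E.DiffAt (fun y ↦ (σ y).1) x := by
  have h' := (mdifferentiableAt_section (𝓡 n) (F := E.F × E'.F) (E := E.V ×ᵇ E'.V) σ).1 h
  exact (mdifferentiableAt_section (𝓡 n) (F := E.F) (E := E.V) _).2
    ((ContinuousLinearMap.fst ℝ E.F E'.F).mdifferentiableAt.comp x h')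

theorem CBundle.DiffAt.snd {E E' : CBundle n M} {σ : ∀ x, (E.sum E').V x} {x : M}
    (h : (E.sum E').DiffAt σ x) : E'.DiffAt (fun y ↦ (σ y).2) x := by
  have h' := (mdifferentiableAt_section (𝓡 n) (F := E.F × E'.F) (E := E.V ×ᵇ E'.V) σ).1 h
  exact (mdifferentiableAt_section (𝓡 n) (F := E'.F) (E := E'.V) _).2
    ((ContinuousLinearMap.snd ℝ E.F E'.F).mdifferentiableAt.comp x h')

/-- The direct sum of two connections. -/
def Connection.sum {E E' : CBundle n M} (D : Connection E) (D' : Connection E') :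
    Connection (E.sum E') where
  toFun σ x := (D.toFun (fun y ↦ (σ y).1) x).prod (D'.toFun (fun y ↦ (σ y).2) x)
  isCovariantDerivativeOnUniv :=
    { add := by
        intro σ τ x hσ hτ _
        have h1 := D.isCovariantDerivativeOnUniv.add (x := x)
          (CBundle.DiffAt.fst hσ) (CBundle.DiffAt.fst hτ)
        have h2 := D'.isCovariantDerivativeOnUniv.add (x := x)
          (CBundle.DiffAt.snd hσ) (CBundle.DiffAt.snd hτ)
        ext v
        · exact DFunLike.congr_fun h1 v
        · exact DFunLike.congr_fun h2 v
      leibniz := by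
        intro σ g x hσ hg _
        have h1 := D.isCovariantDerivativeOnUniv.leibniz (x := x) (CBundle.DiffAt.fst hσ) hg
        have h2 := D'.isCovariantDerivativeOnUniv.leibniz (x := x) (CBundle.DiffAt.snd hσ) hg
        ext v
        · exact DFunLike.congr_fun h1 v
        · exact DFunLike.congr_fun h2 v }
  map_smul c σ x v hσ := Prod.ext (D.map_smul c _ x v (CBundle.DiffAt.fst hσ))
    (D'.map_smul c _ x v (CBundle.DiffAt.snd hσ))
  smooth := by
    refine ⟨⟨fun {σ} hσ x hx ↦ ?_⟩⟩
    have e : (∞ + 1 : WithTop ℕ∞) = ∞ := rfl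
    rw [e] at hσ
    have hf : ContMDiff (𝓡 n) ((𝓡 n).prod 𝓘(ℝ, E.F)) ∞ (E.toTotal fun y ↦ (σ y).1) :=
      fun y ↦ ((trivializationAt E.F E.V y).contMDiffAt_section_iff
        (FiberBundle.mem_baseSet_trivializationAt' y)).2
        ((ContinuousLinearMap.fst ℝ E.F E'.F).contMDiff.contMDiffAt.comp y
          (((trivializationAt (E.F × E'.F) (E.V ×ᵇ E'.V) y).contMDiffAt_section_iff
            (FiberBundle.mem_baseSet_trivializationAt' y)).1 (contMDiffOn_univ.1 hσ y)))
    have hs : ContMDiff (𝓡 n) ((𝓡 n).prod 𝓘(ℝ, E'.F)) ∞ (E'.toTotal fun y ↦ (σ y).2) :=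
      fun y ↦ ((trivializationAt E'.F E'.V y).contMDiffAt_section_iff
        (FiberBundle.mem_baseSet_trivializationAt' y)).2
        ((ContinuousLinearMap.snd ℝ E.F E'.F).contMDiff.contMDiffAt.comp y
          (((trivializationAt (E.F × E'.F) (E.V ×ᵇ E'.V) y).contMDiffAt_section_iff
            (FiberBundle.mem_baseSet_trivializationAt' y)).1 (contMDiffOn_univ.1 hσ y)))
    have h1 := (contMDiffAt_hom_bundle _).1
      (contMDiffOn_univ.1 (D.smooth.contMDiff.contMDiff (e ▸ hf.contMDiffOn)) x)
    have h2 := (contMDiffAt_hom_bundle _).1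
      (contMDiffOn_univ.1 (D'.smooth.contMDiff.contMDiff (e ▸ hs.contMDiffOn)) x)
    refine ContMDiffAt.contMDiffWithinAt ((contMDiffAt_hom_bundle _).2 ⟨contMDiffAt_id, ?_⟩)
    have h3 := h1.2.prodMk_space h2.2
    let P : ((EuclideanSpace ℝ (Fin n) →L[ℝ] E.F) × (EuclideanSpace ℝ (Fin n) →L[ℝ] E'.F)) →L[ℝ]
        (EuclideanSpace ℝ (Fin n) →L[ℝ] E.F × E'.F) :=
      (ContinuousLinearMap.prodₗᵢ (E := EuclideanSpace ℝ (Fin n)) (F := E.F) (G := E'.F)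
        (𝕜 := ℝ) ℝ).toContinuousLinearEquiv.toContinuousLinearMap
    have h4 := P.contMDiff.contMDiffAt.comp x h3
    refine h4.congr_of_eventuallyEq ?_
    filter_upwards [(trivializationAt E.F E.V x).open_baseSet.mem_nhds
      (FiberBundle.mem_baseSet_trivializationAt' x),
      (trivializationAt E'.F E'.V x).open_baseSet.mem_nhds
      (FiberBundle.mem_baseSet_trivializationAt' x)] with y hy hy'
    refine ContinuousLinearMap.ext fun v ↦ ?_
    have hp : y ∈ (trivializationAt (E.F × E'.F) (E.V ×ᵇ E'.V) x).baseSet := ⟨hy, hy'⟩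
    refine (Bundle.Trivialization.continuousLinearMapAt_apply_of_mem ℝ _ hp _).trans ?_
    exact Prod.ext
      (Bundle.Trivialization.continuousLinearMapAt_apply_of_mem ℝ _ hy _).symm
      (Bundle.Trivialization.continuousLinearMapAt_apply_of_mem ℝ _ hy' _).symm

end Bundles

/-! ### Chern-Weil and Chern-Simons forms -/

section ChernWeil

variable {n : ℕ} {M : Type*} [TopologicalSpace M] [ChartedSpace (EuclideanSpace ℝ (Fin n)) M]

/-- The local frame `s₁, …, s_r` of `E` given by the trivialisation at `p` (zero outside of its
domain). -/
def CBundle.frame (E : CBundle n M) (p : M) (j : Fin E.rank) (x : M) : E.V x :=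
  (trivializationAt E.F E.V p).symm x (Module.finBasis ℂ E.F j)

/-- The `i`-th coordinate in the frame given by the trivialisation at `p`. -/
def CBundle.frameCoord (E : CBundle n M) (p : M) (i : Fin E.rank) (x : M) : E.V x →ₗ[ℂ] ℂ :=
  (Module.finBasis ℂ E.F).coord i ∘ₗ (trivializationAt E.F E.V p).linearMapAt ℂ x

/-- The matrix `A` of one-forms of a connection in the frame given by the trivialisation at `p`:
`∇ s_j = ∑ᵢ A_ij s_i`. -/
def CBundle.connMatrix (E : CBundle n M) (D : E.Op) (p : M) :
    Matrix (Fin E.rank) (Fin E.rank) (FormField n M) :=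
  Matrix.of fun i j x ↦
    let a : TangentSpace (𝓡 n) x →ₗ[ℝ] ℂ :=
      (E.frameCoord p i x).restrictScalars ℝ ∘ₗ (D (E.frame p j) x).toLinearMap
    CForms.ofReIm (Complex.reLm ∘ₗ a) (Complex.imLm ∘ₗ a)

/-- The value at `x` of a matrix of forms. -/
def matrixAt {r : ℕ} (A : Matrix (Fin r) (Fin r) (FormField n M)) (x : M) :
    Matrix (Fin r) (Fin r) (CForms (TangentSpace (𝓡 n) x)) :=
  A.map fun a ↦ a x

/-- The value at `x` of the curvature `dA + A ∧ A`. -/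
def curvatureAt {r : ℕ} (A : Matrix (Fin r) (Fin r) (FormField n M)) (x : M) :
    Matrix (Fin r) (Fin r) (CForms (TangentSpace (𝓡 n) x)) :=
  (A.map fun a ↦ FormField.extD a x) + matrixAt A x * matrixAt A x

/-- `exp (- R / 2πi)` for a matrix `R` of two-forms on an `n`-dimensional vector space; the terms of
the exponential series with `2k > n` vanish. -/
def chernExp (n : ℕ) {T : Type*} [AddCommGroup T] [Module ℝ T] {r : ℕ}
    (R : Matrix (Fin r) (Fin r) (CForms T)) : Matrix (Fin r) (Fin r) (CForms T) :=
  ∑ k ∈ Finset.range (n + 1),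
    ((-1 / (2 * Real.pi * Complex.I)) ^ k / (k.factorial : ℂ)) • R ^ k

/-- The Chern character form `ch(∇) = Tr exp(- ∇² / 2πi)`. -/
def CBundle.ch (E : CBundle n M) (D : E.Op) : FormField n M := fun x ↦
  (chernExp n (curvatureAt (E.connMatrix D x) x)).trace

/-- The Chern-Simons form of the path `∇_t = (1 - t) ∇₀ + t ∇₁`:
`- (1 / 2πi) ∫₀¹ Tr((∇₁ - ∇₀) exp(- ∇_t² / 2πi)) dt`. -/
def CBundle.chernSimons (E : CBundle n M) (D₀ D₁ : E.Op) : FormField n M := fun x ↦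
  (-1 / (2 * Real.pi * Complex.I) : ℂ) • ∫ t in (0 : ℝ)..1,
    (matrixAt (E.connMatrix D₁ x - E.connMatrix D₀ x) x *
      chernExp n (curvatureAt
        (((1 - t : ℝ) : ℂ) • E.connMatrix D₀ x + (t : ℂ) • E.connMatrix D₁ x) x)).trace

/-- The curvature vanishes. -/
def CBundle.IsFlat (E : CBundle n M) (D : E.Op) : Prop :=
  ∀ x, curvatureAt (E.connMatrix D x) x = 0

/-- The form `c_{2j+1} = (2πi)^{-j} 2^{-(2j+1)} Tr (θ^{2j+1})` of Bismut and Lott, where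
`θ = ∇* - ∇ = (h^E)⁻¹ (∇ h^E)`; here `D` is `∇` and `D'` is `∇*`. -/
def CBundle.bismutLott (E : CBundle n M) (D D' : E.Op) (j : ℕ) : FormField n M := fun x ↦
  (((2 * Real.pi * Complex.I) ^ j * 2 ^ (2 * j + 1))⁻¹ : ℂ) •
    (matrixAt (E.connMatrix D' x - E.connMatrix D x) x ^ (2 * j + 1)).trace

end ChernWeil

/-! ### Free multiplicative K-theory -/

section KTheory

variable (n : ℕ) (M : Type*) [TopologicalSpace M] [ChartedSpace (EuclideanSpace ℝ (Fin n)) M]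
  [IsManifold (𝓡 n) ∞ M]

/-- A triple `(E, ∇, α)`, with `α` an odd form modulo exact forms. -/
structure KTriple where
  bundle : CBundle n M
  conn : Connection bundle
  form : oddClasses n M

variable {n M}

/-- The direct sum of triples. -/
def KTriple.sum (S T : KTriple n M) : KTriple n M where
  bundle := S.bundle.sum T.bundle
  conn := S.conn.sum T.conn
  form := S.form + T.form

/-- `(E₁, ∇₁, α₁)` and `(E₂, ∇₂, α₂)` are equivalent if there is an isomorphism `f : E₁ → E₂` with
`α₂ = α₁ + c̃h(∇₁, f^* ∇₂)` modulo exact forms. -/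
def KTriple.Equivalent (S T : KTriple n M) : Prop :=
  ∃ f : S.bundle.Iso T.bundle,
    (T.form : FormsModExact n M) = S.form +
      formClass (S.bundle.chernSimons S.conn.toFun (f.pullOp T.conn.toFun))

variable (n M)

/-- The relations of free multiplicative K-theory. -/
def kRelations : AddSubgroup (FreeAbelianGroup (KTriple n M)) :=
  AddSubgroup.closure
    ({z | ∃ S T : KTriple n M, S.Equivalent T ∧
        z = FreeAbelianGroup.of S - FreeAbelianGroup.of T} ∪
      {z | ∃ S T : KTriple n M,
        z = FreeAbelianGroup.of (S.sum T) - (FreeAbelianGroup.of S + FreeAbelianGroup.of T)})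

/-- The free multiplicative K-theory group `K̂_ch(M)`. -/
abbrev FreeMultK : Type _ := FreeAbelianGroup (KTriple n M) ⧸ kRelations n M

variable {n M}

/-- The class of a triple in `K̂_ch(M)`. -/
def KTriple.toK (T : KTriple n M) : FreeMultK n M :=
  QuotientAddGroup.mk (FreeAbelianGroup.of T)

/-- `φ` is the Chern character `(E, ∇, α) ↦ ch(∇) - dα` on `K̂_ch(M)`. -/
def IsChernCharacter (φ : FreeMultK n M →+ FormField n M) : Prop :=
  ∀ (T : KTriple n M) (α : FormField n M), α ∈ oddForms n M → formClass α = T.form →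
    φ T.toK = T.bundle.ch T.conn.toFun - FormField.extD α

/-- The multiplicative K-theory `MK^0(M)`: the preimage of `ℤ` by the Chern character `φ`. -/
def MK0 (φ : FreeMultK n M →+ FormField n M) : AddSubgroup (FreeMultK n M) :=
  (Int.castAddHom (FormField n M)).range.comap φ

/-- `B` is the Borel-type class: `B(E, ∇, α) = c̃h(∇*, ∇) - α + ᾱ` modulo exact forms, for `∇*` the
adjoint transpose of `∇` with respect to any hermitian metric. -/
def IsBorelClass (B : FreeMultK n M →+ FormsModExact n M) : Prop :=
  ∀ (T : KTriple n M) (h : HermitianMetric T.bundle) (D' : Connection T.bundle),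
    IsAdjointConnection h T.conn D' →
      B T.toK = formClass (T.bundle.chernSimons D'.toFun T.conn.toFun)
        - (T.form : FormsModExact n M) + FormsModExact.conj (T.form : FormsModExact n M)

end KTheory

end

/-!
The forms of the statement are differential forms on a manifold, but every argument below is
carried out in local frames, where a connection is a matrix of one-forms. On an open subset
of the manifold the relevant forms are smooth families of forms depending on two real parameters
(`LocalForms`). They make up a graded-commutative differential algebra with a conjugation and with
further commuting derivations, the derivatives in the parameters; `FormAlgebra` records just this
structure.
Over it the Chern-Weil theory is algebra of matrices: with curvature `R = dω + ω ∧ ω` one has the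
Bianchi identity (`FormAlgebra.covEven_curv`), the transgression formula
`∂ Tr Rᵏ = k d Tr (∂ω Rᵏ⁻¹)` (`FormAlgebra.pd_trace_curv_pow`), and the fact that the one-form
`Tr (∂ω Rᵏ⁻¹)` on parameter space is closed up to exact forms
(`FormAlgebra.pd_trace_sub_pd_trace`). Invariance under gauge transformations makes the local traces
agree on overlaps, so that they glue to forms on the manifold.

The Chern-Simons class is the integral of this one-form along a segment. Stokes' theorem on the
parameter square (`IsConnFam.stokes`) gives the triangle identity modulo exact forms
(`IsConnOp.csPow_triangle`), on which the compatibility of both morphisms with the relations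
defining free multiplicative K-theory rests. Additivity comes from the constant matrix `sumFrame`,
which identifies a product frame of a direct sum and makes connection matrices block diagonal.

A hermitian metric with Gram matrix `H` in a frame identifies the complex conjugate of a bundle with
its dual: `H` is a gauge transformation from the conjugate of the connection `∇` to the dual of
its adjoint (`gramL_mul_conj`). As a trace of a product is unchanged, up to sign, under transposition,
this gives the equalities of forms `conj ch(∇) = ch(∇*)` (`conj_ch`) and, for the transgressions,
`conj c̃h(∇₀, ∇₁) = c̃h(∇₀*, ∇₁*)` (`conj_chernSimons`). Since `∇** = ∇`, the class of
`c̃h(∇*, ∇)` changes sign under conjugation (`formClass_conj_representative`), and its differential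
is `ch(∇) - ch(∇*) = 2 i Im ch(∇)` (`extD_representative`). The values of `𝔅` are therefore
imaginary, and closed on classes whose character is real.

Metrics exist by a partition of unity (`HermitianMetric.nonempty`), and any two are joined by a
segment of metrics. Along it the adjoint varies by the covariant derivative of an endomorphism `ξ`
with `ξᵗ = (∂H) H⁻¹` (`pdM_adjoint`), so the integrand of the Chern-Simons form of the path of
adjoints is exact (`edge_mem_exact`), and the class does not depend on the metric
(`csPow_sub_mem_exact`).

For a flat connection with `θ = ∇* - ∇`, flatness of `∇` and of `∇*` forces the covariant
derivative of `θ` to be `-θ²`. The segment from `∇*` to `∇` has curvature `-t (1 - t) θ²`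
(`curvatureAt_seg`), and the Beta integral `∫ tʲ (1 - t)ʲ = (j!)² / (2j + 1)!` turns the
Chern-Simons form into the stated combination of Bismut-Lott forms (`csPow_flat`).
-/

set_option linter.unusedSectionVars false

noncomputable section

/-! ### Graded commutativity of complex exterior forms -/

namespace CForms

/-- The ring structure of the tensor product, as a shortcut instance: negation and multiplication are
then visibly parts of the same structure. -/
instance (priority := 10000) instRingCForms (T : Type*) [AddCommGroup T] [Module ℝ T] :
    Ring (CForms T) := Algebra.TensorProduct.instRing

section Graded

variable {T T' T'' : Type*} [AddCommGroup T] [Module ℝ T] [AddCommGroup T'] [Module ℝ T']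
  [AddCommGroup T''] [Module ℝ T'']

theorem one_tmul_algebraMap (r : ℝ) :
    ((1 : ℂ) ⊗ₜ[ℝ] algebraMap ℝ (ExteriorAlgebra ℝ (Module.Dual ℝ T)) r : CForms T) =
      algebraMap ℂ (CForms T) (r : ℂ) := by
  rw [Algebra.TensorProduct.algebraMap_apply, Algebra.algebraMap_eq_smul_one,
    TensorProduct.tmul_smul, TensorProduct.smul_tmul']
  simp

/-- The exterior forms are generated as an algebra by the real linear forms. -/
theorem induct {C : CForms T → Prop} (scalar : ∀ c : ℂ, C (algebraMap ℂ (CForms T) c))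
    (one_form : ∀ φ : Module.Dual ℝ T, C (ofReal φ)) (mul : ∀ a b, C a → C b → C (a * b))
    (add : ∀ a b, C a → C b → C (a + b)) (z : CForms T) : C z := by
  have hr : ∀ b : ExteriorAlgebra ℝ (Module.Dual ℝ T), C ((1 : ℂ) ⊗ₜ[ℝ] b) := by
    intro b
    induction b using ExteriorAlgebra.induction with
    | algebraMap r =>
      rw [one_tmul_algebraMap]; exact scalar r
    | ι φ => exact one_form φ
    | mul a b ha hb =>
      have := mul _ _ ha hb
      rwa [Algebra.TensorProduct.tmul_mul_tmul, one_mul] at this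
    | add a b ha hb => rw [TensorProduct.tmul_add]; exact add _ _ ha hb
  induction z using TensorProduct.induction_on with
  | zero => simpa using scalar 0
  | tmul a b =>
    have := mul _ _ (scalar a) (hr b)
    rwa [Algebra.TensorProduct.algebraMap_apply, Algebra.TensorProduct.tmul_mul_tmul, mul_one,
      one_mul, Algebra.algebraMap_self_apply] at this
  | add a b ha hb => exact add _ _ ha hb

@[simp] theorem pull_ofReal (L : T →ₗ[ℝ] T') (φ : Module.Dual ℝ T') :
    pull L (ofReal φ) = ofReal (φ ∘ₗ L) := by
  simp [pull, ofReal]; rfl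

theorem pull_comp (L' : T' →ₗ[ℝ] T'') (L : T →ₗ[ℝ] T') (z : CForms T'') :
    pull (L' ∘ₗ L) z = pull L (pull L' z) := by
  induction z using induct with
  | scalar c => simp only [AlgHom.commutes]
  | one_form φ => simp only [pull_ofReal]; rfl
  | mul a b ha hb => simp only [map_mul, ha, hb]
  | add a b ha hb => simp only [map_add, ha, hb]

theorem pull_id (z : CForms T) : pull LinearMap.id z = z := by
  induction z using induct with
  | scalar c => simp only [AlgHom.commutes]
  | one_form φ => simp only [pull_ofReal]; rfl
  | mul a b ha hb => simp only [map_mul, ha, hb]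
  | add a b ha hb => simp only [map_add, ha, hb]

@[simp] theorem ofReal_add (φ ψ : Module.Dual ℝ T) : ofReal (φ + ψ) = ofReal φ + ofReal ψ := by
  simp [ofReal, TensorProduct.tmul_add]

theorem ofReal_smul (r : ℝ) (φ : Module.Dual ℝ T) : ofReal (r • φ) = (r : ℂ) • ofReal φ := by
  simp [ofReal, TensorProduct.tmul_smul, TensorProduct.smul_tmul']

@[simp] theorem ofReal_zero : ofReal (0 : Module.Dual ℝ T) = 0 := by simp [ofReal]

@[simp] theorem ofReal_neg (φ : Module.Dual ℝ T) : ofReal (-φ) = -ofReal φ := by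
  simp [ofReal, TensorProduct.tmul_neg]

theorem ofReal_sq (φ : Module.Dual ℝ T) : ofReal φ * ofReal φ = 0 := by
  simp [ofReal, Algebra.TensorProduct.tmul_mul_tmul]

theorem ofReal_anticomm (φ ψ : Module.Dual ℝ T) :
    ofReal φ * ofReal ψ = -(ofReal ψ * ofReal φ) := by
  have := ofReal_sq (φ + ψ)
  rw [ofReal_add, add_mul, mul_add, mul_add, ofReal_sq, ofReal_sq, zero_add, add_zero] at this
  exact eq_neg_of_add_eq_zero_left this

/-- The grade involution, `(-1)^k` on the forms of degree `k`; it is the pullback by `-1`. -/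
def eps : CForms T →ₐ[ℂ] CForms T := pull (-LinearMap.id)

@[simp] theorem eps_ofReal (φ : Module.Dual ℝ T) : eps (ofReal φ) = -ofReal φ := by
  rw [eps, pull_ofReal, ← ofReal_neg]; congr 1; ext; simp

/-- The grade involution is a pullback, hence commutes with pullbacks. -/
theorem pull_eps (L : T →ₗ[ℝ] T') (z : CForms T') : pull L (eps z) = eps (pull L z) := by
  rw [eps, eps, ← pull_comp, ← pull_comp]; congr 1; ext; simp

/-- Moving a one-form past a form applies the grade involution. Graded commutativity follows from
this. -/
theorem ofReal_mul (φ : Module.Dual ℝ T) (z : CForms T) : ofReal φ * z = eps z * ofReal φ := by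
  induction z using induct with
  | scalar c => rw [AlgHom.commutes, ← Algebra.commutes]
  | one_form ψ => rw [eps_ofReal, neg_mul, ofReal_anticomm]
  | mul a b ha hb => rw [← mul_assoc, ha, mul_assoc, hb, map_mul, mul_assoc]
  | add a b ha hb => rw [mul_add, ha, hb, map_add, add_mul]

/-- Even forms are central. -/
theorem even_commute {z : CForms T} (hz : eps z = z) (w : CForms T) : z * w = w * z := by
  induction w using induct with
  | scalar c => rw [Algebra.commutes]
  | one_form ψ => rw [ofReal_mul, hz]
  | mul a b ha hb => rw [← mul_assoc, ha, mul_assoc, hb, mul_assoc]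
  | add a b ha hb => rw [mul_add, ha, hb, add_mul]

theorem odd_commute {z : CForms T} (hz : eps z = -z) (w : CForms T) : z * w = eps w * z := by
  induction w using induct with
  | scalar c => rw [AlgHom.commutes, Algebra.commutes]
  | one_form ψ => rw [eps_ofReal, neg_mul, ofReal_mul, hz, neg_mul, neg_neg]
  | mul a b ha hb => rw [← mul_assoc, ha, mul_assoc, hb, map_mul, mul_assoc]
  | add a b ha hb => rw [mul_add, ha, hb, map_add, add_mul]

theorem conj_algebraMap (c : ℂ) :
    conj (algebraMap ℂ (CForms T) c) = algebraMap ℂ (CForms T) (starRingEnd ℂ c) := by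
  simp [Algebra.TensorProduct.algebraMap_apply, conj_tmul]

theorem conj_one : conj (1 : CForms T) = 1 := by
  have := conj_algebraMap (T := T) 1
  rwa [map_one (starRingEnd ℂ), map_one (algebraMap ℂ (CForms T))] at this

/-! #### Degrees -/

theorem tmul_mem_degree {k : ℕ} (c : ℂ) {b : ExteriorAlgebra ℝ (Module.Dual ℝ T)}
    (hb : b ∈ ⋀[ℝ]^k (Module.Dual ℝ T)) : (c ⊗ₜ[ℝ] b : CForms T) ∈ degree T k :=
  Submodule.tmul_mem_baseChange_of_mem c hb

/-- Forms of degree `k` are sums of `c ⊗ b` with `b` a real form of degree `k`. -/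
theorem degree_induct {k : ℕ} {C : CForms T → Prop}
    (tmul : ∀ (c : ℂ) (b : ExteriorAlgebra ℝ (Module.Dual ℝ T)),
      b ∈ ⋀[ℝ]^k (Module.Dual ℝ T) → C (c ⊗ₜ[ℝ] b))
    (add : ∀ a b, C a → C b → C (a + b)) {z : CForms T} (hz : z ∈ degree T k) : C z := by
  rw [degree, Submodule.baseChange_eq_span] at hz
  have key : ∀ c : ℂ, C (c • z) := by
    induction hz using Submodule.span_induction with
    | mem w hw =>
      obtain ⟨b, hb, rfl⟩ := hw
      intro c
      have := tmul c b hb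
      rwa [← mul_one c, ← smul_eq_mul, ← TensorProduct.smul_tmul'] at this
    | zero => intro c; simpa using tmul 0 0 (Submodule.zero_mem _)
    | add a b _ _ ha hb => intro c; rw [smul_add]; exact add _ _ (ha c) (hb c)
    | smul a x _ hx => intro c; rw [smul_smul]; exact hx _
  simpa using key 1

theorem mul_mem_degree {j k : ℕ} {z w : CForms T} (hz : z ∈ degree T j) (hw : w ∈ degree T k) :
    z * w ∈ degree T (j + k) := by
  refine degree_induct (C := fun z ↦ z * w ∈ degree T (j + k)) (fun c b hb ↦ ?_)
    (fun a b ha hb ↦ by rw [add_mul]; exact Submodule.add_mem _ ha hb) hz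
  refine degree_induct (C := fun w ↦ (c ⊗ₜ[ℝ] b : CForms T) * w ∈ degree T (j + k))
    (fun c' b' hb' ↦ ?_) (fun a b ha hb ↦ by rw [mul_add]; exact Submodule.add_mem _ ha hb) hw
  rw [Algebra.TensorProduct.tmul_mul_tmul]
  exact tmul_mem_degree _ (SetLike.GradedMul.mul_mem hb hb')

theorem ofReal_mem_degree (φ : Module.Dual ℝ T) : ofReal φ ∈ degree T 1 := by
  refine tmul_mem_degree _ ?_
  have : (⋀[ℝ]^1 (Module.Dual ℝ T)) = LinearMap.range (ExteriorAlgebra.ι ℝ) := pow_one _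
  rw [this]
  exact LinearMap.mem_range_self _ _

theorem algebraMap_mem_degree (c : ℂ) : algebraMap ℂ (CForms T) c ∈ degree T 0 := by
  rw [Algebra.TensorProduct.algebraMap_apply]
  exact tmul_mem_degree _ SetLike.GradedOne.one_mem

theorem eps_of_mem_degree {k : ℕ} {z : CForms T} (hz : z ∈ degree T k) :
    eps z = (-1 : ℂ) ^ k • z := by
  refine degree_induct (C := fun z ↦ eps z = (-1 : ℂ) ^ k • z) (fun c b hb ↦ ?_)
    (fun a b ha hb ↦ by rw [map_add, ha, hb, smul_add]) hz
  clear hz z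
  have key : eps ((1 : ℂ) ⊗ₜ[ℝ] b : CForms T) = (-1 : ℂ) ^ k • (1 : ℂ) ⊗ₜ[ℝ] b := by
    induction hb using Submodule.pow_induction_on_left' with
    | algebraMap r =>
      rw [one_tmul_algebraMap, AlgHom.commutes, pow_zero, one_smul]
    | add _ _ _ _ _ ihx ihy => simp only [TensorProduct.tmul_add, map_add, ihx, ihy, smul_add]
    | mem_mul m hm i x _ ih =>
      obtain ⟨φ, rfl⟩ := hm
      have : ((1 : ℂ) ⊗ₜ[ℝ] (ExteriorAlgebra.ι ℝ φ * x) : CForms T) = ofReal φ * (1 : ℂ) ⊗ₜ[ℝ] x := by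
        rw [ofReal, Algebra.TensorProduct.tmul_mul_tmul, one_mul]
      rw [this, map_mul, eps_ofReal, ih, mul_smul_comm, neg_mul, pow_succ]
      simp
  have e : (c ⊗ₜ[ℝ] b : CForms T) = c • (1 : ℂ) ⊗ₜ[ℝ] b := by
    rw [TensorProduct.smul_tmul', smul_eq_mul, mul_one]
  rw [e, map_smul, key, smul_comm]

theorem iSup_degree : ⨆ k, degree T k = ⊤ := by
  rw [eq_top_iff]
  rintro z -
  induction z using TensorProduct.induction_on with
  | zero => exact Submodule.zero_mem _
  | tmul a b =>
    classical
    rw [← DirectSum.sum_support_decompose (fun i : ℕ ↦ ⋀[ℝ]^i (Module.Dual ℝ T)) b,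
      TensorProduct.tmul_sum]
    exact Submodule.sum_mem _ fun i _ ↦
      Submodule.mem_iSup_of_mem i (tmul_mem_degree a (SetLike.coe_mem _))
  | add a b ha hb => exact Submodule.add_mem _ ha hb

theorem eps_of_mem_even {z : CForms T} (hz : z ∈ even T) : eps z = z := by
  refine Submodule.iSup_induction _ (motive := fun w ↦ eps w = w) hz (fun j w hw ↦ ?_) (by simp)
    (fun a b ha hb ↦ by rw [map_add, ha, hb])
  rw [eps_of_mem_degree hw]; simp

theorem eps_of_mem_odd {z : CForms T} (hz : z ∈ odd T) : eps z = -z := by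
  refine Submodule.iSup_induction _ (motive := fun w ↦ eps w = -w) hz (fun j w hw ↦ ?_) (by simp)
    (fun a b ha hb ↦ by rw [map_add, ha, hb, neg_add])
  rw [eps_of_mem_degree hw]; simp [pow_succ]

theorem even_sup_odd : even T ⊔ odd T = ⊤ := by
  rw [eq_top_iff, ← iSup_degree]
  refine iSup_le fun k ↦ ?_
  rcases Nat.even_or_odd' k with ⟨j, rfl | rfl⟩
  · exact (le_iSup (fun j : ℕ ↦ degree T (2 * j)) j).trans le_sup_left
  · exact (le_iSup (fun j : ℕ ↦ degree T (2 * j + 1)) j).trans le_sup_right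

theorem self_eq_neg_iff {z : CForms T} : z = -z ↔ z = 0 := by
  rw [eq_neg_iff_add_eq_zero, ← two_smul ℂ z, smul_eq_zero]
  simp

/-- Even forms are the fixed points of the grade involution, since the algebra is the sum of its
even and odd parts. This turns parity into an equation. -/
theorem mem_even_iff {z : CForms T} : z ∈ even T ↔ eps z = z := by
  refine ⟨eps_of_mem_even, fun h ↦ ?_⟩
  obtain ⟨a, ha, b, hb, rfl⟩ := Submodule.mem_sup.1 (show z ∈ even T ⊔ odd T by rw [even_sup_odd]; trivial)
  rw [map_add, eps_of_mem_even ha, eps_of_mem_odd hb] at h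
  have hb0 : b = 0 := by
    exact self_eq_neg_iff.1 (add_left_cancel h).symm
  rw [hb0, add_zero]; exact ha

theorem mem_odd_iff {z : CForms T} : z ∈ odd T ↔ eps z = -z := by
  refine ⟨eps_of_mem_odd, fun h ↦ ?_⟩
  obtain ⟨a, ha, b, hb, rfl⟩ := Submodule.mem_sup.1 (show z ∈ even T ⊔ odd T by rw [even_sup_odd]; trivial)
  rw [map_add, eps_of_mem_even ha, eps_of_mem_odd hb, neg_add] at h
  have ha0 : a = 0 := self_eq_neg_iff.1 (add_right_cancel h)
  rw [ha0, zero_add]; exact hb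

/-- The forms of degree at least `k`. -/
def filtration (T : Type*) [AddCommGroup T] [Module ℝ T] (k : ℕ) : Submodule ℂ (CForms T) :=
  ⨆ j : ℕ, degree T (k + j)

theorem filtration_zero : filtration T 0 = ⊤ := by simp [filtration, iSup_degree]

theorem degree_le_filtration {j k : ℕ} (h : k ≤ j) : degree T j ≤ filtration T k := by
  obtain ⟨i, rfl⟩ := Nat.exists_eq_add_of_le h
  exact le_iSup (fun i ↦ degree T (k + i)) i

theorem mul_mem_filtration {j k : ℕ} {z w : CForms T} (hz : z ∈ filtration T j)
    (hw : w ∈ filtration T k) : z * w ∈ filtration T (j + k) := by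
  refine Submodule.iSup_induction _ (motive := fun z ↦ z * w ∈ filtration T (j + k)) hz
    (fun i z hz ↦ ?_) (by simp) (fun a b ha hb ↦ by rw [add_mul]; exact Submodule.add_mem _ ha hb)
  refine Submodule.iSup_induction _ (motive := fun w ↦ z * w ∈ filtration T (j + k)) hw
    (fun l w hw ↦ ?_) (by simp) (fun a b ha hb ↦ by rw [mul_add]; exact Submodule.add_mem _ ha hb)
  exact degree_le_filtration (by omega) (mul_mem_degree hz hw)

theorem degree_eq_bot [FiniteDimensional ℝ T] {k : ℕ} (h : Module.finrank ℝ T < k) :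
    degree T k = ⊥ := by
  have h0 : Module.finrank ℝ (⋀[ℝ]^k (Module.Dual ℝ T)) = 0 := by
    rw [exteriorPower.finrank_eq, Subspace.dual_finrank_eq, Nat.choose_eq_zero_of_lt h]
  have : ⋀[ℝ]^k (Module.Dual ℝ T) = ⊥ := by
    exact Submodule.finrank_eq_zero.1 h0
  rw [degree, this, Submodule.baseChange_bot]

/-- There are no forms of degree larger than the dimension. This is what truncates the exponential
series. -/
theorem filtration_eq_bot [FiniteDimensional ℝ T] {k : ℕ} (h : Module.finrank ℝ T < k) :
    filtration T k = ⊥ := by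
  simp only [filtration, iSup_eq_bot]
  exact fun j ↦ degree_eq_bot (by omega)

theorem pow_mem_filtration {ι : Type*} [Fintype ι] [DecidableEq ι] {X : Matrix ι ι (CForms T)}
    (hX : ∀ i j, X i j ∈ filtration T 1) (k : ℕ) (i j : ι) : (X ^ k) i j ∈ filtration T k := by
  induction k generalizing i j with
  | zero => rw [filtration_zero]; trivial
  | succ k ih =>
    rw [pow_succ, Matrix.mul_apply]
    exact Submodule.sum_mem _ fun l _ ↦ mul_mem_filtration (ih i l) (hX l j)

theorem pow_mem_degree {ι : Type*} [Fintype ι] [DecidableEq ι] {X : Matrix ι ι (CForms T)}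
    (hX : ∀ i j, X i j ∈ degree T 1) (k : ℕ) (i j : ι) : (X ^ k) i j ∈ degree T k := by
  induction k generalizing i j with
  | zero =>
    rw [pow_zero, Matrix.one_apply]
    split_ifs
    · have := algebraMap_mem_degree (T := T) 1
      rwa [map_one] at this
    · exact Submodule.zero_mem _
  | succ k ih =>
    rw [pow_succ, Matrix.mul_apply]
    exact Submodule.sum_mem _ fun l _ ↦ mul_mem_degree (ih i l) (hX l j)

/-! #### Complex valued linear forms -/

/-- A complex valued real linear form, as a complex exterior form of degree one. -/
def toForm : (T →ₗ[ℝ] ℂ) →ₗ[ℂ] CForms T where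
  toFun a := ofReIm (Complex.reLm ∘ₗ a) (Complex.imLm ∘ₗ a)
  map_add' a b := by
    simp only [ofReIm, LinearMap.comp_add, ofReal_add, smul_add]; abel
  map_smul' c a := by
    have h1 : Complex.reLm ∘ₗ (c • a) = c.re • (Complex.reLm ∘ₗ a) - c.im • (Complex.imLm ∘ₗ a) := by
      ext v; simp
    have h2 : Complex.imLm ∘ₗ (c • a) = c.re • (Complex.imLm ∘ₗ a) + c.im • (Complex.reLm ∘ₗ a) := by
      ext v; simp
    simp only [ofReIm, h1, h2, sub_eq_add_neg, ofReal_add, ofReal_neg, ofReal_smul, RingHom.id_apply]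
    conv_rhs => rw [← Complex.re_add_im c]
    simp only [smul_add, add_smul, smul_smul]
    have : ((c.re + c.im * Complex.I) * Complex.I) = Complex.I * c.re - (c.im : ℂ) := by
      linear_combination (c.im : ℂ) * Complex.I_mul_I
    rw [this, sub_smul, mul_comm Complex.I (c.im : ℂ)]
    abel

theorem toForm_mem_degree (a : T →ₗ[ℝ] ℂ) : toForm a ∈ degree T 1 :=
  Submodule.add_mem _ (ofReal_mem_degree _) (Submodule.smul_mem _ _ (ofReal_mem_degree _))

theorem eps_toForm (a : T →ₗ[ℝ] ℂ) : eps (toForm a) = -toForm a := by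
  simpa using eps_of_mem_degree (toForm_mem_degree a)

theorem pull_toForm (L : T →ₗ[ℝ] T') (a : T' →ₗ[ℝ] ℂ) : pull L (toForm a) = toForm (a ∘ₗ L) := by
  simp [toForm, ofReIm]; rfl

theorem conj_toForm (a : T →ₗ[ℝ] ℂ) :
    conj (toForm a) = toForm (Complex.conjAe.toLinearMap ∘ₗ a) := by
  have h1 : Complex.reLm ∘ₗ (Complex.conjAe.toLinearMap ∘ₗ a) = Complex.reLm ∘ₗ a := by
    ext v; simp
  have h2 : Complex.imLm ∘ₗ (Complex.conjAe.toLinearMap ∘ₗ a) = - (Complex.imLm ∘ₗ a) := by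
    ext v; simp
  change conj (ofReIm _ _) = ofReIm _ _
  rw [h1, h2]
  simp [ofReIm, conj_ofReal]

theorem toForm_real (φ : Module.Dual ℝ T) : toForm (Complex.ofRealAm.toLinearMap ∘ₗ φ) = ofReal φ := by
  have h1 : Complex.reLm ∘ₗ (Complex.ofRealAm.toLinearMap ∘ₗ φ) = φ := by ext v; simp
  have h2 : Complex.imLm ∘ₗ (Complex.ofRealAm.toLinearMap ∘ₗ φ) = 0 := by ext v; simp
  change ofReIm _ _ = _
  rw [h1, h2]; simp [ofReIm]

/-- A complex valued linear form in the coordinates of a basis. -/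
theorem toForm_eq_sum {ι : Type*} [Fintype ι] (b : Module.Basis ι ℝ T) (a : T →ₗ[ℝ] ℂ) :
    toForm a = ∑ i, a (b i) • ofReal (b.coord i) := by
  have : a = ∑ i, a (b i) • (Complex.ofRealAm.toLinearMap ∘ₗ b.coord i) := by
    refine b.ext fun j ↦ ?_
    classical
    have h : ∀ x, ((if j = x then 1 else 0 : ℝ) : ℂ) = if j = x then 1 else 0 := fun x ↦ by
      split_ifs <;> simp
    simp [LinearMap.sum_apply, Finsupp.single_apply, h]
  conv_lhs => rw [this]
  simp only [map_sum, map_smul, toForm_real]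

end Graded

end CForms

/-! ### Exterior calculus on Euclidean space -/

namespace CForms

section Continuity

variable {T T' : Type*} [AddCommGroup T] [Module ℝ T] [FiniteDimensional ℝ T]
  [AddCommGroup T'] [Module ℝ T'] [FiniteDimensional ℝ T']

/-- The wedge product as a continuous bilinear map. -/
def mulL (T : Type*) [AddCommGroup T] [Module ℝ T] [FiniteDimensional ℝ T] :
    CForms T →L[ℝ] CForms T →L[ℝ] CForms T :=
  (LinearMap.mul ℝ (CForms T)).toContinuousBilinearMap

/-- The pullback of exterior forms as a continuous real linear map. -/
def pullL (L : T →ₗ[ℝ] T') : CForms T' →L[ℝ] CForms T :=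
  LinearMap.toContinuousLinearMap ((pull L).toLinearMap.restrictScalars ℝ)

variable {X : Type*} [NormedAddCommGroup X] [NormedSpace ℝ X] {f g : X → CForms T} {x : X}

theorem contDiffAt_mul {k : WithTop ℕ∞} (hf : ContDiffAt ℝ k f x) (hg : ContDiffAt ℝ k g x) :
    ContDiffAt ℝ k (fun y ↦ f y * g y) x :=
  ContDiffAt.comp (g := fun q : CForms T × CForms T ↦ mulL T q.1 q.2) x
    (mulL T).isBoundedBilinearMap.contDiff.contDiffAt (hf.prodMk hg)

theorem differentiableAt_mul (hf : DifferentiableAt ℝ f x) (hg : DifferentiableAt ℝ g x) :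
    DifferentiableAt ℝ (fun y ↦ f y * g y) x :=
  ((mulL T).hasFDerivAt_of_bilinear hf.hasFDerivAt hg.hasFDerivAt).differentiableAt

theorem fderiv_mul_apply (hf : DifferentiableAt ℝ f x) (hg : DifferentiableAt ℝ g x) (v : X) :
    fderiv ℝ (fun y ↦ f y * g y) x v = f x * fderiv ℝ g x v + fderiv ℝ f x v * g x := by
  have := ((mulL T).hasFDerivAt_of_bilinear hf.hasFDerivAt hg.hasFDerivAt).fderiv
  change fderiv ℝ (fun y ↦ mulL T (f y) (g y)) x v = _
  rw [this]; rfl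

theorem fderiv_clm_apply (L : CForms T →L[ℝ] CForms T') (hf : DifferentiableAt ℝ f x) (v : X) :
    fderiv ℝ (fun y ↦ L (f y)) x v = L (fderiv ℝ f x v) := by
  exact DFunLike.congr_fun (L.hasFDerivAt.comp x hf.hasFDerivAt).fderiv v

/-- Complex scalars as exterior forms of degree zero. -/
def scalarL (T : Type*) [AddCommGroup T] [Module ℝ T] [FiniteDimensional ℝ T] : ℂ →L[ℝ] CForms T :=
  LinearMap.toContinuousLinearMap ((Algebra.linearMap ℂ (CForms T)).restrictScalars ℝ)

@[simp] theorem scalarL_apply (c : ℂ) : scalarL T c = algebraMap ℂ (CForms T) c := rfl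

/-- Complex scalar multiplication as a continuous bilinear map. -/
theorem contDiffAt_smul {k : WithTop ℕ∞} {c : X → ℂ} (hc : ContDiffAt ℝ k c x)
    (hf : ContDiffAt ℝ k f x) : ContDiffAt ℝ k (fun y ↦ c y • f y) x := by
  simp only [Algebra.smul_def]
  exact contDiffAt_mul ((scalarL T).contDiff.contDiffAt.comp x hc) hf

end Continuity

end CForms

theorem two_le_infty : (2 : WithTop ℕ∞) ≤ ∞ := by
  exact WithTop.coe_le_coe.2 (le_top : (2 : ℕ∞) ≤ ⊤)

/-- Euclidean space of dimension `n`. -/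
abbrev Eucl (n : ℕ) : Type := EuclideanSpace ℝ (Fin n)

section Euclid

variable {n : ℕ}

/-- The coordinate one-form `dxⁱ`. -/
def dx (i : Fin n) : CForms (Eucl n) :=
  CForms.ofReal ((EuclideanSpace.basisFun (Fin n) ℝ).toBasis.coord i)

theorem euclideanExtDeriv_eq (α : Eucl n → CForms (Eucl n)) (y : Eucl n) :
    euclideanExtDeriv α y = ∑ i, dx i * fderiv ℝ α y (EuclideanSpace.single i 1) := rfl

theorem eps_dx (i : Fin n) : CForms.eps (dx i) = -dx i := CForms.eps_ofReal _

theorem dx_mul_dx (i j : Fin n) : dx i * dx j = -(dx j * dx i) := CForms.ofReal_anticomm _ _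

theorem dx_mul (i : Fin n) (z : CForms (Eucl n)) : dx i * z = CForms.eps z * dx i :=
  CForms.ofReal_mul _ z

/-- Symmetric coefficients cancel in `dxⁱ ∧ dxʲ`. This is where the symmetry of second derivatives
enters `d² = 0` and the naturality of `d`. -/
theorem sum_dx_dx_of_symm {c : Fin n → Fin n → CForms (Eucl n)} (hc : ∀ i j, c i j = c j i) :
    ∑ i, ∑ j, dx i * (dx j * c i j) = 0 := by
  have h : ∑ i, ∑ j, dx i * (dx j * c i j) = -∑ i, ∑ j, dx i * (dx j * c i j) := by
    conv_lhs => rw [Finset.sum_comm]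
    rw [← Finset.sum_neg_distrib]
    refine Finset.sum_congr rfl fun i _ ↦ ?_
    rw [← Finset.sum_neg_distrib]
    refine Finset.sum_congr rfl fun j _ ↦ ?_
    rw [← mul_assoc, dx_mul_dx, neg_mul, mul_assoc, hc]
  exact CForms.self_eq_neg_iff.1 h

theorem toForm_eucl (a : Eucl n →ₗ[ℝ] ℂ) :
    CForms.toForm a = ∑ i, a (EuclideanSpace.single i 1) • dx i := by
  rw [CForms.toForm_eq_sum (EuclideanSpace.basisFun (Fin n) ℝ).toBasis]
  simp [dx]

theorem ofReal_eucl (φ : Module.Dual ℝ (Eucl n)) :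
    CForms.ofReal φ = ∑ i, (φ (EuclideanSpace.single i 1) : ℂ) • dx i := by
  rw [← CForms.toForm_real, toForm_eucl]; simp

theorem pull_dx (L : Eucl n →ₗ[ℝ] Eucl n) (j : Fin n) :
    CForms.pull L (dx j) = ∑ i, (L (EuclideanSpace.single i 1) j : ℂ) • dx i := by
  rw [dx, CForms.pull_ofReal, ofReal_eucl]; simp

theorem eucl_eq_sum (v : Eucl n) : v = ∑ j, v j • EuclideanSpace.single j (1 : ℝ) := by
  have := (EuclideanSpace.basisFun (Fin n) ℝ).sum_repr v
  simpa using this.symm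

/-! #### The pullback depends smoothly on the linear map -/

/-- For a fixed form `z`, the pullback of `z` is polynomial in the linear map. -/
theorem contDiff_pull_apply (z : CForms (Eucl n)) :
    ContDiff ℝ ∞ (fun L : Eucl n →L[ℝ] Eucl n ↦ CForms.pull L.toLinearMap z) := by
  induction z using CForms.induct with
  | scalar c => simp only [AlgHom.commutes]; exact contDiff_const
  | one_form φ =>
    have e : (fun L : Eucl n →L[ℝ] Eucl n ↦ CForms.pull L.toLinearMap (CForms.ofReal φ)) =
        fun L ↦ ∑ i, (φ (L (EuclideanSpace.single i 1)) : ℂ) • dx i := by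
      funext L
      rw [CForms.pull_ofReal, ofReal_eucl]; rfl
    rw [e]
    refine ContDiff.sum fun i _ ↦ contDiff_iff_contDiffAt.2 fun L ↦
      CForms.contDiffAt_smul ?_ contDiffAt_const
    have : ContDiff ℝ ∞ (fun L : Eucl n →L[ℝ] Eucl n ↦
        φ.toContinuousLinearMap (L (EuclideanSpace.single i 1))) :=
      φ.toContinuousLinearMap.contDiff.comp (contDiff_id.clm_apply contDiff_const)
    exact (Complex.ofRealCLM.contDiff.comp this).contDiffAt
  | mul a b ha hb =>
    simp only [map_mul]
    exact contDiff_iff_contDiffAt.2 fun L ↦ CForms.contDiffAt_mul ha.contDiffAt hb.contDiffAt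
  | add a b ha hb => simp only [map_add]; exact ha.add hb

/-- The pullback is jointly smooth in the linear map and the form. -/
theorem contDiff_pull : ContDiff ℝ ∞ (fun q : (Eucl n →L[ℝ] Eucl n) × CForms (Eucl n) ↦
    CForms.pull q.1.toLinearMap q.2) := by
  let b := Module.finBasis ℝ (CForms (Eucl n))
  have h : (fun q : (Eucl n →L[ℝ] Eucl n) × CForms (Eucl n) ↦ CForms.pull q.1.toLinearMap q.2) =
      fun q ↦ ∑ i, (b.coord i).toContinuousLinearMap q.2 • CForms.pull q.1.toLinearMap (b i) := by
    funext q
    have h1 : CForms.pullL q.1.toLinearMap q.2 =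
        CForms.pullL q.1.toLinearMap (∑ i, b.repr q.2 i • b i) := by rw [b.sum_repr]
    rw [map_sum] at h1
    simp only [map_smul] at h1
    exact h1
  rw [h]
  exact ContDiff.sum fun i _ ↦
    ((b.coord i).toContinuousLinearMap.contDiff.comp contDiff_snd).smul
      ((contDiff_pull_apply (b i)).comp contDiff_fst)

/-! #### Leibniz rule, grade involution, `d² = 0` -/

variable {α β : Eucl n → CForms (Eucl n)} {y : Eucl n}

theorem euclideanExtDeriv_congr (h : α =ᶠ[nhds y] β) :
    euclideanExtDeriv α y = euclideanExtDeriv β y := by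
  simp only [euclideanExtDeriv_eq, h.fderiv_eq]

theorem euclideanExtDeriv_mul (hα : DifferentiableAt ℝ α y) (hβ : DifferentiableAt ℝ β y) :
    euclideanExtDeriv (fun y ↦ α y * β y) y =
      euclideanExtDeriv α y * β y + CForms.eps (α y) * euclideanExtDeriv β y := by
  simp only [euclideanExtDeriv_eq, CForms.fderiv_mul_apply hα hβ, Finset.sum_mul, Finset.mul_sum,
    ← Finset.sum_add_distrib]
  refine Finset.sum_congr rfl fun i _ ↦ ?_
  rw [mul_add, ← mul_assoc, dx_mul, mul_assoc, mul_assoc, add_comm]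

theorem euclideanExtDeriv_add (hα : DifferentiableAt ℝ α y) (hβ : DifferentiableAt ℝ β y) :
    euclideanExtDeriv (fun y ↦ α y + β y) y = euclideanExtDeriv α y + euclideanExtDeriv β y := by
  simp only [euclideanExtDeriv_eq, fderiv_fun_add hα hβ, add_apply, mul_add, Finset.sum_add_distrib]

theorem euclideanExtDeriv_const (z : CForms (Eucl n)) :
    euclideanExtDeriv (fun _ ↦ z) y = 0 := by
  simp [euclideanExtDeriv_eq]

/-- `d² = 0` on Euclidean space. -/
theorem euclideanExtDeriv_euclideanExtDeriv (hα : ContDiffAt ℝ ∞ α y) :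
    euclideanExtDeriv (euclideanExtDeriv α) y = 0 := by
  have hd : DifferentiableAt ℝ (fderiv ℝ α) y :=
    (hα.fderiv_right (m := ∞) le_rfl).differentiableAt (by simp)
  have hsymm : IsSymmSndFDerivAt ℝ α y := hα.isSymmSndFDerivAt (by simpa using two_le_infty)
  have h : ∀ i, fderiv ℝ (euclideanExtDeriv α) y (EuclideanSpace.single i 1) =
      ∑ j, dx j * fderiv ℝ (fderiv ℝ α) y (EuclideanSpace.single i 1)
        (EuclideanSpace.single j 1) := by
    intro i
    have h1 : ∀ j : Fin n, DifferentiableAt ℝ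
        (fun y ↦ dx j * fderiv ℝ α y (EuclideanSpace.single j 1)) y := fun j ↦
      CForms.differentiableAt_mul (differentiableAt_const _)
        (hd.clm_apply (differentiableAt_const _))
    have : euclideanExtDeriv α = fun y ↦ ∑ j, dx j * fderiv ℝ α y (EuclideanSpace.single j 1) := rfl
    rw [this, fderiv_fun_sum fun j _ ↦ h1 j, sum_apply]
    refine Finset.sum_congr rfl fun j _ ↦ ?_
    rw [CForms.fderiv_mul_apply (differentiableAt_const _)
        (hd.clm_apply (differentiableAt_const _)),
      fderiv_clm_apply hd (differentiableAt_const _)]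
    simp
  rw [euclideanExtDeriv_eq]
  simp only [h, Finset.mul_sum]
  exact sum_dx_dx_of_symm fun i j ↦ hsymm _ _

/-! #### Naturality -/

/-- The pullback of a constant form by a smooth map is closed. -/
theorem euclideanExtDeriv_pull_const {ψ : Eucl n → Eucl n} (hψ : ContDiffAt ℝ ∞ ψ y)
    (z : CForms (Eucl n)) :
    euclideanExtDeriv (fun y ↦ CForms.pull (fderiv ℝ ψ y).toLinearMap z) y = 0 := by
  have hd : DifferentiableAt ℝ (fderiv ℝ ψ) y :=
    (hψ.fderiv_right (m := ∞) le_rfl).differentiableAt (by simp)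
  have hsymm : IsSymmSndFDerivAt ℝ ψ y := hψ.isSymmSndFDerivAt (by simpa using two_le_infty)
  have hz : ∀ z, DifferentiableAt ℝ (fun y ↦ CForms.pull (fderiv ℝ ψ y).toLinearMap z) y := fun z ↦
    ((contDiff_pull_apply z).differentiable (by simp) _).comp y hd
  induction z using CForms.induct with
  | scalar c => simp only [AlgHom.commutes]; exact euclideanExtDeriv_const _
  | one_form φ =>
    have e : (fun y ↦ CForms.pull (fderiv ℝ ψ y).toLinearMap (CForms.ofReal φ)) =
        fun y ↦ ∑ j, CForms.scalarL _ (φ (fderiv ℝ ψ y (EuclideanSpace.single j 1)) : ℂ) * dx j := by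
      funext y
      rw [CForms.pull_ofReal, ofReal_eucl]
      simp [Algebra.smul_def]
    let K : Eucl n →L[ℝ] CForms (Eucl n) :=
      (CForms.scalarL _).comp (Complex.ofRealCLM.comp φ.toContinuousLinearMap)
    have h : ∀ i, fderiv ℝ (fun y ↦ CForms.pull (fderiv ℝ ψ y).toLinearMap (CForms.ofReal φ)) y
        (EuclideanSpace.single i 1) =
        ∑ j, dx j * K (fderiv ℝ (fderiv ℝ ψ) y (EuclideanSpace.single i 1)
          (EuclideanSpace.single j 1)) := by
      intro i
      have hK : ∀ j : Fin n, HasFDerivAt (fun y ↦ K (fderiv ℝ ψ y (EuclideanSpace.single j 1)))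
          (K.comp ((ContinuousLinearMap.apply ℝ _ (EuclideanSpace.single j 1)).comp
            (fderiv ℝ (fderiv ℝ ψ) y))) y := fun j ↦
        K.hasFDerivAt.comp y ((ContinuousLinearMap.apply ℝ (Eucl n)
          (EuclideanSpace.single j (1 : ℝ))).hasFDerivAt.comp y hd.hasFDerivAt)
      rw [e]
      have h1 : ∀ j : Fin n, DifferentiableAt ℝ
          (fun y ↦ K (fderiv ℝ ψ y (EuclideanSpace.single j 1)) * dx j) y := fun j ↦
        CForms.differentiableAt_mul (hK j).differentiableAt (differentiableAt_const _)
      change fderiv ℝ (fun y ↦ ∑ j, K (fderiv ℝ ψ y (EuclideanSpace.single j 1)) * dx j) y _ = _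
      rw [fderiv_fun_sum fun j _ ↦ h1 j, sum_apply]
      refine Finset.sum_congr rfl fun j _ ↦ ?_
      rw [CForms.fderiv_mul_apply (hK j).differentiableAt (differentiableAt_const _), (hK j).fderiv]
      simp only [fderiv_fun_const, Pi.zero_apply, zero_apply, mul_zero, zero_add]
      exact Algebra.commutes (R := ℂ) (A := CForms (Eucl n)) _ _
    rw [euclideanExtDeriv_eq]
    simp only [h, Finset.mul_sum]
    exact sum_dx_dx_of_symm fun i j ↦ by rw [hsymm]
  | mul a b ha hb =>
    -- the pullback is multiplicative, and `d` is a graded derivation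
    simp only [map_mul]
    rw [euclideanExtDeriv_mul (hz a) (hz b), ha, hb, zero_mul, mul_zero, add_zero]
  | add a b ha hb =>
    simp only [map_add]
    rw [euclideanExtDeriv_add (hz a) (hz b), ha, hb, add_zero]

/-- The exterior derivative commutes with pullback by smooth maps. -/
theorem euclideanExtDeriv_pull {ψ : Eucl n → Eucl n} (hψ : ContDiffAt ℝ ∞ ψ y)
    (hβ : DifferentiableAt ℝ β (ψ y)) :
    euclideanExtDeriv (fun y ↦ CForms.pull (fderiv ℝ ψ y).toLinearMap (β (ψ y))) y =
      CForms.pull (fderiv ℝ ψ y).toLinearMap (euclideanExtDeriv β (ψ y)) := by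
  have hd : DifferentiableAt ℝ (fderiv ℝ ψ) y :=
    (hψ.fderiv_right (m := ∞) le_rfl).differentiableAt (by simp)
  have hψd : DifferentiableAt ℝ ψ y := hψ.differentiableAt (by simp)
  let Φ : (Eucl n →L[ℝ] Eucl n) × CForms (Eucl n) → CForms (Eucl n) :=
    fun q ↦ CForms.pull q.1.toLinearMap q.2
  have hΦ : ∀ q, DifferentiableAt ℝ Φ q := fun q ↦ contDiff_pull.differentiable (by simp) q
  have key : ∀ v, fderiv ℝ (fun y ↦ CForms.pull (fderiv ℝ ψ y).toLinearMap (β (ψ y))) y v =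
      fderiv ℝ (fun y' ↦ CForms.pull (fderiv ℝ ψ y').toLinearMap (β (ψ y))) y v +
        CForms.pull (fderiv ℝ ψ y).toLinearMap (fderiv ℝ β (ψ y) (fderiv ℝ ψ y v)) := by
    intro v
    have h1 := ((hΦ (fderiv ℝ ψ y, β (ψ y))).hasFDerivAt.comp y
      (hd.hasFDerivAt.prodMk (hβ.hasFDerivAt.comp y hψd.hasFDerivAt))).fderiv
    have h2 := ((hΦ (fderiv ℝ ψ y, β (ψ y))).hasFDerivAt.comp y
      (hd.hasFDerivAt.prodMk (hasFDerivAt_const (β (ψ y)) y))).fderiv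
    have h3 : ∀ w, fderiv ℝ Φ (fderiv ℝ ψ y, β (ψ y)) (0, w) =
        CForms.pull (fderiv ℝ ψ y).toLinearMap w := by
      intro w
      have := ((hΦ (fderiv ℝ ψ y, β (ψ y))).hasFDerivAt.comp (β (ψ y))
        ((hasFDerivAt_const (fderiv ℝ ψ y) (β (ψ y))).prodMk (hasFDerivAt_id (β (ψ y))))).fderiv
      have h4 := (CForms.pullL (fderiv ℝ ψ y).toLinearMap).fderiv (x := β (ψ y))
      have h5 := this.symm.trans h4
      exact DFunLike.congr_fun h5 w
    refine (DFunLike.congr_fun h1 v).trans ?_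
    refine Eq.trans ?_ (congrArg₂ (· + ·) (DFunLike.congr_fun h2 v).symm (h3 _))
    simp only [ContinuousLinearMap.comp_apply, ContinuousLinearMap.prod_apply, ← map_add]
    simp
  rw [euclideanExtDeriv_eq]
  simp only [key, mul_add, Finset.sum_add_distrib]
  have h0 := euclideanExtDeriv_pull_const hψ (β (ψ y))
  rw [euclideanExtDeriv_eq] at h0
  rw [h0, zero_add, euclideanExtDeriv_eq, map_sum]
  simp only [map_mul, pull_dx, Finset.sum_mul]
  rw [Finset.sum_comm]
  refine Finset.sum_congr rfl fun i _ ↦ ?_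
  have hv : fderiv ℝ β (ψ y) (fderiv ℝ ψ y (EuclideanSpace.single i 1)) =
      ∑ j, (fderiv ℝ ψ y (EuclideanSpace.single i 1) j : ℂ) •
        fderiv ℝ β (ψ y) (EuclideanSpace.single j 1) := by
    conv_lhs => rw [eucl_eq_sum (fderiv ℝ ψ y (EuclideanSpace.single i 1)), map_sum]
    simp only [map_smul]
    refine Finset.sum_congr rfl fun j _ ↦ ?_
    exact (Complex.coe_smul _ _).symm
  rw [hv, map_sum, Finset.mul_sum]
  refine Finset.sum_congr rfl fun j _ ↦ ?_
  rw [map_smul, mul_smul_comm, smul_mul_assoc]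
  rfl

end Euclid

/-! ### Integrals depending smoothly on parameters -/

section ParametricIntegral

open Set MeasureTheory

variable {X : Type} [NormedAddCommGroup X] [NormedSpace ℝ X] [FiniteDimensional ℝ X]
  {G : Type} [NormedAddCommGroup G] [NormedSpace ℝ G]

/-- Differentiation under the integral sign: the derivative of the integrand is bounded on the
compact product of `[0, 1]` and a closed ball around the point. -/
theorem hasFDerivAt_intervalIntegral_of_contDiffOn {f : ℝ × X → G} {O : Set X} (hO : IsOpen O)
    (hf : ContDiffOn ℝ ∞ f (univ ×ˢ O)) {x : X} (hx : x ∈ O) :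
    HasFDerivAt (fun x ↦ ∫ t in (0 : ℝ)..1, f (t, x))
      (∫ t in (0 : ℝ)..1, (fderiv ℝ f (t, x)).comp (ContinuousLinearMap.inr ℝ ℝ X)) x := by
  have hop : IsOpen (univ ×ˢ O : Set (ℝ × X)) := isOpen_univ.prod hO
  have hd : ∀ t, ∀ z ∈ O, HasFDerivAt (fun z ↦ f (t, z))
      ((fderiv ℝ f (t, z)).comp (ContinuousLinearMap.inr ℝ ℝ X)) z := fun t z hz ↦
    (((hf.contDiffAt (hop.mem_nhds ⟨mem_univ t, hz⟩)).differentiableAt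
      (by simp)).hasFDerivAt).comp z (hasFDerivAt_prodMk_right t z)
  have hc : ContinuousOn (fun q : ℝ × X ↦ (fderiv ℝ f q).comp (ContinuousLinearMap.inr ℝ ℝ X))
      (univ ×ˢ O) :=
    (hf.continuousOn_fderiv_of_isOpen hop (by simp)).clm_comp continuousOn_const
  obtain ⟨ε, hε, hεO⟩ := Metric.nhds_basis_closedBall.mem_iff.1 (hO.mem_nhds hx)
  have hK : IsCompact (Icc (0 : ℝ) 1 ×ˢ Metric.closedBall x ε) := by
    have := FiniteDimensional.proper_real X
    exact isCompact_Icc.prod (isCompact_closedBall x ε)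
  obtain ⟨C, hC⟩ := hK.exists_bound_of_continuousOn
    (hc.mono (prod_mono (subset_univ _) hεO))
  have hcx : ∀ z ∈ O, Continuous fun t : ℝ ↦ f (t, z) := fun z hz ↦
    continuous_iff_continuousAt.2 fun t ↦
      ((hf.contDiffAt (hop.mem_nhds ⟨mem_univ t, hz⟩)).continuousAt).comp
        (by fun_prop : ContinuousAt (fun t : ℝ ↦ (t, z)) t)
  have hc' : Continuous fun t : ℝ ↦ (fderiv ℝ f (t, x)).comp (ContinuousLinearMap.inr ℝ ℝ X) :=
    continuous_iff_continuousAt.2 fun t ↦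
      ContinuousAt.comp (g := fun q : ℝ × X ↦ (fderiv ℝ f q).comp (ContinuousLinearMap.inr ℝ ℝ X))
        (hc.continuousAt (hop.mem_nhds ⟨mem_univ t, hx⟩))
        (by fun_prop : ContinuousAt (fun t : ℝ ↦ (t, x)) t)
  refine intervalIntegral.hasFDerivAt_integral_of_dominated_of_fderiv_le (bound := fun _ ↦ C)
    (F' := fun z t ↦ (fderiv ℝ f (t, z)).comp (ContinuousLinearMap.inr ℝ ℝ X))
    (Metric.closedBall_mem_nhds x hε) ?_ ((hcx x hx).intervalIntegrable _ _)
    hc'.aestronglyMeasurable ?_ intervalIntegrable_const ?_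
  · filter_upwards [hO.mem_nhds hx] with z hz using (hcx z hz).aestronglyMeasurable
  · refine Filter.Eventually.of_forall fun t ht z hz ↦ hC (t, z) ⟨?_, hz⟩
    rw [uIoc_of_le zero_le_one] at ht
    exact ⟨ht.1.le, ht.2⟩
  · exact Filter.Eventually.of_forall fun t _ z hz ↦ hd t z (hεO hz)

/-- The integral of a smooth function depends smoothly on the parameters, by induction on the order
of differentiability. -/
theorem contDiffOn_intervalIntegral {f : ℝ × X → G} {O : Set X} (hO : IsOpen O)
    (hf : ContDiffOn ℝ ∞ f (univ ×ˢ O)) :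
    ContDiffOn ℝ ∞ (fun x ↦ ∫ t in (0 : ℝ)..1, f (t, x)) O := by
  rw [contDiffOn_infty]
  intro m
  induction m generalizing G with
  | zero =>
    rw [Nat.cast_zero, contDiffOn_zero]
    exact fun x hx ↦ ((hasFDerivAt_intervalIntegral_of_contDiffOn hO hf
      hx).continuousAt).continuousWithinAt
  | succ m ih =>
    have hop : IsOpen (univ ×ˢ O : Set (ℝ × X)) := isOpen_univ.prod hO
    rw [Nat.cast_add, Nat.cast_one, contDiffOn_succ_iff_fderiv_of_isOpen hO]
    refine ⟨fun x hx ↦ (hasFDerivAt_intervalIntegral_of_contDiffOn hO hf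
      hx).differentiableAt.differentiableWithinAt, by simp, ?_⟩
    refine (ih (f := fun q ↦ (fderiv ℝ f q).comp (ContinuousLinearMap.inr ℝ ℝ X)) ?_).congr
      fun x hx ↦ (hasFDerivAt_intervalIntegral_of_contDiffOn hO hf hx).fderiv
    exact (hf.fderiv_of_isOpen hop le_rfl).clm_comp contDiffOn_const

end ParametricIntegral

/-! ### Chern-Weil algebra over a graded commutative differential algebra -/

/-- A graded commutative differential algebra, with its grade involution `eps`, a conjugation, and a
family of commuting even derivations `pd v` commuting with the differential (the derivatives in the
parameters on which the forms depend). -/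
class FormAlgebra (P : Type*) (R : Type*) [Ring R] [Algebra ℂ R] where
  d : R →ₗ[ℂ] R
  eps : R →ₐ[ℂ] R
  conj : R →+* R
  pd : P → R →ₗ[ℂ] R
  even_comm : ∀ a b : R, eps a = a → a * b = b * a
  odd_comm : ∀ a b : R, eps a = -a → a * b = eps b * a
  d_mul : ∀ a b : R, d (a * b) = d a * b + eps a * d b
  d_eps : ∀ a : R, d (eps a) = -eps (d a)
  d_d : ∀ a : R, d (d a) = 0
  d_conj : ∀ a : R, d (conj a) = conj (d a)
  pd_mul : ∀ (v : P) (a b : R), pd v (a * b) = pd v a * b + a * pd v b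
  pd_d : ∀ (v : P) (a : R), pd v (d a) = d (pd v a)
  pd_eps : ∀ (v : P) (a : R), pd v (eps a) = eps (pd v a)
  pd_comm : ∀ (v w : P) (a : R), pd v (pd w a) = pd w (pd v a)

/-- The trace is cyclic when the entries of one factor are central. -/
theorem Matrix.trace_mul_comm_of_commute {ι κ R : Type*} [Fintype ι] [Fintype κ] [Ring R]
    {X : Matrix ι κ R} (hX : ∀ i j b, X i j * b = b * X i j) (Y : Matrix κ ι R) :
    (X * Y).trace = (Y * X).trace := by
  simp only [Matrix.trace, Matrix.diag, Matrix.mul_apply]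
  rw [Finset.sum_comm]
  exact Finset.sum_congr rfl fun i _ ↦ Finset.sum_congr rfl fun j _ ↦ hX _ _ _

theorem Matrix.transpose_mul_of_commute {ι κ l R : Type*} [Fintype κ] [Ring R]
    {X : Matrix ι κ R} (hX : ∀ i j b, X i j * b = b * X i j) (Y : Matrix κ l R) :
    (X * Y).transpose = Y.transpose * X.transpose := by
  ext i j
  simp only [Matrix.transpose_apply, Matrix.mul_apply]
  exact Finset.sum_congr rfl fun k _ ↦ hX _ _ _

theorem Matrix.transpose_pow_of_commute {ι R : Type*} [Fintype ι] [DecidableEq ι] [Ring R]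
    {X : Matrix ι ι R} (hX : ∀ i j b, X i j * b = b * X i j) (k : ℕ) :
    (X ^ k).transpose = X.transpose ^ k := by
  induction k with
  | zero => simp
  | succ k ih => rw [pow_succ', Matrix.transpose_mul_of_commute hX, ih, pow_succ]

/-- The trace is invariant under conjugation by a matrix with central entries. -/
theorem Matrix.trace_eq_of_intertwine {ι κ R : Type*} [Fintype ι] [Fintype κ] [DecidableEq ι]
    [DecidableEq κ] [Ring R] {G : Matrix κ ι R} {K : Matrix ι κ R} {X : Matrix ι ι R}
    {X' : Matrix κ κ R} (hG : ∀ i j b, G i j * b = b * G i j) (hKG : K * G = 1) (hGK : G * K = 1)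
    (h : G * X = X' * G) : X.trace = X'.trace := by
  have h1 : X = K * X' * G := by rw [Matrix.mul_assoc, ← h, ← Matrix.mul_assoc, hKG, Matrix.one_mul]
  rw [h1, ← Matrix.trace_mul_comm_of_commute hG, ← Matrix.mul_assoc, hGK, Matrix.one_mul]

/-- An intertwiner of two matrices intertwines their powers. -/
theorem Matrix.intertwine_pow {ι κ R : Type*} [Fintype ι] [Fintype κ] [DecidableEq ι]
    [DecidableEq κ] [Ring R] {G : Matrix κ ι R} {X : Matrix ι ι R} {X' : Matrix κ κ R}
    (h : G * X = X' * G) (k : ℕ) : G * X ^ k = X' ^ k * G := by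
  induction k with
  | zero => simp
  | succ k ih => rw [pow_succ, pow_succ, ← Matrix.mul_assoc, ih, Matrix.mul_assoc, h, Matrix.mul_assoc]

namespace FormAlgebra

variable {P R : Type*} [Ring R] [Algebra ℂ R] [FormAlgebra P R]
variable {ι κ l : Type*} [Fintype ι] [Fintype κ] [Fintype l] [DecidableEq ι] [DecidableEq κ]

variable (P) in
/-- The entrywise differential of a matrix. -/
def dM (X : Matrix ι κ R) : Matrix ι κ R := X.map (d P)

/-- The entrywise derivative of a matrix in the parameters. -/
def pdM (v : P) (X : Matrix ι κ R) : Matrix ι κ R := X.map (pd v)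

variable (P) in
/-- All entries are even. -/
def IsEven (X : Matrix ι κ R) : Prop := ∀ i j, eps P (X i j) = X i j

variable (P) in
/-- All entries are odd. -/
def IsOdd (X : Matrix ι κ R) : Prop := ∀ i j, eps P (X i j) = -X i j

variable {X : Matrix ι κ R} {Y : Matrix κ l R}

theorem IsEven.central (hX : IsEven P X) (i j b) : X i j * b = b * X i j :=
  even_comm (P := P) _ _ (hX i j)

theorem IsEven.mul (hX : IsEven P X) (hY : IsEven P Y) : IsEven P (X * Y) := fun i j ↦ by
  simp only [Matrix.mul_apply, map_sum, map_mul, hX i _, hY _ j]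

theorem IsOdd.mul_even (hX : IsOdd P X) (hY : IsEven P Y) : IsOdd P (X * Y) := fun i j ↦ by
  simp only [Matrix.mul_apply, map_sum, map_mul, hX i _, hY _ j, neg_mul, Finset.sum_neg_distrib]

theorem IsOdd.mul (hX : IsOdd P X) (hY : IsOdd P Y) : IsEven P (X * Y) := fun i j ↦ by
  simp only [Matrix.mul_apply, map_sum, map_mul, hX i _, hY _ j, neg_mul_neg]

theorem IsEven.add {Y : Matrix ι κ R} (hX : IsEven P X) (hY : IsEven P Y) : IsEven P (X + Y) :=
  fun i j ↦ by simp only [Matrix.add_apply, map_add, hX i j, hY i j]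

theorem IsOdd.neg (hX : IsOdd P X) : IsOdd P (-X) :=
  fun i j ↦ by simp only [Matrix.neg_apply, map_neg, hX i j]

theorem IsOdd.transpose (hX : IsOdd P X) : IsOdd P X.transpose := fun i j ↦ hX j i

theorem IsEven.transpose (hX : IsEven P X) : IsEven P X.transpose := fun i j ↦ hX j i

theorem isEven_one : IsEven P (1 : Matrix ι ι R) := fun i j ↦ by
  rw [Matrix.one_apply]; split_ifs <;> simp

theorem IsEven.pow {X : Matrix ι ι R} (hX : IsEven P X) (k : ℕ) : IsEven P (X ^ k) := by
  induction k with
  | zero => rw [pow_zero]; exact isEven_one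
  | succ k ih => rw [pow_succ]; exact ih.mul hX

theorem IsOdd.dM (hX : IsOdd P X) : IsEven P (dM P X) := fun i j ↦ by
  have := d_eps (P := P) (X i j)
  rw [hX i j, map_neg, neg_inj] at this
  exact this.symm

theorem IsOdd.pdM (hX : IsOdd P X) (v : P) : IsOdd P (pdM v X) := fun i j ↦ by
  have := pd_eps v (X i j)
  rw [hX i j, map_neg] at this
  exact this.symm

theorem IsEven.pdM (hX : IsEven P X) (v : P) : IsEven P (pdM v X) := fun i j ↦ by
  have := pd_eps v (X i j)
  rw [hX i j] at this
  exact this.symm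

theorem IsEven.trace {X : Matrix ι ι R} (hX : IsEven P X) : eps P X.trace = X.trace := by
  simp only [Matrix.trace, map_sum, Matrix.diag, hX _ _]

theorem IsOdd.trace {X : Matrix ι ι R} (hX : IsOdd P X) : eps P X.trace = -X.trace := by
  simp only [Matrix.trace, map_sum, Matrix.diag, hX _ _, Finset.sum_neg_distrib]

theorem dM_add (X Y : Matrix ι κ R) : dM P (X + Y) = dM P X + dM P Y := by
  ext i j; exact map_add (d P) _ _

theorem dM_neg (X : Matrix ι κ R) : dM P (-X) = -dM P X := by
  ext i j; exact map_neg (d P) _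

theorem dM_dM (X : Matrix ι κ R) : dM P (dM P X) = 0 := by
  ext i j; exact d_d _

theorem dM_transpose (X : Matrix ι κ R) : dM P X.transpose = (dM P X).transpose := rfl

theorem IsEven.dM_mul (hX : IsEven P X) (Y : Matrix κ l R) :
    FormAlgebra.dM P (X * Y) = FormAlgebra.dM P X * Y + X * FormAlgebra.dM P Y := by
  ext i j
  simp only [FormAlgebra.dM, Matrix.map_apply, Matrix.add_apply, Matrix.mul_apply, map_sum, d_mul,
    hX i _, Finset.sum_add_distrib]

theorem IsOdd.dM_mul (hX : IsOdd P X) (Y : Matrix κ l R) :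
    FormAlgebra.dM P (X * Y) = FormAlgebra.dM P X * Y - X * FormAlgebra.dM P Y := by
  ext i j
  simp only [FormAlgebra.dM, Matrix.map_apply, Matrix.sub_apply, Matrix.mul_apply, map_sum, d_mul,
    hX i _, Finset.sum_add_distrib, neg_mul, Finset.sum_neg_distrib, sub_eq_add_neg]

theorem pdM_add (v : P) (X Y : Matrix ι κ R) : pdM v (X + Y) = pdM v X + pdM v Y := by
  ext i j; exact map_add (pd v) _ _

theorem pdM_sub (v : P) (X Y : Matrix ι κ R) : pdM v (X - Y) = pdM v X - pdM v Y := by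
  ext i j; exact map_sub (pd v) _ _

theorem pdM_dM (v : P) (X : Matrix ι κ R) : pdM v (dM P X) = dM P (pdM v X) := by
  ext i j; exact pd_d _ _

theorem pdM_comm (v w : P) (X : Matrix ι κ R) : pdM v (pdM w X) = pdM w (pdM v X) := by
  ext i j; exact pd_comm _ _ _

theorem pdM_mul (v : P) (X : Matrix ι κ R) (Y : Matrix κ l R) :
    pdM v (X * Y) = pdM v X * Y + X * pdM v Y := by
  ext i j
  simp only [pdM, Matrix.map_apply, Matrix.add_apply, Matrix.mul_apply, map_sum, pd_mul,
    Finset.sum_add_distrib]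

theorem pd_one (v : P) : pd v (1 : R) = 0 := by
  have := pd_mul v (1 : R) 1
  rw [mul_one, one_mul, mul_one] at this
  exact left_eq_add.1 this

theorem pdM_one (v : P) : pdM v (1 : Matrix ι ι R) = 0 := by
  ext i j
  simp only [pdM, Matrix.map_apply, Matrix.one_apply]
  split_ifs
  · exact pd_one v
  · exact map_zero _

theorem d_trace (X : Matrix ι ι R) : d P X.trace = (dM P X).trace := by
  simp [Matrix.trace, dM]

theorem pd_trace (v : P) (X : Matrix ι ι R) : pd v X.trace = (pdM v X).trace := by
  simp [Matrix.trace, pdM]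

theorem IsEven.trace_mul_comm {X : Matrix ι κ R} (hX : IsEven P X) (Y : Matrix κ ι R) :
    (X * Y).trace = (Y * X).trace :=
  Matrix.trace_mul_comm_of_commute hX.central Y

/-- The graded cyclicity of the trace, with a sign for two odd matrices. -/
theorem IsOdd.trace_mul_comm {X : Matrix ι κ R} {Y : Matrix κ ι R} (hX : IsOdd P X)
    (hY : IsOdd P Y) : (X * Y).trace = -(Y * X).trace := by
  simp only [Matrix.trace, Matrix.diag, Matrix.mul_apply]
  rw [Finset.sum_comm, ← Finset.sum_neg_distrib]
  refine Finset.sum_congr rfl fun i _ ↦ ?_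
  rw [← Finset.sum_neg_distrib]
  refine Finset.sum_congr rfl fun j _ ↦ ?_
  rw [odd_comm (P := P) _ _ (hX j i), hY i j, neg_mul]

/-! #### Covariant derivatives and curvature -/

variable {A B a b : Matrix ι ι R}

variable (P) in
/-- The curvature `dA + A ∧ A`. -/
def curv (A : Matrix ι ι R) : Matrix ι ι R := dM P A + A * A

variable (P) in
/-- The covariant derivative of an even endomorphism-valued form. -/
def covEven (A X : Matrix ι ι R) : Matrix ι ι R := dM P X + A * X - X * A

variable (P) in
/-- The covariant derivative of an odd endomorphism-valued form. -/
def covOdd (A X : Matrix ι ι R) : Matrix ι ι R := dM P X + A * X + X * A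

theorem IsOdd.curv (hA : IsOdd P A) : IsEven P (curv P A) := hA.dM.add (hA.mul hA)

/-- The trace turns the covariant derivative into the exterior derivative, because the trace of the
commutator with the connection matrix vanishes. -/
theorem trace_covEven {X : Matrix ι ι R} (hX : IsEven P X) :
    (covEven P A X).trace = d P X.trace := by
  rw [covEven, Matrix.trace_sub, Matrix.trace_add, hX.trace_mul_comm A, add_sub_cancel_right, d_trace]

/-- The analogue of `trace_covEven` for odd matrices, with the anticommutator. -/
theorem trace_covOdd {X : Matrix ι ι R} (hA : IsOdd P A) (hX : IsOdd P X) :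
    (covOdd P A X).trace = d P X.trace := by
  rw [covOdd, Matrix.trace_add, Matrix.trace_add, hA.trace_mul_comm hX, neg_add_cancel_right, d_trace]

theorem covEven_mul {X Y : Matrix ι ι R} (hX : IsEven P X) :
    covEven P A (X * Y) = covEven P A X * Y + X * covEven P A Y := by
  simp only [covEven, hX.dM_mul]; noncomm_ring

theorem covOdd_mul {X Y : Matrix ι ι R} (hX : IsOdd P X) :
    covOdd P A (X * Y) = covOdd P A X * Y - X * covEven P A Y := by
  simp only [covEven, covOdd, hX.dM_mul]; noncomm_ring

theorem covEven_mul_odd {X Y : Matrix ι ι R} (hX : IsOdd P X) :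
    covEven P A (X * Y) = covOdd P A X * Y - X * covOdd P A Y := by
  simp only [covEven, covOdd, hX.dM_mul]; noncomm_ring

/-- The Bianchi identity. -/
theorem covEven_curv (hA : IsOdd P A) : covEven P A (curv P A) = 0 := by
  simp only [covEven, curv, dM_add, dM_dM, hA.dM_mul]; noncomm_ring

theorem covEven_curv_pow (hA : IsOdd P A) (k : ℕ) : covEven P A (curv P A ^ k) = 0 := by
  induction k with
  | zero =>
    have : dM P (1 : Matrix ι ι R) = 0 := by
      have := (isEven_one (P := P) (ι := ι) (R := R)).dM_mul (1 : Matrix ι ι R)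
      rw [mul_one, one_mul, mul_one] at this
      exact left_eq_add.1 this
    simp [covEven, this]
  | succ k ih => rw [pow_succ, covEven_mul (hA.curv.pow k), ih, covEven_curv hA]; simp

/-- By the Bianchi identity, `d Tr (a Fᵏ) = Tr ((∇a) Fᵏ)` for odd `a`. -/
theorem d_trace_mul_curv_pow (hA : IsOdd P A) (ha : IsOdd P a) (k : ℕ) :
    d P (a * curv P A ^ k).trace = (covOdd P A a * curv P A ^ k).trace := by
  rw [← trace_covOdd hA (ha.mul_even (hA.curv.pow k)), covOdd_mul ha, covEven_curv_pow hA, mul_zero,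
    sub_zero]

/-- The analogue of `d_trace_mul_curv_pow` for even matrices. -/
theorem d_trace_even_mul_curv_pow {X : Matrix ι ι R} (hA : IsOdd P A) (hX : IsEven P X) (k : ℕ) :
    d P (X * curv P A ^ k).trace = (covEven P A X * curv P A ^ k).trace := by
  rw [← trace_covEven (A := A) (hX.mul (hA.curv.pow k)), covEven_mul hX, covEven_curv_pow hA,
    mul_zero, add_zero]

theorem d_trace_mul_curv_pow_mul (hA : IsOdd P A) (ha : IsOdd P a) (hb : IsOdd P b) (i j : ℕ) :
    d P (a * curv P A ^ i * (b * curv P A ^ j)).trace =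
      (covOdd P A a * curv P A ^ i * (b * curv P A ^ j)).trace -
        (a * curv P A ^ i * (covOdd P A b * curv P A ^ j)).trace := by
  have h1 := ha.mul_even (hA.curv.pow i)
  have h2 := hb.mul_even (hA.curv.pow j)
  rw [← trace_covEven (A := A) (h1.mul h2), covEven_mul_odd h1, covOdd_mul ha, covOdd_mul hb,
    covEven_curv_pow hA, covEven_curv_pow hA, Matrix.trace_sub]
  simp only [mul_zero, sub_zero]

/-- The variation of the curvature is the covariant derivative of the variation of the connection.
-/
theorem pdM_curv (v : P) (A : Matrix ι ι R) : pdM v (curv P A) = covOdd P A (pdM v A) := by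
  rw [curv, covOdd, pdM_add, pdM_mul, pdM_dM, add_assoc, add_comm (pdM v A * A)]

theorem pdM_pow (v : P) (X : Matrix ι ι R) (k : ℕ) :
    pdM v (X ^ k) = ∑ i ∈ Finset.range k, X ^ i * pdM v X * X ^ (k - 1 - i) := by
  induction k with
  | zero => simp [pdM_one]
  | succ k ih =>
    rw [pow_succ, pdM_mul, ih, Finset.sum_range_succ, Finset.sum_mul]
    congr 1
    · refine Finset.sum_congr rfl fun i hi ↦ ?_
      rw [Finset.mem_range] at hi
      rw [mul_assoc, ← pow_succ]
      congr 2; omega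
    · simp

/-- The derivative of the Chern character forms along a family of connections is exact. -/
theorem pd_trace_curv_pow (hA : IsOdd P A) (v : P) (k : ℕ) :
    pd v (curv P A ^ (k + 1)).trace =
      (k + 1 : ℂ) • d P (pdM v A * curv P A ^ k).trace := by
  rw [pd_trace, pdM_pow, Matrix.trace_sum, d_trace_mul_curv_pow hA (hA.pdM v), ← pdM_curv]
  have : ∀ i ∈ Finset.range (k + 1), (curv P A ^ i * pdM v (curv P A) *
      curv P A ^ (k + 1 - 1 - i)).trace = (pdM v (curv P A) * curv P A ^ k).trace := by
    intro i hi
    rw [Finset.mem_range] at hi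
    rw [mul_assoc, (hA.curv.pow i).trace_mul_comm, mul_assoc, ← pow_add]
    congr 3; omega
  rw [Finset.sum_congr rfl this, Finset.sum_const, Finset.card_range, ← Nat.cast_smul_eq_nsmul ℂ]
  simp

/-- The integrand of the homotopy between the Chern-Simons forms of two paths. -/
def homotopyForm (v w : P) (A : Matrix ι ι R) (k : ℕ) : R :=
  ∑ i ∈ Finset.range k, (pdM w A * curv P A ^ i * (pdM v A * curv P A ^ (k - 1 - i))).trace

/-- For a two-parameter family of connections, the Chern-Simons integrands form a closed one-form in
the parameters, up to exact forms. -/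
theorem pd_trace_sub_pd_trace (hA : IsOdd P A) (v w : P) (k : ℕ) :
    pd v (pdM w A * curv P A ^ k).trace - pd w (pdM v A * curv P A ^ k).trace =
      -d P (homotopyForm v w A k) := by
  have h1 : ∀ v w : P, pd v (pdM w A * curv P A ^ k).trace =
      (pdM v (pdM w A) * curv P A ^ k).trace + ∑ i ∈ Finset.range k,
        (pdM w A * curv P A ^ i * (covOdd P A (pdM v A) * curv P A ^ (k - 1 - i))).trace := by
    intro v w
    rw [pd_trace, pdM_mul, Matrix.trace_add, pdM_pow, Finset.mul_sum, Matrix.trace_sum]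
    simp only [pdM_curv, mul_assoc]
  have h2 : ∑ i ∈ Finset.range k,
        (pdM v A * curv P A ^ i * (covOdd P A (pdM w A) * curv P A ^ (k - 1 - i))).trace =
      ∑ i ∈ Finset.range k,
        (covOdd P A (pdM w A) * curv P A ^ i * (pdM v A * curv P A ^ (k - 1 - i))).trace := by
    -- reversing the order of the sum matches the terms cyclically
    rw [← Finset.sum_range_reflect]
    refine Finset.sum_congr rfl fun i hi ↦ ?_
    rw [Finset.mem_range] at hi
    have hi' : k - 1 - (k - 1 - i) = i := by omega
    have hc : IsEven P (covOdd P A (pdM w A)) := by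
      rw [← pdM_curv]; exact hA.curv.pdM w
    rw [hi', ← (hc.mul (hA.curv.pow i)).trace_mul_comm]
  rw [h1 v w, h1 w v, pdM_comm v w, h2, homotopyForm, map_sum, add_sub_add_left_eq_sub,
    ← Finset.sum_sub_distrib, ← Finset.sum_neg_distrib]
  refine Finset.sum_congr rfl fun i _ ↦ ?_
  rw [d_trace_mul_curv_pow_mul hA (hA.pdM w) (hA.pdM v), neg_sub]

/-! #### Gauge transformations, conjugate and transposed connections -/

/-- An intertwiner of connections intertwines their curvatures. -/
theorem curv_intertwine {G : Matrix κ ι R} {A' : Matrix κ κ R} (hG : IsEven P G) (hA' : IsOdd P A')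
    (h : G * A = A' * G + dM P G) : G * curv P A = curv P A' * G := by
  have h1 := congrArg (dM P) h
  rw [hG.dM_mul, dM_add, dM_dM, hA'.dM_mul, add_zero] at h1
  have h2 : G * dM P A = dM P A' * G - A' * dM P G - dM P G * A := by
    rw [← h1]; abel
  rw [curv, curv, Matrix.mul_add, h2, ← Matrix.mul_assoc, h, Matrix.add_mul, Matrix.add_mul,
    Matrix.mul_assoc A' G A, h, Matrix.mul_add, ← Matrix.mul_assoc]
  abel

/-- The dual connection `-Bᵗ` has curvature `-Fᵗ`: transposing a product of odd matrices reverses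
the sign. -/
theorem curv_neg_transpose (hB : IsOdd P B) :
    curv P (-B.transpose) = -(curv P B).transpose := by
  have : (B * B).transpose = -(B.transpose * B.transpose) := by
    ext i j
    simp only [Matrix.transpose_apply, Matrix.mul_apply, Matrix.neg_apply, ← Finset.sum_neg_distrib]
    refine Finset.sum_congr rfl fun k _ ↦ ?_
    rw [odd_comm (P := P) _ _ (hB j k), hB k i, neg_mul]
  rw [curv, curv, Matrix.transpose_add, this, dM_neg, dM_transpose]
  noncomm_ring

theorem curv_conj (A : Matrix ι ι R) : curv P (A.map (conj P)) = (curv P A).map (conj P) := by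
  ext i j
  simp [curv, dM, Matrix.mul_apply, d_conj]

/-- The variation of the adjoint connection under a variation of the metric `H` is the covariant
derivative of `ξ`, where `ξᵀ = (∂H) H⁻¹`. -/
theorem pdM_adjoint (v : P) {H K C ξ : Matrix ι ι R} (hKK : H * K = 1)
    (hK : K * H = 1) (hξ : ξ.transpose = pdM v H * K) (hC : pdM v C = 0) (hξe : IsEven P ξ)
    (h : B.transpose * H = dM P H - H * C) : pdM v B = covEven P B ξ := by
  have hξH : pdM v H = ξ.transpose * H := by rw [hξ, Matrix.mul_assoc, hK, Matrix.mul_one]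
  -- differentiate the equation of the adjoint, and multiply by `H⁻¹` on the right
  have h1 := congrArg (pdM v) h
  rw [pdM_mul, pdM_sub, pdM_mul, hC, pdM_dM, hξH, hξe.transpose.dM_mul, Matrix.mul_zero, add_zero,
    Matrix.mul_assoc ξ.transpose, ← add_sub, ← Matrix.mul_sub, ← h] at h1
  have h2 : (pdM v B.transpose) * H = (dM P ξ.transpose + ξ.transpose * B.transpose -
      B.transpose * ξ.transpose) * H := by
    rw [Matrix.sub_mul, Matrix.add_mul, Matrix.mul_assoc ξ.transpose, Matrix.mul_assoc B.transpose]
    rw [← h1]; abel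
  have h3 := congrArg (· * K) h2
  simp only [Matrix.mul_assoc, hKK, Matrix.mul_one] at h3
  have h4 : (ξ * B).transpose = B.transpose * ξ.transpose :=
    Matrix.transpose_mul_of_commute hξe.central B
  have h5 : (ξ.transpose * B.transpose).transpose = B * ξ := by
    rw [Matrix.transpose_mul_of_commute hξe.transpose.central]; simp
  have h6 := congrArg Matrix.transpose h3
  rw [Matrix.transpose_sub, Matrix.transpose_add, h5, ← h4] at h6
  exact h6

end FormAlgebra

/-! ### Families of differential forms on a manifold -/

section Manifold

variable {n : ℕ} {M : Type*} [TopologicalSpace M] [ChartedSpace (EuclideanSpace ℝ (Fin n)) M]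

/-- The value of a form at a point, read through the identification of the tangent space with the
model space that is built into its definition. -/
def FormField.val (α : FormField n M) (m : M) : CForms (Eucl n) := α m

/-- The derivative of the inverse chart, as an endomorphism of the model space. -/
def chartInvD (p : M) (y : Eucl n) : Eucl n →L[ℝ] Eucl n := chartSymmDeriv p y

/-- The derivative of the chart at its centre, as an endomorphism of the model space. -/
def chartD (p : M) : Eucl n →L[ℝ] Eucl n := chartDeriv p

theorem FormField.inChart_eq (α : FormField n M) (p : M) (y : Eucl n) :
    α.inChart p y = CForms.pull (chartInvD p y).toLinearMap
      (α.val ((extChartAt (𝓡 n) p).symm y)) := rfl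

theorem FormField.extD_eq (α : FormField n M) (p : M) :
    α.extD.val p = CForms.pull (chartD p).toLinearMap
      (euclideanExtDeriv (α.inChart p) (extChartAt (𝓡 n) p p)) := rfl

/-- The change of charts. -/
def chartChange (p x : M) : Eucl n → Eucl n := extChartAt (𝓡 n) x ∘ (extChartAt (𝓡 n) p).symm

variable [IsManifold (𝓡 n) ∞ M]

theorem chartChange_contDiffAt {p x : M} {y : Eucl n} (hy : y ∈ (extChartAt (𝓡 n) p).target)
    (hx : (extChartAt (𝓡 n) p).symm y ∈ (extChartAt (𝓡 n) x).source) :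
    ContDiffAt ℝ ∞ (chartChange p x) y := by
  have h := contDiffWithinAt_ext_coord_change (I := 𝓡 n) (n := ∞) x p (y := y)
    (by simp only [PartialEquiv.trans_source, PartialEquiv.symm_source, Set.mem_inter_iff,
          Set.mem_preimage]; exact ⟨hy, hx⟩)
  rwa [ModelWithCorners.range_eq_univ, contDiffWithinAt_univ] at h

theorem mdiffAt_extChartAt_symm {p : M} {y : Eucl n} (hy : y ∈ (extChartAt (𝓡 n) p).target) :
    MDifferentiableAt 𝓘(ℝ, Eucl n) (𝓡 n) (extChartAt (𝓡 n) p).symm y := by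
  have := (contMDiffOn_extChartAt_symm (I := 𝓡 n) (n := ∞) p).contMDiffAt
    ((isOpen_extChartAt_target p).mem_nhds hy)
  exact this.mdifferentiableAt (by simp)

theorem mdiffAt_extChartAt {p x : M} (hx : x ∈ (extChartAt (𝓡 n) p).source) :
    MDifferentiableAt (𝓡 n) 𝓘(ℝ, Eucl n) (extChartAt (𝓡 n) p) x :=
  (contMDiffAt_extChartAt' (I := 𝓡 n) (n := ∞) (by rwa [← extChartAt_source (𝓡 n)])).mdifferentiableAt
    (by simp)

theorem chartInvD_comp {p x : M} {y : Eucl n} (hy : y ∈ (extChartAt (𝓡 n) p).target)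
    (hx : (extChartAt (𝓡 n) p).symm y ∈ (extChartAt (𝓡 n) x).source) :
    (chartInvD x (chartChange p x y)).comp (fderiv ℝ (chartChange p x) y) = chartInvD p y := by
  have hψ := (chartChange_contDiffAt hy hx).differentiableAt (by simp)
  have ht : chartChange p x y ∈ (extChartAt (𝓡 n) x).target := (extChartAt (𝓡 n) x).map_source hx
  have h1 : mfderiv 𝓘(ℝ, Eucl n) (𝓡 n) ((extChartAt (𝓡 n) x).symm ∘ chartChange p x) y =
      (mfderiv 𝓘(ℝ, Eucl n) (𝓡 n) (extChartAt (𝓡 n) x).symm (chartChange p x y)).comp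
        (mfderiv 𝓘(ℝ, Eucl n) 𝓘(ℝ, Eucl n) (chartChange p x) y) :=
    mfderiv_comp y (mdiffAt_extChartAt_symm ht) hψ.mdifferentiableAt
  have h2 : (extChartAt (𝓡 n) x).symm ∘ chartChange p x =ᶠ[nhds y] (extChartAt (𝓡 n) p).symm := by
    have hc : ContinuousAt (extChartAt (𝓡 n) p).symm y :=
      (mdiffAt_extChartAt_symm hy).continuousAt
    filter_upwards [hc.preimage_mem_nhds ((isOpen_extChartAt_source (I := 𝓡 n) x).mem_nhds hx)]
      with z hz using (extChartAt (𝓡 n) x).left_inv hz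
  have h3 := h2.mfderiv_eq (I := 𝓘(ℝ, Eucl n)) (I' := 𝓡 n)
  rw [mfderiv_eq_fderiv] at h1
  exact h1.symm.trans h3

theorem chartD_comp {p x : M} {y : Eucl n} (hy : y ∈ (extChartAt (𝓡 n) p).target)
    (hx : (extChartAt (𝓡 n) p).symm y = x) :
    (chartD x).comp (chartInvD p y) = fderiv ℝ (chartChange p x) y := by
  subst hx
  have h1 := mfderiv_comp (I := 𝓘(ℝ, Eucl n)) (I' := 𝓡 n) (I'' := 𝓘(ℝ, Eucl n)) y
    (mdiffAt_extChartAt (mem_extChartAt_source ((extChartAt (𝓡 n) p).symm y)))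
    (mdiffAt_extChartAt_symm hy)
  rw [mfderiv_eq_fderiv] at h1
  exact h1.symm

theorem chartChange_self (x : M) : chartChange x x =ᶠ[nhds (extChartAt (𝓡 n) x x)] id := by
  filter_upwards [extChartAt_target_mem_nhds (I := 𝓡 n) x] with z hz
  exact (extChartAt (𝓡 n) x).right_inv hz

theorem chartD_chartInvD (x : M) :
    (chartD x).comp (chartInvD x (extChartAt (𝓡 n) x x)) = ContinuousLinearMap.id ℝ _ := by
  rw [chartD_comp (mem_extChartAt_target x) (extChartAt_to_inv x), (chartChange_self x).fderiv_eq,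
    fderiv_id]

theorem chartInvD_chartD (x : M) :
    (chartInvD x (extChartAt (𝓡 n) x x)).comp (chartD x) = ContinuousLinearMap.id ℝ _ := by
  have h := chartD_chartInvD (n := n) x
  ext1 v
  have h2 := mul_eq_one_comm.1 (show (chartD x).toLinearMap *
    (chartInvD x (extChartAt (𝓡 n) x x)).toLinearMap = 1 from
    congrArg ContinuousLinearMap.toLinearMap h)
  exact DFunLike.congr_fun h2 v

/-- The expressions of a form in two charts differ by the pullback along the change of charts. -/
theorem FormField.inChart_eq_pull (α : FormField n M) {p x : M} {y : Eucl n}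
    (hy : y ∈ (extChartAt (𝓡 n) p).target)
    (hx : (extChartAt (𝓡 n) p).symm y ∈ (extChartAt (𝓡 n) x).source) :
    α.inChart p y = CForms.pull (fderiv ℝ (chartChange p x) y).toLinearMap
      (α.inChart x (chartChange p x y)) := by
  rw [FormField.inChart_eq, FormField.inChart_eq, ← CForms.pull_comp]
  have h := chartInvD_comp hy hx
  have e : (extChartAt (𝓡 n) x).symm (chartChange p x y) = (extChartAt (𝓡 n) p).symm y :=
    (extChartAt (𝓡 n) x).left_inv hx
  rw [e, ← h]; rfl

theorem FormField.val_eq_pull (α : FormField n M) (x : M) :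
    α.val x = CForms.pull (chartD x).toLinearMap (α.inChart x (extChartAt (𝓡 n) x x)) := by
  rw [FormField.inChart_eq, ← CForms.pull_comp]
  have h : (chartInvD x (extChartAt (𝓡 n) x x)).toLinearMap ∘ₗ (chartD x).toLinearMap =
      LinearMap.id := congrArg ContinuousLinearMap.toLinearMap (chartInvD_chartD (n := n) x)
  rw [h, CForms.pull_id, extChartAt_to_inv]

/-- The exterior derivative, computed in the chart at `p`, is given by the Euclidean formula. -/
theorem FormField.inChart_extD (α : FormField n M) {p : M} {y : Eucl n}
    (hy : y ∈ (extChartAt (𝓡 n) p).target)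
    (hα : DifferentiableAt ℝ (α.inChart ((extChartAt (𝓡 n) p).symm y))
      (extChartAt (𝓡 n) ((extChartAt (𝓡 n) p).symm y) ((extChartAt (𝓡 n) p).symm y))) :
    α.extD.inChart p y = euclideanExtDeriv (α.inChart p) y := by
  set x := (extChartAt (𝓡 n) p).symm y with hxdef
  have hx : (extChartAt (𝓡 n) p).symm y ∈ (extChartAt (𝓡 n) x).source := mem_extChartAt_source x
  have hψ := chartChange_contDiffAt hy hx
  have h1 : α.inChart p =ᶠ[nhds y] fun y ↦ CForms.pull (fderiv ℝ (chartChange p x) y).toLinearMap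
      (α.inChart x (chartChange p x y)) := by
    have hc : ContinuousAt (extChartAt (𝓡 n) p).symm y :=
      (mdiffAt_extChartAt_symm hy).continuousAt
    filter_upwards [hc.preimage_mem_nhds ((isOpen_extChartAt_source (I := 𝓡 n) x).mem_nhds hx),
      (isOpen_extChartAt_target (I := 𝓡 n) p).mem_nhds hy] with z hz hz'
      using α.inChart_eq_pull hz' hz
  have e : chartChange p x y = extChartAt (𝓡 n) x x := rfl
  rw [euclideanExtDeriv_congr h1, euclideanExtDeriv_pull hψ hα, e, FormField.inChart_eq, ← hxdef,
    FormField.extD_eq, ← CForms.pull_comp, ← chartD_comp hy rfl]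
  rfl

/-! #### Smooth families -/

/-- The space of parameters. Two of them are needed, for Stokes' theorem on a square of
connections. -/
abbrev Params : Type := ℝ × ℝ

/-- A family of forms depending on parameters is jointly smooth at a point. -/
def FamSmoothAt (α : Params → FormField n M) (u : Params) (x : M) : Prop :=
  ContDiffAt ℝ ∞ (fun q : Params × Eucl n ↦ (α q.1).inChart x q.2) (u, extChartAt (𝓡 n) x x)

/-- Joint smoothness of a family in one chart implies joint smoothness in any other chart. -/
theorem contDiffAt_inChart_change {α : Params → FormField n M} {u : Params} {p p' x : M}
    (hp : x ∈ (extChartAt (𝓡 n) p).source) (hp' : x ∈ (extChartAt (𝓡 n) p').source)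
    (h : ContDiffAt ℝ ∞ (fun q : Params × Eucl n ↦ (α q.1).inChart p q.2)
      (u, extChartAt (𝓡 n) p x)) :
    ContDiffAt ℝ ∞ (fun q : Params × Eucl n ↦ (α q.1).inChart p' q.2)
      (u, extChartAt (𝓡 n) p' x) := by
  set y := extChartAt (𝓡 n) p' x with hydef
  have hy : y ∈ (extChartAt (𝓡 n) p').target := (extChartAt (𝓡 n) p').map_source hp'
  have hinv : (extChartAt (𝓡 n) p').symm y = x := (extChartAt (𝓡 n) p').left_inv hp'
  have hx : (extChartAt (𝓡 n) p').symm y ∈ (extChartAt (𝓡 n) p).source := by rwa [hinv]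
  have hψ := chartChange_contDiffAt hy hx
  have hψy : chartChange p' p y = extChartAt (𝓡 n) p x := congrArg _ hinv
  have h1 : (fun q : Params × Eucl n ↦ (α q.1).inChart p' q.2) =ᶠ[nhds (u, y)] fun q ↦
      CForms.pull (fderiv ℝ (chartChange p' p) q.2).toLinearMap
        ((α q.1).inChart p (chartChange p' p q.2)) := by
    have hc : ContinuousAt (extChartAt (𝓡 n) p').symm y :=
      (mdiffAt_extChartAt_symm hy).continuousAt
    have h2 := hc.preimage_mem_nhds ((isOpen_extChartAt_source (I := 𝓡 n) p).mem_nhds hx)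
    have h3 := (isOpen_extChartAt_target (I := 𝓡 n) p').mem_nhds hy
    filter_upwards [continuousAt_snd.preimage_mem_nhds (x := (u, y)) h2,
      continuousAt_snd.preimage_mem_nhds (x := (u, y)) h3] with q hq hq'
      using (α q.1).inChart_eq_pull hq' hq
  have hs : ContDiffAt ℝ ∞ (fun q : Params × Eucl n ↦ q.2) (u, y) := contDiffAt_snd
  have hL : ContDiffAt ℝ ∞ (fun q : Params × Eucl n ↦ fderiv ℝ (chartChange p' p) q.2) (u, y) :=
    ContDiffAt.comp (g := fderiv ℝ (chartChange p' p)) (u, y) (hψ.fderiv_right le_rfl) hs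
  have hψ2 : ContDiffAt ℝ ∞ (fun q : Params × Eucl n ↦ chartChange p' p q.2) (u, y) :=
    ContDiffAt.comp (g := chartChange p' p) (u, y) hψ hs
  have hα : ContDiffAt ℝ ∞ (fun q : Params × Eucl n ↦ (α q.1).inChart p (chartChange p' p q.2))
      (u, y) := by
    rw [← hψy] at h
    exact ContDiffAt.comp (g := fun q : Params × Eucl n ↦ (α q.1).inChart p q.2)
      (f := fun q : Params × Eucl n ↦ (q.1, chartChange p' p q.2)) (u, y)
      h (contDiffAt_fst.prodMk hψ2)
  have h4 := (contDiff_pull (n := n)).contDiffAt (x := (fderiv ℝ (chartChange p' p) y,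
    (α u).inChart p (chartChange p' p y)))
  have h5 := ContDiffAt.comp (f := fun q : Params × Eucl n ↦ (fderiv ℝ (chartChange p' p) q.2,
    (α q.1).inChart p (chartChange p' p q.2))) (u, y) h4 (hL.prodMk hα)
  exact ContDiffAt.congr_of_eventuallyEq h5 h1

theorem FamSmoothAt.inChart {α : Params → FormField n M} {u : Params} {x p : M}
    (h : FamSmoothAt α u x) (hp : x ∈ (extChartAt (𝓡 n) p).source) :
    ContDiffAt ℝ ∞ (fun q : Params × Eucl n ↦ (α q.1).inChart p q.2) (u, extChartAt (𝓡 n) p x) :=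
  contDiffAt_inChart_change (mem_extChartAt_source x) hp h

theorem FamSmoothAt.inChart' {α : Params → FormField n M} {u : Params} {p : M} {y : Eucl n}
    (hy : y ∈ (extChartAt (𝓡 n) p).target)
    (h : FamSmoothAt α u ((extChartAt (𝓡 n) p).symm y)) :
    ContDiffAt ℝ ∞ (fun q : Params × Eucl n ↦ (α q.1).inChart p q.2) (u, y) := by
  have := h.inChart ((extChartAt (𝓡 n) p).map_target hy)
  rwa [(extChartAt (𝓡 n) p).right_inv hy] at this

/-- A form is smooth if and only if the constant family is smooth. -/
theorem isSmooth_iff_famSmoothAt {α : FormField n M} (u : Params) :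
    α.IsSmooth ↔ ∀ x, FamSmoothAt (fun _ ↦ α) u x := by
  constructor
  · intro h x
    have h1 : ContDiffAt ℝ ∞ (α.inChart x) (extChartAt (𝓡 n) x x) :=
      (h x).contDiffAt (extChartAt_target_mem_nhds x)
    exact ContDiffAt.comp (g := α.inChart x) (f := fun q : Params × Eucl n ↦ q.2)
      (u, extChartAt (𝓡 n) x x) h1 contDiffAt_snd
  · intro h p y hy
    have h1 := FamSmoothAt.inChart' hy (h ((extChartAt (𝓡 n) p).symm y))
    exact (ContDiffAt.comp (g := fun q : Params × Eucl n ↦ α.inChart p q.2)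
      (f := fun y ↦ (u, y)) y h1 (contDiffAt_const.prodMk contDiffAt_id)).contDiffWithinAt

theorem FamSmoothAt.differentiableAt {α : Params → FormField n M} {u : Params} {x : M}
    (h : FamSmoothAt α u x) : ContDiffAt ℝ ∞ ((α u).inChart x) (extChartAt (𝓡 n) x x) :=
  ContDiffAt.comp (g := fun q : Params × Eucl n ↦ (α q.1).inChart x q.2)
      (f := fun y ↦ (u, y)) _ h (contDiffAt_const.prodMk contDiffAt_id)

theorem eventually_symm {x : M} {C : M → Prop} (h : ∀ᶠ y in nhds x, C y) :
    ∀ᶠ y in nhds (extChartAt (𝓡 n) x x), C ((extChartAt (𝓡 n) x).symm y) := by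
  have hc := continuousAt_extChartAt_symm (I := 𝓡 n) x
  rw [← extChartAt_to_inv (I := 𝓡 n) x] at h
  exact hc.eventually h

theorem FamSmoothAt.congr {α β : Params → FormField n M} {u : Params} {x : M}
    (h : FamSmoothAt α u x) (he : ∀ᶠ y in nhds x, ∀ u, β u y = α u y) : FamSmoothAt β u x := by
  refine ContDiffAt.congr_of_eventuallyEq h ?_
  have h1 := (continuous_snd (X := Params) (Y := Eucl n)).continuousAt
    (x := (u, extChartAt (𝓡 n) x x))
  filter_upwards [h1.eventually (eventually_symm he)] with q hq
  rw [FormField.inChart_eq, FormField.inChart_eq, FormField.val, FormField.val, hq]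

theorem FormField.extD_congr {α β : FormField n M} {x : M} (he : ∀ᶠ y in nhds x, α y = β y) :
    α.extD x = β.extD x := by
  refine congrArg (CForms.pull (chartD x).toLinearMap) (euclideanExtDeriv_congr ?_)
  filter_upwards [eventually_symm he] with y hy
  rw [FormField.inChart_eq, FormField.inChart_eq, FormField.val, FormField.val, hy]

end Manifold

/-! ### The algebra of families of forms on an open set -/

section LocalForms

open TopologicalSpace

variable {n : ℕ} {M : Type*} [TopologicalSpace M] [ChartedSpace (EuclideanSpace ℝ (Fin n)) M]

/-- A family of forms read in the chart at `p`. -/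
def fam (α : Params → FormField n M) (p : M) (q : Params × Eucl n) : CForms (Eucl n) :=
  (α q.1).inChart p q.2

variable (n) in
/-- Families of fields of forms on an open set, without regularity. -/
abbrev LocalField (W : Opens M) : Type _ := Params → ∀ x : W, CForms (TangentSpace (𝓡 n) (x : M))

variable {W : Opens M}

open Classical in
/-- The extension by zero. -/
def LocalField.ext (a : LocalField n W) : Params → FormField n M :=
  fun u x ↦ if h : x ∈ W then a u ⟨x, h⟩ else 0

theorem LocalField.ext_apply (a : LocalField n W) (u : Params) {x : M} (h : x ∈ W) :
    a.ext u x = a u ⟨x, h⟩ := dif_pos h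

theorem LocalField.ext_coe (a : LocalField n W) (u : Params) (x : W) :
    a.ext u (x : M) = a u x := dif_pos x.2

/-- The part of the chart domain that lies in `W`. -/
def chartDom (W : Opens M) (p : M) : Set (Params × Eucl n) :=
  {q | q.2 ∈ (extChartAt (𝓡 n) p).target ∧ (extChartAt (𝓡 n) p).symm q.2 ∈ W}

variable (W) in
theorem isOpen_chartDom (p : M) : IsOpen (chartDom (n := n) W p) := by
  have h := (continuousOn_extChartAt_symm (I := 𝓡 n) p).isOpen_inter_preimage
    (isOpen_extChartAt_target p) W.isOpen
  exact h.preimage continuous_snd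

theorem center_mem_chartDom {x : M} (hx : x ∈ W) (u : Params) :
    (u, extChartAt (𝓡 n) x x) ∈ chartDom W x :=
  ⟨mem_extChartAt_target x, by rwa [extChartAt_to_inv]⟩

theorem fam_congr {α β : Params → FormField n M} {p : M} {q : Params × Eucl n}
    (h : α q.1 ((extChartAt (𝓡 n) p).symm q.2) = β q.1 ((extChartAt (𝓡 n) p).symm q.2)) :
    fam α p q = fam β p q := congrArg (CForms.pull _) h

theorem fam_ext {a : LocalField n W} {β : Params → FormField n M} {p : M}
    {q : Params × Eucl n} (hq : q ∈ chartDom W p) (h : ∀ x : W, a q.1 x = β q.1 x) :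
    fam a.ext p q = fam β p q :=
  fam_congr ((a.ext_apply q.1 hq.2).trans (h ⟨_, hq.2⟩))

theorem fam_add (α β : Params → FormField n M) (p : M) (q : Params × Eucl n) :
    fam (α + β) p q = fam α p q + fam β p q := map_add (CForms.pull _) _ _

theorem fam_mul (α β : Params → FormField n M) (p : M) (q : Params × Eucl n) :
    fam (α * β) p q = fam α p q * fam β p q := map_mul (CForms.pull _) _ _

theorem fam_smul (c : ℂ) (α : Params → FormField n M) (p : M) (q : Params × Eucl n) :
    fam (c • α) p q = c • fam α p q := map_smul (CForms.pull (chartInvD p q.2).toLinearMap) c (α q.1 _)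

theorem fam_eps (α : Params → FormField n M) (p : M) (q : Params × Eucl n) :
    fam (fun u x ↦ CForms.eps (α u x)) p q = CForms.eps (fam α p q) := CForms.pull_eps _ _

theorem fam_conj (α : Params → FormField n M) (p : M) (q : Params × Eucl n) :
    fam (fun u x ↦ CForms.conj (α u x)) p q = CForms.conj (fam α p q) := CForms.pull_conj _ _

theorem fam_algebraMap (f : Params → M → ℂ) (p : M) (q : Params × Eucl n) :
    fam (fun u x ↦ algebraMap ℂ (CForms (TangentSpace (𝓡 n) x)) (f u x)) p q =
      algebraMap ℂ (CForms (Eucl n)) (f q.1 ((extChartAt (𝓡 n) p).symm q.2)) :=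
  AlgHom.commutes _ _

theorem LocalField.ext_add (a b : LocalField n W) : (a + b).ext = a.ext + b.ext := by
  funext u x
  by_cases h : x ∈ W <;> simp [LocalField.ext, h]

theorem LocalField.ext_mul (a b : LocalField n W) : (a * b).ext = a.ext * b.ext := by
  funext u x
  by_cases h : x ∈ W <;> simp [LocalField.ext, h]

theorem LocalField.ext_smul (c : ℂ) (a : LocalField n W) : (c • a).ext = c • a.ext := by
  funext u x
  by_cases h : x ∈ W <;> simp [LocalField.ext, h]

/-- Smoothness at `x` of a function of the parameters and the point. -/
def FunSmoothAt (n : ℕ) {M : Type*} [TopologicalSpace M]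
    [ChartedSpace (EuclideanSpace ℝ (Fin n)) M] (f : Params → M → ℂ) (u : Params) (x : M) : Prop :=
  ContDiffAt ℝ ∞ (fun q : Params × Eucl n ↦ f q.1 ((extChartAt (𝓡 n) x).symm q.2))
    (u, extChartAt (𝓡 n) x x)

theorem FunSmoothAt.famSmoothAt {f : Params → M → ℂ} {u : Params} {x : M}
    (h : FunSmoothAt n f u x) :
    FamSmoothAt (fun u x ↦ algebraMap ℂ (CForms (TangentSpace (𝓡 n) x)) (f u x)) u x := by
  have h2 := (CForms.scalarL (Eucl n)).contDiff.contDiffAt.comp (u, extChartAt (𝓡 n) x x) h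
  refine ContDiffAt.congr_of_eventuallyEq h2 (Filter.Eventually.of_forall fun q ↦ ?_)
  exact fam_algebraMap f x q

variable [IsManifold (𝓡 n) ∞ M]

theorem famSmoothAt_ext {a : LocalField n W} {β : Params → FormField n M} {u : Params} {x : M}
    (hx : x ∈ W) (h : FamSmoothAt β u x) (he : ∀ u, ∀ x : W, a u x = β u x) :
    FamSmoothAt a.ext u x := by
  refine h.congr ?_
  filter_upwards [W.isOpen.mem_nhds hx] with y hy v
  rw [a.ext_apply v hy, he]

variable (n W) in
/-- The smooth families, as a subalgebra of all families. -/
def localFormsSubalgebra : Subalgebra ℂ (LocalField n W) where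
  carrier := {a | ∀ u, ∀ x ∈ W, FamSmoothAt a.ext u x}
  mul_mem' {a b} ha hb u x hx := by
    refine ContDiffAt.congr_of_eventuallyEq (CForms.contDiffAt_mul (ha u x hx) (hb u x hx))
      (Filter.Eventually.of_forall fun q ↦ ?_)
    rw [LocalField.ext_mul]
    exact fam_mul a.ext b.ext x q
  add_mem' {a b} ha hb u x hx := by
    refine ContDiffAt.congr_of_eventuallyEq (ContDiffAt.add (ha u x hx) (hb u x hx))
      (Filter.Eventually.of_forall fun q ↦ ?_)
    rw [LocalField.ext_add]
    exact fam_add a.ext b.ext x q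
  algebraMap_mem' c u x hx := famSmoothAt_ext (β := fun _ x ↦ algebraMap ℂ _ c) hx
    (FunSmoothAt.famSmoothAt (f := fun _ _ ↦ c) contDiffAt_const) fun _ _ ↦ rfl

variable (n W) in
/-- Smooth families of forms on an open set. -/
def LocalForms : Type _ := localFormsSubalgebra n W

namespace LocalForms

instance : Ring (LocalForms n W) := inferInstanceAs (Ring (localFormsSubalgebra n W))

instance : Algebra ℂ (LocalForms n W) := inferInstanceAs (Algebra ℂ (localFormsSubalgebra n W))

theorem ext_iff' {a b : LocalForms n W} : a = b ↔ ∀ u x, a.1 u x = b.1 u x :=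
  ⟨fun h _ _ ↦ h ▸ rfl, fun h ↦ Subtype.ext (funext fun u ↦ funext fun x ↦ h u x)⟩

theorem contDiffAt (a : LocalForms n W) {p : M} {q : Params × Eucl n} (hq : q ∈ chartDom W p) :
    ContDiffAt ℝ ∞ (fam a.1.ext p) q :=
  FamSmoothAt.inChart' hq.1 (a.2 q.1 _ hq.2)

theorem differentiableAt (a : LocalForms n W) {p : M} {q : Params × Eucl n}
    (hq : q ∈ chartDom W p) : DifferentiableAt ℝ (fam a.1.ext p) q :=
  (LocalForms.contDiffAt a hq).differentiableAt (by simp)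

/-- A local family is determined by its expressions in charts. -/
theorem ext_of_fam {a b : LocalForms n W}
    (h : ∀ u, ∀ x ∈ W, fam a.1.ext x (u, extChartAt (𝓡 n) x x) =
      fam b.1.ext x (u, extChartAt (𝓡 n) x x)) : a = b := by
  refine ext_iff'.2 fun u x ↦ ?_
  have h1 := FormField.val_eq_pull (a.1.ext u) (x : M)
  have h2 := FormField.val_eq_pull (b.1.ext u) (x : M)
  have h3 := h u x x.2
  rw [← a.1.ext_coe, ← b.1.ext_coe]
  exact h1.trans ((congrArg _ h3).trans h2.symm)

/-- The exterior derivative on families, without its smoothness. -/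
def dField (a : LocalField n W) : LocalField n W := fun u x ↦ (a.ext u).extD x

theorem fderiv_fam_inr (a : LocalForms n W) {p : M} {q : Params × Eucl n}
    (hq : q ∈ chartDom W p) (v : Eucl n) :
    fderiv ℝ (fun y ↦ fam a.1.ext p (q.1, y)) q.2 v = fderiv ℝ (fam a.1.ext p) q (0, v) := by
  have h := HasFDerivAt.comp (f := fun y ↦ (q.1, y)) q.2
    (LocalForms.differentiableAt a hq).hasFDerivAt (hasFDerivAt_prodMk_right (𝕜 := ℝ) q.1 q.2)
  exact DFunLike.congr_fun h.fderiv v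

theorem fderiv_fam_inl (a : LocalForms n W) {p : M} {q : Params × Eucl n}
    (hq : q ∈ chartDom W p) :
    HasFDerivAt (fun u ↦ fam a.1.ext p (u, q.2))
      ((fderiv ℝ (fam a.1.ext p) q).comp (ContinuousLinearMap.inl ℝ _ _)) q.1 :=
  HasFDerivAt.comp (f := fun u ↦ (u, q.2)) q.1
    (LocalForms.differentiableAt a hq).hasFDerivAt (hasFDerivAt_prodMk_left (𝕜 := ℝ) q.1 q.2)

/-- In a chart, the exterior derivative of a family is the sum of the `dxⁱ ∧ ∂ᵢ` in the space
variables. -/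
theorem fam_dField (a : LocalForms n W) {p : M} {q : Params × Eucl n} (hq : q ∈ chartDom W p) :
    fam (dField a.1).ext p q =
      ∑ i, dx i * fderiv ℝ (fam a.1.ext p) q (0, EuclideanSpace.single i 1) := by
  rw [fam_ext (β := fun u ↦ (a.1.ext u).extD) hq fun _ ↦ rfl]
  have h := FormField.inChart_extD (a.1.ext q.1) hq.1
    (((a.2 q.1 _ hq.2).differentiableAt).differentiableAt (by simp))
  refine h.trans ?_
  rw [euclideanExtDeriv_eq]
  exact Finset.sum_congr rfl fun i _ ↦ congrArg _ (LocalForms.fderiv_fam_inr a hq _)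

theorem contDiffAt_fderiv (a : LocalForms n W) {p : M} {q : Params × Eucl n}
    (hq : q ∈ chartDom W p) (v : Params × Eucl n) :
    ContDiffAt ℝ ∞ (fun q ↦ fderiv ℝ (fam a.1.ext p) q v) q :=
  ((LocalForms.contDiffAt a hq).fderiv_right (m := ∞) le_rfl).clm_apply contDiffAt_const

/-- Smoothness of a family that is given in charts by a smooth expression. -/
theorem mem_of_fam {b : LocalField n W} (g : M → Params × Eucl n → CForms (Eucl n))
    (h : ∀ p, ∀ q ∈ chartDom W p, fam b.ext p q = g p q)
    (hg : ∀ p, ∀ q ∈ chartDom W p, ContDiffAt ℝ ∞ (g p) q) : b ∈ localFormsSubalgebra n W := by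
  intro u x hx
  have hq := center_mem_chartDom (n := n) hx u
  refine ContDiffAt.congr_of_eventuallyEq (hg x _ hq) ?_
  filter_upwards [(isOpen_chartDom W x).mem_nhds hq] with q hq using h x q hq

/-- The exterior derivative. -/
def dL : LocalForms n W →ₗ[ℂ] LocalForms n W where
  toFun a := ⟨dField a.1, mem_of_fam _ (fun _ _ hq ↦ LocalForms.fam_dField a hq) fun p q hq ↦
    ContDiffAt.sum fun i _ ↦ CForms.contDiffAt_mul contDiffAt_const (LocalForms.contDiffAt_fderiv a hq _)⟩
  map_add' a b := by
    refine ext_of_fam fun u x hx ↦ ?_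
    have hq := center_mem_chartDom (n := n) hx u
    have e : fam (a + b).1.ext x = fam a.1.ext x + fam b.1.ext x := by
      change fam (LocalField.ext (a.1 + b.1)) x = _
      rw [LocalField.ext_add]; exact funext fun q ↦ fam_add _ _ x q
    change fam (dField (a + b).1).ext x _ = fam (LocalField.ext (dField a.1 + dField b.1)) x _
    rw [LocalField.ext_add, fam_add, fam_dField _ hq, fam_dField _ hq, fam_dField _ hq, e,
      fderiv_add (LocalForms.differentiableAt a hq) (LocalForms.differentiableAt b hq), ← Finset.sum_add_distrib]
    exact Finset.sum_congr rfl fun i _ ↦ mul_add _ _ _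
  map_smul' c a := by
    refine ext_of_fam fun u x hx ↦ ?_
    have hq := center_mem_chartDom (n := n) hx u
    have e : fam (c • a).1.ext x = fun q ↦ CForms.smulL c (fam a.1.ext x q) := by
      change fam (LocalField.ext (c • a.1)) x = _
      rw [LocalField.ext_smul]; exact funext fun q ↦ fam_smul _ _ x q
    change fam (dField (c • a).1).ext x _ = fam (LocalField.ext (c • dField a.1)) x _
    rw [LocalField.ext_smul, fam_smul, fam_dField _ hq, fam_dField _ hq, e, Finset.smul_sum]
    refine Finset.sum_congr rfl fun i _ ↦ ?_
    rw [CForms.fderiv_clm_apply _ (LocalForms.differentiableAt a hq), ← mul_smul_comm]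
    rfl

theorem fam_dL (a : LocalForms n W) {p : M} {q : Params × Eucl n} (hq : q ∈ chartDom W p) :
    fam (dL a).1.ext p q =
      ∑ i, dx i * fderiv ℝ (fam a.1.ext p) q (0, EuclideanSpace.single i 1) := LocalForms.fam_dField a hq

/-- The derivative in the parameters, without its smoothness. -/
def pdField (v : Params) (a : LocalField n W) : LocalField n W := fun u x ↦
  fderiv ℝ (fun u ↦ a u x) u v

/-- The family at a fixed point is the pullback of a fixed fibre of its expression in a chart. -/
theorem val_eq_pull_fam (a : LocalField n W) (u : Params) (x : W) :
    a u x = CForms.pull (chartD (x : M)).toLinearMap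
      (fam a.ext (x : M) (u, extChartAt (𝓡 n) (x : M) (x : M))) :=
  (a.ext_coe u x).symm.trans (FormField.val_eq_pull (a.ext u) (x : M))

theorem differentiableAt_param (a : LocalForms n W) (u : Params) (x : W) :
    DifferentiableAt ℝ (fun u ↦ a.1 u x) u := by
  have h := (CForms.pullL (chartD (x : M)).toLinearMap).hasFDerivAt.comp u
    (LocalForms.fderiv_fam_inl a (center_mem_chartDom (n := n) x.2 u))
  have e : (fun u ↦ a.1 u x) = fun u ↦ CForms.pullL (chartD (x : M)).toLinearMap
      (fam a.1.ext (x : M) (u, extChartAt (𝓡 n) (x : M) (x : M))) :=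
    funext fun u ↦ val_eq_pull_fam a.1 u x
  rw [e]
  exact h.differentiableAt

/-- In a chart, the derivative in the parameters is the partial derivative of the expression of the
family. -/
theorem fam_pdField (v : Params) (a : LocalForms n W) {p : M} {q : Params × Eucl n}
    (hq : q ∈ chartDom W p) :
    fam (pdField v a.1).ext p q = fderiv ℝ (fam a.1.ext p) q (v, 0) := by
  have h := LocalForms.fderiv_fam_inl a hq
  have h2 : fderiv ℝ (fam a.1.ext p) q (v, 0) = fderiv ℝ (fun u ↦ fam a.1.ext p (u, q.2)) q.1 v := by
    rw [h.fderiv]; rfl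
  obtain ⟨x, hx⟩ : ∃ x : W, (extChartAt (𝓡 n) p).symm q.2 = x := ⟨⟨_, hq.2⟩, rfl⟩
  let L : CForms (TangentSpace (𝓡 n) (x : M)) →L[ℝ] CForms (Eucl n) :=
    CForms.pullL (chartInvD p q.2).toLinearMap
  have e1 : ∀ b : LocalField n W, ∀ u, fam b.ext p (u, q.2) = L (b u x) := fun b u ↦ by
    rw [← b.ext_coe, ← hx]; rfl
  rw [h2, funext (e1 a.1), CForms.fderiv_clm_apply L (LocalForms.differentiableAt_param a q.1 _)]
  exact e1 (pdField v a.1) q.1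

/-- The derivative in the parameters in the direction `v`. -/
def pdL (v : Params) : LocalForms n W →ₗ[ℂ] LocalForms n W where
  toFun a := ⟨pdField v a.1, mem_of_fam _ (fun _ _ hq ↦ fam_pdField v a hq) fun p q hq ↦
    LocalForms.contDiffAt_fderiv a hq _⟩
  map_add' a b := ext_iff'.2 fun u x ↦ DFunLike.congr_fun (fderiv_add
    (LocalForms.differentiableAt_param a u x) (LocalForms.differentiableAt_param b u x)) v
  map_smul' c a := ext_iff'.2 fun u x ↦ by
    have hL : ∀ z : CForms (TangentSpace (𝓡 n) (x : M)),
      CForms.mulL _ (algebraMap ℂ _ c) z = c • z := fun z ↦ (Algebra.smul_def c z).symm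
    have := CForms.fderiv_clm_apply (CForms.mulL _ (algebraMap ℂ _ c))
      (LocalForms.differentiableAt_param a u x) v
    simp only [hL] at this
    exact this

theorem fam_pdL (v : Params) (a : LocalForms n W) {p : M} {q : Params × Eucl n}
    (hq : q ∈ chartDom W p) : fam (pdL v a).1.ext p q = fderiv ℝ (fam a.1.ext p) q (v, 0) :=
  fam_pdField v a hq

/-- The grade involution. -/
def epsL : LocalForms n W →ₐ[ℂ] LocalForms n W where
  toFun a := ⟨fun u x ↦ CForms.eps (a.1 u x), mem_of_fam
    (fun p q ↦ CForms.pullL (-LinearMap.id) (fam a.1.ext p q))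
    (fun p q hq ↦ (fam_ext (β := fun u x ↦ CForms.eps (a.1.ext u x)) hq
      fun x ↦ by rw [a.1.ext_coe]).trans (fam_eps _ _ _))
    fun p q hq ↦ (CForms.pullL (-LinearMap.id)).contDiff.contDiffAt.comp q (LocalForms.contDiffAt a hq)⟩
  map_one' := ext_iff'.2 fun _ _ ↦ map_one CForms.eps
  map_mul' _ _ := ext_iff'.2 fun _ _ ↦ map_mul CForms.eps _ _
  map_zero' := ext_iff'.2 fun _ _ ↦ map_zero CForms.eps
  map_add' _ _ := ext_iff'.2 fun _ _ ↦ map_add CForms.eps _ _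
  commutes' _ := ext_iff'.2 fun _ _ ↦ AlgHom.commutes CForms.eps _

/-- The complex conjugation. -/
def conjL : LocalForms n W →+* LocalForms n W where
  toFun a := ⟨fun u x ↦ CForms.conj (a.1 u x), mem_of_fam
    (fun p q ↦ CForms.conjL (fam a.1.ext p q))
    (fun p q hq ↦ (fam_ext (β := fun u x ↦ CForms.conj (a.1.ext u x)) hq
      fun x ↦ by rw [a.1.ext_coe]).trans (fam_conj _ _ _))
    fun p q hq ↦ CForms.conjL.contDiff.contDiffAt.comp q (LocalForms.contDiffAt a hq)⟩
  map_one' := ext_iff'.2 fun _ _ ↦ CForms.conj_one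
  map_mul' _ _ := ext_iff'.2 fun _ _ ↦ CForms.conj_mul _ _
  map_zero' := ext_iff'.2 fun _ _ ↦ map_zero CForms.conj
  map_add' _ _ := ext_iff'.2 fun _ _ ↦ map_add CForms.conj _ _

theorem fam_epsL (a : LocalForms n W) {p : M} {q : Params × Eucl n} (hq : q ∈ chartDom W p) :
    fam (epsL a).1.ext p q = CForms.eps (fam a.1.ext p q) :=
  (fam_ext (β := fun u x ↦ CForms.eps (a.1.ext u x)) hq
      fun x ↦ by rw [a.1.ext_coe]; rfl).trans (fam_eps _ _ _)

theorem fam_conjL (a : LocalForms n W) {p : M} {q : Params × Eucl n} (hq : q ∈ chartDom W p) :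
    fam (conjL a).1.ext p q = CForms.conj (fam a.1.ext p q) :=
  (fam_ext (β := fun u x ↦ CForms.conj (a.1.ext u x)) hq
      fun x ↦ by rw [a.1.ext_coe]; rfl).trans (fam_conj _ _ _)

theorem fam_mulL (a b : LocalForms n W) (p : M) (q : Params × Eucl n) :
    fam (a * b).1.ext p q = fam a.1.ext p q * fam b.1.ext p q := by
  change fam (LocalField.ext (a.1 * b.1)) p q = _
  rw [LocalField.ext_mul, fam_mul]

theorem fam_addL (a b : LocalForms n W) (p : M) (q : Params × Eucl n) :
    fam (a + b).1.ext p q = fam a.1.ext p q + fam b.1.ext p q := by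
  change fam (LocalField.ext (a.1 + b.1)) p q = _
  rw [LocalField.ext_add, fam_add]

theorem eventually_chartDom {p : M} {q : Params × Eucl n} (hq : q ∈ chartDom W p) :
    ∀ᶠ z in nhds q, z ∈ chartDom W p := (isOpen_chartDom W p).mem_nhds hq

theorem pdL_dL (v : Params) (a : LocalForms n W) : pdL v (dL a) = dL (pdL v a) := by
  refine ext_of_fam fun u x hx ↦ ?_
  have hq := center_mem_chartDom (n := n) hx u
  have h1 : fam (dL a).1.ext x =ᶠ[nhds (u, extChartAt (𝓡 n) x x)] fun q ↦
      ∑ i, dx i * fderiv ℝ (fam a.1.ext x) q (0, EuclideanSpace.single i 1) :=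
    (eventually_chartDom hq).mono fun q hq ↦ fam_dL a hq
  have h2 : fam (pdL v a).1.ext x =ᶠ[nhds (u, extChartAt (𝓡 n) x x)] fun q ↦ fderiv ℝ (fam a.1.ext x) q (v, 0) :=
    (eventually_chartDom hq).mono fun q hq ↦ fam_pdL v a hq
  have hd := ((LocalForms.contDiffAt a hq).fderiv_right (m := ∞) le_rfl).differentiableAt (by simp)
  have hs : IsSymmSndFDerivAt ℝ (fam a.1.ext x) _ :=
    (LocalForms.contDiffAt a hq).isSymmSndFDerivAt (by simpa using two_le_infty)
  have h3 : ∀ w w' : Params × Eucl n,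
      fderiv ℝ (fun q ↦ fderiv ℝ (fam a.1.ext x) q w) (u, extChartAt (𝓡 n) x x) w' =
        fderiv ℝ (fderiv ℝ (fam a.1.ext x)) (u, extChartAt (𝓡 n) x x) w' w := fun w w' ↦ by
    rw [fderiv_clm_apply hd (differentiableAt_const w)]; simp
  rw [fam_pdL v (dL a) hq, fam_dL (pdL v a) hq, h1.fderiv_eq, h2.fderiv_eq, fderiv_fun_sum fun i _ ↦
    CForms.differentiableAt_mul (differentiableAt_const _)
      ((LocalForms.contDiffAt_fderiv a hq _).differentiableAt (by simp)), sum_apply]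
  refine Finset.sum_congr rfl fun i _ ↦ ?_
  rw [CForms.fderiv_mul_apply (differentiableAt_const _)
      ((LocalForms.contDiffAt_fderiv a hq _).differentiableAt (by simp)), h3, h3, hs.eq]
  simp

theorem pdL_comm (v w : Params) (a : LocalForms n W) : pdL v (pdL w a) = pdL w (pdL v a) := by
  refine ext_of_fam fun u x hx ↦ ?_
  have hq := center_mem_chartDom (n := n) hx u
  have h2 : ∀ v, fam (pdL v a).1.ext x =ᶠ[nhds (u, extChartAt (𝓡 n) x x)] fun q ↦ fderiv ℝ (fam a.1.ext x) q (v, 0) :=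
    fun v ↦ (eventually_chartDom hq).mono fun q hq ↦ fam_pdL v a hq
  have hd := ((LocalForms.contDiffAt a hq).fderiv_right (m := ∞) le_rfl).differentiableAt (by simp)
  have hs : IsSymmSndFDerivAt ℝ (fam a.1.ext x) _ :=
    (LocalForms.contDiffAt a hq).isSymmSndFDerivAt (by simpa using two_le_infty)
  have h3 : ∀ w w' : Params × Eucl n,
      fderiv ℝ (fun q ↦ fderiv ℝ (fam a.1.ext x) q w) (u, extChartAt (𝓡 n) x x) w' =
        fderiv ℝ (fderiv ℝ (fam a.1.ext x)) (u, extChartAt (𝓡 n) x x) w' w := fun w w' ↦ by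
    rw [fderiv_clm_apply hd (differentiableAt_const w)]; simp
  rw [fam_pdL v (pdL w a) hq, fam_pdL w (pdL v a) hq, (h2 v).fderiv_eq, (h2 w).fderiv_eq, h3, h3, hs.eq]

theorem dL_dL (a : LocalForms n W) : dL (dL a) = 0 := by
  refine ext_iff'.2 fun u x ↦ ?_
  have hx := x.2
  have hq := center_mem_chartDom (n := n) hx u
  have h1 : ((dL a).1.ext u).inChart (x : M) =ᶠ[nhds (extChartAt (𝓡 n) (x : M) (x : M))]
      euclideanExtDeriv ((a.1.ext u).inChart (x : M)) := by
    have : ∀ᶠ y in nhds (extChartAt (𝓡 n) (x : M) (x : M)), (u, y) ∈ chartDom W (x : M) :=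
      (Continuous.prodMk_right u).continuousAt.eventually (eventually_chartDom hq)
    filter_upwards [this] with y hy
    refine (fam_dL a hy).trans ?_
    rw [euclideanExtDeriv_eq]
    exact (Finset.sum_congr rfl fun i _ ↦ congrArg _ (LocalForms.fderiv_fam_inr a hy _)).symm
  refine (congrArg (CForms.pull _) ((euclideanExtDeriv_congr h1).trans
    (euclideanExtDeriv_euclideanExtDeriv (a.2 u x hx).differentiableAt))).trans (map_zero _)

theorem fam_dL_eq_euclideanExtDeriv (a : LocalForms n W) {p : M} {q : Params × Eucl n}
    (hq : q ∈ chartDom W p) :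
    fam (dL a).1.ext p q = euclideanExtDeriv (fun y ↦ fam a.1.ext p (q.1, y)) q.2 := by
  rw [fam_dL a hq, euclideanExtDeriv_eq]
  exact Finset.sum_congr rfl fun i _ ↦ congrArg _ (LocalForms.fderiv_fam_inr a hq _).symm

theorem dL_mul (a b : LocalForms n W) : dL (a * b) = dL a * b + epsL a * dL b := by
  refine ext_of_fam fun u x hx ↦ ?_
  have hq := center_mem_chartDom (n := n) hx u
  have hd : ∀ a : LocalForms n W, DifferentiableAt ℝ (fun y ↦ fam a.1.ext x (u, y))
      (extChartAt (𝓡 n) x x) := fun a ↦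
    ((a.2 u x hx).differentiableAt).differentiableAt (by simp)
  rw [fam_addL, fam_mulL, fam_mulL, fam_dL_eq_euclideanExtDeriv (a * b) hq,
    fam_dL_eq_euclideanExtDeriv a hq, fam_dL_eq_euclideanExtDeriv b hq, fam_epsL a hq]
  refine Eq.trans ?_ (euclideanExtDeriv_mul (hd a) (hd b))
  exact congrArg (euclideanExtDeriv · _) (funext fun y ↦ fam_mulL a b x (u, y))

theorem dL_epsL (a : LocalForms n W) : dL (epsL a) = -epsL (dL a) := by
  rw [eq_neg_iff_add_eq_zero]
  refine ext_of_fam fun u x hx ↦ ?_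
  have hq := center_mem_chartDom (n := n) hx u
  have h1 : fam (epsL a).1.ext x =ᶠ[nhds (u, extChartAt (𝓡 n) x x)] fun q ↦
      CForms.pullL (-LinearMap.id) (fam a.1.ext x q) :=
    (eventually_chartDom hq).mono fun q hq ↦ fam_epsL a hq
  have h0 : fam (0 : LocalForms n W).1.ext x (u, extChartAt (𝓡 n) x x) = 0 := by
    refine (congrArg (CForms.pull _) (LocalField.ext_apply _ _ (by rwa [extChartAt_to_inv]))).trans
      (map_zero _)
  rw [fam_addL, fam_dL (epsL a) hq, fam_epsL (dL a) hq, fam_dL a hq, h1.fderiv_eq, h0, map_sum,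
    ← Finset.sum_add_distrib]
  refine Finset.sum_eq_zero fun i _ ↦ ?_
  rw [CForms.fderiv_clm_apply _ (LocalForms.differentiableAt a hq), map_mul, eps_dx, neg_mul]
  exact add_neg_cancel _

theorem dL_conjL (a : LocalForms n W) : dL (conjL a) = conjL (dL a) := by
  refine ext_of_fam fun u x hx ↦ ?_
  have hq := center_mem_chartDom (n := n) hx u
  have h1 : fam (conjL a).1.ext x =ᶠ[nhds (u, extChartAt (𝓡 n) x x)] fun q ↦ CForms.conjL (fam a.1.ext x q) :=
    (eventually_chartDom hq).mono fun q hq ↦ fam_conjL a hq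
  rw [fam_dL (conjL a) hq, fam_conjL (dL a) hq, fam_dL a hq, h1.fderiv_eq, map_sum]
  refine Finset.sum_congr rfl fun i _ ↦ ?_
  rw [CForms.fderiv_clm_apply _ (LocalForms.differentiableAt a hq), CForms.conj_mul]
  exact congrArg (· * _) (CForms.conj_ofReal _).symm

instance : FormAlgebra Params (LocalForms n W) where
  d := dL
  eps := epsL
  conj := conjL
  pd := pdL
  even_comm a b h := ext_iff'.2 fun u x ↦ CForms.even_commute (ext_iff'.1 h u x) _
  odd_comm a b h := ext_iff'.2 fun u x ↦ CForms.odd_commute (ext_iff'.1 h u x) _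
  d_mul := dL_mul
  d_eps := dL_epsL
  d_d := dL_dL
  d_conj := dL_conjL
  pd_mul v a b := ext_iff'.2 fun u x ↦ by
    have := CForms.fderiv_mul_apply (LocalForms.differentiableAt_param a u x) (LocalForms.differentiableAt_param b u x) v
    rw [add_comm] at this
    exact this
  pd_d := pdL_dL
  pd_eps v a := ext_iff'.2 fun u x ↦ CForms.fderiv_clm_apply (CForms.pullL (-LinearMap.id))
    (LocalForms.differentiableAt_param a u x) v
  pd_comm := pdL_comm

end LocalForms

end LocalForms

section LocalForms2

open TopologicalSpace

variable {n : ℕ} {M : Type*} [TopologicalSpace M] [ChartedSpace (EuclideanSpace ℝ (Fin n)) M]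
variable {W : Opens M}

instance (T : Type*) [AddCommGroup T] [Module ℝ T] [FiniteDimensional ℝ T] :
    CompleteSpace (CForms T) := FiniteDimensional.complete ℝ _

variable [IsManifold (𝓡 n) ∞ M]

namespace LocalForms

/-! #### Functions and restrictions of global fields -/

/-- The restriction of a family which is smooth over `W`. -/
def ofField (α : Params → FormField n M) (h : ∀ u, ∀ x ∈ W, FamSmoothAt α u x) :
    LocalForms n W :=
  ⟨fun u x ↦ α u x, fun u x hx ↦ famSmoothAt_ext hx (h u x hx) fun _ _ ↦ rfl⟩

/-- A smooth function, as a form of degree zero. -/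
def ofFun (f : Params → M → ℂ) (h : ∀ u, ∀ x ∈ W, FunSmoothAt n f u x) : LocalForms n W :=
  ofField (fun u x ↦ algebraMap ℂ (CForms (TangentSpace (𝓡 n) x)) (f u x)) fun u x hx ↦
    (h u x hx).famSmoothAt

theorem epsL_ofFun (f : Params → M → ℂ) (h : ∀ u, ∀ x ∈ W, FunSmoothAt n f u x) :
    epsL (ofFun f h) = ofFun f h :=
  ext_iff'.2 fun _ _ ↦ AlgHom.commutes CForms.eps _

theorem pdL_ofFun (v : Params) (f : Params → M → ℂ) (h : ∀ u, ∀ x ∈ W, FunSmoothAt n f u x)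
    (u : Params) (x : W) (hg : DifferentiableAt ℝ (fun u ↦ f u x) u) :
    (pdL v (ofFun f h)).1 u x =
      algebraMap ℂ (CForms (TangentSpace (𝓡 n) (x : M))) (fderiv ℝ (fun u ↦ f u x) u v) :=
  DFunLike.congr_fun ((CForms.scalarL (TangentSpace (𝓡 n) (x : M))).hasFDerivAt.comp u
    hg.hasFDerivAt).fderiv v

/-- A form which is locally a member of a smooth family has the exterior derivative of that family.
-/
theorem dL_val_of_eq (a : LocalForms n W) {u : Params} {α : FormField n M}
    (h : ∀ x : W, α x = a.1 u x) (x : W) : (dL a).1 u x = α.extD x := by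
  refine FormField.extD_congr ?_
  filter_upwards [W.isOpen.mem_nhds x.2] with y hy
  exact (a.1.ext_apply u hy).trans (h ⟨y, hy⟩).symm

theorem famSmoothAt_of_eq (a : LocalForms n W) {u : Params} {α : FormField n M}
    (h : ∀ x : W, α x = a.1 u x) (x : W) : FamSmoothAt (fun _ ↦ α) u x := by
  have h1 : FamSmoothAt (fun _ ↦ a.1.ext u) u (x : M) :=
    ContDiffAt.comp (g := fam a.1.ext (x : M)) (f := fun q : Params × Eucl n ↦ (u, q.2))
      (u, extChartAt (𝓡 n) (x : M) (x : M)) (a.2 u x x.2) (contDiffAt_const.prodMk contDiffAt_snd)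
  refine h1.congr ?_
  filter_upwards [W.isOpen.mem_nhds x.2] with y hy _
  exact ((a.1.ext_apply u hy).trans (h ⟨y, hy⟩).symm).symm

/-- A form which is locally a member of a smooth family is smooth. -/
theorem isSmooth_of_local {α : FormField n M} (u : Params)
    (h : ∀ p : M, ∃ W : Opens M, p ∈ W ∧ ∃ a : LocalForms n W, ∀ x : W, α x = a.1 u x) :
    α.IsSmooth := by
  refine (isSmooth_iff_famSmoothAt u).2 fun x ↦ ?_
  obtain ⟨W, hx, a, ha⟩ := h x
  exact a.famSmoothAt_of_eq ha ⟨x, hx⟩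

/-! #### Integration in the parameters -/

section Integral

variable (ρ : ℝ × Params → Params)

/-- The integral of a family along paths of parameters, without its smoothness: at the parameter `u`
the path is `σ ↦ ρ (σ, u)`, for `σ` in `[0, 1]`. -/
def integField (a : LocalField n W) : LocalField n W := fun u x ↦
  ∫ σ in (0 : ℝ)..1, a (ρ (σ, u)) x

variable {ρ}

theorem continuous_path (hρ : ContDiff ℝ ∞ ρ) (a : LocalForms n W) (u : Params) (x : W) :
    Continuous fun σ : ℝ ↦ a.1 (ρ (σ, u)) x := by
  have h1 : Continuous fun u ↦ a.1 u x :=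
    continuous_iff_continuousAt.2 fun u ↦ (a.differentiableAt_param u x).continuousAt
  exact h1.comp (hρ.continuous.comp (Continuous.prodMk_left u))

theorem fam_integField (hρ : ContDiff ℝ ∞ ρ) (a : LocalForms n W) {p : M} {q : Params × Eucl n}
    (hq : q ∈ chartDom W p) :
    fam (integField ρ a.1).ext p q = ∫ σ in (0 : ℝ)..1, fam a.1.ext p (ρ (σ, q.1), q.2) := by
  obtain ⟨x, hx⟩ : ∃ x : W, (extChartAt (𝓡 n) p).symm q.2 = x := ⟨⟨_, hq.2⟩, rfl⟩
  let L : CForms (TangentSpace (𝓡 n) (x : M)) →L[ℝ] CForms (Eucl n) :=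
    CForms.pullL (chartInvD p q.2).toLinearMap
  have e1 : ∀ b : LocalField n W, ∀ u, fam b.ext p (u, q.2) = L (b u x) := fun b u ↦ by
    rw [← b.ext_coe, ← hx]; rfl
  simp only [e1 a.1]
  rw [L.intervalIntegral_comp_comm ((continuous_path hρ a q.1 x).intervalIntegrable _ _)]
  exact e1 (integField ρ a.1) q.1

theorem contDiffOn_integrand (hρ : ContDiff ℝ ∞ ρ) (a : LocalForms n W) (p : M) :
    ContDiffOn ℝ ∞ (fun z : ℝ × (Params × Eucl n) ↦ fam a.1.ext p (ρ (z.1, z.2.1), z.2.2))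
      (Set.univ ×ˢ chartDom W p) := by
  intro z hz
  refine ContDiffAt.contDiffWithinAt ?_
  have h1 : (ρ (z.1, z.2.1), z.2.2) ∈ chartDom W p := hz.2
  have h2 : ContDiff ℝ ∞ (fun z : ℝ × (Params × Eucl n) ↦ (ρ (z.1, z.2.1), z.2.2)) := by fun_prop
  exact ContDiffAt.comp (g := fam a.1.ext p)
    (f := fun z : ℝ × (Params × Eucl n) ↦ (ρ (z.1, z.2.1), z.2.2)) z (a.contDiffAt h1) h2.contDiffAt

/-- The integral of a family along paths of parameters. -/
def integ (hρ : ContDiff ℝ ∞ ρ) (a : LocalForms n W) : LocalForms n W :=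
  ⟨integField ρ a.1, mem_of_fam _ (fun _ _ hq ↦ fam_integField hρ a hq) fun p _ hq ↦
    (contDiffOn_intervalIntegral (isOpen_chartDom W p)
      (contDiffOn_integrand hρ a p)).contDiffAt ((isOpen_chartDom W p).mem_nhds hq)⟩

/-- By definition, the value of an integral of families is the integral of the values. -/
theorem integ_val (hρ : ContDiff ℝ ∞ ρ) (a : LocalForms n W) (u : Params) (x : W) :
    (integ hρ a).1 u x = ∫ σ in (0 : ℝ)..1, a.1 (ρ (σ, u)) x := rfl

theorem fam_integ (hρ : ContDiff ℝ ∞ ρ) (a : LocalForms n W) {p : M} {q : Params × Eucl n} (hq : q ∈ chartDom W p) :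
    fam (integ hρ a).1.ext p q = ∫ σ in (0 : ℝ)..1, fam a.1.ext p (ρ (σ, q.1), q.2) :=
  fam_integField hρ a hq

theorem continuous_fderiv_fam (hρ : ContDiff ℝ ∞ ρ) (a : LocalForms n W) {p : M} {q : Params × Eucl n}
    (hq : q ∈ chartDom W p) :
    Continuous fun σ : ℝ ↦ fderiv ℝ (fam a.1.ext p) (ρ (σ, q.1), q.2) := by
  refine continuous_iff_continuousAt.2 fun σ ↦ ?_
  have h1 : (ρ (σ, q.1), q.2) ∈ chartDom W p := hq
  have h2 : Continuous fun σ : ℝ ↦ (ρ (σ, q.1), q.2) :=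
    (hρ.continuous.comp (Continuous.prodMk_left q.1)).prodMk continuous_const
  exact ContinuousAt.comp (g := fderiv ℝ (fam a.1.ext p)) (f := fun σ : ℝ ↦ (ρ (σ, q.1), q.2))
    ((a.contDiffAt h1).fderiv_right (m := ∞) le_rfl).continuousAt h2.continuousAt

/-- Differentiation under the integral sign, with the chain rule along `ρ`. -/
theorem fderiv_fam_integ (hρ : ContDiff ℝ ∞ ρ) (a : LocalForms n W) {p : M} {q : Params × Eucl n}
    (hq : q ∈ chartDom W p) (w : Params × Eucl n) :
    fderiv ℝ (fam (integ hρ a).1.ext p) q w = ∫ σ in (0 : ℝ)..1,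
      fderiv ℝ (fam a.1.ext p) (ρ (σ, q.1), q.2) (fderiv ℝ ρ (σ, q.1) (0, w.1), w.2) := by
  have hop := isOpen_chartDom (n := n) W p
  have h1 := hasFDerivAt_intervalIntegral_of_contDiffOn hop (contDiffOn_integrand hρ a p) hq
  have h2 : fam (integ hρ a).1.ext p =ᶠ[nhds q] fun q ↦
      ∫ σ in (0 : ℝ)..1, fam a.1.ext p (ρ (σ, q.1), q.2) :=
    (eventually_chartDom hq).mono fun q hq ↦ fam_integ hρ a hq
  have h3 : ∀ σ : ℝ, fderiv ℝ
      (fun z : ℝ × (Params × Eucl n) ↦ fam a.1.ext p (ρ (z.1, z.2.1), z.2.2)) (σ, q) (0, w) =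
      fderiv ℝ (fam a.1.ext p) (ρ (σ, q.1), q.2) (fderiv ℝ ρ (σ, q.1) (0, w.1), w.2) := by
    intro σ
    have hq' : (ρ (σ, q.1), q.2) ∈ chartDom W p := hq
    have hr : HasFDerivAt (fun z : ℝ × (Params × Eucl n) ↦ ρ (z.1, z.2.1))
        ((fderiv ℝ ρ (σ, q.1)).comp ((ContinuousLinearMap.fst ℝ ℝ _).prod
          ((ContinuousLinearMap.fst ℝ _ _).comp (ContinuousLinearMap.snd ℝ ℝ _)))) (σ, q) :=
      HasFDerivAt.comp (f := fun z : ℝ × (Params × Eucl n) ↦ (z.1, z.2.1)) (σ, q)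
        ((hρ.differentiable (by simp)) (σ, q.1)).hasFDerivAt
        (hasFDerivAt_fst.prodMk (hasFDerivAt_fst.comp (σ, q) hasFDerivAt_snd))
    have hs : HasFDerivAt (fun z : ℝ × (Params × Eucl n) ↦ z.2.2)
        ((ContinuousLinearMap.snd ℝ _ _).comp (ContinuousLinearMap.snd ℝ ℝ _)) (σ, q) :=
      hasFDerivAt_snd.comp (σ, q) hasFDerivAt_snd
    have := HasFDerivAt.comp (g := fam a.1.ext p)
      (f := fun z : ℝ × (Params × Eucl n) ↦ (ρ (z.1, z.2.1), z.2.2)) (σ, q)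
      (a.differentiableAt hq').hasFDerivAt (hr.prodMk hs)
    exact DFunLike.congr_fun this.fderiv (0, w)
  have hc : Continuous fun σ : ℝ ↦ (fderiv ℝ (fun z : ℝ × (Params × Eucl n) ↦
      fam a.1.ext p (ρ (z.1, z.2.1), z.2.2)) (σ, q)).comp (ContinuousLinearMap.inr ℝ ℝ _) := by
    have hU : IsOpen (Set.univ ×ˢ chartDom W p : Set (ℝ × (Params × Eucl n))) :=
      isOpen_univ.prod hop
    have hf := (contDiffOn_integrand hρ a p).continuousOn_fderiv_of_isOpen hU (by simp)
    refine continuous_iff_continuousAt.2 fun σ ↦ ContinuousAt.clm_comp ?_ continuousAt_const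
    exact ContinuousAt.comp (f := fun σ : ℝ ↦ (σ, q))
      (hf.continuousAt (hU.mem_nhds ⟨Set.mem_univ σ, hq⟩))
      (Continuous.prodMk_left q).continuousAt
  rw [h2.fderiv_eq, h1.fderiv, ContinuousLinearMap.intervalIntegral_apply
    (hc.intervalIntegrable _ _)]
  exact intervalIntegral.integral_congr fun σ _ ↦ h3 σ

/-- The exterior derivative commutes with integration in the parameters. -/
theorem dL_integ (hρ : ContDiff ℝ ∞ ρ) (a : LocalForms n W) : dL (integ hρ a) = integ hρ (dL a) := by
  refine ext_of_fam fun u x hx ↦ ?_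
  have hq := center_mem_chartDom (n := n) hx u
  rw [fam_dL (integ hρ a) hq, fam_integ hρ (dL a) hq]
  have h1 : ∀ σ : ℝ, fam (dL a).1.ext x (ρ (σ, u), extChartAt (𝓡 n) x x) =
      ∑ i, CForms.mulL _ (dx i) (fderiv ℝ (fam a.1.ext x) (ρ (σ, u), extChartAt (𝓡 n) x x)
        (0, EuclideanSpace.single i 1)) := fun σ ↦
    fam_dL a (q := (ρ (σ, u), extChartAt (𝓡 n) x x)) hq
  have h2 : ∀ i : Fin n, Continuous fun σ : ℝ ↦
      fderiv ℝ (fam a.1.ext x) (ρ (σ, u), extChartAt (𝓡 n) x x)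
        (0, EuclideanSpace.single i 1) := fun i ↦
    (continuous_fderiv_fam hρ a hq).clm_apply continuous_const
  simp only [h1]
  have h3 := intervalIntegral.integral_finsetSum (a := 0) (b := 1) (μ := MeasureTheory.volume)
    (s := Finset.univ) (f := fun (i : Fin n) (σ : ℝ) ↦ CForms.mulL _ (dx i)
      (fderiv ℝ (fam a.1.ext x) (ρ (σ, u), extChartAt (𝓡 n) x x)
        (0, EuclideanSpace.single i 1))) fun i _ ↦
    ((CForms.mulL _ (dx i)).continuous.comp (h2 i)).intervalIntegrable _ _
  refine Eq.trans ?_ h3.symm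
  refine Finset.sum_congr rfl fun i _ ↦ ?_
  rw [ContinuousLinearMap.intervalIntegral_comp_comm _ ((h2 i).intervalIntegrable _ _),
    fderiv_fam_integ hρ a hq]
  refine congrArg (dx i * ·) (intervalIntegral.integral_congr fun σ _ ↦ ?_)
  have h4 : fderiv ℝ ρ (σ, u) (0, 0) = 0 := map_zero _
  simp only [h4]

/-- Differentiation in a direction of parameters that `ρ` does not move commutes with the
integration. -/
theorem pdL_integ (hρ : ContDiff ℝ ∞ ρ) (a : LocalForms n W) {v : Params} (hv : ∀ z, fderiv ℝ ρ z (0, v) = v) :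
    pdL v (integ hρ a) = integ hρ (pdL v a) := by
  refine ext_of_fam fun u x hx ↦ ?_
  have hq := center_mem_chartDom (n := n) hx u
  rw [fam_pdL v (integ hρ a) hq, fam_integ hρ (pdL v a) hq, fderiv_fam_integ hρ a hq]
  refine intervalIntegral.integral_congr fun σ _ ↦ ?_
  refine Eq.trans ?_ (fam_pdL v a (q := (ρ (σ, u), extChartAt (𝓡 n) x x)) hq).symm
  simp only [hv]

/-- The fundamental theorem of calculus. -/
theorem integ_pdL (hρ : ContDiff ℝ ∞ ρ) (a : LocalForms n W) (u : Params) (x : W) {v : Params}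
    (hv : ∀ σ, HasDerivAt (fun σ ↦ ρ (σ, u)) v σ) :
    (integ hρ (pdL v a)).1 u x = a.1 (ρ (1, u)) x - a.1 (ρ (0, u)) x := by
  rw [integ_val]
  refine intervalIntegral.integral_eq_sub_of_hasDerivAt (f := fun σ ↦ a.1 (ρ (σ, u)) x)
    (fun σ _ ↦ ?_) ((continuous_path hρ (pdL v a) u x).intervalIntegrable _ _)
  exact HasFDerivAt.comp_hasDerivAt (f := fun σ ↦ ρ (σ, u)) σ
    (a.differentiableAt_param (ρ (σ, u)) x).hasFDerivAt (hv σ)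

end Integral

end LocalForms

end LocalForms2

/-! ### Smooth functions and complex one-forms -/

section OneForms

open TopologicalSpace

variable {n : ℕ} {M : Type*} [TopologicalSpace M] [ChartedSpace (EuclideanSpace ℝ (Fin n)) M]
variable {W : Opens M}

/-- The coefficients of a one-form in the chart at `p`. -/
def oneCoeff (a : ∀ x : M, TangentSpace (𝓡 n) x →ₗ[ℝ] ℂ) (p : M) (k : Fin n) (y : Eucl n) : ℂ :=
  a ((extChartAt (𝓡 n) p).symm y) (chartSymmDeriv p y (EuclideanSpace.single k 1))

/-- Smoothness of a complex one-form at a point. -/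
def OneSmoothAt (a : ∀ x : M, TangentSpace (𝓡 n) x →ₗ[ℝ] ℂ) (x : M) : Prop :=
  ∀ k, ContDiffAt ℝ ∞ (oneCoeff a x k) (extChartAt (𝓡 n) x x)

/-- A smooth complex one-form is a smooth form of degree one. -/
theorem OneSmoothAt.famSmoothAt {a : ∀ x : M, TangentSpace (𝓡 n) x →ₗ[ℝ] ℂ} {x : M}
    (h : OneSmoothAt a x) (u : Params) : FamSmoothAt (fun _ x ↦ CForms.toForm (a x)) u x := by
  have e : (fun q : Params × Eucl n ↦
      FormField.inChart (fun x : M ↦ CForms.toForm (a x)) x q.2) =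
      fun q ↦ ∑ k, oneCoeff a x k q.2 • dx k := by
    funext q
    refine (CForms.pull_toForm _ _).trans ?_
    exact toForm_eucl _
  unfold FamSmoothAt
  rw [e]
  refine ContDiffAt.sum fun k _ ↦ CForms.contDiffAt_smul ?_ contDiffAt_const
  exact ContDiffAt.comp (f := fun q : Params × Eucl n ↦ q.2) (u, extChartAt (𝓡 n) x x)
    (h k) contDiffAt_snd

variable [IsManifold (𝓡 n) ∞ M]

theorem contMDiffAt_iff_contDiffAt_chart {f : M → ℂ} {x : M} :
    ContMDiffAt (𝓡 n) 𝓘(ℝ, ℂ) ∞ f x ↔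
      ContDiffAt ℝ ∞ (f ∘ (extChartAt (𝓡 n) x).symm) (extChartAt (𝓡 n) x x) := by
  rw [contMDiffAt_iff, ModelWithCorners.range_eq_univ, contDiffWithinAt_univ]
  refine ⟨fun h ↦ h.2, fun h ↦ ⟨?_, h⟩⟩
  have h1 : ContinuousAt (f ∘ (extChartAt (𝓡 n) x).symm ∘ extChartAt (𝓡 n) x) x :=
    h.continuousAt.comp (continuousAt_extChartAt x)
  refine h1.congr ?_
  filter_upwards [extChartAt_source_mem_nhds (I := 𝓡 n) x] with y hy
  exact congrArg f ((extChartAt (𝓡 n) x).left_inv hy)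

theorem ContMDiffAt.complex_mul {f g : M → ℂ} {x : M} (hf : ContMDiffAt (𝓡 n) 𝓘(ℝ, ℂ) ∞ f x)
    (hg : ContMDiffAt (𝓡 n) 𝓘(ℝ, ℂ) ∞ g x) :
    ContMDiffAt (𝓡 n) 𝓘(ℝ, ℂ) ∞ (fun y ↦ f y * g y) x :=
  contMDiffAt_iff_contDiffAt_chart.2
    ((contMDiffAt_iff_contDiffAt_chart.1 hf).mul (contMDiffAt_iff_contDiffAt_chart.1 hg))

theorem FunSmoothAt.of_contMDiffAt {f : M → ℂ} {x : M} (h : ContMDiffAt (𝓡 n) 𝓘(ℝ, ℂ) ∞ f x)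
    (u : Params) : FunSmoothAt n (fun _ ↦ f) u x :=
  ContDiffAt.comp (f := fun q : Params × Eucl n ↦ q.2) (u, extChartAt (𝓡 n) x x)
    (contMDiffAt_iff_contDiffAt_chart.1 h) contDiffAt_snd

theorem FunSmoothAt.of_contDiff {g : Params → ℂ} (h : ContDiff ℝ ∞ g) (u : Params) (x : M) :
    FunSmoothAt n (fun u _ ↦ g u) u x :=
  (h.comp contDiff_fst).contDiffAt

/-- In a chart, the coefficients of the differential of a function are its partial derivatives. -/
theorem oneCoeff_mvfderiv {f : M → ℂ} {p : M} {y : Eucl n}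
    (hy : y ∈ (extChartAt (𝓡 n) p).target)
    (hf : MDifferentiableAt (𝓡 n) 𝓘(ℝ, ℂ) f ((extChartAt (𝓡 n) p).symm y)) (k : Fin n) :
    oneCoeff (fun x ↦ (mvfderiv (𝓡 n) f x).toLinearMap) p k y =
      fderiv ℝ (f ∘ (extChartAt (𝓡 n) p).symm) y (EuclideanSpace.single k 1) := by
  have h := mfderiv_comp (I := 𝓘(ℝ, Eucl n)) (I' := 𝓡 n) (I'' := 𝓘(ℝ, ℂ)) y hf
    (mdiffAt_extChartAt_symm hy)
  rw [mfderiv_eq_fderiv] at h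
  exact (DFunLike.congr_fun h (EuclideanSpace.single k (1 : ℝ))).symm

theorem OneSmoothAt.mvfderiv {f : M → ℂ} {x : M} (h : ContMDiffAt (𝓡 n) 𝓘(ℝ, ℂ) ∞ f x) :
    OneSmoothAt (fun x ↦ (mvfderiv (𝓡 n) f x).toLinearMap) x := by
  intro k
  have h1 := (contMDiffAt_iff_contDiffAt_chart.1 h).fderiv_right (m := ∞) le_rfl
  have h2 := h1.clm_apply (contDiffAt_const (c := EuclideanSpace.single k (1 : ℝ)))
  refine ContDiffAt.congr_of_eventuallyEq h2 ?_
  have h3 : ∀ᶠ y in nhds x, MDifferentiableAt (𝓡 n) 𝓘(ℝ, ℂ) f y := by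
    have := (contMDiffAt_iff_contMDiffAt_nhds (n := 1) (by simp)).1
      (h.of_le (WithTop.coe_le_coe.2 (le_top : (1 : ℕ∞) ≤ ⊤)))
    exact this.mono fun y hy ↦ hy.mdifferentiableAt (by simp)
  filter_upwards [eventually_symm h3, extChartAt_target_mem_nhds (I := 𝓡 n) x] with y hy hy'
  exact oneCoeff_mvfderiv hy' hy k

theorem OneSmoothAt.congr {a b : ∀ x : M, TangentSpace (𝓡 n) x →ₗ[ℝ] ℂ} {x : M}
    (h : OneSmoothAt a x) (he : ∀ᶠ y in nhds x, b y = a y) : OneSmoothAt b x := by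
  intro k
  refine (h k).congr_of_eventuallyEq ?_
  filter_upwards [eventually_symm he] with y hy
  rw [oneCoeff, oneCoeff, hy]

theorem OneSmoothAt.add {a b : ∀ x : M, TangentSpace (𝓡 n) x →ₗ[ℝ] ℂ} {x : M}
    (ha : OneSmoothAt a x) (hb : OneSmoothAt b x) : OneSmoothAt (fun x ↦ a x + b x) x :=
  fun k ↦ (ha k).add (hb k)

theorem OneSmoothAt.neg {a : ∀ x : M, TangentSpace (𝓡 n) x →ₗ[ℝ] ℂ} {x : M}
    (ha : OneSmoothAt a x) : OneSmoothAt (fun x ↦ -a x) x := fun k ↦ (ha k).neg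

theorem OneSmoothAt.smul {a : ∀ x : M, TangentSpace (𝓡 n) x →ₗ[ℝ] ℂ} {f : M → ℂ} {x : M}
    (hf : ContMDiffAt (𝓡 n) 𝓘(ℝ, ℂ) ∞ f x) (ha : OneSmoothAt a x) :
    OneSmoothAt (fun x ↦ f x • a x) x :=
  fun k ↦ (contMDiffAt_iff_contDiffAt_chart.1 hf).mul (ha k)

theorem OneSmoothAt.zero (x : M) :
    OneSmoothAt (fun x : M ↦ (0 : TangentSpace (𝓡 n) x →ₗ[ℝ] ℂ)) x :=
  fun _ ↦ contDiffAt_const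

theorem OneSmoothAt.sum {ι : Type*} {s : Finset ι} {a : ι → ∀ x : M, TangentSpace (𝓡 n) x →ₗ[ℝ] ℂ}
    {x : M} (ha : ∀ i ∈ s, OneSmoothAt (a i) x) : OneSmoothAt (fun x ↦ ∑ i ∈ s, a i x) x := by
  classical
  induction s using Finset.induction_on with
  | empty => simpa using OneSmoothAt.zero x
  | insert i s hi ih =>
    simp only [Finset.sum_insert hi]
    exact (ha i (Finset.mem_insert_self i s)).add
      (ih fun j hj ↦ ha j (Finset.mem_insert_of_mem hj))

theorem OneSmoothAt.conj {a : ∀ x : M, TangentSpace (𝓡 n) x →ₗ[ℝ] ℂ} {x : M}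
    (ha : OneSmoothAt a x) : OneSmoothAt (fun x ↦ Complex.conjAe.toLinearMap ∘ₗ a x) x :=
  fun k ↦ Complex.conjCLE.contDiff.contDiffAt.comp _ (ha k)

/-- The exterior derivative of a function is its differential. -/
theorem extD_algebraMap {f : M → ℂ} {x : M} (h : MDifferentiableAt (𝓡 n) 𝓘(ℝ, ℂ) f x) :
    FormField.extD (fun x ↦ algebraMap ℂ (CForms (TangentSpace (𝓡 n) x)) (f x)) x =
      CForms.toForm (mvfderiv (𝓡 n) f x).toLinearMap := by
  have e : FormField.inChart (fun x : M ↦ algebraMap ℂ (CForms (TangentSpace (𝓡 n) x)) (f x)) x =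
      fun y ↦ CForms.scalarL (Eucl n) ((f ∘ (extChartAt (𝓡 n) x).symm) y) :=
    funext fun y ↦ AlgHom.commutes _ _
  have hx : MDifferentiableAt (𝓡 n) 𝓘(ℝ, ℂ) f
      ((extChartAt (𝓡 n) x).symm (extChartAt (𝓡 n) x x)) := by rwa [extChartAt_to_inv]
  have hd : DifferentiableAt ℝ (f ∘ (extChartAt (𝓡 n) x).symm) (extChartAt (𝓡 n) x x) :=
    mdifferentiableAt_iff_differentiableAt.1
      (hx.comp _ (mdiffAt_extChartAt_symm (mem_extChartAt_target x)))
  have h1 : euclideanExtDeriv (FormField.inChart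
      (fun x : M ↦ algebraMap ℂ (CForms (TangentSpace (𝓡 n) x)) (f x)) x)
      (extChartAt (𝓡 n) x x) =
      (FormField.inChart (fun x ↦ CForms.toForm (mvfderiv (𝓡 n) f x).toLinearMap) x)
        (extChartAt (𝓡 n) x x) := by
    have h2 : ∀ k, fderiv ℝ (fun y ↦ CForms.scalarL (Eucl n) ((f ∘ (extChartAt (𝓡 n) x).symm) y))
        (extChartAt (𝓡 n) x x) (EuclideanSpace.single k 1) = CForms.scalarL (Eucl n)
        (oneCoeff (fun x ↦ (mvfderiv (𝓡 n) f x).toLinearMap) x k (extChartAt (𝓡 n) x x)) := by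
      intro k
      rw [oneCoeff_mvfderiv (mem_extChartAt_target x) hx]
      exact DFunLike.congr_fun ((CForms.scalarL (Eucl n)).hasFDerivAt.comp _ hd.hasFDerivAt).fderiv _
    rw [e, euclideanExtDeriv_eq]
    simp only [h2]
    refine Eq.trans ?_ ((CForms.pull_toForm _ _).trans (toForm_eucl _)).symm
    refine Finset.sum_congr rfl fun k _ ↦ ?_
    rw [CForms.scalarL_apply, ← Algebra.commutes, ← Algebra.smul_def]
    rfl
  have h3 := FormField.val_eq_pull (fun x ↦ CForms.toForm (mvfderiv (𝓡 n) f x).toLinearMap) x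
  exact (congrArg (CForms.pull (chartD x).toLinearMap) h1).trans h3.symm

end OneForms

/-! ### Frames of vector bundles and connection forms -/

section Frames

open TopologicalSpace

variable {n : ℕ} {M : Type*} [TopologicalSpace M] [ChartedSpace (EuclideanSpace ℝ (Fin n)) M]

theorem mdifferentiableAt_finsetSum {G : Type*} [NormedAddCommGroup G] [NormedSpace ℝ G]
    {ι : Type*} {s : Finset ι} {f : ι → M → G} {x : M}
    (h : ∀ i ∈ s, MDifferentiableAt (𝓡 n) 𝓘(ℝ, G) (f i) x) :
    MDifferentiableAt (𝓡 n) 𝓘(ℝ, G) (fun y ↦ ∑ i ∈ s, f i y) x := by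
  classical
  induction s using Finset.induction_on with
  | empty => simpa only [Finset.sum_empty] using mdifferentiableAt_const
  | insert i s hi ih =>
    simp only [Finset.sum_insert hi]
    exact (h i (Finset.mem_insert_self i s)).add
      (ih fun j hj ↦ h j (Finset.mem_insert_of_mem hj))

namespace CBundle

variable (E : CBundle n M)

/-- The domain of the trivialisation at `p`. -/
def dom (p : M) : Opens M :=
  ⟨(trivializationAt E.F E.V p).baseSet, (trivializationAt E.F E.V p).open_baseSet⟩

theorem mem_dom_self (p : M) : p ∈ E.dom p := FiberBundle.mem_baseSet_trivializationAt' p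

variable {E}

theorem frameCoord_apply {p x : M} (hx : x ∈ E.dom p) (i : Fin E.rank) (v : E.V x) :
    E.frameCoord p i x v =
      (Module.finBasis ℂ E.F).coord i (trivializationAt E.F E.V p ⟨x, v⟩).2 := by
  have h : x ∈ (trivializationAt E.F E.V p).baseSet := hx
  simp only [frameCoord, LinearMap.comp_apply, Bundle.Trivialization.coe_linearMapAt_of_mem _ h]

theorem frameCoord_frame {p x : M} (hx : x ∈ E.dom p) (i j : Fin E.rank) :
    E.frameCoord p i x (E.frame p j x) = if i = j then 1 else 0 := by
  have h : x ∈ (trivializationAt E.F E.V p).baseSet := hx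
  simp only [frameCoord, frame, LinearMap.comp_apply,
    Bundle.Trivialization.linearMapAt_symm _ h]
  have key : ∀ i j : Fin (Module.finrank ℂ E.F),
      (Module.finBasis ℂ E.F).coord i (Module.finBasis ℂ E.F j) = if i = j then 1 else 0 := by
    intro i j
    rw [Module.Basis.coord_apply, Module.Basis.repr_self, Finsupp.single_apply]
    simp only [eq_comm]
  exact key i j

theorem sum_frame {p x : M} (hx : x ∈ E.dom p) (v : E.V x) :
    ∑ i, E.frameCoord p i x v • E.frame p i x = v := by
  have h : x ∈ (trivializationAt E.F E.V p).baseSet := hx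
  have h1 : ∀ i, E.frame p i x = (trivializationAt E.F E.V p).symmₗ ℂ x
      (Module.finBasis ℂ E.F i) := fun i ↦
    (Bundle.Trivialization.symmₗ_apply (R := ℂ) (trivializationAt E.F E.V p) h _).symm
  simp only [h1, ← map_smul, ← map_sum]
  have h2 : ∑ i, E.frameCoord p i x v • Module.finBasis ℂ E.F i =
      (trivializationAt E.F E.V p).linearMapAt ℂ x v := (Module.finBasis ℂ E.F).sum_repr _
  erw [h2]
  exact Bundle.Trivialization.symmₗ_linearMapAt _ h v

theorem frame_ext {p x : M} (hx : x ∈ E.dom p) {v w : E.V x}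
    (h : ∀ i, E.frameCoord p i x v = E.frameCoord p i x w) : v = w := by
  rw [← sum_frame hx v, ← sum_frame hx w]; simp only [h]

/-- The coordinates in the basis of the typical fibre. -/
def fibreCoord (E : CBundle n M) : E.F ≃L[ℝ] (Fin E.rank → ℂ) :=
  ((Module.finBasis ℂ E.F).equivFun.restrictScalars ℝ).toContinuousLinearEquiv

/-- A section is smooth if and only if its coordinates in a local frame are. -/
theorem contMDiffAt_iff_coord {σ : ∀ x, E.V x} {p x : M} (hx : x ∈ E.dom p) :
    ContMDiffAt (𝓡 n) ((𝓡 n).prod 𝓘(ℝ, E.F)) ∞ (E.toTotal σ) x ↔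
      ∀ i, ContMDiffAt (𝓡 n) 𝓘(ℝ, ℂ) ∞ (fun y ↦ E.frameCoord p i y (σ y)) x := by
  have h1 := (trivializationAt E.F E.V p).contMDiffAt_section_iff (IB := 𝓡 n) (n := ∞) (s := σ)
    (x₀ := x) hx
  have he : ∀ᶠ y in nhds x, y ∈ E.dom p := (E.dom p).isOpen.mem_nhds hx
  refine h1.trans ⟨fun h i ↦ ?_, fun h ↦ ?_⟩
  · have h2 : ContMDiffAt (𝓡 n) 𝓘(ℝ, Fin E.rank → ℂ) ∞
        (fun y ↦ E.fibreCoord (trivializationAt E.F E.V p ⟨y, σ y⟩).2) x :=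
      E.fibreCoord.contDiff.contMDiff.contMDiffAt.comp x h
    refine ((contMDiffAt_pi_space.1 h2) i).congr_of_eventuallyEq ?_
    filter_upwards [he] with y hy using frameCoord_apply hy i _
  · have h2 : ContMDiffAt (𝓡 n) 𝓘(ℝ, Fin E.rank → ℂ) ∞
        (fun y ↦ fun i ↦ E.frameCoord p i y (σ y)) x := contMDiffAt_pi_space.2 h
    have h3 := E.fibreCoord.symm.contDiff.contMDiff.contMDiffAt.comp x h2
    refine h3.congr_of_eventuallyEq ?_
    filter_upwards [he] with y hy
    refine (E.fibreCoord.symm_apply_eq.2 (funext fun i ↦ ?_)).symm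
    exact frameCoord_apply hy i _

theorem diffAt_iff_coord {σ : ∀ x, E.V x} {p x : M} (hx : x ∈ E.dom p) :
    E.DiffAt σ x ↔
      ∀ i, MDifferentiableAt (𝓡 n) 𝓘(ℝ, ℂ) (fun y ↦ E.frameCoord p i y (σ y)) x := by
  have h1 := (trivializationAt E.F E.V p).mdifferentiableAt_section_iff (𝓡 n) σ (b₀ := x) hx
  have he : ∀ᶠ y in nhds x, y ∈ E.dom p := (E.dom p).isOpen.mem_nhds hx
  refine h1.trans ⟨fun h i ↦ ?_, fun h ↦ ?_⟩
  · have h2 : MDifferentiableAt (𝓡 n) 𝓘(ℝ, Fin E.rank → ℂ)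
        (fun y ↦ E.fibreCoord (trivializationAt E.F E.V p ⟨y, σ y⟩).2) x :=
      E.fibreCoord.toContinuousLinearMap.mdifferentiableAt.comp x h
    have h3 : MDifferentiableAt (𝓡 n) 𝓘(ℝ, ℂ)
        (fun y ↦ E.fibreCoord (trivializationAt E.F E.V p ⟨y, σ y⟩).2 i) x :=
      (ContinuousLinearMap.proj (R := ℝ) (φ := fun _ : Fin E.rank ↦ ℂ) i).mdifferentiableAt.comp x h2
    refine h3.congr_of_eventuallyEq ?_
    filter_upwards [he] with y hy using frameCoord_apply hy i _
  · have h2 : ∀ i, MDifferentiableAt (𝓡 n) 𝓘(ℝ, E.F)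
        (fun y ↦ E.frameCoord p i y (σ y) • Module.finBasis ℂ E.F i) x := fun i ↦
      ((ContinuousLinearMap.toSpanSingleton ℂ
        (Module.finBasis ℂ E.F i)).restrictScalars ℝ).mdifferentiableAt.comp x (h i)
    have h3 := mdifferentiableAt_finsetSum (s := Finset.univ) fun i _ ↦ h2 i
    refine h3.congr_of_eventuallyEq ?_
    filter_upwards [he] with y hy
    simp only [frameCoord_apply hy]
    exact ((Module.finBasis ℂ E.F).sum_repr _).symm

theorem contMDiffAt_frame {p x : M} (hx : x ∈ E.dom p) (j : Fin E.rank) :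
    ContMDiffAt (𝓡 n) ((𝓡 n).prod 𝓘(ℝ, E.F)) ∞ (E.toTotal (E.frame p j)) x := by
  refine (contMDiffAt_iff_coord hx).2 fun i ↦ ?_
  refine (contMDiffAt_const (c := if i = j then (1 : ℂ) else 0)).congr_of_eventuallyEq ?_
  filter_upwards [(E.dom p).isOpen.mem_nhds hx] with y hy using frameCoord_frame hy i j

theorem diffAt_of_contMDiffAt {σ : ∀ x, E.V x} {x : M}
    (h : ContMDiffAt (𝓡 n) ((𝓡 n).prod 𝓘(ℝ, E.F)) ∞ (E.toTotal σ) x) : E.DiffAt σ x :=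
  h.mdifferentiableAt (by simp)

theorem diffAt_frame {p x : M} (hx : x ∈ E.dom p) (j : Fin E.rank) :
    E.DiffAt (E.frame p j) x := diffAt_of_contMDiffAt (contMDiffAt_frame hx j)

theorem DiffAt.coord {σ : ∀ x, E.V x} {p x : M} (h : E.DiffAt σ x) (hx : x ∈ E.dom p)
    (i : Fin E.rank) :
    MDifferentiableAt (𝓡 n) 𝓘(ℝ, ℂ) (fun y ↦ E.frameCoord p i y (σ y)) x :=
  (diffAt_iff_coord hx).1 h i

theorem DiffAt.csmul {σ : ∀ x, E.V x} {x : M} {f : M → ℂ}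
    (hf : MDifferentiableAt (𝓡 n) 𝓘(ℝ, ℂ) f x) (h : E.DiffAt σ x) :
    E.DiffAt (fun y ↦ f y • σ y) x := by
  refine (diffAt_iff_coord (E.mem_dom_self x)).2 fun i ↦ ?_
  simp only [map_smul, smul_eq_mul]
  exact hf.mul (h.coord (E.mem_dom_self x) i)

theorem DiffAt.add {σ τ : ∀ x, E.V x} {x : M} (h : E.DiffAt σ x) (h' : E.DiffAt τ x) :
    E.DiffAt (σ + τ) x := mdifferentiableAt_add_section h h'

theorem DiffAt.sum {ι : Type*} {s : Finset ι} {σ : ι → ∀ x, E.V x} {x : M}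
    (h : ∀ i ∈ s, E.DiffAt (σ i) x) : E.DiffAt (fun y ↦ ∑ i ∈ s, σ i y) x := by
  refine (diffAt_iff_coord (E.mem_dom_self x)).2 fun i ↦ ?_
  simp only [map_sum]
  exact mdifferentiableAt_finsetSum fun j hj ↦ (h j hj).coord (E.mem_dom_self x) i

/-- The entries of the connection matrix, as complex valued one-forms. -/
def conn1 (D : E.Op) (p : M) (i j : Fin E.rank) (x : M) : TangentSpace (𝓡 n) x →ₗ[ℝ] ℂ :=
  (E.frameCoord p i x).restrictScalars ℝ ∘ₗ (D (E.frame p j) x).toLinearMap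

theorem connMatrix_apply (D : E.Op) (p : M) (i j : Fin E.rank) (x : M) :
    E.connMatrix D p i j x = CForms.toForm (conn1 D p i j x) := rfl

theorem mvfderiv_clm_comp {G G' : Type*} [NormedAddCommGroup G] [NormedSpace ℝ G]
    [NormedAddCommGroup G'] [NormedSpace ℝ G'] (L : G →L[ℝ] G') {f : M → G} {x : M}
    (hf : MDifferentiableAt (𝓡 n) 𝓘(ℝ, G) f x) (v : TangentSpace (𝓡 n) x) :
    mvfderiv (𝓡 n) (fun y ↦ L (f y)) x v = L (mvfderiv (𝓡 n) f x v) := by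
  have h := mfderiv_comp x (g := L) L.mdifferentiableAt hf
  rw [mfderiv_eq_fderiv, ContinuousLinearMap.fderiv] at h
  exact DFunLike.congr_fun h v

variable [IsManifold (𝓡 n) ∞ M]

/-- An operator on sections is a smooth complex linear connection. -/
structure IsConnOp (D : E.Op) : Prop where
  cov : IsCovariantDerivativeOn E.F D Set.univ
  map_smul : ∀ (c : ℂ) (σ : ∀ x, E.V x) (x : M) (v : TangentSpace (𝓡 n) x), E.DiffAt σ x →
    D (fun y ↦ c • σ y) x v = c • D σ x v
  smooth : ∀ p i j, ∀ x ∈ E.dom p, OneSmoothAt (conn1 D p i j) x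

section Local

variable {D : E.Op}

/-- The Leibniz rule for complex valued functions. -/
theorem leibniz_complex (hc : IsCovariantDerivativeOn E.F D Set.univ)
    (hs : ∀ (c : ℂ) (σ : ∀ x, E.V x) (x : M) (v : TangentSpace (𝓡 n) x), E.DiffAt σ x →
      D (fun y ↦ c • σ y) x v = c • D σ x v) {f : M → ℂ} {σ : ∀ x, E.V x} {x : M}
    (hf : MDifferentiableAt (𝓡 n) 𝓘(ℝ, ℂ) f x) (hσ : E.DiffAt σ x)
    (v : TangentSpace (𝓡 n) x) :
    D (fun y ↦ f y • σ y) x v = f x • D σ x v + (mvfderiv (𝓡 n) f x v : ℂ) • σ x := by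
  have hre : MDifferentiableAt (𝓡 n) 𝓘(ℝ, ℝ) (fun y ↦ (f y).re) x :=
    Complex.reCLM.mdifferentiableAt.comp x hf
  have him : MDifferentiableAt (𝓡 n) 𝓘(ℝ, ℝ) (fun y ↦ (f y).im) x :=
    Complex.imCLM.mdifferentiableAt.comp x hf
  have hI : E.DiffAt (fun y ↦ Complex.I • σ y) x := hσ.csmul mdifferentiableAt_const
  have dre : mvfderiv (𝓡 n) (fun y ↦ (f y).re) x v = (mvfderiv (𝓡 n) f x v : ℂ).re :=
    mvfderiv_clm_comp Complex.reCLM hf v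
  have dim : mvfderiv (𝓡 n) (fun y ↦ (f y).im) x v = (mvfderiv (𝓡 n) f x v : ℂ).im :=
    mvfderiv_clm_comp Complex.imCLM hf v
  have hre' : E.DiffAt ((fun y ↦ (f y).re) • σ) x := hre.smul_section hσ
  have him' : E.DiffAt ((fun y ↦ (f y).im) • fun y ↦ Complex.I • σ y) x := him.smul_section hI
  -- the Leibniz rule is only known for real functions: split into real and imaginary parts
  have key : ∀ (z : ℂ) (y : M) (w : E.V y), z • w = z.re • w + z.im • (Complex.I • w) := by
    intro z y w
    conv_lhs => rw [← Complex.re_add_im z, add_smul, mul_smul]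
    rfl
  have e : (fun y ↦ f y • σ y) =
      (fun y ↦ (f y).re) • σ + (fun y ↦ (f y).im) • (fun y ↦ Complex.I • σ y) :=
    funext fun y ↦ key (f y) y (σ y)
  rw [e, hc.add hre' him', hc.leibniz hσ hre, hc.leibniz hI him]
  simp only [add_apply, smul_apply, ContinuousLinearMap.smulRight_apply, hs _ _ _ _ hσ, dre, dim]
  rw [key (f x), key (mvfderiv (𝓡 n) f x v)]
  abel

theorem conn_sum (hc : IsCovariantDerivativeOn E.F D Set.univ) {ι : Type*} {s : Finset ι}
    {σ : ι → ∀ x, E.V x} {x : M} (h : ∀ i ∈ s, E.DiffAt (σ i) x) :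
    D (fun y ↦ ∑ i ∈ s, σ i y) x = ∑ i ∈ s, D (σ i) x := by
  classical
  induction s using Finset.induction_on with
  | empty => exact hc.zero
  | insert i s hi ih =>
    simp only [Finset.sum_insert hi]
    have h1 := h i (Finset.mem_insert_self i s)
    have h2 : ∀ j ∈ s, E.DiffAt (σ j) x := fun j hj ↦ h j (Finset.mem_insert_of_mem hj)
    rw [← ih h2]
    exact hc.add h1 (DiffAt.sum h2)

/-- The local expression of a connection. -/
theorem frameCoord_conn (hc : IsCovariantDerivativeOn E.F D Set.univ)
    (hs : ∀ (c : ℂ) (σ : ∀ x, E.V x) (x : M) (v : TangentSpace (𝓡 n) x), E.DiffAt σ x →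
      D (fun y ↦ c • σ y) x v = c • D σ x v) {σ : ∀ x, E.V x} {p x : M} (hx : x ∈ E.dom p)
    (hσ : E.DiffAt σ x) (i : Fin E.rank) (v : TangentSpace (𝓡 n) x) :
    E.frameCoord p i x (D σ x v) = mvfderiv (𝓡 n) (fun y ↦ E.frameCoord p i y (σ y)) x v +
      ∑ j, E.frameCoord p j x (σ x) * conn1 D p i j x v := by
  have h1 : ∀ j, E.DiffAt (fun y ↦ E.frameCoord p j y (σ y) • E.frame p j y) x := fun j ↦
    (diffAt_frame hx j).csmul (hσ.coord hx j)
  have h2 : D σ x = D (fun y ↦ ∑ j, E.frameCoord p j y (σ y) • E.frame p j y) x := by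
    refine hc.congr_of_eventuallyEq hσ (DiffAt.sum fun j _ ↦ h1 j) Filter.univ_mem ?_
    filter_upwards [(E.dom p).isOpen.mem_nhds hx] with y hy using (sum_frame hy _).symm
  rw [h2, conn_sum hc fun j _ ↦ h1 j, sum_apply, map_sum]
  have h3 : ∀ j, E.frameCoord p i x (D (fun y ↦ E.frameCoord p j y (σ y) • E.frame p j y) x v) =
      E.frameCoord p j x (σ x) * conn1 D p i j x v +
        mvfderiv (𝓡 n) (fun y ↦ E.frameCoord p j y (σ y)) x v * (if i = j then 1 else 0) := by
    intro j
    rw [leibniz_complex hc hs (hσ.coord hx j) (diffAt_frame hx j), map_add, _root_.map_smul,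
      _root_.map_smul, frameCoord_frame hx]
    rfl
  simp only [h3, Finset.sum_add_distrib, mul_ite, mul_one, mul_zero, Finset.sum_ite_eq,
    Finset.mem_univ, if_true]
  exact add_comm _ _

end Local

end CBundle

end Frames

section ConnOps

open TopologicalSpace

variable {n : ℕ} {M : Type*} [TopologicalSpace M] [ChartedSpace (EuclideanSpace ℝ (Fin n)) M]

/-- The `k`-th coordinate vector field of the chart at `x`. -/
def coordVec (x : M) (k : Fin n) (y : M) : TangentSpace (𝓡 n) y :=
  (chartInvD x (extChartAt (𝓡 n) x y) (EuclideanSpace.single k 1) : Eucl n)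

variable [IsManifold (𝓡 n) ∞ M]

/-- A one-form is smooth if and only if its values on the coordinate fields are. -/
theorem oneSmoothAt_iff {a : ∀ x : M, TangentSpace (𝓡 n) x →ₗ[ℝ] ℂ} {x : M} :
    OneSmoothAt a x ↔ ∀ k, ContMDiffAt (𝓡 n) 𝓘(ℝ, ℂ) ∞ (fun y ↦ a y (coordVec x k y)) x := by
  refine forall_congr' fun k ↦ ?_
  rw [contMDiffAt_iff_contDiffAt_chart]
  have h : oneCoeff a x k =ᶠ[nhds (extChartAt (𝓡 n) x x)]
      ((fun y ↦ a y (coordVec x k y)) ∘ (extChartAt (𝓡 n) x).symm) := by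
    filter_upwards [extChartAt_target_mem_nhds (I := 𝓡 n) x] with y hy
    simp only [Function.comp_apply, coordVec, (extChartAt (𝓡 n) x).right_inv hy]
    rfl
  exact ⟨fun h' ↦ h'.congr_of_eventuallyEq h.symm, fun h' ↦ h'.congr_of_eventuallyEq h⟩

theorem symmL_single {x y : M} (hy : y ∈ (chartAt (Eucl n) x).source) (k : Fin n) :
    (trivializationAt (Eucl n) (TangentSpace (𝓡 n)) x).symmL ℝ y (EuclideanSpace.single k 1) =
      coordVec x k y := by
  rw [TangentBundle.symmL_trivializationAt hy, ModelWithCorners.range_eq_univ, mfderivWithin_univ]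
  rfl

namespace CBundle

variable {E : CBundle n M}

/-- Smoothness of a section of `Hom(TM, E)` in terms of its values on coordinate fields. -/
theorem contMDiffAt_hom_iff {τ : ∀ x, TangentSpace (𝓡 n) x →L[ℝ] E.V x} {x : M} :
    ContMDiffAt (𝓡 n) ((𝓡 n).prod 𝓘(ℝ, Eucl n →L[ℝ] E.F)) ∞
      (fun y ↦ Bundle.TotalSpace.mk' (Eucl n →L[ℝ] E.F)
        (E := fun x ↦ TangentSpace (𝓡 n) x →L[ℝ] E.V x) y (τ y)) x ↔
    ∀ k, ContMDiffAt (𝓡 n) ((𝓡 n).prod 𝓘(ℝ, E.F)) ∞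
      (E.toTotal fun y ↦ τ y (coordVec x k y)) x := by
  rw [contMDiffAt_hom_bundle]
  have h1 : ∀ k, ContMDiffAt (𝓡 n) ((𝓡 n).prod 𝓘(ℝ, E.F)) ∞
      (E.toTotal fun y ↦ τ y (coordVec x k y)) x ↔ ContMDiffAt (𝓡 n) 𝓘(ℝ, E.F) ∞
      (fun y ↦ ContinuousLinearMap.inCoordinates (Eucl n) (TangentSpace (𝓡 n)) E.F E.V
        x y x y (τ y) (EuclideanSpace.single k (1 : ℝ))) x := by
    intro k
    rw [(trivializationAt E.F E.V x).contMDiffAt_section_iff (IB := 𝓡 n) (n := ∞)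
      (x₀ := x) (E.mem_dom_self x)]
    refine Filter.EventuallyEq.contMDiffAt_iff ?_
    filter_upwards [(E.dom x).isOpen.mem_nhds (E.mem_dom_self x),
      chart_source_mem_nhds (Eucl n) x] with y hy hy'
    refine (Bundle.Trivialization.continuousLinearMapAt_apply_of_mem ℝ _ hy _).symm.trans ?_
    rw [← symmL_single hy' k]
    rfl
  refine ⟨fun h k ↦ (h1 k).2 ?_, fun h ↦ ⟨contMDiffAt_id, ?_⟩⟩
  · exact (ContinuousLinearMap.apply ℝ E.F
      (EuclideanSpace.single k (1 : ℝ) : Eucl n)).contMDiff.contMDiffAt.comp x h.2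
  · have h2 : ∀ k, ContMDiffAt (𝓡 n) 𝓘(ℝ, Eucl n →L[ℝ] E.F) ∞
        (fun y ↦ (EuclideanSpace.proj k : Eucl n →L[ℝ] ℝ).smulRight
          (ContinuousLinearMap.inCoordinates (Eucl n) (TangentSpace (𝓡 n)) E.F E.V
            x y x y (τ y) (EuclideanSpace.single k (1 : ℝ)))) x := fun k ↦
      (ContinuousLinearMap.smulRightL ℝ (Eucl n) E.F
        (EuclideanSpace.proj k)).contMDiff.contMDiffAt.comp x ((h1 k).1 (h k))
    have h3 := ContMDiffAt.sum (t := Finset.univ) fun k _ ↦ h2 k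
    refine h3.congr_of_eventuallyEq (Filter.Eventually.of_forall fun y ↦ ?_)
    refine ContinuousLinearMap.ext fun v ↦ ?_
    have hv : v = ∑ k, v k • (EuclideanSpace.single k (1 : ℝ) : Eucl n) := by
      simpa using ((EuclideanSpace.basisFun (Fin n) ℝ).sum_repr v).symm
    conv_lhs => rw [hv, map_sum]
    simp

/-- A section which agrees near `x` with `σ` and is smooth everywhere, if `σ` is smooth near `x`. -/
theorem exists_smooth_extension [T2Space M] {σ : ∀ x, E.V x} {W : Opens M}
    (hσ : ∀ y ∈ W, ContMDiffAt (𝓡 n) ((𝓡 n).prod 𝓘(ℝ, E.F)) ∞ (E.toTotal σ) y)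
    {x : M} (hx : x ∈ W) :
    ∃ τ : ∀ x, E.V x, (∀ y, ContMDiffAt (𝓡 n) ((𝓡 n).prod 𝓘(ℝ, E.F)) ∞ (E.toTotal τ) y) ∧
      ∀ᶠ y in nhds x, τ y = σ y := by
  obtain ⟨f, -, hf⟩ := (SmoothBumpFunction.nhds_basis_tsupport (I := 𝓡 n) x).mem_iff.1
    (W.isOpen.mem_nhds hx)
  refine ⟨fun y ↦ ((f y : ℝ) : ℂ) • σ y, fun y ↦ ?_, ?_⟩
  · by_cases hy : y ∈ tsupport f
    · refine (contMDiffAt_iff_coord (E.mem_dom_self y)).2 fun i ↦ ?_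
      simp only [_root_.map_smul, smul_eq_mul]
      exact ContMDiffAt.complex_mul
        (Complex.ofRealCLM.contMDiff.contMDiffAt.comp y f.contMDiffAt)
        ((contMDiffAt_iff_coord (E.mem_dom_self y)).1 (hσ y (hf hy)) i)
    · refine (contMDiffAt_iff_coord (E.mem_dom_self y)).2 fun i ↦ ?_
      refine (contMDiffAt_const (c := (0 : ℂ))).congr_of_eventuallyEq ?_
      filter_upwards [(isClosed_tsupport f).isOpen_compl.mem_nhds hy] with z hz
      rw [image_eq_zero_of_notMem_tsupport hz]
      simp
  · filter_upwards [f.eventuallyEq_one] with y hy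
    rw [hy]; simp

/-- A connection is defined on global sections, while a local frame is only smooth on its domain: a
bump function extends the frame near a point without changing the connection form there. -/
theorem _root_.Connection.isConnOp [T2Space M] (D : Connection E) : IsConnOp D.toFun where
  cov := D.isCovariantDerivativeOnUniv
  map_smul := D.map_smul
  smooth := by
    intro p i j x hx
    obtain ⟨τ, hτ, he⟩ := exists_smooth_extension (σ := E.frame p j) (W := E.dom p)
      (fun y hy ↦ contMDiffAt_frame hy j) hx
    have e : (∞ + 1 : WithTop ℕ∞) = ∞ := rfl
    have h1 := contMDiffOn_univ.1 (D.smooth.contMDiff.contMDiff (σ := τ)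
      (e ▸ fun y _ ↦ (hτ y).contMDiffWithinAt)) x
    have h2 := contMDiffAt_hom_iff.1 h1
    have h3 : OneSmoothAt (fun y ↦ (E.frameCoord p i y).restrictScalars ℝ ∘ₗ
        (D.toFun τ y).toLinearMap) x :=
      oneSmoothAt_iff.2 fun k ↦ (contMDiffAt_iff_coord hx).1 (h2 k) i
    refine h3.congr ?_
    filter_upwards [he.eventually_nhds, (E.dom p).isOpen.mem_nhds hx] with y hy hy'
    have : D.toFun (E.frame p j) y = D.toFun τ y :=
      D.isCovariantDerivativeOnUniv.congr_of_eventuallyEq (diffAt_frame hy' j)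
        (diffAt_of_contMDiffAt (hτ y)) Filter.univ_mem (hy.mono fun z hz ↦ hz.symm)
    simp only [conn1, this]

/-- The connection given by an operator with the properties of one. -/
def IsConnOp.toConnection {D : E.Op} (h : IsConnOp D) : Connection E where
  toFun := D
  isCovariantDerivativeOnUniv := h.cov
  map_smul := h.map_smul
  smooth := ⟨⟨fun {σ} hσ x _ ↦ by
    have e : (∞ + 1 : WithTop ℕ∞) = ∞ := rfl
    rw [e, contMDiffOn_univ] at hσ
    refine (contMDiffAt_hom_iff.2 fun k ↦ ?_).contMDiffWithinAt
    have hx := E.mem_dom_self x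
    refine (contMDiffAt_iff_coord hx).2 fun i ↦ ?_
    have hs := (contMDiffAt_iff_coord hx).1 (hσ x)
    have h1 : OneSmoothAt (fun y ↦ (mvfderiv (𝓡 n) (fun y ↦ E.frameCoord x i y (σ y)) y).toLinearMap
        + ∑ j, E.frameCoord x j y (σ y) • conn1 D x i j y) x :=
      (OneSmoothAt.mvfderiv (hs i)).add
        (OneSmoothAt.sum fun j _ ↦ (h.smooth x i j x hx).smul (hs j))
    refine (oneSmoothAt_iff.1 h1 k).congr_of_eventuallyEq ?_
    filter_upwards [(E.dom x).isOpen.mem_nhds hx] with y hy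
    rw [frameCoord_conn h.cov h.map_smul hy (diffAt_of_contMDiffAt (hσ y))]
    simp [LinearMap.sum_apply]⟩⟩

end CBundle

end ConnOps

/-! ### Isomorphisms of bundles and gauge transformations -/

section Gauge

open TopologicalSpace

variable {n : ℕ} {M : Type*} [TopologicalSpace M] [ChartedSpace (EuclideanSpace ℝ (Fin n)) M]
variable {E E' : CBundle n M}

namespace CBundle

/-- The identity isomorphism. -/
def Iso.refl (E : CBundle n M) : E.Iso E where
  equiv x := ContinuousLinearEquiv.refl ℂ (E.V x)
  smooth := contMDiff_id
  smooth_symm := contMDiff_id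

/-- The inverse isomorphism. -/
def Iso.symm (f : E.Iso E') : E'.Iso E where
  equiv x := (f.equiv x).symm
  smooth := f.smooth_symm
  smooth_symm := f.smooth

/-- The matrix of an isomorphism in the frames given by the trivialisations at `p` and `q`. -/
def Iso.gauge (f : E.Iso E') (p q : M) (i : Fin E'.rank) (j : Fin E.rank) (x : M) : ℂ :=
  E'.frameCoord q i x (f.equiv x (E.frame p j x))

variable (f : E.Iso E')

theorem Iso.contMDiffAt {σ : ∀ x, E.V x} {x : M}
    (h : ContMDiffAt (𝓡 n) ((𝓡 n).prod 𝓘(ℝ, E.F)) ∞ (E.toTotal σ) x) :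
    ContMDiffAt (𝓡 n) ((𝓡 n).prod 𝓘(ℝ, E'.F)) ∞ (E'.toTotal fun y ↦ f.equiv y (σ y)) x :=
  f.smooth.contMDiffAt.comp x h

theorem Iso.diffAt {σ : ∀ x, E.V x} {x : M} (h : E.DiffAt σ x) :
    E'.DiffAt (fun y ↦ f.equiv y (σ y)) x :=
  (f.smooth.contMDiffAt.mdifferentiableAt (by simp)).comp x h

theorem Iso.contMDiffAt_gauge {p q x : M} (hp : x ∈ E.dom p) (hq : x ∈ E'.dom q)
    (i : Fin E'.rank) (j : Fin E.rank) : ContMDiffAt (𝓡 n) 𝓘(ℝ, ℂ) ∞ (f.gauge p q i j) x :=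
  (contMDiffAt_iff_coord hq).1 (f.contMDiffAt (contMDiffAt_frame hp j)) i

theorem Iso.frameCoord_equiv {p q x : M} (hp : x ∈ E.dom p) (i : Fin E'.rank) (v : E.V x) :
    E'.frameCoord q i x (f.equiv x v) = ∑ j, f.gauge p q i j x * E.frameCoord p j x v := by
  conv_lhs => rw [← sum_frame hp v]
  simp only [map_sum, map_smul, smul_eq_mul, Iso.gauge, mul_comm]

theorem Iso.gauge_mul_gauge {p q x : M} (hp : x ∈ E.dom p) (hq : x ∈ E'.dom q)
    (i j : Fin E.rank) : ∑ k, f.symm.gauge q p i k x * f.gauge p q k j x = if i = j then 1 else 0 := by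
  rw [← frameCoord_frame hp i j]
  have h := f.symm.frameCoord_equiv (q := p) hq i (f.equiv x (E.frame p j x))
  rw [show f.symm.equiv x (f.equiv x (E.frame p j x)) = E.frame p j x from
    (f.equiv x).symm_apply_apply _] at h
  exact h.symm

variable [IsManifold (𝓡 n) ∞ M]

/-- A pushed forward frame, differentiated by a connection: `D(G e) = dG + A G` in components. -/
theorem sum_comp_conn1 {D' : E'.Op} (hD : IsConnOp D') {p q x : M}
    (hp : x ∈ E.dom p) (hq : x ∈ E'.dom q) (i : Fin E'.rank) (k : Fin E.rank) :
    (E'.frameCoord q i x).restrictScalars ℝ ∘ₗ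
      (D' (fun y ↦ f.equiv y (E.frame p k y)) x).toLinearMap =
      (mvfderiv (𝓡 n) (f.gauge p q i k) x).toLinearMap +
      ∑ j, f.gauge p q j k x • conn1 D' q i j x := by
  refine LinearMap.ext fun v ↦ ?_
  refine (frameCoord_conn hD.cov hD.map_smul hq (f.diffAt (diffAt_frame hp k)) i v).trans ?_
  simp only [LinearMap.add_apply, LinearMap.sum_apply, LinearMap.smul_apply, smul_eq_mul]
  rfl

/-- The gauge transformation formula for connection matrices. -/
theorem gauge_conn1 {D' : E'.Op} (hD : IsConnOp D') {p q x : M}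
    (hp : x ∈ E.dom p) (hq : x ∈ E'.dom q) (i : Fin E'.rank) (k : Fin E.rank) :
    ∑ j, f.gauge p q i j x • conn1 (f.pullOp D') p j k x =
      (mvfderiv (𝓡 n) (f.gauge p q i k) x).toLinearMap +
      ∑ j, f.gauge p q j k x • conn1 D' q i j x := by
  rw [← sum_comp_conn1 f hD hp hq i k]
  refine LinearMap.ext fun v ↦ ?_
  have h := f.frameCoord_equiv (q := q) hp i (f.pullOp D' (E.frame p k) x v)
  rw [show f.equiv x (f.pullOp D' (E.frame p k) x v) = D' (fun y ↦ f.equiv y (E.frame p k y)) x v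
    from (f.equiv x).apply_symm_apply _] at h
  simp only [LinearMap.sum_apply, LinearMap.smul_apply, smul_eq_mul]
  exact h.symm

theorem conn1_pullOp {D' : E'.Op} (hD : IsConnOp D') {p q x : M}
    (hp : x ∈ E.dom p) (hq : x ∈ E'.dom q) (l k : Fin E.rank) :
    conn1 (f.pullOp D') p l k x = ∑ i, f.symm.gauge q p l i x •
      ((mvfderiv (𝓡 n) (f.gauge p q i k) x).toLinearMap +
        ∑ j, f.gauge p q j k x • conn1 D' q i j x) := by
  simp only [← gauge_conn1 f hD hp hq, Finset.smul_sum, smul_smul]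
  rw [Finset.sum_comm]
  simp only [← Finset.sum_smul, f.gauge_mul_gauge hp hq, ite_smul, one_smul, zero_smul,
    Finset.sum_ite_eq, Finset.mem_univ, if_true]

theorem IsConnOp.pullOp {D' : E'.Op} (hD : IsConnOp D') : IsConnOp (f.pullOp D') where
  cov :=
    { add := by
        intro σ τ x hσ hτ _
        have h := hD.cov.add (x := x) (f.diffAt hσ) (f.diffAt hτ)
        refine ContinuousLinearMap.ext fun v ↦ ?_
        have e : (fun y ↦ f.equiv y ((σ + τ) y)) =
            (fun y ↦ f.equiv y (σ y)) + fun y ↦ f.equiv y (τ y) :=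
          funext fun y ↦ map_add (f.equiv y) _ _
        change (f.equiv x).symm (D' (fun y ↦ f.equiv y ((σ + τ) y)) x v) = _
        rw [e, h]
        exact map_add (f.equiv x).symm _ _
      leibniz := by
        intro σ g x hσ hg _
        have h := hD.cov.leibniz (x := x) (f.diffAt hσ) hg
        refine ContinuousLinearMap.ext fun v ↦ ?_
        have e : (fun y ↦ f.equiv y ((g • σ) y)) = g • fun y ↦ f.equiv y (σ y) :=
          funext fun y ↦
            ((f.equiv y : E.V y →L[ℂ] E'.V y).restrictScalars ℝ).map_smul (g y) (σ y)
        change (f.equiv x).symm (D' (fun y ↦ f.equiv y ((g • σ) y)) x v) = _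
        rw [e, h]
        change ((f.equiv x).symm : E'.V x →L[ℂ] E.V x).restrictScalars ℝ _ = _
        simp only [add_apply, smul_apply, ContinuousLinearMap.smulRight_apply, map_add, _root_.map_smul]
        congr 2
        exact (f.equiv x).symm_apply_apply _ }
  map_smul c σ x v hσ := by
    have e : (fun y ↦ f.equiv y (c • σ y)) = fun y ↦ c • f.equiv y (σ y) :=
      funext fun y ↦ _root_.map_smul (f.equiv y) _ _
    change (f.equiv x).symm (D' (fun y ↦ f.equiv y (c • σ y)) x v) = _
    rw [e, hD.map_smul c _ x v (f.diffAt hσ)]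
    exact _root_.map_smul (f.equiv x).symm _ _
  smooth p l k x hx := by
    have hq := E'.mem_dom_self x
    have h : OneSmoothAt (fun y ↦ ∑ i, f.symm.gauge x p l i y •
      ((mvfderiv (𝓡 n) (f.gauge p x i k) y).toLinearMap +
        ∑ j, f.gauge p x j k y • conn1 D' x i j y)) x :=
      OneSmoothAt.sum fun i _ ↦ ((OneSmoothAt.mvfderiv (f.contMDiffAt_gauge hx hq i k)).add
        (OneSmoothAt.sum fun j _ ↦ (hD.smooth x i j x hq).smul
          (f.contMDiffAt_gauge hx hq j k))).smul (f.symm.contMDiffAt_gauge hq hx l i)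
    refine h.congr ?_
    filter_upwards [(E.dom p).isOpen.mem_nhds hx, (E'.dom x).isOpen.mem_nhds hq] with y hy hy'
    exact conn1_pullOp f hD hy hy' l k

/-- The affine combination `(1 - t) D₀ + t D₁` of two operators. -/
def seg (D₀ D₁ : E.Op) (t : ℝ) : E.Op := fun σ x ↦ (1 - t) • D₀ σ x + t • D₁ σ x

theorem conn1_seg (D₀ D₁ : E.Op) (t : ℝ) (p : M) (i j : Fin E.rank) (x : M) :
    conn1 (seg D₀ D₁ t) p i j x =
      ((1 - t : ℝ) : ℂ) • conn1 D₀ p i j x + (t : ℂ) • conn1 D₁ p i j x := by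
  refine LinearMap.ext fun v ↦ ?_
  change (E.frameCoord p i x).restrictScalars ℝ
    ((1 - t) • D₀ (E.frame p j) x v + t • D₁ (E.frame p j) x v) = _
  rw [map_add, map_smul, map_smul]
  rfl

theorem IsConnOp.affine {D₀ D₁ : E.Op} (h₀ : IsConnOp D₀) (h₁ : IsConnOp D₁) (t : ℝ) :
    IsConnOp (seg D₀ D₁ t) where
  cov :=
    { add := by
        intro σ τ x hσ hτ _
        simp only [seg, h₀.cov.add hσ hτ, h₁.cov.add hσ hτ, smul_add]
        abel
      leibniz := by
        intro σ g x hσ hg _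
        refine ContinuousLinearMap.ext fun v ↦ ?_
        simp only [seg, h₀.cov.leibniz hσ hg, h₁.cov.leibniz hσ hg, add_apply, smul_apply,
          ContinuousLinearMap.smulRight_apply]
        module }
  map_smul c σ x v hσ := by
    simp only [seg, add_apply, smul_apply, h₀.map_smul c σ x v hσ, h₁.map_smul c σ x v hσ,
      smul_add, smul_comm c]
  smooth p i j x hx := by
    refine OneSmoothAt.congr ?_ (Filter.Eventually.of_forall fun y ↦ conn1_seg D₀ D₁ t p i j y)
    exact ((h₀.smooth p i j x hx).smul (f := fun _ ↦ _) contMDiffAt_const).add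
      ((h₁.smooth p i j x hx).smul (f := fun _ ↦ _) contMDiffAt_const)

end CBundle

end Gauge

/-! ### Families of connections and their local matrices -/

section Families

open TopologicalSpace FormAlgebra

variable {n : ℕ} {M : Type*} [TopologicalSpace M] [ChartedSpace (EuclideanSpace ℝ (Fin n)) M]
  [IsManifold (𝓡 n) ∞ M]
variable {W : Opens M} {E E' : CBundle n M}

namespace LocalForms

/-- A family of global forms that is locally given by a smooth family is smooth. -/
theorem famSmoothAt_of_family (a : LocalForms n W) {α : Params → FormField n M}
    (h : ∀ u, ∀ x : W, α u x = a.1 u x) (u : Params) {x : M} (hx : x ∈ W) :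
    FamSmoothAt α u x :=
  (a.2 u x hx).congr (by
    filter_upwards [W.isOpen.mem_nhds hx] with y hy v
    exact (h v ⟨y, hy⟩).trans (a.1.ext_apply v hy).symm)

/-- The value of a family of forms at a parameter and a point. -/
def eval (u : Params) (x : W) : LocalForms n W →ₐ[ℂ] CForms (TangentSpace (𝓡 n) (x : M)) where
  toFun a := a.1 u x
  map_one' := rfl
  map_mul' _ _ := rfl
  map_zero' := rfl
  map_add' _ _ := rfl
  commutes' _ := rfl

theorem eval_apply (u : Params) (x : W) (a : LocalForms n W) : eval u x a = a.1 u x := rfl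

theorem eval_trace {ι : Type*} [Fintype ι] (u : Params) (x : W)
    (X : Matrix ι ι (LocalForms n W)) : eval u x X.trace = (X.map (eval u x)).trace := by
  simp [Matrix.trace]

theorem map_eval_mul {ι κ l : Type*} [Fintype κ] (u : Params) (x : W)
    (X : Matrix ι κ (LocalForms n W)) (Y : Matrix κ l (LocalForms n W)) :
    (X * Y).map (eval u x) = X.map (eval u x) * Y.map (eval u x) := Matrix.map_mul

theorem map_eval_pow {ι : Type*} [Fintype ι] [DecidableEq ι] (u : Params) (x : W)
    (X : Matrix ι ι (LocalForms n W)) (k : ℕ) :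
    (X ^ k).map (eval u x) = X.map (eval u x) ^ k := map_pow (eval u x).mapMatrix X k

end LocalForms

namespace CBundle

open LocalForms

/-- A smooth two-parameter family of connections. -/
structure IsConnFam (𝒟 : Params → E.Op) : Prop where
  conn : ∀ u, IsConnOp (𝒟 u)
  smooth : ∀ p i j u, ∀ x ∈ E.dom p, FamSmoothAt (fun u ↦ E.connMatrix (𝒟 u) p i j) u x

theorem IsConnOp.const {D : E.Op} (h : IsConnOp D) : IsConnFam fun _ ↦ D :=
  ⟨fun _ ↦ h, fun p i j u x hx ↦ (h.smooth p i j x hx).famSmoothAt u⟩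

variable {𝒟 : Params → E.Op}

/-- The matrix of a family of connections in the frame given by the trivialisation at `p`. -/
def IsConnFam.mat (h : IsConnFam 𝒟) {p : M} (hW : W ≤ E.dom p) :
    Matrix (Fin E.rank) (Fin E.rank) (LocalForms n W) :=
  Matrix.of fun i j ↦ ofField (fun u ↦ E.connMatrix (𝒟 u) p i j)
    fun u x hx ↦ h.smooth p i j u x (hW hx)

theorem connMatrix_seg (D₀ D₁ : E.Op) (t : ℝ) (p : M) : E.connMatrix (seg D₀ D₁ t) p =
    ((1 - t : ℝ) : ℂ) • E.connMatrix D₀ p + (t : ℂ) • E.connMatrix D₁ p := by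
  ext i j x
  change CForms.toForm (conn1 (seg D₀ D₁ t) p i j x) =
    ((1 - t : ℝ) : ℂ) • CForms.toForm (conn1 D₀ p i j x) + (t : ℂ) • CForms.toForm (conn1 D₁ p i j x)
  rw [conn1_seg, map_add, map_smul, map_smul]

theorem funSmoothAt_real {g : Params → ℝ} (hg : ContDiff ℝ ∞ g) (u : Params) (x : M) :
    FunSmoothAt n (fun u _ ↦ (g u : ℂ)) u x :=
  FunSmoothAt.of_contDiff (g := fun u ↦ (g u : ℂ)) (Complex.ofRealCLM.contDiff.comp hg) u x

/-- Affine combinations of families of connections, with a smooth coefficient. -/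
theorem IsConnFam.affine {𝒟₀ 𝒟₁ : Params → E.Op} (h₀ : IsConnFam 𝒟₀) (h₁ : IsConnFam 𝒟₁)
    {g : Params → ℝ} (hg : ContDiff ℝ ∞ g) :
    IsConnFam fun u ↦ seg (𝒟₀ u) (𝒟₁ u) (g u) where
  conn u := (h₀.conn u).affine (h₁.conn u) (g u)
  smooth p i j u x hx := by
    refine LocalForms.famSmoothAt_of_family (W := E.dom p)
      (ofFun (fun u _ ↦ ((1 - g u : ℝ) : ℂ))
          (fun u x _ ↦ funSmoothAt_real (contDiff_const.sub hg) u x) * h₀.mat le_rfl i j +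
        ofFun (fun u _ ↦ (g u : ℂ)) (fun u x _ ↦ funSmoothAt_real hg u x) * h₁.mat le_rfl i j)
      (fun u x ↦ ?_) u hx
    rw [connMatrix_seg]
    exact congrArg₂ (· + ·) (Algebra.smul_def ((1 - g u : ℝ) : ℂ) (E.connMatrix (𝒟₀ u) p i j x))
      (Algebra.smul_def (g u : ℂ) (E.connMatrix (𝒟₁ u) p i j x))

theorem isOdd_of_val {ι κ : Type*} {X : Matrix ι κ (LocalForms n W)}
    (h : ∀ u (x : W) i j, ∃ a, (X i j).1 u x = CForms.toForm a) : IsOdd Params X := fun i j ↦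
  ext_iff'.2 fun u x ↦ by
    obtain ⟨a, ha⟩ := h u x i j
    change CForms.eps ((X i j).1 u x) = -(X i j).1 u x
    rw [ha, CForms.eps_toForm]

theorem IsConnFam.isOdd (h : IsConnFam 𝒟) {p : M} (hW : W ≤ E.dom p) :
    IsOdd Params (h.mat hW) := isOdd_of_val fun _ _ _ _ ↦ ⟨_, rfl⟩

theorem IsConnFam.map_eval (h : IsConnFam 𝒟) {p : M} (hW : W ≤ E.dom p) (u : Params) (x : W) :
    (h.mat hW).map (eval u x) = matrixAt (E.connMatrix (𝒟 u) p) x := rfl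

/-- The curvature in the algebra of families specialises to the curvature matrix at a point. -/
theorem IsConnFam.map_eval_curv (h : IsConnFam 𝒟) {p : M} (hW : W ≤ E.dom p) (u : Params) (x : W) :
    (curv Params (h.mat hW)).map (eval u x) = curvatureAt (E.connMatrix (𝒟 u) p) x := by
  rw [curv, curvatureAt, Matrix.map_add _ (map_add _), map_eval_mul, h.map_eval]
  congr 1
  ext i j
  exact dL_val_of_eq (h.mat hW i j) (u := u) (α := E.connMatrix (𝒟 u) p i j) (fun _ ↦ rfl) x

/-- The derivative in the parameters of the matrix of a family of connections. -/
def connVar (𝒟 : Params → E.Op) (v : Params) (p : M) (u : Params) (x : M) :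
    Matrix (Fin E.rank) (Fin E.rank) (CForms (TangentSpace (𝓡 n) x)) :=
  Matrix.of fun i j ↦ fderiv ℝ (fun u ↦ E.connMatrix (𝒟 u) p i j x) u v

theorem IsConnFam.map_eval_pdM (h : IsConnFam 𝒟) {p : M} (hW : W ≤ E.dom p) (v u : Params) (x : W) :
    (pdM v (h.mat hW)).map (eval u x) = connVar 𝒟 v p u x := rfl

/-- The Chern-Weil form `Tr F^k`. -/
def chernPow (D : E.Op) (k : ℕ) : FormField n M := fun x ↦
  (curvatureAt (E.connMatrix D x) x ^ k).trace

/-- The Chern-Simons integrand `Tr (∂_v A F^k)` of a family of connections. -/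
def transgr (𝒟 : Params → E.Op) (v : Params) (k : ℕ) (u : Params) : FormField n M := fun x ↦
  (connVar 𝒟 v x u x * curvatureAt (E.connMatrix (𝒟 u) x) x ^ k).trace

/-! #### Gauge invariance -/

variable {𝒟' : Params → E'.Op} (f : E.Iso E')

theorem Iso.funSmoothAt_gauge {p q : M} (hp : W ≤ E.dom p) (hq : W ≤ E'.dom q)
    (i : Fin E'.rank) (j : Fin E.rank) (u : Params) :
    ∀ x ∈ W, FunSmoothAt n (fun _ ↦ f.gauge p q i j) u x :=
  fun _ hx ↦ FunSmoothAt.of_contMDiffAt (f.contMDiffAt_gauge (hp hx) (hq hx) i j) u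

/-- The gauge transformation of an isomorphism, as a matrix of functions. -/
def Iso.gaugeL {p q : M} (hp : W ≤ E.dom p) (hq : W ≤ E'.dom q) :
    Matrix (Fin E'.rank) (Fin E.rank) (LocalForms n W) :=
  Matrix.of fun i j ↦ ofFun (fun _ ↦ f.gauge p q i j) (f.funSmoothAt_gauge hp hq i j)

theorem Iso.isEven_gaugeL {p q : M} (hp : W ≤ E.dom p) (hq : W ≤ E'.dom q) :
    IsEven Params (f.gaugeL hp hq) := fun i j ↦
  epsL_ofFun _ (f.funSmoothAt_gauge hp hq i j)

theorem Iso.pdM_gaugeL {p q : M} (hp : W ≤ E.dom p) (hq : W ≤ E'.dom q) (v : Params) :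
    pdM v (f.gaugeL hp hq) = 0 := by
  ext i j
  refine ext_iff'.2 fun u x ↦ ?_
  have h := pdL_ofFun v _ (f.funSmoothAt_gauge hp hq i j) u x (differentiableAt_const _)
  rw [fderiv_fun_const] at h
  exact h.trans (map_zero _)

theorem Iso.gaugeL_mul {p q : M} (hp : W ≤ E.dom p) (hq : W ≤ E'.dom q) :
    f.symm.gaugeL hq hp * f.gaugeL hp hq = 1 := by
  ext i j
  refine ext_iff'.2 fun u x ↦ ?_
  rw [← eval_apply, ← eval_apply, Matrix.mul_apply, map_sum]
  have h : ∀ k, eval u x (f.symm.gaugeL hq hp i k * f.gaugeL hp hq k j) =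
      algebraMap ℂ _ (f.symm.gauge q p i k x * f.gauge p q k j x) := fun k ↦ (map_mul _ _ _).symm
  simp only [h, ← map_sum, f.gauge_mul_gauge (hp x.2) (hq x.2), Matrix.one_apply]
  split_ifs
  · exact (map_one _).trans (map_one _).symm
  · exact (map_zero _).trans (map_zero _).symm

theorem Iso.gaugeL_mul' {p q : M} (hp : W ≤ E.dom p) (hq : W ≤ E'.dom q) :
    f.gaugeL hp hq * f.symm.gaugeL hq hp = 1 := f.symm.gaugeL_mul hq hp

theorem _root_.LocalForms.dL_ofFun {g : M → ℂ} (hg : ∀ u : Params, ∀ x ∈ W, FunSmoothAt n (fun _ ↦ g) u x)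
    (hg' : ∀ x ∈ W, ContMDiffAt (𝓡 n) 𝓘(ℝ, ℂ) ∞ g x) (u : Params) (x : W) :
    (dL (ofFun (fun _ ↦ g) hg)).1 u x = CForms.toForm (mvfderiv (𝓡 n) g x).toLinearMap :=
  (dL_val_of_eq (ofFun (fun _ ↦ g) hg) (u := u)
    (α := fun x ↦ algebraMap ℂ (CForms (TangentSpace (𝓡 n) x)) (g x)) (fun _ ↦ rfl) x).trans
    (extD_algebraMap ((hg' x x.2).mdifferentiableAt (by simp)))

/-- The gauge transformation formula `G A = A' G + dG` for families. -/
theorem Iso.gaugeL_mul_mat (h : IsConnFam 𝒟) (h' : IsConnFam 𝒟')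
    (he : ∀ u, 𝒟 u = f.pullOp (𝒟' u)) {p q : M} (hp : W ≤ E.dom p) (hq : W ≤ E'.dom q) :
    f.gaugeL hp hq * h.mat hp = h'.mat hq * f.gaugeL hp hq + dM Params (f.gaugeL hp hq) := by
  ext i k
  refine ext_iff'.2 fun u x ↦ ?_
  have h0 := congrArg CForms.toForm
    (gauge_conn1 f (h'.conn u) (hp x.2) (hq x.2) i k)
  rw [map_add, map_sum, map_sum, ← he u] at h0
  simp only [map_smul] at h0
  have h1 : (dM Params (f.gaugeL hp hq) i k).1 u x =
      CForms.toForm (mvfderiv (𝓡 n) (f.gauge p q i k) x).toLinearMap :=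
    dL_ofFun (f.funSmoothAt_gauge hp hq i k) (fun x hx ↦ f.contMDiffAt_gauge (hp hx) (hq hx) i k) u x
  rw [← eval_apply, ← eval_apply, Matrix.add_apply, map_add, Matrix.mul_apply, Matrix.mul_apply,
    map_sum, map_sum, eval_apply u x (dM Params (f.gaugeL hp hq) i k), h1, add_comm]
  have h2 : ∀ j, eval u x (f.gaugeL hp hq i j * h.mat hp j k) =
      f.gauge p q i j x • CForms.toForm (conn1 (𝒟 u) p j k x) := fun j ↦
    (Algebra.smul_def _ _).symm
  have h3 : ∀ j, eval u x (h'.mat hq i j * f.gaugeL hp hq j k) =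
      f.gauge p q j k x • CForms.toForm (conn1 (𝒟' u) q i j x) := fun j ↦
    (Algebra.commutes _ _).symm.trans (Algebra.smul_def _ _).symm
  simp only [h2, h3, h0]

theorem Iso.gaugeL_mul_curv (h : IsConnFam 𝒟) (h' : IsConnFam 𝒟')
    (he : ∀ u, 𝒟 u = f.pullOp (𝒟' u)) {p q : M} (hp : W ≤ E.dom p) (hq : W ≤ E'.dom q) :
    f.gaugeL hp hq * curv Params (h.mat hp) = curv Params (h'.mat hq) * f.gaugeL hp hq :=
  curv_intertwine (f.isEven_gaugeL hp hq) (h'.isOdd hq) (f.gaugeL_mul_mat h h' he hp hq)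

theorem _root_.FormAlgebra.dM_zero {ι κ : Type*} :
    dM Params (0 : Matrix ι κ (LocalForms n W)) = 0 :=
  Matrix.ext fun _ _ ↦ map_zero (d (P := Params) (R := LocalForms n W))

theorem Iso.gaugeL_mul_pdM (h : IsConnFam 𝒟) (h' : IsConnFam 𝒟')
    (he : ∀ u, 𝒟 u = f.pullOp (𝒟' u)) {p q : M} (hp : W ≤ E.dom p) (hq : W ≤ E'.dom q)
    (v : Params) :
    f.gaugeL hp hq * pdM v (h.mat hp) = pdM v (h'.mat hq) * f.gaugeL hp hq := by
  have h1 := congrArg (pdM v) (f.gaugeL_mul_mat h h' he hp hq)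
  rwa [pdM_mul, pdM_add, pdM_mul, pdM_dM, f.pdM_gaugeL, Matrix.zero_mul, Matrix.mul_zero,
    zero_add, add_zero, dM_zero, add_zero] at h1

/-- Traces of matrices that are intertwined by a gauge transformation agree. -/
theorem Iso.trace_gauge {p q : M} (hp : W ≤ E.dom p) (hq : W ≤ E'.dom q)
    {X : Matrix (Fin E.rank) (Fin E.rank) (LocalForms n W)}
    {X' : Matrix (Fin E'.rank) (Fin E'.rank) (LocalForms n W)}
    (h : f.gaugeL hp hq * X = X' * f.gaugeL hp hq) : X.trace = X'.trace :=
  Matrix.trace_eq_of_intertwine (f.isEven_gaugeL hp hq).central (f.gaugeL_mul hp hq)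
    (f.gaugeL_mul' hp hq) h

theorem Matrix.intertwine_mul {ι κ R : Type*} [Fintype ι] [Fintype κ] [Ring R]
    {G : Matrix κ ι R} {X Y : Matrix ι ι R} {X' Y' : Matrix κ κ R}
    (h : G * X = X' * G) (h' : G * Y = Y' * G) : G * (X * Y) = X' * Y' * G := by
  rw [← Matrix.mul_assoc, h, Matrix.mul_assoc, h', Matrix.mul_assoc]

/-- The Chern-Weil forms do not depend on the local frame. -/
theorem IsConnFam.trace_curv_pow_frame (h : IsConnFam 𝒟) {p q : M} (hp : W ≤ E.dom p)
    (hq : W ≤ E.dom q) (k : ℕ) :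
    (curv Params (h.mat hp) ^ k).trace = (curv Params (h.mat hq) ^ k).trace :=
  (Iso.refl E).trace_gauge hp hq (Matrix.intertwine_pow
    ((Iso.refl E).gaugeL_mul_curv h h (fun _ ↦ rfl) hp hq) k)

theorem Iso.trace_pdM_mul_curv_pow (h : IsConnFam 𝒟) (h' : IsConnFam 𝒟')
    (he : ∀ u, 𝒟 u = f.pullOp (𝒟' u)) {p q : M} (hp : W ≤ E.dom p) (hq : W ≤ E'.dom q)
    (v : Params) (k : ℕ) : (pdM v (h.mat hp) * curv Params (h.mat hp) ^ k).trace =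
      (pdM v (h'.mat hq) * curv Params (h'.mat hq) ^ k).trace :=
  f.trace_gauge hp hq (Matrix.intertwine_mul (f.gaugeL_mul_pdM h h' he hp hq v)
    (Matrix.intertwine_pow (f.gaugeL_mul_curv h h' he hp hq) k))

/-- The homotopy integrands do not depend on the local frame. -/
theorem IsConnFam.homotopyForm_frame (h : IsConnFam 𝒟) {p q : M} (hp : W ≤ E.dom p)
    (hq : W ≤ E.dom q) (v w : Params) (k : ℕ) :
    homotopyForm v w (h.mat hp) k = homotopyForm v w (h.mat hq) k := by
  have hc := (Iso.refl E).gaugeL_mul_curv h h (fun _ ↦ rfl) hp hq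
  have hv := fun v ↦ (Iso.refl E).gaugeL_mul_pdM h h (fun _ ↦ rfl) hp hq v
  refine Finset.sum_congr rfl fun i _ ↦ (Iso.refl E).trace_gauge hp hq ?_
  exact Matrix.intertwine_mul (Matrix.intertwine_mul (hv w) (Matrix.intertwine_pow hc i))
    (Matrix.intertwine_mul (hv v) (Matrix.intertwine_pow hc _))

theorem IsConnFam.eval_trace_curv_pow (h : IsConnFam 𝒟) {p : M} (hW : W ≤ E.dom p) (k : ℕ)
    (u : Params) (x : W) :
    eval u x (curv Params (h.mat hW) ^ k).trace =
      (curvatureAt (E.connMatrix (𝒟 u) p) x ^ k).trace := by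
  rw [eval_trace, map_eval_pow, h.map_eval_curv]

theorem IsConnFam.eval_transgr (h : IsConnFam 𝒟) {p : M} (hW : W ≤ E.dom p) (v : Params) (k : ℕ)
    (u : Params) (x : W) :
    eval u x (pdM v (h.mat hW) * curv Params (h.mat hW) ^ k).trace =
      (connVar 𝒟 v p u x * curvatureAt (E.connMatrix (𝒟 u) p) x ^ k).trace := by
  rw [eval_trace, map_eval_mul, map_eval_pow, h.map_eval_curv, h.map_eval_pdM]

/-- The Chern-Weil form, defined at each point with the frame centred there, is computed by any
local frame. -/
theorem IsConnFam.chernPow_eq (h : IsConnFam 𝒟) {p : M} (u : Params) (k : ℕ) (x : E.dom p) :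
    chernPow (𝒟 u) k x = (curv Params (h.mat (le_refl (E.dom p))) ^ k).trace.1 u x := by
  have hx : (x : M) ∈ E.dom p ⊓ E.dom x := ⟨x.2, E.mem_dom_self x⟩
  have h1 := h.eval_trace_curv_pow (p := p) inf_le_left k u (⟨x, hx⟩ : (E.dom p ⊓ E.dom x : Opens M))
  rw [h.trace_curv_pow_frame inf_le_left inf_le_right, h.eval_trace_curv_pow] at h1
  exact h1.trans (h.eval_trace_curv_pow le_rfl k u x).symm

/-- The Chern-Simons integrand is invariant under isomorphisms of bundles. -/
theorem Iso.transgr_eq (h : IsConnFam 𝒟) (h' : IsConnFam 𝒟')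
    (he : ∀ u, 𝒟 u = f.pullOp (𝒟' u)) (v : Params) (k : ℕ) (u : Params) :
    transgr 𝒟 v k u = transgr 𝒟' v k u := by
  funext x
  have hx : x ∈ E.dom x ⊓ E'.dom x := ⟨E.mem_dom_self x, E'.mem_dom_self x⟩
  have h1 := h.eval_transgr (p := x) inf_le_left v k u (⟨x, hx⟩ : (E.dom x ⊓ E'.dom x : Opens M))
  rw [f.trace_pdM_mul_curv_pow h h' he inf_le_left inf_le_right, h'.eval_transgr] at h1
  exact h1.symm

/-- The Chern-Simons integrand is computed by any local frame. -/
theorem IsConnFam.transgr_eq (h : IsConnFam 𝒟) {p : M} (v : Params) (k : ℕ) (u : Params)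
    (x : E.dom p) : transgr 𝒟 v k u x = ((pdM v (h.mat (le_refl (E.dom p))) *
      curv Params (h.mat (le_refl (E.dom p))) ^ k).trace).1 u x := by
  have hx : (x : M) ∈ E.dom p ⊓ E.dom x := ⟨x.2, E.mem_dom_self x⟩
  have h1 := h.eval_transgr (p := p) inf_le_left v k u (⟨x, hx⟩ : (E.dom p ⊓ E.dom x : Opens M))
  rw [(Iso.refl E).trace_pdM_mul_curv_pow h h (fun _ ↦ rfl) inf_le_left inf_le_right,
    h.eval_transgr] at h1
  exact h1.trans (h.eval_transgr le_rfl v k u x).symm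

end CBundle

end Families

/-! ### Chern-Weil and Chern-Simons forms of families, and Stokes' theorem -/

section Stokes

open TopologicalSpace FormAlgebra

variable {n : ℕ} {M : Type*} [TopologicalSpace M] [ChartedSpace (EuclideanSpace ℝ (Fin n)) M]
  [IsManifold (𝓡 n) ∞ M]
variable {W : Opens M} {E E' : CBundle n M}

theorem CForms.intervalIntegral_smul {T : Type*} [AddCommGroup T] [Module ℝ T]
    [FiniteDimensional ℝ T] (c : ℂ) {f : ℝ → CForms T}
    (hf : IntervalIntegrable f MeasureTheory.volume 0 1) :
    ∫ t in (0 : ℝ)..1, c • f t = c • ∫ t in (0 : ℝ)..1, f t := by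
  have h := (CForms.mulL T (algebraMap ℂ _ c)).intervalIntegral_comp_comm hf
  simp only [Algebra.smul_def]
  exact h

namespace LocalForms

theorem epsL_integ {ρ : ℝ × Params → Params} (hρ : ContDiff ℝ ∞ ρ) (a : LocalForms n W) :
    epsL (integ hρ a) = integ hρ (epsL a) :=
  ext_iff'.2 fun u x ↦ ((CForms.pullL (-LinearMap.id)).intervalIntegral_comp_comm
    ((continuous_path hρ a u x).intervalIntegrable 0 1)).symm

/-- Replacing the first parameter, for integration in that parameter. -/
def rho₁ (z : ℝ × Params) : Params := (z.1, z.2.2)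

/-- Replacing the second parameter, for integration in that parameter. -/
def rho₂ (z : ℝ × Params) : Params := (z.2.1, z.1)

theorem contDiff_rho₁ : ContDiff ℝ ∞ rho₁ := by unfold rho₁; fun_prop

theorem contDiff_rho₂ : ContDiff ℝ ∞ rho₂ := by unfold rho₂; fun_prop

theorem fderiv_rho₁ (z : ℝ × Params) : fderiv ℝ rho₁ z (0, (0, 1)) = (0, 1) := by
  have h : rho₁ = ((ContinuousLinearMap.fst ℝ ℝ Params).prod
      ((ContinuousLinearMap.snd ℝ ℝ ℝ).comp (ContinuousLinearMap.snd ℝ ℝ Params)) :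
        ℝ × Params →L[ℝ] Params) := rfl
  rw [h, ContinuousLinearMap.fderiv]; rfl

theorem hasDerivAt_rho₁ (u : Params) (σ : ℝ) : HasDerivAt (fun σ ↦ rho₁ (σ, u)) (1, 0) σ :=
  (hasDerivAt_id σ).prodMk (hasDerivAt_const σ u.2)

theorem hasDerivAt_rho₂ (u : Params) (σ : ℝ) : HasDerivAt (fun σ ↦ rho₂ (σ, u)) (0, 1) σ :=
  (hasDerivAt_const σ u.1).prodMk (hasDerivAt_id σ)

/-- Stokes' theorem on the unit square for forms which are closed up to exact forms. -/
theorem stokes_square {P₁ P₂ H : LocalForms n W} (h : pdL (1, 0) P₂ - pdL (0, 1) P₁ = -dL H)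
    (x : W) :
    (integ contDiff_rho₂ P₂).1 (1, 0) x - (integ contDiff_rho₂ P₂).1 (0, 0) x -
      (integ contDiff_rho₁ P₁).1 (0, 1) x + (integ contDiff_rho₁ P₁).1 (0, 0) x =
      -(dL (integ contDiff_rho₂ (integ contDiff_rho₁ H))).1 (0, 0) x := by
  have h1 : (integ contDiff_rho₂ (integ contDiff_rho₁ (pdL (1, 0) P₂))).1 (0, 0) x =
      (integ contDiff_rho₂ P₂).1 (1, 0) x - (integ contDiff_rho₂ P₂).1 (0, 0) x := by
    rw [integ_val, integ_val, integ_val, ← intervalIntegral.integral_sub]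
    · exact intervalIntegral.integral_congr fun σ _ ↦
        integ_pdL contDiff_rho₁ P₂ (rho₂ (σ, (0, 0))) x (hasDerivAt_rho₁ _)
    · exact (continuous_path contDiff_rho₂ P₂ (1, 0) x).intervalIntegrable _ _
    · exact (continuous_path contDiff_rho₂ P₂ (0, 0) x).intervalIntegrable _ _
  have h2 : (integ contDiff_rho₂ (integ contDiff_rho₁ (pdL (0, 1) P₁))).1 (0, 0) x =
      (integ contDiff_rho₁ P₁).1 (0, 1) x - (integ contDiff_rho₁ P₁).1 (0, 0) x := by
    rw [← pdL_integ contDiff_rho₁ P₁ fderiv_rho₁]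
    exact integ_pdL contDiff_rho₂ _ _ x (hasDerivAt_rho₂ _)
  have h3 : (integ contDiff_rho₂ (integ contDiff_rho₁ (pdL (1, 0) P₂))).1 (0, 0) x -
      (integ contDiff_rho₂ (integ contDiff_rho₁ (pdL (0, 1) P₁))).1 (0, 0) x =
      (integ contDiff_rho₂ (integ contDiff_rho₁ (pdL (1, 0) P₂ - pdL (0, 1) P₁))).1 (0, 0) x := by
    rw [integ_val, integ_val, integ_val, ← intervalIntegral.integral_sub
      ((continuous_path contDiff_rho₂ _ (0, 0) x).intervalIntegrable _ _)
      ((continuous_path contDiff_rho₂ _ (0, 0) x).intervalIntegrable _ _)]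
    refine intervalIntegral.integral_congr fun σ _ ↦ ?_
    exact (intervalIntegral.integral_sub
      ((continuous_path contDiff_rho₁ (pdL (1, 0) P₂) (rho₂ (σ, (0, 0))) x).intervalIntegrable _ _)
      ((continuous_path contDiff_rho₁ (pdL (0, 1) P₁) (rho₂ (σ, (0, 0))) x).intervalIntegrable
        _ _)).symm
  rw [dL_integ, dL_integ]
  have h4 : (integ contDiff_rho₂ (integ contDiff_rho₁ (-dL H))).1 (0, 0) x =
      -(integ contDiff_rho₂ (integ contDiff_rho₁ (dL H))).1 (0, 0) x := by
    rw [integ_val, integ_val, ← intervalIntegral.integral_neg]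
    refine intervalIntegral.integral_congr fun σ _ ↦ ?_
    exact intervalIntegral.integral_neg (f := fun s ↦ (dL H).1 (rho₁ (s, rho₂ (σ, (0, 0)))) x)
  rw [← h4, ← h, ← h3, h1, h2]
  abel

end LocalForms

namespace CBundle

open LocalForms

variable {𝒟 : Params → E.Op}

/-- The integrand of the homotopy between the Chern-Simons forms of two paths, at a point. -/
def homotopyAt (𝒟 : Params → E.Op) (v w : Params) (k : ℕ) (u : Params) : FormField n M := fun x ↦
  ∑ i ∈ Finset.range k, (connVar 𝒟 w x u x * curvatureAt (E.connMatrix (𝒟 u) x) x ^ i *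
    (connVar 𝒟 v x u x * curvatureAt (E.connMatrix (𝒟 u) x) x ^ (k - 1 - i))).trace

/-- The homotopy integrand is computed by any local frame. -/
theorem IsConnFam.homotopyAt_eq (h : IsConnFam 𝒟) {p : M} (v w : Params) (k : ℕ) (u : Params)
    (x : E.dom p) : homotopyAt 𝒟 v w k u x =
      (homotopyForm v w (h.mat (le_refl (E.dom p))) k).1 u x := by
  have hx : (x : M) ∈ E.dom p ⊓ E.dom x := ⟨x.2, E.mem_dom_self x⟩
  have h0 : ∀ {W : Opens M} {p : M} (hW : W ≤ E.dom p) (x : W),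
      eval u x (homotopyForm v w (h.mat hW) k) =
      ∑ i ∈ Finset.range k, (connVar 𝒟 w p u x * curvatureAt (E.connMatrix (𝒟 u) p) x ^ i *
        (connVar 𝒟 v p u x * curvatureAt (E.connMatrix (𝒟 u) p) x ^ (k - 1 - i))).trace := by
    intro W p hW x
    rw [homotopyForm, map_sum]
    refine Finset.sum_congr rfl fun i _ ↦ ?_
    rw [eval_trace, map_eval_mul, map_eval_mul, map_eval_mul, map_eval_pow, map_eval_pow,
      h.map_eval_curv, h.map_eval_pdM, h.map_eval_pdM]
  have h1 := h0 (p := p) inf_le_left (⟨x, hx⟩ : (E.dom p ⊓ E.dom x : Opens M))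
  rw [h.homotopyForm_frame inf_le_left inf_le_right, h0] at h1
  exact h1.trans (h0 le_rfl x).symm

/-- The integral of the Chern-Simons integrand along a path of parameters. -/
def edge (𝒟 : Params → E.Op) (v : Params) (k : ℕ) (ρ : ℝ × Params → Params) (u : Params) :
    FormField n M := fun x ↦ ∫ σ in (0 : ℝ)..1, transgr 𝒟 v k (ρ (σ, u)) x

variable {ρ : ℝ × Params → Params}

/-- A transgression form is computed by any local frame. -/
theorem IsConnFam.edge_eq (h : IsConnFam 𝒟) {p : M} (v : Params) (k : ℕ) (hρ : ContDiff ℝ ∞ ρ)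
    (u : Params) (x : E.dom p) : edge 𝒟 v k ρ u x =
      (integ hρ (pdM v (h.mat (le_refl (E.dom p))) *
        curv Params (h.mat (le_refl (E.dom p))) ^ k).trace).1 u x := by
  rw [integ_val]
  exact intervalIntegral.integral_congr fun σ _ ↦ h.transgr_eq v k (ρ (σ, u)) x

/-- A field of forms which is locally an odd smooth family is an odd form. -/
theorem mem_oddForms_of_local {α : FormField n M} (u : Params)
    (h : ∀ p : M, ∃ a : LocalForms n (E.dom p), epsL a = -a ∧ ∀ x : E.dom p, α x = a.1 u x) :
    α ∈ oddForms n M := by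
  refine ⟨isSmooth_of_local u fun p ↦ ?_, fun x ↦ ?_⟩
  · obtain ⟨a, -, ha⟩ := h p
    exact ⟨E.dom p, E.mem_dom_self p, a, ha⟩
  · obtain ⟨a, he, ha⟩ := h x
    rw [CForms.mem_odd_iff, ha ⟨x, E.mem_dom_self x⟩]
    exact ext_iff'.1 he u ⟨x, E.mem_dom_self x⟩

theorem mem_evenForms_of_local {α : FormField n M} (u : Params)
    (h : ∀ p : M, ∃ a : LocalForms n (E.dom p), epsL a = a ∧ ∀ x : E.dom p, α x = a.1 u x) :
    α ∈ evenForms n M := by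
  refine ⟨isSmooth_of_local u fun p ↦ ?_, fun x ↦ ?_⟩
  · obtain ⟨a, -, ha⟩ := h p
    exact ⟨E.dom p, E.mem_dom_self p, a, ha⟩
  · obtain ⟨a, he, ha⟩ := h x
    rw [CForms.mem_even_iff, ha ⟨x, E.mem_dom_self x⟩]
    exact ext_iff'.1 he u ⟨x, E.mem_dom_self x⟩

theorem IsConnFam.edge_mem (h : IsConnFam 𝒟) (v : Params) (k : ℕ) (hρ : ContDiff ℝ ∞ ρ)
    (u : Params) : edge 𝒟 v k ρ u ∈ oddForms n M :=
  mem_oddForms_of_local u fun p ↦ ⟨_, by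
    rw [epsL_integ]
    have h1 := (((h.isOdd (le_refl (E.dom p))).pdM v).mul_even
      ((h.isOdd (le_refl (E.dom p))).curv.pow k)).trace
    refine ext_iff'.2 fun u x ↦ ?_
    change (integ hρ (eps Params _)).1 u x = _
    rw [h1]
    exact intervalIntegral.integral_neg, h.edge_eq v k hρ u⟩

theorem IsConnOp.chernPow_mem {D : E.Op} (h : IsConnOp D) (k : ℕ) :
    chernPow D k ∈ evenForms n M :=
  mem_evenForms_of_local (0, 0) fun p ↦
    ⟨_, ((h.const.isOdd (le_refl (E.dom p))).curv.pow k).trace, h.const.chernPow_eq (0, 0) k⟩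

/-- The transgression formula: the differential of a transgression form is the difference of the
Chern-Weil forms at the end points of the path. -/
theorem IsConnFam.extD_edge (h : IsConnFam 𝒟) {v : Params} (k : ℕ) (hρ : ContDiff ℝ ∞ ρ)
    (u : Params) (hv : ∀ σ, HasDerivAt (fun σ ↦ ρ (σ, u)) v σ) :
    (k + 1 : ℂ) • (edge 𝒟 v k ρ u).extD =
      chernPow (𝒟 (ρ (1, u))) (k + 1) - chernPow (𝒟 (ρ (0, u))) (k + 1) := by
  funext x
  have hx := E.mem_dom_self x
  have h1 := dL_val_of_eq _ (h.edge_eq (p := x) v k hρ u) ⟨x, hx⟩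
  have h2 := integ_pdL hρ (curv Params (h.mat (le_refl (E.dom x))) ^ (k + 1)).trace u ⟨x, hx⟩ hv
  rw [← h.chernPow_eq, ← h.chernPow_eq] at h2
  change (k + 1 : ℂ) • (edge 𝒟 v k ρ u).extD x =
    chernPow (𝒟 (ρ (1, u))) (k + 1) x - chernPow (𝒟 (ρ (0, u))) (k + 1) x
  rw [← h2, ← h1, dL_integ]
  have h3 := pd_trace_curv_pow (h.isOdd (le_refl (E.dom x))) v k
  change pdL v _ = _ • dL _ at h3
  rw [h3]
  exact (CForms.intervalIntegral_smul _
    ((continuous_path hρ _ u ⟨x, hx⟩).intervalIntegrable _ _)).symm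

/-- Stokes' theorem for the Chern-Simons forms of a two-parameter family of connections. -/
theorem IsConnFam.stokes (h : IsConnFam 𝒟) (k : ℕ) :
    edge 𝒟 (0, 1) k rho₂ (1, 0) - edge 𝒟 (0, 1) k rho₂ (0, 0) - edge 𝒟 (1, 0) k rho₁ (0, 1) +
      edge 𝒟 (1, 0) k rho₁ (0, 0) ∈ exactOddForms n M := by
  have hη : ∀ (p : M) (x : E.dom p), (∫ t in (0 : ℝ)..1, ∫ s in (0 : ℝ)..1,
        homotopyAt 𝒟 (1, 0) (0, 1) k (s, t) (x : M)) = (integ contDiff_rho₂ (integ contDiff_rho₁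
          (homotopyForm ((1, 0) : Params) (0, 1) (h.mat (le_refl (E.dom p))) k))).1 (0, 0) x := by
    intro p x
    rw [integ_val]
    refine intervalIntegral.integral_congr fun t _ ↦ ?_
    exact intervalIntegral.integral_congr fun s _ ↦ h.homotopyAt_eq _ _ k (s, t) x
  have hmem : (fun x ↦ ∫ t in (0 : ℝ)..1, ∫ s in (0 : ℝ)..1,
      homotopyAt 𝒟 (1, 0) (0, 1) k (s, t) x : FormField n M) ∈ evenForms n M := by
    refine mem_evenForms_of_local (E := E) (0, 0) fun p ↦ ⟨_, ?_, hη p⟩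
    have hA := h.isOdd (le_refl (E.dom p))
    have he : epsL (homotopyForm ((1, 0) : Params) (0, 1) (h.mat (le_refl (E.dom p))) k) =
        homotopyForm ((1, 0) : Params) (0, 1) (h.mat (le_refl (E.dom p))) k := by
      rw [homotopyForm, map_sum]
      exact Finset.sum_congr rfl fun i _ ↦ (((hA.pdM _).mul_even (hA.curv.pow i)).mul
        ((hA.pdM _).mul_even (hA.curv.pow _))).trace
    rw [epsL_integ, epsL_integ, he]
  have hd : FormField.extD (fun x ↦ ∫ t in (0 : ℝ)..1, ∫ s in (0 : ℝ)..1,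
      homotopyAt 𝒟 (1, 0) (0, 1) k (s, t) x : FormField n M) =
      -(edge 𝒟 (0, 1) k rho₂ (1, 0) - edge 𝒟 (0, 1) k rho₂ (0, 0) - edge 𝒟 (1, 0) k rho₁ (0, 1) +
      edge 𝒟 (1, 0) k rho₁ (0, 0)) := by
    funext x
    have hx := E.mem_dom_self x
    have h1 := stokes_square (pd_trace_sub_pd_trace (h.isOdd (le_refl (E.dom x)))
      ((1, 0) : Params) (0, 1) k) ⟨x, hx⟩
    rw [← h.edge_eq, ← h.edge_eq, ← h.edge_eq, ← h.edge_eq] at h1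
    refine (dL_val_of_eq _ (hη x) ⟨x, hx⟩).symm.trans ?_
    exact neg_eq_iff_eq_neg.1 h1.symm
  exact neg_mem_iff.1 ⟨_, hmem, hd⟩

end CBundle

end Stokes

/-! ### Chern-Simons forms of pairs of connections -/

section ChernSimonsForms

open TopologicalSpace FormAlgebra LocalForms

variable {n : ℕ} {M : Type*} [TopologicalSpace M] [ChartedSpace (EuclideanSpace ℝ (Fin n)) M]
  [IsManifold (𝓡 n) ∞ M]
variable {E E' : CBundle n M}

namespace CBundle

/-- The Chern-Simons form `∫₀¹ Tr ((∇₁ - ∇₀) (∇_t²)^k) dt`. -/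
def csPow (D₀ D₁ : E.Op) (k : ℕ) : FormField n M := fun x ↦ ∫ t in (0 : ℝ)..1,
  (matrixAt (E.connMatrix D₁ x - E.connMatrix D₀ x) x *
    curvatureAt (((1 - t : ℝ) : ℂ) • E.connMatrix D₀ x + (t : ℂ) • E.connMatrix D₁ x) x ^ k).trace

variable {𝒟 : Params → E.Op} {D D₀ D₁ D₂ : E.Op}

/-- The variation of the connection matrix in the direction of a curve of parameters is the
derivative along the curve. -/
theorem IsConnFam.connVar_of_hasDerivAt (h : IsConnFam 𝒟) {γ : ℝ → Params} {v : Params} {t : ℝ}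
    (hγ : HasDerivAt γ v t) {p x : M} (hx : x ∈ E.dom p)
    {B : Matrix (Fin E.rank) (Fin E.rank) (CForms (TangentSpace (𝓡 n) x))}
    (hB : ∀ i j, HasDerivAt (fun σ ↦ E.connMatrix (𝒟 (γ σ)) p i j x) (B i j) t) :
    connVar 𝒟 v p (γ t) x = B := by
  ext i j
  have h1 : HasFDerivAt (fun u ↦ E.connMatrix (𝒟 u) p i j x) _ (γ t) :=
    ((h.mat (le_refl (E.dom p)) i j).differentiableAt_param (γ t) ⟨x, hx⟩).hasFDerivAt
  exact (HasFDerivAt.comp_hasDerivAt t h1 hγ).unique (hB i j)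

theorem hasDerivAt_connMatrix_seg (D₀ D₁ : E.Op) (p x : M) (i j : Fin E.rank) (t : ℝ) :
    HasDerivAt (fun σ ↦ E.connMatrix (seg D₀ D₁ σ) p i j x)
      (matrixAt (E.connMatrix D₁ p - E.connMatrix D₀ p) x i j) t := by
  have e : ∀ σ : ℝ, E.connMatrix (seg D₀ D₁ σ) p i j x = E.connMatrix D₀ p i j x +
      σ • (E.connMatrix D₁ p i j x - E.connMatrix D₀ p i j x) := by
    intro σ
    rw [connMatrix_seg]
    change ((1 - σ : ℝ) : ℂ) • E.connMatrix D₀ p i j x + (σ : ℂ) • E.connMatrix D₁ p i j x = _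
    rw [Complex.coe_smul, Complex.coe_smul]
    module
  simp only [e]
  simpa only [one_smul] using! ((hasDerivAt_id t).smul_const
    (E.connMatrix D₁ p i j x - E.connMatrix D₀ p i j x)).const_add (E.connMatrix D₀ p i j x)

/-- Along a path of parameters on which the family is an affine segment, the transgression form is
the Chern-Simons form of the segment. -/
theorem IsConnFam.edge_seg (h : IsConnFam 𝒟) {ρ : ℝ × Params → Params} {u v : Params}
    (hv : ∀ σ, HasDerivAt (fun σ ↦ ρ (σ, u)) v σ) (k : ℕ)
    (he : ∀ σ, 𝒟 (ρ (σ, u)) = seg D₀ D₁ σ) : edge 𝒟 v k ρ u = csPow D₀ D₁ k := by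
  funext x
  refine intervalIntegral.integral_congr fun σ _ ↦ ?_
  change Matrix.trace (_ * _) = Matrix.trace (_ * _)
  rw [← connMatrix_seg, he, h.connVar_of_hasDerivAt (hv σ) (E.mem_dom_self x)
    (B := matrixAt (E.connMatrix D₁ x - E.connMatrix D₀ x) x)]
  intro i j
  simp only [he]
  exact hasDerivAt_connMatrix_seg D₀ D₁ x x i j σ

/-- Along a path of parameters on which the family is constant, the transgression form vanishes. -/
theorem IsConnFam.edge_const (h : IsConnFam 𝒟) {ρ : ℝ × Params → Params} {u v : Params}
    (hv : ∀ σ, HasDerivAt (fun σ ↦ ρ (σ, u)) v σ) (k : ℕ)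
    (he : ∀ σ, 𝒟 (ρ (σ, u)) = D) : edge 𝒟 v k ρ u = 0 := by
  funext x
  refine (intervalIntegral.integral_congr (g := fun _ ↦ 0) fun σ _ ↦ ?_).trans
    intervalIntegral.integral_zero
  change Matrix.trace (_ * _) = _
  rw [h.connVar_of_hasDerivAt (hv σ) (E.mem_dom_self x) (B := 0), Matrix.zero_mul,
    Matrix.trace_zero]
  intro i j
  simp only [he]
  exact hasDerivAt_const _ _

theorem IsConnOp.segFam (h₀ : IsConnOp D₀) (h₁ : IsConnOp D₁) :
    IsConnFam fun u ↦ seg D₀ D₁ u.1 := h₀.const.affine h₁.const contDiff_fst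

theorem IsConnOp.csPow_eq_edge (h₀ : IsConnOp D₀) (h₁ : IsConnOp D₁) (k : ℕ) :
    csPow D₀ D₁ k = edge (fun u ↦ seg D₀ D₁ u.1) (1, 0) k rho₁ (0, 0) :=
  ((h₀.segFam h₁).edge_seg (hasDerivAt_rho₁ _) k fun _ ↦ rfl).symm

theorem IsConnOp.csPow_mem (h₀ : IsConnOp D₀) (h₁ : IsConnOp D₁) (k : ℕ) :
    csPow D₀ D₁ k ∈ oddForms n M := by
  rw [h₀.csPow_eq_edge h₁]
  exact (h₀.segFam h₁).edge_mem _ k contDiff_rho₁ _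

theorem seg_zero : seg D₀ D₁ 0 = D₀ := by
  funext σ x; simp [seg]

theorem seg_one : seg D₀ D₁ 1 = D₁ := by
  funext σ x; simp [seg]

/-- The transgression formula for the Chern-Simons forms. -/
theorem IsConnOp.extD_csPow (h₀ : IsConnOp D₀) (h₁ : IsConnOp D₁) (k : ℕ) :
    (k + 1 : ℂ) • (csPow D₀ D₁ k).extD = chernPow D₁ (k + 1) - chernPow D₀ (k + 1) := by
  rw [h₀.csPow_eq_edge h₁, (h₀.segFam h₁).extD_edge k contDiff_rho₁ _ (hasDerivAt_rho₁ _)]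
  change chernPow (seg D₀ D₁ 1) _ - chernPow (seg D₀ D₁ 0) _ = _
  rw [seg_one, seg_zero]

theorem csPow_self (D : E.Op) (k : ℕ) : csPow D D k = 0 := by
  funext x
  refine (intervalIntegral.integral_congr (g := fun _ ↦ 0) fun σ _ ↦ ?_).trans
    intervalIntegral.integral_zero
  rw [sub_self, show matrixAt (0 : Matrix (Fin E.rank) (Fin E.rank) (FormField n M)) x = 0 from rfl,
    Matrix.zero_mul, Matrix.trace_zero]

/-- The triangle identity for Chern-Simons forms modulo exact forms: Stokes' theorem on the square
`(s, t) ↦ (1 - s) D₀ + s ((1 - t) D₁ + t D₂)`, one edge of which is constant. -/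
theorem IsConnOp.csPow_triangle (h₀ : IsConnOp D₀) (h₁ : IsConnOp D₁) (h₂ : IsConnOp D₂) (k : ℕ) :
    csPow D₁ D₂ k - csPow D₀ D₂ k + csPow D₀ D₁ k ∈ exactOddForms n M := by
  -- the cone over the segment from `D₁` to `D₂` with vertex `D₀`
  have h : IsConnFam fun u ↦ seg D₀ (seg D₁ D₂ u.2) u.1 :=
    h₀.const.affine (h₁.const.affine h₂.const contDiff_snd) contDiff_fst
  have h1 := h.stokes k
  have e1 : edge _ (0, 1) k rho₂ (1, 0) = csPow D₁ D₂ k :=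
    h.edge_seg (hasDerivAt_rho₂ (1, 0)) k fun σ ↦ seg_one (D₀ := D₀) (D₁ := seg D₁ D₂ σ)
  have e2 : edge _ (0, 1) k rho₂ (0, 0) = 0 :=
    h.edge_const (hasDerivAt_rho₂ (0, 0)) k fun σ ↦ seg_zero (D₀ := D₀) (D₁ := seg D₁ D₂ σ)
  have e3 : edge _ (1, 0) k rho₁ (0, 1) = csPow D₀ D₂ k :=
    h.edge_seg (hasDerivAt_rho₁ (0, 1)) k fun σ ↦
      congrArg (fun D ↦ seg D₀ D σ) (seg_one (D₀ := D₁) (D₁ := D₂))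
  have e4 : edge _ (1, 0) k rho₁ (0, 0) = csPow D₀ D₁ k :=
    h.edge_seg (hasDerivAt_rho₁ (0, 0)) k fun σ ↦
      congrArg (fun D ↦ seg D₀ D σ) (seg_zero (D₀ := D₁) (D₁ := D₂))
  rwa [e1, e2, e3, e4, sub_zero] at h1

theorem IsConnOp.csPow_symm (h₀ : IsConnOp D₀) (h₁ : IsConnOp D₁) (k : ℕ) :
    csPow D₁ D₀ k + csPow D₀ D₁ k ∈ exactOddForms n M := by
  have h := h₀.csPow_triangle h₁ h₀ k
  rwa [csPow_self, sub_zero] at h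

theorem Iso.pullOp_seg (f : E.Iso E') (D₀ D₁ : E'.Op) (t : ℝ) :
    seg (f.pullOp D₀) (f.pullOp D₁) t = f.pullOp (seg D₀ D₁ t) := by
  funext σ x
  refine ContinuousLinearMap.ext fun v ↦ ?_
  change (1 - t) • ((f.equiv x).symm : E'.V x →L[ℂ] E.V x).restrictScalars ℝ _ +
    t • ((f.equiv x).symm : E'.V x →L[ℂ] E.V x).restrictScalars ℝ _ =
    ((f.equiv x).symm : E'.V x →L[ℂ] E.V x).restrictScalars ℝ
      ((1 - t) • D₀ (fun y ↦ f.equiv y (σ y)) x v + t • D₁ (fun y ↦ f.equiv y (σ y)) x v)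
  rw [map_add, map_smul, map_smul]
  rfl

/-- Chern-Simons forms are invariant under isomorphisms. -/
theorem Iso.csPow_pullOp (f : E.Iso E') {D₀ D₁ : E'.Op} (h₀ : IsConnOp D₀) (h₁ : IsConnOp D₁)
    (k : ℕ) : csPow (f.pullOp D₀) (f.pullOp D₁) k = csPow D₀ D₁ k := by
  have h₀' := h₀.pullOp f
  have h₁' := h₁.pullOp f
  rw [h₀.csPow_eq_edge h₁, h₀'.csPow_eq_edge h₁']
  funext x
  refine intervalIntegral.integral_congr fun σ _ ↦ ?_
  exact congrFun (f.transgr_eq (h₀'.segFam h₁') (h₀.segFam h₁)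
    (fun u ↦ f.pullOp_seg D₀ D₁ u.1) _ _ _) x

theorem Iso.chernPow_pullOp (f : E.Iso E') {D : E'.Op} (h : IsConnOp D) (k : ℕ) :
    chernPow (f.pullOp D) k = chernPow D k := by
  have h' := h.pullOp f
  funext x
  have hx : x ∈ E.dom x ⊓ E'.dom x := ⟨E.mem_dom_self x, E'.mem_dom_self x⟩
  have h1 := h'.const.eval_trace_curv_pow (p := x) inf_le_left k (0, 0)
    (⟨x, hx⟩ : (E.dom x ⊓ E'.dom x : Opens M))
  rw [f.trace_gauge inf_le_left inf_le_right (Matrix.intertwine_pow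
    (f.gaugeL_mul_curv h'.const h.const (fun _ ↦ rfl) inf_le_left inf_le_right) k),
    h.const.eval_trace_curv_pow] at h1
  exact h1.symm

/-! #### The Chern character and the total Chern-Simons form -/

theorem extD_mem_filtration (α : FormField n M) (x : M) :
    α.extD x ∈ CForms.filtration (TangentSpace (𝓡 n) x) 1 := by
  rw [FormField.extD, euclideanExtDeriv, map_sum]
  refine Submodule.sum_mem _ fun i _ ↦ ?_
  rw [map_mul]
  exact CForms.mul_mem_filtration (j := 1) (k := 0)
    (CForms.degree_le_filtration le_rfl (by
      rw [CForms.pull_ofReal]; exact CForms.ofReal_mem_degree _))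
    (by rw [CForms.filtration_zero]; trivial)

/-- The powers of the curvature vanish above the dimension, because its entries have positive
degree. -/
theorem curvatureAt_pow_eq_zero (D : E.Op) (p x : M) :
    curvatureAt (E.connMatrix D p) x ^ (n + 1) = 0 := by
  have h : ∀ i j, curvatureAt (E.connMatrix D p) x i j ∈
      CForms.filtration (TangentSpace (𝓡 n) x) 1 := by
    intro i j
    have hm : ∀ i j, matrixAt (E.connMatrix D p) x i j ∈
        CForms.filtration (TangentSpace (𝓡 n) x) 1 := fun i j ↦
      CForms.degree_le_filtration le_rfl (CForms.toForm_mem_degree _)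
    refine Submodule.add_mem _ (extD_mem_filtration _ x) ?_
    rw [Matrix.mul_apply]
    refine Submodule.sum_mem _ fun l _ ↦ ?_
    exact CForms.mul_mem_filtration (j := 1) (k := 0) (hm i l)
      (by rw [CForms.filtration_zero]; trivial)
  have h2 := CForms.pow_mem_filtration h (n + 1)
  ext i j
  have h3 := h2 i j
  rw [CForms.filtration_eq_bot (by
    rw [show Module.finrank ℝ (TangentSpace (𝓡 n) x) = n from finrank_euclideanSpace_fin]
    omega)] at h3
  simpa using h3

theorem chernPow_eq_zero (D : E.Op) : chernPow D (n + 1) = 0 := by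
  funext x
  rw [chernPow, curvatureAt_pow_eq_zero, Matrix.trace_zero]
  rfl

theorem chernPow_zero (D : E.Op) :
    chernPow D 0 = fun x ↦ algebraMap ℂ (CForms (TangentSpace (𝓡 n) x)) E.rank := by
  funext x
  simp [chernPow]

/-- The constant `-1 / 2πi`. -/
def chernConst : ℂ := -1 / (2 * Real.pi * Complex.I)

/-- The Chern character as a combination of the Chern-Weil forms. -/
theorem ch_eq (D : E.Op) : E.ch D = ∑ k ∈ Finset.range (n + 1),
    (chernConst ^ k / (k.factorial : ℂ)) • chernPow D k := by
  funext x
  simp only [ch, chernExp, Matrix.trace_sum, Matrix.trace_smul, Finset.sum_apply, Pi.smul_apply]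
  rfl

/-- The total Chern-Simons form as a combination of the forms `csPow`. -/
theorem IsConnOp.chernSimons_eq (h₀ : IsConnOp D₀) (h₁ : IsConnOp D₁) :
    E.chernSimons D₀ D₁ = ∑ k ∈ Finset.range (n + 1),
      (chernConst ^ (k + 1) / (k.factorial : ℂ)) • csPow D₀ D₁ k := by
  funext x
  have hi : ∀ k, Continuous (fun t : ℝ ↦
      (matrixAt (E.connMatrix D₁ x - E.connMatrix D₀ x) x *
      curvatureAt (((1 - t : ℝ) : ℂ) • E.connMatrix D₀ x +
        (t : ℂ) • E.connMatrix D₁ x) x ^ k).trace) := by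
    intro k
    have hf := h₀.segFam h₁
    have hc := continuous_path contDiff_rho₁ (pdM ((1, 0) : Params) (hf.mat (le_refl (E.dom x))) *
      curv Params (hf.mat (le_refl (E.dom x))) ^ k).trace (0, 0) ⟨x, E.mem_dom_self x⟩
    refine hc.congr fun t ↦ ?_
    refine (hf.transgr_eq (1, 0) k (rho₁ (t, (0, 0))) ⟨x, E.mem_dom_self x⟩).symm.trans ?_
    rw [transgr, hf.connVar_of_hasDerivAt (hasDerivAt_rho₁ (0, 0) t)
      (E.mem_dom_self x) fun i j ↦ hasDerivAt_connMatrix_seg D₀ D₁ x x i j t, ← connMatrix_seg]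
    rfl
  have e : ∀ t : ℝ, (matrixAt (E.connMatrix D₁ x - E.connMatrix D₀ x) x * chernExp n (curvatureAt
        (((1 - t : ℝ) : ℂ) • E.connMatrix D₀ x + (t : ℂ) • E.connMatrix D₁ x) x)).trace =
      ∑ k ∈ Finset.range (n + 1), (chernConst ^ k / (k.factorial : ℂ)) •
      (matrixAt (E.connMatrix D₁ x - E.connMatrix D₀ x) x *
      curvatureAt (((1 - t : ℝ) : ℂ) • E.connMatrix D₀ x +
        (t : ℂ) • E.connMatrix D₁ x) x ^ k).trace := by
    intro t
    simp only [chernExp, Finset.mul_sum, Matrix.trace_sum, Matrix.mul_smul, Matrix.trace_smul]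
    rfl
  have hi' : ∀ k ∈ Finset.range (n + 1), IntervalIntegrable (fun t : ℝ ↦
      (chernConst ^ k / (k.factorial : ℂ)) •
      (matrixAt (E.connMatrix D₁ x - E.connMatrix D₀ x) x *
      curvatureAt (((1 - t : ℝ) : ℂ) • E.connMatrix D₀ x + (t : ℂ) • E.connMatrix D₁ x) x ^ k).trace)
      MeasureTheory.volume 0 1 := by
    intro k _
    have h := (CForms.mulL _ (algebraMap ℂ (CForms (TangentSpace (𝓡 n) x))
      (chernConst ^ k / (k.factorial : ℂ)))).continuous.comp (hi k)
    refine Continuous.intervalIntegrable (h.congr fun t ↦ ?_) _ _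
    exact (Algebra.smul_def _ _).symm
  rw [chernSimons]
  simp only [e]
  rw [intervalIntegral.integral_finsetSum hi', Finset.smul_sum, Finset.sum_apply]
  refine Finset.sum_congr rfl fun k _ ↦ ?_
  rw [CForms.intervalIntegral_smul _ ((hi k).intervalIntegrable _ _), smul_smul, pow_succ', mul_div_assoc]
  rfl

end CBundle

end ChernSimonsForms

/-! ### Hermitian metrics and adjoint connections -/

section Metrics

open TopologicalSpace FormAlgebra LocalForms

theorem contDiffAt_det {X : Type*} [NormedAddCommGroup X] [NormedSpace ℝ X] {r : ℕ}
    {A : X → Matrix (Fin r) (Fin r) ℂ} {q : X}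
    (hA : ∀ i j, ContDiffAt ℝ ∞ (fun q ↦ A q i j) q) : ContDiffAt ℝ ∞ (fun q ↦ (A q).det) q := by
  simp only [Matrix.det_apply']
  exact ContDiffAt.sum fun σ _ ↦ contDiffAt_const.mul (contDiffAt_prod fun i _ ↦ hA _ _)

theorem contDiffAt_matrix_inv {X : Type*} [NormedAddCommGroup X] [NormedSpace ℝ X] {r : ℕ}
    {A : X → Matrix (Fin r) (Fin r) ℂ} {q : X}
    (hA : ∀ i j, ContDiffAt ℝ ∞ (fun q ↦ A q i j) q) (hq : (A q).det ≠ 0) (i j : Fin r) :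
    ContDiffAt ℝ ∞ (fun q ↦ (A q)⁻¹ i j) q := by
  simp only [Matrix.inv_def, Ring.inverse_eq_inv', Matrix.smul_apply, smul_eq_mul,
    Matrix.adjugate_apply]
  refine ((contDiffAt_det hA).inv hq).mul (contDiffAt_det fun k l ↦ ?_)
  by_cases h : k = j
  · subst h
    simp only [Matrix.updateRow_self]
    exact contDiffAt_const
  · simp only [Matrix.updateRow_ne h]
    exact hA k l

variable {n : ℕ} {M : Type*} [TopologicalSpace M] [ChartedSpace (EuclideanSpace ℝ (Fin n)) M]

theorem mvfderiv_complex_mul {f g : M → ℂ} {x : M} (hf : MDifferentiableAt (𝓡 n) 𝓘(ℝ, ℂ) f x)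
    (hg : MDifferentiableAt (𝓡 n) 𝓘(ℝ, ℂ) g x) (v : TangentSpace (𝓡 n) x) :
    mvfderiv (𝓡 n) (fun y ↦ f y * g y) x v =
      f x * mvfderiv (𝓡 n) g x v + g x * mvfderiv (𝓡 n) f x v :=
  DFunLike.congr_fun (hf.hasMFDerivAt.mul hg.hasMFDerivAt).mfderiv v

theorem mvfderiv_finsetSum {ι : Type*} {s : Finset ι} {f : ι → M → ℂ} {x : M}
    (h : ∀ i ∈ s, MDifferentiableAt (𝓡 n) 𝓘(ℝ, ℂ) (f i) x) :
    mvfderiv (𝓡 n) (fun y ↦ ∑ i ∈ s, f i y) x = ∑ i ∈ s, mvfderiv (𝓡 n) (f i) x := by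
  classical
  induction s using Finset.induction_on with
  | empty => simpa only [Finset.sum_empty] using mvfderiv_const (0 : ℂ)
  | insert i s hi ih =>
    simp only [Finset.sum_insert hi]
    have h2 := fun j hj ↦ h j (Finset.mem_insert_of_mem (a := j) hj)
    rw [← ih h2]
    exact mvfderiv_add (h i (Finset.mem_insert_self i s)) (mdifferentiableAt_finsetSum h2)

theorem mvfderiv_congr {f g : M → ℂ} {x : M} (h : f =ᶠ[nhds x] g) :
    mvfderiv (𝓡 n) f x = mvfderiv (𝓡 n) g x := by
  refine ContinuousLinearMap.ext fun v ↦ ?_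
  exact DFunLike.congr_fun (h.mfderiv_eq (I := 𝓡 n) (I' := 𝓘(ℝ, ℂ))) v

theorem mdifferentiableAt_conj {f : M → ℂ} {x : M} (hf : MDifferentiableAt (𝓡 n) 𝓘(ℝ, ℂ) f x) :
    MDifferentiableAt (𝓡 n) 𝓘(ℝ, ℂ) (fun y ↦ starRingEnd ℂ (f y)) x :=
  Complex.conjCLE.toContinuousLinearMap.mdifferentiableAt.comp x hf

instance (x : M) : T2Space (TangentSpace (𝓡 n) x) :=
  inferInstanceAs (T2Space (EuclideanSpace ℝ (Fin n)))

variable {E : CBundle n M}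

namespace HermitianMetric

open CBundle

variable (h : HermitianMetric E)

/-- The Gram matrix of the frame given by the trivialisation at `p`. -/
def gram (p : M) (x : M) : Matrix (Fin E.rank) (Fin E.rank) ℂ :=
  Matrix.of fun i j ↦ h.form x (E.frame p i x) (E.frame p j x)

theorem contMDiffAt_gram {p x : M} (hx : x ∈ E.dom p) (i j : Fin E.rank) :
    ContMDiffAt (𝓡 n) 𝓘(ℝ, ℂ) ∞ (fun y ↦ h.gram p y i j) x :=
  (h.smooth (E.dom p) (E.frame p i) (E.frame p j) (E.dom p).isOpen
    (fun _ hy ↦ (contMDiffAt_frame hy i).contMDiffWithinAt)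
    (fun _ hy ↦ (contMDiffAt_frame hy j).contMDiffWithinAt)).contMDiffAt
    ((E.dom p).isOpen.mem_nhds hx)

theorem form_right {p x : M} (hx : x ∈ E.dom p) (u w : E.V x) :
    h.form x u w = ∑ j, starRingEnd ℂ (E.frameCoord p j x w) * h.form x u (E.frame p j x) := by
  conv_lhs => rw [← sum_frame hx w]
  rw [map_sum]
  exact Finset.sum_congr rfl fun j _ ↦ (h.form x u).map_smulₛₗ _ _

theorem form_left {p x : M} (hx : x ∈ E.dom p) (u w : E.V x) :
    h.form x u w = ∑ i, E.frameCoord p i x u * h.form x (E.frame p i x) w := by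
  conv_lhs => rw [← sum_frame hx u]
  rw [map_sum, LinearMap.sum_apply]
  exact Finset.sum_congr rfl fun i _ ↦ by rw [map_smul]; rfl

theorem form_frame_right {p x : M} (hx : x ∈ E.dom p) (u : E.V x) (j : Fin E.rank) :
    h.form x u (E.frame p j x) = ∑ i, E.frameCoord p i x u * h.gram p x i j :=
  h.form_left hx u _

theorem eq_of_form_frame {p x : M} (hx : x ∈ E.dom p) {u w : E.V x}
    (he : ∀ j, h.form x u (E.frame p j x) = h.form x w (E.frame p j x)) : u = w := by
  by_contra hne
  have h1 := h.pos x (u - w) (sub_ne_zero.2 hne)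
  have h2 : h.form x (u - w) (u - w) = 0 := by
    rw [h.form_right hx]
    refine Finset.sum_eq_zero fun j _ ↦ ?_
    rw [map_sub (h.form x), LinearMap.sub_apply, he j, sub_self, mul_zero]
  rw [h2] at h1
  exact lt_irrefl _ h1

theorem det_gram_ne_zero {p x : M} (hx : x ∈ E.dom p) : (h.gram p x).det ≠ 0 := by
  intro h0
  obtain ⟨c, hc, hcv⟩ := Matrix.exists_vecMul_eq_zero_iff.2 h0
  refine hc (funext fun l ↦ ?_)
  have hco : ∀ i, E.frameCoord p i x (∑ l, c l • E.frame p l x) = c i := by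
    intro i
    simp only [map_sum, map_smul, frameCoord_frame hx, smul_eq_mul, mul_ite, mul_one, mul_zero,
      Finset.sum_ite_eq, Finset.mem_univ, if_true]
  have h1 : ∑ l, c l • E.frame p l x = 0 := h.eq_of_form_frame hx fun j ↦ by
    rw [h.form_frame_right hx, map_zero, LinearMap.zero_apply]
    simp only [hco]
    exact congrFun hcv j
  rw [← hco l, h1, map_zero]
  rfl

theorem gram_mul_inv {p x : M} (hx : x ∈ E.dom p) : h.gram p x * (h.gram p x)⁻¹ = 1 :=
  Matrix.mul_nonsing_inv _ (isUnit_iff_ne_zero.2 (h.det_gram_ne_zero hx))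

theorem inv_mul_gram {p x : M} (hx : x ∈ E.dom p) : (h.gram p x)⁻¹ * h.gram p x = 1 :=
  Matrix.nonsing_inv_mul _ (isUnit_iff_ne_zero.2 (h.det_gram_ne_zero hx))

theorem mdifferentiableAt_form {σ θ : ∀ x, E.V x} {x : M} (hσ : E.DiffAt σ x)
    (hθ : E.DiffAt θ x) :
    MDifferentiableAt (𝓡 n) 𝓘(ℝ, ℂ) (fun y ↦ h.form y (σ y) (θ y)) x := by
  have hx := E.mem_dom_self x
  have h1 : MDifferentiableAt (𝓡 n) 𝓘(ℝ, ℂ) (fun y ↦ ∑ j, starRingEnd ℂ (E.frameCoord x j y (θ y)) *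
      ∑ i, E.frameCoord x i y (σ y) * h.gram x y i j) x :=
    mdifferentiableAt_finsetSum fun j _ ↦ (mdifferentiableAt_conj (hθ.coord hx j)).mul
      (mdifferentiableAt_finsetSum fun i _ ↦ (hσ.coord hx i).mul
        ((h.contMDiffAt_gram hx i j).mdifferentiableAt (by simp)))
  refine h1.congr_of_eventuallyEq ?_
  filter_upwards [(E.dom x).isOpen.mem_nhds hx] with y hy
  rw [h.form_right hy]
  simp only [h.form_frame_right hy]

/-- The one-form `v ↦ v.h(σ, θ) - h(σ, D_v θ)`. -/
def adjLin (D : E.Op) (σ θ : ∀ x, E.V x) (x : M) : TangentSpace (𝓡 n) x →ₗ[ℝ] ℂ where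
  toFun v := mvfderiv (𝓡 n) (fun y ↦ h.form y (σ y) (θ y)) x v - h.form x (σ x) (D θ x v)
  map_add' v w := by rw [map_add, map_add, map_add]; ring
  map_smul' c v := by
    rw [map_smul, map_smul]
    have : h.form x (σ x) (c • D θ x v) = c • h.form x (σ x) (D θ x v) := by
      rw [← Complex.coe_smul c (D θ x v), (h.form x (σ x)).map_smulₛₗ, Complex.conj_ofReal,
        Complex.coe_smul]
    rw [this, RingHom.id_apply, smul_sub]

theorem adjLin_apply (D : E.Op) (σ θ : ∀ x, E.V x) (x : M) (v : TangentSpace (𝓡 n) x) :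
    h.adjLin D σ θ x v =
      mvfderiv (𝓡 n) (fun y ↦ h.form y (σ y) (θ y)) x v - h.form x (σ x) (D θ x v) := rfl

/-- The defining property of the adjoint transpose, for operators. -/
def IsAdjointOp (D D' : E.Op) : Prop :=
  ∀ (x : M) (σ θ : ∀ x, E.V x) (v : TangentSpace (𝓡 n) x), E.DiffAt σ x → E.DiffAt θ x →
    h.form x (D' σ x v) (θ x) = h.adjLin D σ θ x v

/-- The adjoint transpose of an operator: the solution of the defining equation for the sections of
the local frame, found with the inverse of the Gram matrix. -/
def adjOp (D : E.Op) : E.Op := fun σ x ↦ LinearMap.toContinuousLinearMap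
  (∑ i, ∑ j, (LinearMap.toSpanSingleton ℂ (E.V x) (E.frame x i x)).restrictScalars ℝ ∘ₗ
    ((h.gram x x)⁻¹ j i • h.adjLin D σ (E.frame x j) x))

/-- The coordinates of `adjOp`, by construction: the functional `adjLin` applied to the frame,
solved with the inverse Gram matrix. -/
theorem frameCoord_adjOp (D : E.Op) (σ : ∀ x, E.V x) (x : M) (v : TangentSpace (𝓡 n) x)
    (l : Fin E.rank) : E.frameCoord x l x (h.adjOp D σ x v) =
      ∑ j, (h.gram x x)⁻¹ j l * h.adjLin D σ (E.frame x j) x v := by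
  have hx := E.mem_dom_self x
  have h1 : h.adjOp D σ x v = ∑ i, ∑ j,
      ((h.gram x x)⁻¹ j i * h.adjLin D σ (E.frame x j) x v) • E.frame x i x := by
    change (∑ i, ∑ j, (LinearMap.toSpanSingleton ℂ (E.V x) (E.frame x i x)).restrictScalars ℝ ∘ₗ
      ((h.gram x x)⁻¹ j i • h.adjLin D σ (E.frame x j) x)) v = _
    simp only [LinearMap.sum_apply]
    rfl
  simp only [h1, map_sum, map_smul, frameCoord_frame hx, smul_eq_mul, mul_ite, mul_one, mul_zero,
    ← Finset.sum_smul, Finset.sum_ite_eq, Finset.mem_univ, if_true]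

theorem form_adjOp_frame (D : E.Op) (σ : ∀ x, E.V x) (x : M) (v : TangentSpace (𝓡 n) x)
    (j : Fin E.rank) : h.form x (h.adjOp D σ x v) (E.frame x j x) =
      h.adjLin D σ (E.frame x j) x v := by
  have hx := E.mem_dom_self x
  rw [h.form_frame_right hx]
  simp only [frameCoord_adjOp, Finset.sum_mul]
  rw [Finset.sum_comm]
  have h1 : ∀ k, ∑ i, (h.gram x x)⁻¹ k i * h.adjLin D σ (E.frame x k) x v * h.gram x x i j =
      ((h.gram x x)⁻¹ * h.gram x x) k j * h.adjLin D σ (E.frame x k) x v := by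
    intro k
    rw [Matrix.mul_apply, Finset.sum_mul]
    exact Finset.sum_congr rfl fun i _ ↦ by ring
  simp only [h1, h.inv_mul_gram hx, Matrix.one_apply, ite_mul, one_mul, zero_mul,
    Finset.sum_ite_eq', Finset.mem_univ, if_true]

variable [IsManifold (𝓡 n) ∞ M]

/-- The functional `adjLin` is antilinear over functions in the second section: the derivatives of
the coefficients cancel. -/
theorem adjLin_right {D : E.Op} (hD : IsConnOp D) {σ θ : ∀ x, E.V x} {p x : M} (hx : x ∈ E.dom p)
    (hσ : E.DiffAt σ x) (hθ : E.DiffAt θ x) (v : TangentSpace (𝓡 n) x) :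
    h.adjLin D σ θ x v =
      ∑ j, starRingEnd ℂ (E.frameCoord p j x (θ x)) * h.adjLin D σ (E.frame p j) x v := by
  have hf := fun j ↦ h.mdifferentiableAt_form hσ (diffAt_frame hx j)
  have hc := fun j ↦ mdifferentiableAt_conj (hθ.coord hx j)
  have e1 : mvfderiv (𝓡 n) (fun y ↦ h.form y (σ y) (θ y)) x = mvfderiv (𝓡 n) (fun y ↦
      ∑ j, starRingEnd ℂ (E.frameCoord p j y (θ y)) * h.form y (σ y) (E.frame p j y)) x := by
    refine mvfderiv_congr ?_
    filter_upwards [(E.dom p).isOpen.mem_nhds hx] with y hy using h.form_right hy _ _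
  have e2 : D θ x v = ∑ j, (E.frameCoord p j x (θ x) • D (E.frame p j) x v +
      (mvfderiv (𝓡 n) (fun y ↦ E.frameCoord p j y (θ y)) x v : ℂ) • E.frame p j x) := by
    have h1 : ∀ j, E.DiffAt (fun y ↦ E.frameCoord p j y (θ y) • E.frame p j y) x := fun j ↦
      (diffAt_frame hx j).csmul (hθ.coord hx j)
    have h2 : D θ x = D (fun y ↦ ∑ j, E.frameCoord p j y (θ y) • E.frame p j y) x := by
      refine hD.cov.congr_of_eventuallyEq hθ (DiffAt.sum fun j _ ↦ h1 j) Filter.univ_mem ?_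
      filter_upwards [(E.dom p).isOpen.mem_nhds hx] with y hy using (sum_frame hy _).symm
    rw [h2, conn_sum hD.cov fun j _ ↦ h1 j, sum_apply]
    exact Finset.sum_congr rfl fun j _ ↦
      leibniz_complex hD.cov hD.map_smul (hθ.coord hx j) (diffAt_frame hx j) v
  have e3 : ∀ j, mvfderiv (𝓡 n) (fun y ↦ starRingEnd ℂ (E.frameCoord p j y (θ y))) x v =
      starRingEnd ℂ (mvfderiv (𝓡 n) (fun y ↦ E.frameCoord p j y (θ y)) x v) := fun j ↦
    mvfderiv_clm_comp Complex.conjCLE.toContinuousLinearMap (hθ.coord hx j) v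
  rw [adjLin_apply, e1, mvfderiv_finsetSum (f := fun j y ↦ starRingEnd ℂ (E.frameCoord p j y (θ y)) *
      h.form y (σ y) (E.frame p j y)) fun j _ ↦ (hc j).mul (hf j), sum_apply, e2, map_sum,
    ← Finset.sum_sub_distrib]
  refine Finset.sum_congr rfl fun j _ ↦ ?_
  rw [mvfderiv_complex_mul (hc j) (hf j), e3, map_add, (h.form x (σ x)).map_smulₛₗ,
    (h.form x (σ x)).map_smulₛₗ, adjLin_apply, smul_eq_mul, smul_eq_mul]
  ring

theorem isAdjointOp_adjOp {D : E.Op} (hD : IsConnOp D) : h.IsAdjointOp D (h.adjOp D) := by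
  intro x σ θ v hσ hθ
  have hx := E.mem_dom_self x
  rw [h.form_right hx, h.adjLin_right hD hx hσ hθ]
  simp only [form_adjOp_frame]

theorem adjLin_add_left (D : E.Op) {σ τ θ : ∀ x, E.V x} {x : M}
    (hσ : E.DiffAt σ x) (hτ : E.DiffAt τ x) (hθ : E.DiffAt θ x) (v : TangentSpace (𝓡 n) x) :
    h.adjLin D (σ + τ) θ x v = h.adjLin D σ θ x v + h.adjLin D τ θ x v := by
  have e : (fun y ↦ h.form y ((σ + τ) y) (θ y)) =
      (fun y ↦ h.form y (σ y) (θ y)) + fun y ↦ h.form y (τ y) (θ y) := by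
    funext y; simp
  rw [adjLin_apply, e, mvfderiv_add (h.mdifferentiableAt_form hσ hθ)
    (h.mdifferentiableAt_form hτ hθ)]
  simp only [adjLin_apply, Pi.add_apply, add_apply, map_add, LinearMap.add_apply]
  ring

/-- The Leibniz rule for `adjLin` in the first section. -/
theorem adjLin_csmul_left (D : E.Op) {f : M → ℂ} {σ θ : ∀ x, E.V x} {x : M}
    (hf : MDifferentiableAt (𝓡 n) 𝓘(ℝ, ℂ) f x) (hσ : E.DiffAt σ x) (hθ : E.DiffAt θ x)
    (v : TangentSpace (𝓡 n) x) :
    h.adjLin D (fun y ↦ f y • σ y) θ x v =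
      f x * h.adjLin D σ θ x v + mvfderiv (𝓡 n) f x v * h.form x (σ x) (θ x) := by
  have e : (fun y ↦ h.form y (f y • σ y) (θ y)) = fun y ↦ f y * h.form y (σ y) (θ y) := by
    funext y; rw [map_smul]; rfl
  rw [adjLin_apply, e, mvfderiv_complex_mul hf (h.mdifferentiableAt_form hσ hθ), map_smul,
    LinearMap.smul_apply, smul_eq_mul, adjLin_apply]
  ring

/-- The matrix of the adjoint of a connection. -/
theorem IsAdjointOp.conn1_mul_gram {h : HermitianMetric E} {D D' : E.Op}
    (ha : h.IsAdjointOp D D') {p x : M} (hx : x ∈ E.dom p) (i j : Fin E.rank)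
    (v : TangentSpace (𝓡 n) x) :
    ∑ l, conn1 D' p l i x v * h.gram p x l j = mvfderiv (𝓡 n) (fun y ↦ h.gram p y i j) x v -
      ∑ l, h.gram p x i l * starRingEnd ℂ (conn1 D p l j x v) := by
  have h1 := ha x (E.frame p i) (E.frame p j) v (diffAt_frame hx i) (diffAt_frame hx j)
  rw [h.form_frame_right hx, adjLin_apply, h.form_right hx] at h1
  refine h1.trans ?_
  congr 1
  exact Finset.sum_congr rfl fun l _ ↦ mul_comm _ _

/-- The matrix of the adjoint solved for: `Bᵗ = (dH - H Ā) H⁻¹`. -/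
theorem IsAdjointOp.conn1_eq {h : HermitianMetric E} {D D' : E.Op}
    (ha : h.IsAdjointOp D D') {p x : M} (hx : x ∈ E.dom p) (l i : Fin E.rank) :
    conn1 D' p l i x = ∑ j, (h.gram p x)⁻¹ j l • ((mvfderiv (𝓡 n) (fun y ↦ h.gram p y i j)
      x).toLinearMap + -∑ k, h.gram p x i k • (Complex.conjAe.toLinearMap ∘ₗ conn1 D p k j x)) := by
  refine LinearMap.ext fun v ↦ ?_
  have h1 : ∀ j, ((h.gram p x)⁻¹ j l • ((mvfderiv (𝓡 n) (fun y ↦ h.gram p y i j)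
      x).toLinearMap + -∑ k, h.gram p x i k • (Complex.conjAe.toLinearMap ∘ₗ conn1 D p k j x))) v =
      ∑ m, conn1 D' p m i x v * (h.gram p x m j * (h.gram p x)⁻¹ j l) := by
    intro j
    have h2 := ha.conn1_mul_gram hx i j v
    simp only [← mul_assoc, ← Finset.sum_mul, h2]
    simp only [LinearMap.smul_apply, LinearMap.add_apply, LinearMap.neg_apply, LinearMap.sum_apply,
      smul_eq_mul]
    rw [mul_comm, sub_eq_add_neg]
    rfl
  rw [LinearMap.sum_apply]
  simp only [h1]
  rw [Finset.sum_comm]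
  simp only [← Finset.mul_sum, ← Matrix.mul_apply, h.gram_mul_inv hx, Matrix.one_apply, mul_ite,
    mul_one, mul_zero, Finset.sum_ite_eq', Finset.mem_univ, if_true]

theorem contMDiffAt_gram_inv {p x : M} (hx : x ∈ E.dom p) (i j : Fin E.rank) :
    ContMDiffAt (𝓡 n) 𝓘(ℝ, ℂ) ∞ (fun y ↦ (h.gram p y)⁻¹ i j) x := by
  refine contMDiffAt_iff_contDiffAt_chart.2 (contDiffAt_matrix_inv
    (A := fun y ↦ h.gram p ((extChartAt (𝓡 n) x).symm y))
    (fun k l ↦ contMDiffAt_iff_contDiffAt_chart.1 (h.contMDiffAt_gram hx k l)) ?_ i j)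
  simp only [extChartAt_to_inv]
  exact h.det_gram_ne_zero hx

/-- The adjoint transpose of a connection is a connection. -/
theorem IsAdjointOp.isConnOp {h : HermitianMetric E} {D D' : E.Op} (hD : IsConnOp D)
    (ha : h.IsAdjointOp D D') : IsConnOp D' where
  cov :=
    { add := by
        intro σ τ x hσ hτ _
        refine ContinuousLinearMap.ext fun v ↦
          h.eq_of_form_frame (E.mem_dom_self x) fun j ↦ ?_
        have hj := diffAt_frame (E.mem_dom_self x) j
        rw [ha x _ _ v (DiffAt.add hσ hτ) hj, h.adjLin_add_left D hσ hτ hj, add_apply, map_add,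
          LinearMap.add_apply, ha x _ _ v hσ hj, ha x _ _ v hτ hj]
      leibniz := by
        intro σ g x hσ hg _
        refine ContinuousLinearMap.ext fun v ↦
          h.eq_of_form_frame (E.mem_dom_self x) fun j ↦ ?_
        have hj := diffAt_frame (E.mem_dom_self x) j
        have hg' : MDifferentiableAt (𝓡 n) 𝓘(ℝ, ℂ) (fun y ↦ (g y : ℂ)) x :=
          Complex.ofRealCLM.mdifferentiableAt.comp x hg
        have hd : mvfderiv (𝓡 n) (fun y ↦ (g y : ℂ)) x v = ((mvfderiv (𝓡 n) g x v : ℝ) : ℂ) :=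
          mvfderiv_clm_comp Complex.ofRealCLM hg v
        have e : (g • σ) = fun y ↦ (g y : ℂ) • σ y := funext fun y ↦ (Complex.coe_smul _ _).symm
        rw [e, ha x _ _ v (DiffAt.csmul hg' hσ) hj, h.adjLin_csmul_left D hg' hσ hj, hd]
        have e2 : (g x • D' σ x + (mvfderiv (𝓡 n) g x).smulRight (σ x)) v =
            (g x : ℂ) • D' σ x v + ((mvfderiv (𝓡 n) g x v : ℝ) : ℂ) • σ x := by
          rw [Complex.coe_smul, Complex.coe_smul]; rfl
        rw [e2, map_add, map_smul, map_smul, LinearMap.add_apply, LinearMap.smul_apply,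
          LinearMap.smul_apply, ha x _ _ v hσ hj]
        rfl }
  map_smul c σ x v hσ := by
    refine h.eq_of_form_frame (E.mem_dom_self x) fun j ↦ ?_
    have hj := diffAt_frame (E.mem_dom_self x) j
    have hc : MDifferentiableAt (𝓡 n) 𝓘(ℝ, ℂ) (fun _ : M ↦ c) x := mdifferentiableAt_const
    rw [ha x _ _ v (DiffAt.csmul hc hσ) hj, h.adjLin_csmul_left D hc hσ hj, mvfderiv_const, map_smul,
      LinearMap.smul_apply, ha x _ _ v hσ hj]
    simp
  smooth p l i x hx := by
    have h1 : OneSmoothAt (fun x ↦ ∑ j, (h.gram p x)⁻¹ j l • ((mvfderiv (𝓡 n)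
        (fun y ↦ h.gram p y i j) x).toLinearMap +
        -∑ k, h.gram p x i k • (Complex.conjAe.toLinearMap ∘ₗ conn1 D p k j x))) x :=
      OneSmoothAt.sum fun j _ ↦ OneSmoothAt.smul (h.contMDiffAt_gram_inv hx j l)
        ((OneSmoothAt.mvfderiv (h.contMDiffAt_gram hx i j)).add
          (OneSmoothAt.sum fun k _ ↦ OneSmoothAt.smul (h.contMDiffAt_gram hx i k)
            (hD.smooth p k j x hx).conj).neg)
    refine h1.congr ?_
    filter_upwards [(E.dom p).isOpen.mem_nhds hx] with y hy using ha.conn1_eq hy l i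

end HermitianMetric

/-- Every connection has an adjoint transpose. -/
theorem exists_isAdjointConnection [IsManifold (𝓡 n) ∞ M] [T2Space M] (h : HermitianMetric E)
    (D : Connection E) : ∃ D' : Connection E, IsAdjointConnection h D D' :=
  ⟨((h.isAdjointOp_adjOp D.isConnOp).isConnOp D.isConnOp).toConnection,
    h.isAdjointOp_adjOp D.isConnOp⟩

end Metrics

/-! ### Families of hermitian metrics -/

section MetricFamilies

open TopologicalSpace FormAlgebra LocalForms CBundle

variable {n : ℕ} {M : Type*} [TopologicalSpace M] [ChartedSpace (EuclideanSpace ℝ (Fin n)) M]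
  [IsManifold (𝓡 n) ∞ M]
variable {W : Opens M} {E E' : CBundle n M}

namespace LocalForms

/-- A matrix of smooth functions, as a matrix of forms of degree zero. -/
def ofFunMat {ι κ : Type*} (F : Params → M → Matrix ι κ ℂ)
    (h : ∀ i j u, ∀ x ∈ W, FunSmoothAt n (fun u x ↦ F u x i j) u x) :
    Matrix ι κ (LocalForms n W) := Matrix.of fun i j ↦ ofFun (fun u x ↦ F u x i j) (h i j)

theorem matrix_ext {ι κ : Type*} {X Y : Matrix ι κ (LocalForms n W)}
    (h : ∀ u x, X.map (eval u x) = Y.map (eval u x)) : X = Y :=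
  Matrix.ext fun i j ↦ ext_iff'.2 fun u x ↦ congrFun (congrFun (h u x) i) j

theorem isEven_ofFunMat {ι κ : Type*} (F : Params → M → Matrix ι κ ℂ)
    (h : ∀ i j u, ∀ x ∈ W, FunSmoothAt n (fun u x ↦ F u x i j) u x) :
    IsEven Params (ofFunMat F h) := fun i j ↦ epsL_ofFun _ (h i j)

/-- The parameters are real, so their derivatives commute with conjugation. -/
theorem pdL_conjL (v : Params) (a : LocalForms n W) : pdL v (conjL a) = conjL (pdL v a) := by
  refine ext_iff'.2 fun u x ↦ ?_
  let L : CForms (TangentSpace (𝓡 n) (x : M)) →L[ℝ] CForms (TangentSpace (𝓡 n) (x : M)) :=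
    LinearMap.toContinuousLinearMap
    (Algebra.TensorProduct.map (Complex.conjAe : ℂ →ₐ[ℝ] ℂ)
      (AlgHom.id ℝ (ExteriorAlgebra ℝ (Module.Dual ℝ (TangentSpace (𝓡 n) (x : M)))))).toLinearMap
  exact CForms.fderiv_clm_apply L (LocalForms.differentiableAt_param a u x) v

/-- The exterior derivative of a family of functions. -/
theorem dL_ofFun' {f : Params → M → ℂ} (hf : ∀ u, ∀ x ∈ W, FunSmoothAt n f u x) (u : Params) (x : W)
    (hd : MDifferentiableAt (𝓡 n) 𝓘(ℝ, ℂ) (f u) x) :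
    (dL (ofFun f hf)).1 u x = CForms.toForm (mvfderiv (𝓡 n) (f u) x).toLinearMap :=
  (dL_val_of_eq (ofFun f hf) (u := u)
    (α := fun x ↦ algebraMap ℂ (CForms (TangentSpace (𝓡 n) x)) (f u x)) (fun _ ↦ rfl) x).trans
    (extD_algebraMap hd)

end LocalForms

namespace HermitianMetric

/-- A smooth two-parameter family of hermitian metrics. -/
def IsMetricFam (𝓗 : Params → HermitianMetric E) : Prop :=
  ∀ p i j u, ∀ x ∈ E.dom p, FunSmoothAt n (fun u y ↦ (𝓗 u).gram p y i j) u x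

theorem isMetricFam_const (h : HermitianMetric E) : IsMetricFam fun _ ↦ h :=
  fun _ i j u _ hx ↦ FunSmoothAt.of_contMDiffAt (h.contMDiffAt_gram hx i j) u

variable {𝓗 : Params → HermitianMetric E}

theorem IsMetricFam.inv (h : IsMetricFam 𝓗) {p x : M} (hx : x ∈ E.dom p) (i j : Fin E.rank)
    (u : Params) : FunSmoothAt n (fun u y ↦ ((𝓗 u).gram p y)⁻¹ i j) u x := by
  refine contDiffAt_matrix_inv
    (A := fun q : Params × Eucl n ↦ (𝓗 q.1).gram p ((extChartAt (𝓡 n) x).symm q.2))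
    (fun k l ↦ h p k l u x hx) ?_ i j
  simp only [extChartAt_to_inv]
  exact (𝓗 u).det_gram_ne_zero hx

/-- The Gram matrices of a family of metrics, as a matrix of functions. -/
def IsMetricFam.gramL (h : IsMetricFam 𝓗) {p : M} (hW : W ≤ E.dom p) :
    Matrix (Fin E.rank) (Fin E.rank) (LocalForms n W) :=
  ofFunMat (fun u y ↦ (𝓗 u).gram p y) fun i j u x hx ↦ h p i j u x (hW hx)

/-- The inverse Gram matrices of a family of metrics, as a matrix of functions. -/
def IsMetricFam.gramInvL (h : IsMetricFam 𝓗) {p : M} (hW : W ≤ E.dom p) :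
    Matrix (Fin E.rank) (Fin E.rank) (LocalForms n W) :=
  ofFunMat (fun u y ↦ ((𝓗 u).gram p y)⁻¹) fun i j u _ hx ↦ h.inv (hW hx) i j u

theorem IsMetricFam.gramL_mul_gramInvL (h : IsMetricFam 𝓗) {p : M} (hW : W ≤ E.dom p) :
    h.gramL hW * h.gramInvL hW = 1 := by
  refine matrix_ext fun u x ↦ ?_
  rw [map_eval_mul]
  refine (Matrix.map_mul (f := algebraMap ℂ (CForms (TangentSpace (𝓡 n) (x : M))))
    (L := (𝓗 u).gram p x) (M := ((𝓗 u).gram p x)⁻¹)).symm.trans ?_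
  rw [(𝓗 u).gram_mul_inv (hW x.2), Matrix.map_one _ (map_zero _) (map_one _),
    Matrix.map_one _ (map_zero _) (map_one _)]

theorem IsMetricFam.gramInvL_mul_gramL (h : IsMetricFam 𝓗) {p : M} (hW : W ≤ E.dom p) :
    h.gramInvL hW * h.gramL hW = 1 := by
  refine matrix_ext fun u x ↦ ?_
  rw [map_eval_mul]
  refine (Matrix.map_mul (f := algebraMap ℂ (CForms (TangentSpace (𝓡 n) (x : M))))
    (L := ((𝓗 u).gram p x)⁻¹) (M := (𝓗 u).gram p x)).symm.trans ?_
  rw [(𝓗 u).inv_mul_gram (hW x.2), Matrix.map_one _ (map_zero _) (map_one _),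
    Matrix.map_one _ (map_zero _) (map_one _)]

theorem mdifferentiableAt_gram (h : HermitianMetric E) {p x : M} (hx : x ∈ E.dom p)
    (i j : Fin E.rank) : MDifferentiableAt (𝓡 n) 𝓘(ℝ, ℂ) (fun y ↦ h.gram p y i j) x :=
  (h.contMDiffAt_gram hx i j).mdifferentiableAt (by simp)

theorem IsMetricFam.eval_dM (h : IsMetricFam 𝓗) {p : M} (hW : W ≤ E.dom p) (i j : Fin E.rank)
    (u : Params) (x : W) : (dM Params (h.gramL hW) i j).1 u x =
      CForms.toForm (mvfderiv (𝓡 n) (fun y ↦ (𝓗 u).gram p y i j) x).toLinearMap :=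
  dL_ofFun' (f := fun u y ↦ (𝓗 u).gram p y i j) (fun u x hx ↦ h p i j u x (hW hx)) u x
    ((𝓗 u).mdifferentiableAt_gram (hW x.2) i j)

variable {𝒟 𝒟' : Params → E.Op}

/-- The adjoints of a family of connections with respect to a family of metrics. -/
theorem IsMetricFam.isConnFam (h : IsMetricFam 𝓗) (h𝒟 : IsConnFam 𝒟)
    (ha : ∀ u, (𝓗 u).IsAdjointOp (𝒟 u) (𝒟' u)) : IsConnFam 𝒟' where
  conn u := (ha u).isConnOp (h𝒟.conn u)
  smooth p l i u x hx := by
    refine LocalForms.famSmoothAt_of_family (W := E.dom p)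
      (((dM Params (h.gramL (le_refl (E.dom p))) +
        -(h.gramL (le_refl (E.dom p)) * (h𝒟.mat (le_refl (E.dom p))).map conjL)) *
        h.gramInvL (le_refl (E.dom p)) : Matrix (Fin E.rank) (Fin E.rank)
          (LocalForms n (E.dom p))) i l) (fun u x ↦ ?_) u hx
    rw [connMatrix_apply, (ha u).conn1_eq x.2, map_sum, ← eval_apply, Matrix.mul_apply, map_sum]
    refine Finset.sum_congr rfl fun j _ ↦ ?_
    rw [map_smul, map_mul, map_add, map_neg, map_sum, Matrix.add_apply, map_add, Matrix.neg_apply,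
      map_neg, eval_apply u x (dM Params _ i j), h.eval_dM, Matrix.mul_apply, map_sum]
    refine (Algebra.smul_def _ _).trans ((Algebra.commutes _ _).trans ?_)
    congr 3
    refine congrArg _ (funext fun k ↦ ?_)
    rw [map_smul, ← CForms.conj_toForm, map_mul]
    exact Algebra.smul_def _ _

/-- The relation between the matrices of a connection and of its adjoint. -/
theorem IsMetricFam.transpose_mat_mul (h : IsMetricFam 𝓗) (h𝒟 : IsConnFam 𝒟) (h𝒟' : IsConnFam 𝒟')
    (ha : ∀ u, (𝓗 u).IsAdjointOp (𝒟 u) (𝒟' u)) {p : M} (hW : W ≤ E.dom p) :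
    (h𝒟'.mat hW).transpose * h.gramL hW =
      dM Params (h.gramL hW) - h.gramL hW * (h𝒟.mat hW).map conjL := by
  ext i j
  refine ext_iff'.2 fun u x ↦ ?_
  rw [← eval_apply, ← eval_apply, Matrix.sub_apply, map_sub,
    eval_apply u x (dM Params _ i j), h.eval_dM, Matrix.mul_apply, Matrix.mul_apply, map_sum, map_sum]
  have e : ∑ l, (𝓗 u).gram p x l j • conn1 (𝒟' u) p l i x =
      (mvfderiv (𝓡 n) (fun y ↦ (𝓗 u).gram p y i j) x).toLinearMap -
      ∑ l, (𝓗 u).gram p x i l • (Complex.conjAe.toLinearMap ∘ₗ conn1 (𝒟 u) p l j x) := by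
    refine LinearMap.ext fun v ↦ ?_
    have h1 := (ha u).conn1_mul_gram (hW x.2) i j v
    simp only [LinearMap.sub_apply, LinearMap.sum_apply, LinearMap.smul_apply, smul_eq_mul,
      mul_comm ((𝓗 u).gram p x _ j)]
    exact h1
  have e' := congrArg CForms.toForm e
  rw [map_sub, map_sum, map_sum] at e'
  simp only [map_smul, ← CForms.conj_toForm] at e'
  have h2 : ∀ l, eval u x ((h𝒟'.mat hW).transpose i l * h.gramL hW l j) =
      (𝓗 u).gram p x l j • CForms.toForm (conn1 (𝒟' u) p l i x) := fun l ↦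
    (Algebra.commutes _ _).symm.trans (Algebra.smul_def _ _).symm
  have h3 : ∀ l, eval u x (h.gramL hW i l * (h𝒟.mat hW).map conjL l j) =
      (𝓗 u).gram p x i l • CForms.conj (CForms.toForm (conn1 (𝒟 u) p l j x)) := fun l ↦
    (Algebra.smul_def _ _).symm
  simp only [h2, h3, e']

theorem IsMetricFam.isEven_gramL (h : IsMetricFam 𝓗) {p : M} (hW : W ≤ E.dom p) :
    IsEven Params (h.gramL hW) := isEven_ofFunMat _ _

theorem IsMetricFam.isEven_gramInvL (h : IsMetricFam 𝓗) {p : M} (hW : W ≤ E.dom p) :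
    IsEven Params (h.gramInvL hW) := isEven_ofFunMat _ _

/-! #### Conjugation of Chern-Weil and Chern-Simons forms -/

section Conj

variable (h : HermitianMetric E)

theorem pdM_gramL_const {p : M} (hW : W ≤ E.dom p) (v : Params) :
    pdM v (h.isMetricFam_const.gramL hW) = 0 := by
  ext i j
  refine ext_iff'.2 fun u x ↦ ?_
  have h1 := pdL_ofFun (W := W) v (fun _ y ↦ h.gram p y i j)
    (fun u x hx ↦ h.isMetricFam_const p i j u x (hW hx)) u x (differentiableAt_const _)
  rw [fderiv_fun_const] at h1
  exact h1.trans (map_zero _)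

variable {h}

/-- The Gram matrix is a gauge transformation from the conjugate of a connection to the connection
with matrix `-Bᵗ`, where `B` is the matrix of the adjoint. -/
theorem gramL_mul_conj (h𝒟 : IsConnFam 𝒟) (h𝒟' : IsConnFam 𝒟')
    (ha : ∀ u, h.IsAdjointOp (𝒟 u) (𝒟' u)) {p : M} (hW : W ≤ E.dom p) :
    h.isMetricFam_const.gramL hW * (h𝒟.mat hW).map conjL =
      -(h𝒟'.mat hW).transpose * h.isMetricFam_const.gramL hW +
        dM Params (h.isMetricFam_const.gramL hW) := by
  rw [Matrix.neg_mul, h.isMetricFam_const.transpose_mat_mul h𝒟 h𝒟' ha hW]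
  abel

/-- The Gram matrix intertwines the conjugate of the curvature with minus the transpose of the
curvature of the adjoint. -/
theorem gramL_mul_curv_conj (h𝒟 : IsConnFam 𝒟) (h𝒟' : IsConnFam 𝒟')
    (ha : ∀ u, h.IsAdjointOp (𝒟 u) (𝒟' u)) {p : M} (hW : W ≤ E.dom p) :
    h.isMetricFam_const.gramL hW * (curv Params (h𝒟.mat hW)).map conjL =
      -(curv Params (h𝒟'.mat hW)).transpose * h.isMetricFam_const.gramL hW := by
  have h1 := curv_intertwine (h.isMetricFam_const.isEven_gramL hW) (h𝒟'.isOdd hW).transpose.neg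
    (gramL_mul_conj h𝒟 h𝒟' ha hW)
  rw [curv_neg_transpose (h𝒟'.isOdd hW)] at h1
  exact (congrArg _ (curv_conj (P := Params) (h𝒟.mat hW)).symm).trans h1

theorem gramL_mul_pdM_conj (h𝒟 : IsConnFam 𝒟) (h𝒟' : IsConnFam 𝒟')
    (ha : ∀ u, h.IsAdjointOp (𝒟 u) (𝒟' u)) {p : M} (hW : W ≤ E.dom p) (v : Params) :
    h.isMetricFam_const.gramL hW * (pdM v (h𝒟.mat hW)).map conjL =
      -(pdM v (h𝒟'.mat hW)).transpose * h.isMetricFam_const.gramL hW := by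
  have h1 := congrArg (pdM v) (gramL_mul_conj h𝒟 h𝒟' ha hW)
  rw [pdM_mul, pdM_add, pdM_mul, pdM_dM, h.pdM_gramL_const, Matrix.zero_mul, Matrix.mul_zero,
    zero_add, add_zero, dM_zero, add_zero] at h1
  have e1 : pdM v ((h𝒟.mat hW).map conjL) = (pdM v (h𝒟.mat hW)).map conjL :=
    Matrix.ext fun i j ↦ pdL_conjL v _
  have e2 : pdM v (-(h𝒟'.mat hW).transpose) = -(pdM v (h𝒟'.mat hW)).transpose :=
    Matrix.ext fun i j ↦ map_neg (pdL v) _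
  rwa [e1, e2] at h1

theorem trace_conj {p : M} (hW : W ≤ E.dom p) {X Y : Matrix (Fin E.rank) (Fin E.rank) (LocalForms n W)}
    (hX : h.isMetricFam_const.gramL hW * X = Y * h.isMetricFam_const.gramL hW) :
    X.trace = Y.trace :=
  Matrix.trace_eq_of_intertwine (h.isMetricFam_const.isEven_gramL hW).central
    (h.isMetricFam_const.gramInvL_mul_gramL hW) (h.isMetricFam_const.gramL_mul_gramInvL hW) hX

/-- The conjugate of `Tr F^k` is `(-1)^k` times the form of the adjoint connection. -/
theorem conj_chernPow {D D' : E.Op} (hD : IsConnOp D) (hD' : IsConnOp D')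
    (ha : h.IsAdjointOp D D') (k : ℕ) :
    FormField.conj (chernPow D k) = (-1 : ℂ) ^ k • chernPow D' k := by
  funext p
  have hp := E.mem_dom_self p
  have hc := trace_conj (le_refl (E.dom p)) (Matrix.intertwine_pow
    (gramL_mul_curv_conj hD.const hD'.const (fun _ ↦ ha) (le_refl (E.dom p))) k)
  have e1 : ((curv Params (hD.const.mat (le_refl (E.dom p)))).map conjL ^ k).trace =
      conjL (curv Params (hD.const.mat (le_refl (E.dom p))) ^ k).trace := by
    rw [← RingHom.mapMatrix_apply, ← map_pow, RingHom.mapMatrix_apply]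
    simp [Matrix.trace]
  have hF := (hD'.const.isOdd (le_refl (E.dom p))).curv
  have e2 : ((-(curv Params (hD'.const.mat (le_refl (E.dom p)))).transpose) ^ k).trace =
      (-1 : ℂ) ^ k • (curv Params (hD'.const.mat (le_refl (E.dom p))) ^ k).trace := by
    rw [← neg_one_smul ℂ, smul_pow, Matrix.trace_smul, ← Matrix.transpose_pow_of_commute hF.central,
      Matrix.trace_transpose]
  rw [e1, e2] at hc
  have h1 := ext_iff'.1 hc (0, 0) ⟨p, hp⟩
  have h2 := hD.const.eval_trace_curv_pow (le_refl (E.dom p)) k (0, 0) ⟨p, hp⟩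
  have h3 := hD'.const.eval_trace_curv_pow (le_refl (E.dom p)) k (0, 0) ⟨p, hp⟩
  change CForms.conj (chernPow D k p) = (-1 : ℂ) ^ k • chernPow D' k p
  rw [chernPow, chernPow, ← h2, ← h3]
  exact h1

theorem conj_transgr (h𝒟 : IsConnFam 𝒟) (h𝒟' : IsConnFam 𝒟')
    (ha : ∀ u, h.IsAdjointOp (𝒟 u) (𝒟' u)) (v : Params) (k : ℕ) (u : Params) (p : M) :
    CForms.conj (transgr 𝒟 v k u p) = (-1 : ℂ) ^ (k + 1) • transgr 𝒟' v k u p := by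
  have hp := E.mem_dom_self p
  have hW := le_refl (E.dom p)
  have hc := trace_conj hW (Matrix.intertwine_mul (gramL_mul_pdM_conj h𝒟 h𝒟' ha hW v)
    (Matrix.intertwine_pow (gramL_mul_curv_conj h𝒟 h𝒟' ha hW) k))
  have e1 : ((pdM v (h𝒟.mat hW)).map conjL * (curv Params (h𝒟.mat hW)).map conjL ^ k).trace =
      conjL (pdM v (h𝒟.mat hW) * curv Params (h𝒟.mat hW) ^ k).trace := by
    rw [← RingHom.mapMatrix_apply conjL (curv Params (h𝒟.mat hW)), ← map_pow,
      RingHom.mapMatrix_apply, ← Matrix.map_mul]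
    exact (map_sum conjL _ _).symm
  have hF := (h𝒟'.isOdd hW).curv
  have e2 : (-(pdM v (h𝒟'.mat hW)).transpose *
      (-(curv Params (h𝒟'.mat hW)).transpose) ^ k).trace =
      (-1 : ℂ) ^ (k + 1) • (pdM v (h𝒟'.mat hW) * curv Params (h𝒟'.mat hW) ^ k).trace := by
    rw [← neg_one_smul ℂ, ← neg_one_smul ℂ (curv Params (h𝒟'.mat hW)).transpose, smul_pow,
      Matrix.smul_mul, Matrix.mul_smul, smul_smul, Matrix.trace_smul, ← pow_succ',
      ← Matrix.transpose_pow_of_commute hF.central,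
      ← Matrix.transpose_mul_of_commute (hF.pow k).central, Matrix.trace_transpose,
      (hF.pow k).trace_mul_comm]
  rw [e1, e2] at hc
  have h1 := ext_iff'.1 hc u ⟨p, hp⟩
  have h2 := h𝒟.eval_transgr hW v k u ⟨p, hp⟩
  have h3 := h𝒟'.eval_transgr hW v k u ⟨p, hp⟩
  rw [transgr, transgr, ← h2, ← h3]
  exact h1

/-- The adjoint of an affine combination is the affine combination of the adjoints. -/
theorem IsAdjointOp.seg {D₀ D₁ D₀' D₁' : E.Op} (h₀ : h.IsAdjointOp D₀ D₀')
    (h₁ : h.IsAdjointOp D₁ D₁') (t : ℝ) :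
    h.IsAdjointOp (CBundle.seg D₀ D₁ t) (CBundle.seg D₀' D₁' t) := by
  intro x σ θ v hσ hθ
  have e0 := h₀ x σ θ v hσ hθ
  have e1 := h₁ x σ θ v hσ hθ
  rw [adjLin_apply] at e0 e1 ⊢
  have hl : ∀ (c : ℝ) (u w : E.V x), h.form x (c • u) w = c * h.form x u w := fun c u w ↦ by
    rw [← Complex.coe_smul, map_smul, LinearMap.smul_apply, smul_eq_mul]
  have hr : ∀ (c : ℝ) (u w : E.V x), h.form x u (c • w) = c * h.form x u w := fun c u w ↦ by
    rw [← Complex.coe_smul, (h.form x u).map_smulₛₗ, Complex.conj_ofReal, smul_eq_mul]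
  change h.form x ((1 - t) • D₀' σ x v + t • D₁' σ x v) (θ x) =
    _ - h.form x (σ x) ((1 - t) • D₀ θ x v + t • D₁ θ x v)
  rw [map_add, LinearMap.add_apply, hl, hl, e0, e1, map_add, hr, hr]
  push_cast
  ring

/-- Conjugation of the Chern-Simons forms. The sign is opposite to the one of the constant `(-1 /
2πi)^(k+1)`. -/
theorem conj_csPow {D₀ D₁ D₀' D₁' : E.Op} (hD₀ : IsConnOp D₀) (hD₁ : IsConnOp D₁)
    (hD₀' : IsConnOp D₀') (hD₁' : IsConnOp D₁')
    (h₀ : h.IsAdjointOp D₀ D₀') (h₁ : h.IsAdjointOp D₁ D₁') (k : ℕ) :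
    FormField.conj (csPow D₀ D₁ k) = (-1 : ℂ) ^ (k + 1) • csPow D₀' D₁' k := by
  rw [hD₀.csPow_eq_edge hD₁, hD₀'.csPow_eq_edge hD₁']
  funext p
  have hf := hD₀.segFam hD₁
  have hf' := hD₀'.segFam hD₁'
  have hp := E.mem_dom_self p
  let L : CForms (TangentSpace (𝓡 n) p) →L[ℝ] CForms (TangentSpace (𝓡 n) p) :=
    LinearMap.toContinuousLinearMap
    (Algebra.TensorProduct.map (Complex.conjAe : ℂ →ₐ[ℝ] ℂ)
      (AlgHom.id ℝ (ExteriorAlgebra ℝ (Module.Dual ℝ (TangentSpace (𝓡 n) p))))).toLinearMap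
  have hi : ∀ {𝒟 : Params → E.Op} (hf : IsConnFam 𝒟), Continuous fun σ : ℝ ↦
      transgr 𝒟 (1, 0) k (rho₁ (σ, (0, 0))) p := fun hf ↦
    (continuous_path contDiff_rho₁ _ (0, 0) ⟨p, hp⟩).congr fun σ ↦
      (hf.transgr_eq (1, 0) k (rho₁ (σ, (0, 0))) ⟨p, hp⟩).symm
  have e1 := L.intervalIntegral_comp_comm ((hi hf).intervalIntegrable
    (μ := MeasureTheory.volume) 0 1)
  refine e1.symm.trans (Eq.trans ?_ (CForms.intervalIntegral_smul _
    ((hi hf').intervalIntegrable _ _)))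
  exact intervalIntegral.integral_congr fun σ _ ↦
    conj_transgr hf hf' (fun u ↦ h₀.seg h₁ u.1) (1, 0) k _ p

/-- The adjoint of the adjoint of a connection is the connection. -/
theorem IsAdjointOp.symm {D D' : E.Op} (ha : h.IsAdjointOp D D') : h.IsAdjointOp D' D := by
  intro x σ θ v hσ hθ
  have h1 := congrArg (starRingEnd ℂ) (ha x θ σ v hθ hσ)
  rw [← h.conj_symm, adjLin_apply, map_sub, ← h.conj_symm] at h1
  have h2 : mvfderiv (𝓡 n) (fun y ↦ h.form y (σ y) (θ y)) x v =
      starRingEnd ℂ (mvfderiv (𝓡 n) (fun y ↦ h.form y (θ y) (σ y)) x v) := by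
    refine Eq.trans ?_ (mvfderiv_clm_comp Complex.conjCLE.toContinuousLinearMap
      (h.mdifferentiableAt_form hθ hσ) v)
    refine DFunLike.congr_fun (mvfderiv_congr (Filter.Eventually.of_forall fun y ↦ ?_)) v
    exact h.conj_symm y _ _
  rw [adjLin_apply, h1, h2, sub_sub_cancel]

end Conj

end HermitianMetric

end MetricFamilies

/-! ### Independence of the metric -/

section MetricIndependence

open TopologicalSpace FormAlgebra LocalForms CBundle

variable {n : ℕ} {M : Type*} [TopologicalSpace M] [ChartedSpace (EuclideanSpace ℝ (Fin n)) M]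
  [IsManifold (𝓡 n) ∞ M]
variable {W : Opens M} {E E' : CBundle n M}

/-- A transgression form only depends on the family along the path of integration. -/
theorem CBundle.IsConnFam.edge_congr {𝒟 𝒟' : Params → E.Op} (h : IsConnFam 𝒟) (h' : IsConnFam 𝒟')
    {ρ : ℝ × Params → Params} {u v : Params} (hv : ∀ σ, HasDerivAt (fun σ ↦ ρ (σ, u)) v σ) (k : ℕ)
    (he : ∀ σ, 𝒟 (ρ (σ, u)) = 𝒟' (ρ (σ, u))) : edge 𝒟 v k ρ u = edge 𝒟' v k ρ u := by
  funext x
  refine intervalIntegral.integral_congr fun σ _ ↦ ?_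
  change Matrix.trace (_ * _) = Matrix.trace (_ * _)
  rw [he, h.connVar_of_hasDerivAt (hv σ) (E.mem_dom_self x)
    (B := connVar 𝒟' v x (ρ (σ, u)) x)]
  intro i j
  simp only [he]
  exact HasFDerivAt.comp_hasDerivAt (f := fun σ ↦ ρ (σ, u)) σ
    ((h'.mat (le_refl (E.dom x)) i j).differentiableAt_param (ρ (σ, u))
      ⟨x, E.mem_dom_self x⟩).hasFDerivAt (hv σ)

namespace HermitianMetric

variable {𝓗 : Params → HermitianMetric E}

/-- The matrix of functions `ξ` with `ξᵗ = (∂_v H) H⁻¹`. -/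
def IsMetricFam.xi (h : IsMetricFam 𝓗) {p : M} (hW : W ≤ E.dom p) (v : Params) :
    Matrix (Fin E.rank) (Fin E.rank) (LocalForms n W) :=
  (pdM v (h.gramL hW) * h.gramInvL hW).transpose

theorem IsMetricFam.isEven_xi (h : IsMetricFam 𝓗) {p : M} (hW : W ≤ E.dom p) (v : Params) :
    IsEven Params (h.xi hW v) :=
  (((h.isEven_gramL hW).pdM v).mul (h.isEven_gramInvL hW)).transpose

/-- The change of the Gram matrix under a change of frame: `H = Gᵗ H' Ḡ`. -/
theorem IsMetricFam.gramL_frame (h : IsMetricFam 𝓗) {p q : M} (hp : W ≤ E.dom p)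
    (hq : W ≤ E.dom q) : h.gramL hp = ((Iso.refl E).gaugeL hp hq).transpose *
      (h.gramL hq * ((Iso.refl E).gaugeL hp hq).map conjL) := by
  refine matrix_ext fun u x ↦ ?_
  set G₀ : Matrix (Fin E.rank) (Fin E.rank) ℂ :=
    Matrix.of fun i j ↦ (Iso.refl E).gauge p q i j x with hG₀
  have e : (𝓗 u).gram p x = G₀.transpose * ((𝓗 u).gram q x * G₀.map (starRingEnd ℂ)) := by
    ext i j
    refine ((𝓗 u).form_left (hq x.2) _ _).trans ?_
    rw [Matrix.mul_apply]
    refine Finset.sum_congr rfl fun k _ ↦ congrArg _ (((𝓗 u).form_right (hq x.2) _ _).trans ?_)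
    rw [Matrix.mul_apply]
    exact Finset.sum_congr rfl fun l _ ↦ mul_comm _ _
  have e1 := congrArg (fun X : Matrix (Fin E.rank) (Fin E.rank) ℂ ↦
    X.map (algebraMap ℂ (CForms (TangentSpace (𝓡 n) (x : M))))) e
  simp only [Matrix.map_mul] at e1
  rw [map_eval_mul, map_eval_mul]
  refine e1.trans (congrArg₂ _ rfl (congrArg₂ _ rfl ?_))
  exact Matrix.ext fun i j ↦ (CForms.conj_algebraMap _).symm

/-- The change of `(∂H) H⁻¹` under a change of frame which does not depend on the parameters. -/
theorem transpose_gauge_mul {R ι : Type*} [Ring R] [Fintype ι] [DecidableEq ι]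
    {Hp Hq Kp Kq dHp dHq T T' C : Matrix ι ι R} (h : Hp = T * (Hq * C)) (hd : dHp = T * (dHq * C))
    (hp : Hp * Kp = 1) (hq : Kq * Hq = 1) (hT : T' * T = 1) :
    dHp * Kp * T = T * (dHq * Kq) := by
  have h1 : C * Kp * T = Kq := by
    have e : Kq * (T' * (T * (Hq * C) * Kp)) * T = Kq * (T' * 1) * T := by rw [← h, hp]
    have e1 : Kq * (T' * (T * (Hq * C) * Kp)) * T = Kq * ((T' * T) * Hq) * (C * Kp * T) := by
      noncomm_ring
    rw [e1, hT, one_mul, hq, one_mul, mul_one] at e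
    rw [e, mul_assoc, hT, mul_one]
  rw [hd, ← h1]
  noncomm_ring

/-- The matrix `ξ` changes as an endomorphism under changes of frame. -/
theorem IsMetricFam.gaugeL_mul_xi (h : IsMetricFam 𝓗) {p q : M} (hp : W ≤ E.dom p)
    (hq : W ≤ E.dom q) (v : Params) : (Iso.refl E).gaugeL hp hq * h.xi hp v =
      h.xi hq v * (Iso.refl E).gaugeL hp hq := by
  have hG := (Iso.refl E).isEven_gaugeL hp hq
  have hG' := (Iso.refl E).isEven_gaugeL hq hp
  have h1 : pdM v ((Iso.refl E).gaugeL hp hq).transpose = 0 :=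
    congrArg Matrix.transpose ((Iso.refl E).pdM_gaugeL hp hq v)
  have h2 : pdM v (((Iso.refl E).gaugeL hp hq).map conjL) = 0 := by
    refine Matrix.ext fun i j ↦ (pdL_conjL v _).trans ?_
    have := congrFun (congrFun ((Iso.refl E).pdM_gaugeL hp hq v) i) j
    exact (congrArg conjL this).trans (map_zero conjL)
  have hd := congrArg (pdM v) (h.gramL_frame hp hq)
  rw [pdM_mul, pdM_mul, h1, h2, Matrix.zero_mul, Matrix.mul_zero, zero_add, add_zero] at hd
  have hT : ((Iso.refl E).gaugeL hq hp).transpose * ((Iso.refl E).gaugeL hp hq).transpose = 1 := by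
    rw [← Matrix.transpose_mul_of_commute hG.central]
    exact (congrArg Matrix.transpose ((Iso.refl E).gaugeL_mul' hp hq)).trans Matrix.transpose_one
  have key := transpose_gauge_mul (h.gramL_frame hp hq) hd (h.gramL_mul_gramInvL hp)
    (h.gramInvL_mul_gramL hq) hT
  have e := congrArg Matrix.transpose key
  rw [Matrix.transpose_mul_of_commute (((h.isEven_gramL hp).pdM v).mul
    (h.isEven_gramInvL hp)).central, Matrix.transpose_mul_of_commute hG.transpose.central,
    Matrix.transpose_transpose] at e
  exact e

/-- The value of the matrix `ξ` in the frame given by the trivialisation at `p`. -/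
def metricVar (𝓗 : Params → HermitianMetric E) (v : Params) (p : M) (u : Params) (x : M) :
    Matrix (Fin E.rank) (Fin E.rank) (CForms (TangentSpace (𝓡 n) x)) :=
  (Matrix.of (fun i j ↦ fderiv ℝ (fun u ↦ algebraMap ℂ (CForms (TangentSpace (𝓡 n) x))
    ((𝓗 u).gram p x i j)) u v) * ((𝓗 u).gram p x)⁻¹.map
      (algebraMap ℂ (CForms (TangentSpace (𝓡 n) x)))).transpose

theorem IsMetricFam.map_eval_xi (h : IsMetricFam 𝓗) {p : M} (hW : W ≤ E.dom p) (v u : Params)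
    (x : W) : (h.xi hW v).map (eval u x) = metricVar 𝓗 v p u x :=
  congrArg Matrix.transpose (map_eval_mul u x (pdM v (h.gramL hW)) (h.gramInvL hW))

/-- The form `Tr (ξ F^k)`, whose exterior derivative is the Chern-Simons integrand of the adjoint
connections: their variation is the covariant derivative of `ξ`. -/
def metricTransgr (𝓗 : Params → HermitianMetric E) (𝒟 : Params → E.Op) (v : Params) (k : ℕ)
    (u : Params) : FormField n M := fun x ↦
  (metricVar 𝓗 v x u x * curvatureAt (E.connMatrix (𝒟 u) x) x ^ k).trace

variable {𝒟 : Params → E.Op}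

theorem IsMetricFam.eval_trace_xi (h : IsMetricFam 𝓗) (h𝒟 : IsConnFam 𝒟) {p : M} (hW : W ≤ E.dom p)
    (v : Params) (k : ℕ) (u : Params) (x : W) :
    eval u x (h.xi hW v * curv Params (h𝒟.mat hW) ^ k).trace =
      (metricVar 𝓗 v p u x * curvatureAt (E.connMatrix (𝒟 u) p) x ^ k).trace := by
  rw [eval_trace, map_eval_mul, map_eval_pow, h𝒟.map_eval_curv, h.map_eval_xi]

theorem IsMetricFam.metricTransgr_eq (h : IsMetricFam 𝓗) (h𝒟 : IsConnFam 𝒟) {p : M} (v : Params)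
    (k : ℕ) (u : Params) (x : E.dom p) : metricTransgr 𝓗 𝒟 v k u x =
      (h.xi (le_refl (E.dom p)) v * curv Params (h𝒟.mat (le_refl (E.dom p))) ^ k).trace.1 u x := by
  have hx : (x : M) ∈ E.dom p ⊓ E.dom x := ⟨x.2, E.mem_dom_self x⟩
  have h1 := h.eval_trace_xi h𝒟 (p := p) inf_le_left v k u
    (⟨x, hx⟩ : (E.dom p ⊓ E.dom x : Opens M))
  rw [(Iso.refl E).trace_gauge inf_le_left inf_le_right (Matrix.intertwine_mul
    (h.gaugeL_mul_xi inf_le_left inf_le_right v) (Matrix.intertwine_pow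
    ((Iso.refl E).gaugeL_mul_curv h𝒟 h𝒟 (fun _ ↦ rfl) inf_le_left inf_le_right) k)),
    h.eval_trace_xi h𝒟] at h1
  exact h1.trans (h.eval_trace_xi h𝒟 le_rfl v k u x).symm

/-- The transgression form of a family of adjoints of a fixed connection is exact. -/
theorem IsMetricFam.edge_mem_exact (h : IsMetricFam 𝓗) {D : E.Op} (hD : IsConnOp D)
    (h𝒟 : IsConnFam 𝒟) (ha : ∀ u, (𝓗 u).IsAdjointOp D (𝒟 u)) (v : Params) (k : ℕ)
    {ρ : ℝ × Params → Params} (hρ : ContDiff ℝ ∞ ρ) (u : Params) :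
    edge 𝒟 v k ρ u ∈ exactOddForms n M := by
  have hη : ∀ (p : M) (x : E.dom p),
      (∫ t in (0 : ℝ)..1, metricTransgr 𝓗 𝒟 v k (ρ (t, u)) (x : M)) =
        (integ hρ (h.xi (le_refl (E.dom p)) v *
          curv Params (h𝒟.mat (le_refl (E.dom p))) ^ k).trace).1 u x := fun p x ↦
    intervalIntegral.integral_congr fun t _ ↦ h.metricTransgr_eq h𝒟 v k _ x
  refine ⟨fun x ↦ ∫ t in (0 : ℝ)..1, metricTransgr 𝓗 𝒟 v k (ρ (t, u)) x,
    mem_evenForms_of_local (E := E) u fun p ↦ ⟨_, ?_, hη p⟩, ?_⟩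
  · have he := ((h.isEven_xi (le_refl (E.dom p)) v).mul
      ((h𝒟.isOdd (le_refl (E.dom p))).curv.pow k)).trace
    rw [epsL_integ]
    exact congrArg (integ hρ) he
  · funext x
    have hx := E.mem_dom_self x
    refine (dL_val_of_eq _ (hη x) ⟨x, hx⟩).symm.trans ?_
    rw [h𝒟.edge_eq (p := x) v k hρ u ⟨x, hx⟩, dL_integ]
    have hA := h𝒟.isOdd (le_refl (E.dom x))
    have h1 := d_trace_even_mul_curv_pow hA (h.isEven_xi (le_refl (E.dom x)) v) k
    -- the connection `D` does not depend on the parameters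
    have hC : pdM v ((hD.const.mat (le_refl (E.dom x))).map conjL) = 0 := by
      refine Matrix.ext fun i j ↦ (pdL_conjL v _).trans ?_
      refine (congrArg conjL (ext_iff'.2 fun u y ↦ ?_)).trans (map_zero conjL)
      have h0 : fderiv ℝ (fun _ : Params ↦ E.connMatrix D x i j (y : M)) u v = 0 := by
        rw [fderiv_fun_const]; rfl
      exact h0
    have h2 := pdM_adjoint v (h.gramL_mul_gramInvL (le_refl (E.dom x)))
      (h.gramInvL_mul_gramL (le_refl (E.dom x))) (ξ := h.xi (le_refl (E.dom x)) v)
      (Matrix.transpose_transpose _) hC (h.isEven_xi _ v)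
      (h.transpose_mat_mul hD.const h𝒟 ha (le_refl (E.dom x)))
    rw [← h2] at h1
    exact ext_iff'.1 (congrArg (integ hρ) h1) u ⟨x, hx⟩

/-! #### Convex combinations of metrics -/

/-- The metric `(1 - s) h₁ + s h₂`. -/
def mix (h₁ h₂ : HermitianMetric E) (s : ℝ) (hs : 0 ≤ s) (hs' : s ≤ 1) : HermitianMetric E where
  form x := ((1 - s : ℝ) : ℂ) • h₁.form x + (s : ℂ) • h₂.form x
  conj_symm x u v := by
    simp only [LinearMap.add_apply, LinearMap.smul_apply, smul_eq_mul, map_add, map_mul,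
      Complex.conj_ofReal, ← h₁.conj_symm, ← h₂.conj_symm]
  pos x u hu := by
    simp only [LinearMap.add_apply, LinearMap.smul_apply, smul_eq_mul, Complex.add_re,
      Complex.re_ofReal_mul]
    have h1 := h₁.pos x u hu
    have h2 := h₂.pos x u hu
    rcases hs.eq_or_lt with rfl | hs
    · simpa using h1
    · exact add_pos_of_nonneg_of_pos (mul_nonneg (sub_nonneg.2 hs') h1.le) (mul_pos hs h2)
  smooth U σ τ hU hσ hτ :=
    ((ContinuousLinearMap.mul ℝ ℂ ((1 - s : ℝ) : ℂ)).contMDiff.comp_contMDiffOn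
      (h₁.smooth U σ τ hU hσ hτ)).add
    ((ContinuousLinearMap.mul ℝ ℂ (s : ℂ)).contMDiff.comp_contMDiffOn
      (h₂.smooth U σ τ hU hσ hτ))

theorem ext_form {h₁ h₂ : HermitianMetric E} (h : h₁.form = h₂.form) : h₁ = h₂ := by
  cases h₁; cases h₂; cases h; rfl

theorem mix_zero (h₁ h₂ : HermitianMetric E) (hs : (0 : ℝ) ≤ 0) (hs' : (0 : ℝ) ≤ 1) :
    h₁.mix h₂ 0 hs hs' = h₁ := ext_form (by funext x; simp [mix])

theorem mix_one (h₁ h₂ : HermitianMetric E) (hs : (0 : ℝ) ≤ 1) (hs' : (1 : ℝ) ≤ 1) :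
    h₁.mix h₂ 1 hs hs' = h₂ := ext_form (by funext x; simp [mix])

/-- The smooth path of metrics from `h₁` to `h₂`, as a family. The smooth transition function keeps
the coefficients in `[0, 1]`, so that the family is defined for all real parameters. -/
def path (h₁ h₂ : HermitianMetric E) (u : Params) : HermitianMetric E :=
  h₁.mix h₂ (Real.smoothTransition u.2) (Real.smoothTransition.nonneg _)
    (Real.smoothTransition.le_one _)

theorem isMetricFam_path (h₁ h₂ : HermitianMetric E) : IsMetricFam (h₁.path h₂) := by
  intro p i j u x hx
  have hτ : ContDiff ℝ ∞ fun u : Params ↦ Real.smoothTransition u.2 :=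
    Real.smoothTransition.contDiff.comp contDiff_snd
  exact ((funSmoothAt_real (contDiff_const.sub hτ) u x).mul (h₁.isMetricFam_const p i j u x hx)).add
    ((funSmoothAt_real hτ u x).mul (h₂.isMetricFam_const p i j u x hx))

/-- The class of the Chern-Simons form of a connection and its adjoint does not depend on the
metric. -/
theorem csPow_sub_mem_exact {D D₁ D₂ : E.Op} {h₁ h₂ : HermitianMetric E} (hD : IsConnOp D)
    (ha₁ : h₁.IsAdjointOp D D₁) (ha₂ : h₂.IsAdjointOp D D₂) (k : ℕ) :
    csPow D D₁ k - csPow D D₂ k ∈ exactOddForms n M := by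
  classical
  -- the adjoints along the path of metrics; at the end points they are the given ones, which agree
  -- with `adjOp` only on differentiable sections
  let ℬ : Params → E.Op := fun u ↦ if u.2 = 0 then D₁ else if u.2 = 1 then D₂ else
    (h₁.path h₂ u).adjOp D
  have ha : ∀ u, (h₁.path h₂ u).IsAdjointOp D (ℬ u) := by
    intro u
    by_cases h0 : u.2 = 0
    · have e : h₁.path h₂ u = h₁ := by
        simp only [path, h0, Real.smoothTransition.zero, mix_zero]
      simpa only [ℬ, h0, if_true, e] using ha₁
    · by_cases h1 : u.2 = 1
      · have e : h₁.path h₂ u = h₂ := by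
          simp only [path, h1, Real.smoothTransition.one, mix_one]
        simpa only [ℬ, h1, one_ne_zero, if_false, if_true, e] using ha₂
      · simpa only [ℬ, h0, h1, if_false] using (h₁.path h₂ u).isAdjointOp_adjOp hD
  have h𝓗 := h₁.isMetricFam_path h₂
  have hB : IsConnFam ℬ := h𝓗.isConnFam hD.const ha
  have hS : IsConnFam fun u ↦ CBundle.seg D (ℬ u) u.1 := hD.const.affine hB contDiff_fst
  -- the edges of the square of connections `(s, t) ↦ (1 - s) D + s ℬ_t`
  have e1 : edge (fun u ↦ CBundle.seg D (ℬ u) u.1) (0, 1) k rho₂ (1, 0) =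
      edge ℬ (0, 1) k rho₂ (1, 0) :=
    hS.edge_congr hB (hasDerivAt_rho₂ _) k fun σ ↦ seg_one
  have e2 : edge (fun u ↦ CBundle.seg D (ℬ u) u.1) (0, 1) k rho₂ (0, 0) = 0 :=
    hS.edge_const (hasDerivAt_rho₂ (0, 0)) k fun σ ↦ seg_zero
  have e3 : edge (fun u ↦ CBundle.seg D (ℬ u) u.1) (1, 0) k rho₁ (0, 1) = csPow D D₂ k :=
    hS.edge_seg (hasDerivAt_rho₁ (0, 1)) k fun σ ↦ by simp [ℬ, rho₁]
  have e4 : edge (fun u ↦ CBundle.seg D (ℬ u) u.1) (1, 0) k rho₁ (0, 0) = csPow D D₁ k :=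
    hS.edge_seg (hasDerivAt_rho₁ (0, 0)) k fun σ ↦ by simp [ℬ, rho₁]
  have h1 := hS.stokes k
  rw [e1, e2, e3, e4] at h1
  have h2 := sub_mem h1 (h𝓗.edge_mem_exact hD hB ha (0, 1) k contDiff_rho₂ (1, 0))
  convert h2 using 1
  abel

end HermitianMetric

end MetricIndependence

/-! ### Existence and pullback of metrics -/

section MetricExistence

open TopologicalSpace CBundle

variable {n : ℕ} {M : Type*} [TopologicalSpace M] [ChartedSpace (EuclideanSpace ℝ (Fin n)) M]
variable {E E' : CBundle n M}

namespace HermitianMetric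

/-- The pullback of a metric by an isomorphism. -/
def pull (h : HermitianMetric E') (f : E.Iso E') : HermitianMetric E where
  form x := LinearMap.mk₂'ₛₗ (RingHom.id ℂ) (starRingEnd ℂ)
    (fun u w ↦ h.form x (f.equiv x u) (f.equiv x w))
    (fun u u' w ↦ by rw [map_add, map_add, LinearMap.add_apply])
    (fun c u w ↦ by rw [map_smul, map_smul]; rfl)
    (fun u w w' ↦ by rw [map_add, map_add])
    (fun c u w ↦ by rw [map_smul, (h.form x _).map_smulₛₗ])
  conj_symm x u w := h.conj_symm x _ _
  pos x u hu := h.pos x _ fun h0 ↦ hu ((f.equiv x).map_eq_zero_iff.1 h0)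
  smooth U σ τ hU hσ hτ := h.smooth U _ _ hU
    (fun x hx ↦ (f.contMDiffAt ((hσ x hx).contMDiffAt (hU.mem_nhds hx))).contMDiffWithinAt)
    (fun x hx ↦ (f.contMDiffAt ((hτ x hx).contMDiffAt (hU.mem_nhds hx))).contMDiffWithinAt)

theorem pull_form (h : HermitianMetric E') (f : E.Iso E') (x : M) (u w : E.V x) :
    (h.pull f).form x u w = h.form x (f.equiv x u) (f.equiv x w) := rfl

theorem IsAdjointOp.pull [IsManifold (𝓡 n) ∞ M] {h : HermitianMetric E'} {D D' : E'.Op} (ha : h.IsAdjointOp D D')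
    (f : E.Iso E') : (h.pull f).IsAdjointOp (f.pullOp D) (f.pullOp D') := by
  intro x σ θ v hσ hθ
  have h1 := ha x _ _ v (f.diffAt hσ) (f.diffAt hθ)
  rw [adjLin_apply, pull_form, pull_form]
  have e : ∀ (D : E'.Op) (σ : ∀ x, E.V x), f.equiv x (f.pullOp D σ x v) =
      D (fun y ↦ f.equiv y (σ y)) x v := fun D σ ↦ (f.equiv x).apply_symm_apply _
  rw [e, e]
  exact h1

/-- The hermitian form for which the frame given by the trivialisation at `p` is orthonormal. -/
def frameForm (E : CBundle n M) (p x : M) : E.V x →ₗ[ℂ] E.V x →ₗ⋆[ℂ] ℂ :=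
  ∑ i, (E.frameCoord p i x).smulRight
    (((starRingEnd ℂ).toSemilinearMap).comp (E.frameCoord p i x) : E.V x →ₗ⋆[ℂ] ℂ)

theorem frameForm_apply (p x : M) (u w : E.V x) : frameForm E p x u w =
    ∑ i, E.frameCoord p i x u * starRingEnd ℂ (E.frameCoord p i x w) := by
  rw [frameForm, LinearMap.sum_apply, LinearMap.sum_apply]
  rfl

/-- Every bundle has a hermitian metric: local metrics are glued with a partition of unity. -/
theorem nonempty [T2Space M] [SigmaCompactSpace M] [IsManifold (𝓡 n) ∞ M] (E : CBundle n M) :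
    Nonempty (HermitianMetric E) := by
  obtain ⟨ρ, hρ⟩ := SmoothPartitionOfUnity.exists_isSubordinate (𝓡 n) (isClosed_univ (X := M))
    (fun p ↦ (E.dom p : Set M)) (fun p ↦ (E.dom p).isOpen)
    fun x _ ↦ Set.mem_iUnion.2 ⟨x, E.mem_dom_self x⟩
  have hform : ∀ x (u w : E.V x), (∑ p ∈ ρ.finsupport x, ((ρ p x : ℝ) : ℂ) • frameForm E p x) u w =
      ∑ p ∈ ρ.finsupport x, ((ρ p x : ℝ) : ℂ) * frameForm E p x u w := by
    intro x u w
    rw [LinearMap.sum_apply, LinearMap.sum_apply]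
    rfl
  refine ⟨⟨fun x ↦ ∑ p ∈ ρ.finsupport x, ((ρ p x : ℝ) : ℂ) • frameForm E p x, ?_, ?_, ?_⟩⟩
  · intro x u w
    simp only [hform, map_sum, map_mul, Complex.conj_ofReal, frameForm_apply, Complex.conj_conj]
    refine Finset.sum_congr rfl fun p _ ↦ congrArg _ (Finset.sum_congr rfl fun i _ ↦ mul_comm _ _)
  · intro x u hu
    have hre : ∀ p, (frameForm E p x u u).re = ∑ i, Complex.normSq (E.frameCoord p i x u) := by
      intro p
      rw [frameForm_apply, Complex.re_sum]
      exact Finset.sum_congr rfl fun i _ ↦ by rw [Complex.mul_conj, Complex.ofReal_re]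
    rw [hform, Complex.re_sum]
    simp only [Complex.re_ofReal_mul, hre]
    obtain ⟨p, hp⟩ := ρ.exists_pos_of_mem (Set.mem_univ x)
    have hx : x ∈ E.dom p := hρ p (subset_closure hp.ne')
    refine Finset.sum_pos' (fun q _ ↦ mul_nonneg (ρ.nonneg q x)
      (Finset.sum_nonneg fun i _ ↦ Complex.normSq_nonneg _)) ⟨p, ?_, mul_pos hp ?_⟩
    · rw [ρ.mem_finsupport]; exact hp.ne'
    · by_contra h0
      refine hu (frame_ext hx fun i ↦ ?_)
      have h1 := le_antisymm (not_lt.1 h0) (Finset.sum_nonneg fun i _ ↦ Complex.normSq_nonneg _)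
      have h2 := (Finset.sum_eq_zero_iff_of_nonneg fun i _ ↦ Complex.normSq_nonneg _).1 h1 i
        (Finset.mem_univ i)
      rw [map_zero]
      exact Complex.normSq_eq_zero.1 h2
  · intro U σ τ hU hσ hτ x hx
    have hσ' := (hσ x hx).contMDiffAt (hU.mem_nhds hx)
    have hτ' := (hτ x hx).contMDiffAt (hU.mem_nhds hx)
    have e : (fun y ↦ (∑ p ∈ ρ.finsupport y, ((ρ p y : ℝ) : ℂ) • frameForm E p y) (σ y) (τ y)) =
        fun y ↦ ∑ᶠ p, ρ p y • frameForm E p y (σ y) (τ y) := by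
      funext y
      rw [hform, ← ρ.sum_finsupport_smul_eq_finsum y (fun p y ↦ frameForm E p y (σ y) (τ y))]
      exact Finset.sum_congr rfl fun p _ ↦ (Complex.real_smul).symm
    rw [e]
    refine (ρ.contMDiffAt_finsum (n := ⊤) fun p hp ↦ ?_).contMDiffWithinAt
    have hxp : x ∈ E.dom p := hρ p hp
    simp only [frameForm_apply]
    refine ContMDiffAt.sum fun i _ ↦ ?_
    exact ContMDiffAt.complex_mul ((contMDiffAt_iff_coord hxp).1 hσ' i)
      (Complex.conjCLE.contDiff.contMDiff.contMDiffAt.comp x ((contMDiffAt_iff_coord hxp).1 hτ' i))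

end HermitianMetric

end MetricExistence

/-! ### Flat connections -/

section Flat

open TopologicalSpace FormAlgebra LocalForms CBundle

/-- The value `k!² / (2k+1)!` of the Beta integral. -/
theorem integral_pow_mul_one_sub_pow (k : ℕ) :
    ∫ t in (0 : ℝ)..1, ((t : ℂ) ^ k * (1 - t : ℂ) ^ k) =
      (k.factorial : ℂ) ^ 2 / ((2 * k + 1).factorial : ℂ) := by
  have hk : 0 < ((k : ℂ) + 1).re := by
    rw [Complex.add_re, Complex.natCast_re, Complex.one_re]; positivity
  have h := Complex.Gamma_mul_Gamma_eq_betaIntegral hk hk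
  have e : (k : ℂ) + 1 + (k + 1) = ((2 * k + 1 : ℕ) : ℂ) + 1 := by push_cast; ring
  rw [e, Complex.Gamma_nat_eq_factorial, Complex.Gamma_nat_eq_factorial] at h
  -- the Gamma function at natural numbers gives the Beta integral
  have hb : Complex.betaIntegral (k + 1) (k + 1) =
      ∫ t in (0 : ℝ)..1, ((t : ℂ) ^ k * (1 - t : ℂ) ^ k) := by
    unfold Complex.betaIntegral
    simp only [add_sub_cancel_right, Complex.cpow_natCast]
  rw [← hb, eq_div_iff (Nat.cast_ne_zero.2 (Nat.factorial_ne_zero _)), sq, h, mul_comm]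

namespace FormAlgebra

variable {P R : Type*} [Ring R] [Algebra ℂ R] [FormAlgebra P R]
variable {ι : Type*} [Fintype ι] [DecidableEq ι]

theorem dM_smul (c : ℂ) (X : Matrix ι ι R) : dM P (c • X) = c • dM P X :=
  Matrix.ext fun _ _ ↦ map_smul (d P) c _

/-- The curvature of an affine combination of two connections. -/
theorem curv_affine (s t : ℂ) (hst : s + t = 1) (A B : Matrix ι ι R) :
    curv P (s • A + t • B) = s • curv P A + t • curv P B - (s * t) • (A - B) ^ 2 := by
  obtain rfl : s = 1 - t := eq_sub_of_add_eq hst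
  simp only [curv, dM_add, dM_smul, sq, smul_add, Matrix.add_mul, Matrix.mul_add, Matrix.sub_mul,
    Matrix.mul_sub, Matrix.smul_mul, Matrix.mul_smul, smul_smul]
  module

end FormAlgebra

variable {n : ℕ} {M : Type*} [TopologicalSpace M] [ChartedSpace (EuclideanSpace ℝ (Fin n)) M]
  [IsManifold (𝓡 n) ∞ M]
variable {E : CBundle n M} {D D' D₀ D₁ : E.Op}

namespace CBundle

/-- The trace of an odd power of the difference of two connections. -/
def tracePow (D₀ D₁ : E.Op) (j : ℕ) : FormField n M := fun x ↦
  (matrixAt (E.connMatrix D₁ x - E.connMatrix D₀ x) x ^ (2 * j + 1)).trace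

theorem bismutLott_eq (D D' : E.Op) (j : ℕ) : E.bismutLott D D' j =
    (((2 * Real.pi * Complex.I) ^ j * 2 ^ (2 * j + 1))⁻¹ : ℂ) • tracePow D D' j := rfl

theorem tracePow_mem_degree (D₀ D₁ : E.Op) (j : ℕ) (x : M) :
    tracePow D₀ D₁ j x ∈ CForms.degree (TangentSpace (𝓡 n) x) (2 * j + 1) := by
  refine Submodule.sum_mem (p := CForms.degree (TangentSpace (𝓡 n) x) (2 * j + 1))
    (f := fun i ↦ (matrixAt (E.connMatrix D₁ x - E.connMatrix D₀ x) x ^ (2 * j + 1)) i i)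
    (t := Finset.univ) fun i _ ↦ CForms.pow_mem_degree (fun i j ↦ ?_) _ i i
  exact Submodule.sub_mem _ (CForms.toForm_mem_degree (conn1 D₁ x i j x))
    (CForms.toForm_mem_degree (conn1 D₀ x i j x))

theorem tracePow_symm (D₀ D₁ : E.Op) (j : ℕ) : tracePow D₁ D₀ j = -tracePow D₀ D₁ j := by
  funext x
  have e : matrixAt (E.connMatrix D₀ x - E.connMatrix D₁ x) x =
      -matrixAt (E.connMatrix D₁ x - E.connMatrix D₀ x) x :=
    Matrix.ext fun i j ↦ (neg_sub (E.connMatrix D₁ x i j x) (E.connMatrix D₀ x i j x)).symm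
  change Matrix.trace (_ ^ _) = -Matrix.trace (_ ^ _)
  rw [e, Odd.neg_pow ⟨j, rfl⟩, Matrix.trace_neg]

/-- The curvature of the segment between two flat connections. -/
theorem curvatureAt_seg (h₀ : IsConnOp D₀) (h₁ : IsConnOp D₁) (hF₀ : E.IsFlat D₀)
    (hF₁ : E.IsFlat D₁) (t : ℝ) (x : M) :
    curvatureAt (((1 - t : ℝ) : ℂ) • E.connMatrix D₀ x + (t : ℂ) • E.connMatrix D₁ x) x =
      (-(t * (1 - t)) : ℂ) • matrixAt (E.connMatrix D₁ x - E.connMatrix D₀ x) x ^ 2 := by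
  have hW := le_refl (E.dom x)
  have hx := E.mem_dom_self x
  have e1 : ((h₀.affine h₁ t).const.mat hW) =
      ((1 - t : ℝ) : ℂ) • h₀.const.mat hW + (t : ℂ) • h₁.const.mat hW :=
    matrix_ext fun u y ↦ (congrArg (fun A ↦ matrixAt A (y : M)) (connMatrix_seg D₀ D₁ t x))
  have e2 := curv_affine (P := Params) ((1 - t : ℝ) : ℂ) (t : ℂ) (by push_cast; ring)
    (h₀.const.mat hW) (h₁.const.mat hW)
  rw [← e1] at e2
  have e3 := congrArg (fun X ↦ (eval (0, 0) ⟨x, hx⟩).mapMatrix X) e2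
  simp only [map_sub, map_add, map_smul, map_pow] at e3
  rw [← connMatrix_seg]
  have hz : ∀ {D : E.Op} (h : IsConnOp D), E.IsFlat D →
      (eval (0, 0) ⟨x, hx⟩).mapMatrix (curv Params (h.const.mat hW)) = 0 := fun h hF ↦
    (h.const.map_eval_curv hW (0, 0) ⟨x, hx⟩).trans (hF x)
  rw [hz h₀ hF₀, hz h₁ hF₁, smul_zero, smul_zero, add_zero, zero_sub, ← neg_smul] at e3
  refine ((h₀.affine h₁ t).const.map_eval_curv hW (0, 0) ⟨x, hx⟩).symm.trans (e3.trans ?_)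
  have e4 : matrixAt (E.connMatrix D₀ x) x - matrixAt (E.connMatrix D₁ x) x =
      -matrixAt (E.connMatrix D₁ x - E.connMatrix D₀ x) x :=
    Matrix.ext fun i j ↦ (neg_sub (E.connMatrix D₁ x i j x) (E.connMatrix D₀ x i j x)).symm
  rw [← neg_sq (matrixAt (E.connMatrix D₁ x - E.connMatrix D₀ x) x), ← e4]
  refine congrArg₂ _ ?_ rfl
  push_cast; ring

/-- The Chern-Simons forms of two flat connections. -/
theorem csPow_flat (h₀ : IsConnOp D₀) (h₁ : IsConnOp D₁) (hF₀ : E.IsFlat D₀)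
    (hF₁ : E.IsFlat D₁) (k : ℕ) : csPow D₀ D₁ k =
      ((-1) ^ k * ((k.factorial : ℂ) ^ 2 / ((2 * k + 1).factorial : ℂ))) • tracePow D₀ D₁ k := by
  funext x
  have e : ∀ t : ℝ, (matrixAt (E.connMatrix D₁ x - E.connMatrix D₀ x) x *
      curvatureAt (((1 - t : ℝ) : ℂ) • E.connMatrix D₀ x +
        (t : ℂ) • E.connMatrix D₁ x) x ^ k).trace =
      ((t : ℂ) ^ k * (1 - t : ℂ) ^ k) • ((-1 : ℂ) ^ k • tracePow D₀ D₁ k x) := by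
    intro t
    rw [curvatureAt_seg h₀ h₁ hF₀ hF₁, smul_pow, Matrix.mul_smul, Matrix.trace_smul, ← pow_mul,
      ← pow_succ', smul_smul]
    congr 1
    rw [← mul_pow, ← mul_pow]
    congr 1
    ring
  refine (intervalIntegral.integral_congr fun t _ ↦ e t).trans ?_
  rw [Pi.smul_apply, mul_comm, ← smul_smul, ← integral_pow_mul_one_sub_pow]
  generalize (-1 : ℂ) ^ k • tracePow D₀ D₁ k x = z
  let L : ℂ →L[ℝ] CForms (TangentSpace (𝓡 n) x) := LinearMap.toContinuousLinearMap
    ((LinearMap.toSpanSingleton ℂ (CForms (TangentSpace (𝓡 n) x)) z).restrictScalars ℝ)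
  have hc : Continuous fun t : ℝ ↦ ((t : ℂ) ^ k * (1 - t : ℂ) ^ k) := by fun_prop
  exact L.intervalIntegral_comp_comm (hc.intervalIntegrable (μ := MeasureTheory.volume) 0 1)

theorem chernPow_flat (hF : E.IsFlat D) (k : ℕ) : chernPow D (k + 1) = 0 := by
  funext x
  rw [chernPow, hF x, pow_succ, Matrix.mul_zero, Matrix.trace_zero]
  rfl

/-- The adjoint of a flat connection is flat. -/
theorem _root_.HermitianMetric.IsAdjointOp.isFlat {h : HermitianMetric E} (hD : IsConnOp D)
    (ha : h.IsAdjointOp D D') (hF : E.IsFlat D) : E.IsFlat D' := by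
  intro x
  have hW := le_refl (E.dom x)
  have hx := E.mem_dom_self x
  have hD' := ha.isConnOp hD
  have h1 := HermitianMetric.gramL_mul_curv_conj hD.const hD'.const (fun _ ↦ ha) hW
  have h2 := congrArg (· * h.isMetricFam_const.gramInvL hW) h1
  simp only [Matrix.mul_assoc, h.isMetricFam_const.gramL_mul_gramInvL hW, Matrix.mul_one] at h2
  have h3 := congrArg (fun X ↦ X.map (eval (0, 0) ⟨x, hx⟩)) h2
  rw [map_eval_mul, map_eval_mul] at h3
  have h4 : ((curv Params (hD.const.mat hW)).map conjL).map (eval (0, 0) ⟨x, hx⟩) = 0 := by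
    have h5 := hD.const.map_eval_curv hW (0, 0) ⟨x, hx⟩
    ext i j
    have h6 := congrFun (congrFun (h5.trans (hF x)) i) j
    exact (congrArg CForms.conj h6).trans (map_zero CForms.conj)
  rw [h4, Matrix.zero_mul, Matrix.mul_zero] at h3
  have h5 := hD'.const.map_eval_curv hW (0, 0) ⟨x, hx⟩
  ext i j
  have h6 := congrFun (congrFun h3 j) i
  have h7 := congrFun (congrFun h5 i) j
  rw [← h7]
  exact (neg_eq_zero.1 h6.symm)

end CBundle

end Flat

/-! ### Direct sums -/

namespace FormAlgebra

variable {P R : Type*} [Ring R] [Algebra ℂ R] [FormAlgebra P R]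
variable {ι κ : Type*} [Fintype ι] [Fintype κ]

theorem dM_map_algebraMap (C : Matrix κ ι ℂ) : dM P (C.map (algebraMap ℂ R)) = 0 := by
  have h1 : d P (1 : R) = 0 := by
    have h := d_mul (P := P) (1 : R) 1
    rw [map_one (eps P), mul_one, mul_one, one_mul] at h
    exact left_eq_add.1 h
  ext i j
  change d P (algebraMap ℂ R (C i j)) = 0
  rw [Algebra.algebraMap_eq_smul_one, map_smul, h1, smul_zero]

theorem pdM_map_algebraMap (v : P) (C : Matrix κ ι ℂ) :
    pdM v (C.map (algebraMap ℂ R)) = 0 := by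
  ext i j
  change pd v (algebraMap ℂ R (C i j)) = 0
  rw [Algebra.algebraMap_eq_smul_one, map_smul, pd_one, smul_zero]

theorem isEven_map_algebraMap (C : Matrix κ ι ℂ) : IsEven P (C.map (algebraMap ℂ R)) :=
  fun _ _ ↦ AlgHom.commutes (eps P) _

variable [DecidableEq ι] [DecidableEq κ]

theorem pdM_fromBlocks (v : P) (A : Matrix ι ι R) (B : Matrix κ κ R) :
    pdM v (Matrix.fromBlocks A 0 0 B) = Matrix.fromBlocks (pdM v A) 0 0 (pdM v B) := by
  rw [pdM, Matrix.fromBlocks_map]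
  congr 1 <;> exact Matrix.ext fun _ _ ↦ map_zero (pd v)

theorem curv_fromBlocks (A : Matrix ι ι R) (B : Matrix κ κ R) :
    curv P (Matrix.fromBlocks A 0 0 B) = Matrix.fromBlocks (curv P A) 0 0 (curv P B) := by
  have h : dM P (Matrix.fromBlocks A 0 0 B) = Matrix.fromBlocks (dM P A) 0 0 (dM P B) := by
    rw [dM, Matrix.fromBlocks_map]
    congr 1 <;> exact Matrix.ext fun _ _ ↦ map_zero (d P)
  rw [curv, h, Matrix.fromBlocks_multiply, Matrix.fromBlocks_add]
  simp [curv]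

end FormAlgebra

section DirectSums

open TopologicalSpace FormAlgebra LocalForms

variable {n : ℕ} {M : Type*} [TopologicalSpace M] [ChartedSpace (EuclideanSpace ℝ (Fin n)) M]
  [IsManifold (𝓡 n) ∞ M]
variable {W : Opens M} {E E' : CBundle n M}

namespace CBundle

/-- The direct sum of two operators. -/
def sumOp (D : E.Op) (D' : E'.Op) : (E.sum E').Op := fun σ x ↦
  (D (fun y ↦ (σ y).1) x).prod (D' (fun y ↦ (σ y).2) x)

theorem seg_sumOp (D₀ D₁ : E.Op) (D₀' D₁' : E'.Op) (t : ℝ) :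
    seg (sumOp D₀ D₀') (sumOp D₁ D₁') t = sumOp (seg D₀ D₁ t) (seg D₀' D₁' t) := by
  funext σ x
  exact ContinuousLinearMap.ext fun v ↦ rfl

theorem dom_sum_le_left (p : M) : (E.sum E').dom p ≤ E.dom p := fun _ hx ↦ hx.1

theorem dom_sum_le_right (p : M) : (E.sum E').dom p ≤ E'.dom p := fun _ hx ↦ hx.2

/-- The constant change of basis from the frame of `E ⊕ E'` to the union of the frames of `E`
and `E'`. -/
def sumFrame (E E' : CBundle n M) : Matrix (Fin E.rank ⊕ Fin E'.rank) (Fin (E.sum E').rank) ℂ :=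
  ((Module.finBasis ℂ E.F).prod (Module.finBasis ℂ E'.F)).toMatrix
    (Module.finBasis ℂ (E.F × E'.F))

/-- The inverse of `sumFrame`. -/
def sumFrameInv (E E' : CBundle n M) : Matrix (Fin (E.sum E').rank) (Fin E.rank ⊕ Fin E'.rank) ℂ :=
  (Module.finBasis ℂ (E.F × E'.F)).toMatrix
    ((Module.finBasis ℂ E.F).prod (Module.finBasis ℂ E'.F))

theorem sumFrame_mul_inv : sumFrame E E' * sumFrameInv E E' = 1 :=
  Module.Basis.toMatrix_mul_toMatrix_flip _ _

theorem sumFrameInv_mul : sumFrameInv E E' * sumFrame E E' = 1 :=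
  Module.Basis.toMatrix_mul_toMatrix_flip _ _

theorem sum_sumFrame_inl {p x : M} (hx : x ∈ (E.sum E').dom p) (i : Fin E.rank)
    (u : (E.sum E').V x) :
    ∑ k, sumFrame E E' (Sum.inl i) k * (E.sum E').frameCoord p k x u = E.frameCoord p i x u.1 := by
  simp only [frameCoord_apply hx, frameCoord_apply (dom_sum_le_left p hx)]
  exact congrFun (Module.Basis.toMatrix_mulVec_repr
    (Module.finBasis ℂ (E.F × E'.F))
    ((Module.finBasis ℂ E.F).prod (Module.finBasis ℂ E'.F)) _) (Sum.inl i)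

theorem sum_sumFrame_inr {p x : M} (hx : x ∈ (E.sum E').dom p) (i : Fin E'.rank)
    (u : (E.sum E').V x) :
    ∑ k, sumFrame E E' (Sum.inr i) k * (E.sum E').frameCoord p k x u = E'.frameCoord p i x u.2 := by
  simp only [frameCoord_apply hx, frameCoord_apply (dom_sum_le_right p hx)]
  exact congrFun (Module.Basis.toMatrix_mulVec_repr
    (Module.finBasis ℂ (E.F × E'.F))
    ((Module.finBasis ℂ E.F).prod (Module.finBasis ℂ E'.F)) _) (Sum.inr i)

theorem frameCoord_fst_frame {p x : M} (hx : x ∈ (E.sum E').dom p) (i : Fin E.rank)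
    (j : Fin (E.sum E').rank) :
    E.frameCoord p i x ((E.sum E').frame p j x).1 = sumFrame E E' (Sum.inl i) j := by
  rw [← sum_sumFrame_inl hx]
  simp only [frameCoord_frame hx, mul_ite, mul_one, mul_zero, Finset.sum_ite_eq', Finset.mem_univ,
    if_true]

theorem frameCoord_snd_frame {p x : M} (hx : x ∈ (E.sum E').dom p) (i : Fin E'.rank)
    (j : Fin (E.sum E').rank) :
    E'.frameCoord p i x ((E.sum E').frame p j x).2 = sumFrame E E' (Sum.inr i) j := by
  rw [← sum_sumFrame_inr hx]
  simp only [frameCoord_frame hx, mul_ite, mul_one, mul_zero, Finset.sum_ite_eq', Finset.mem_univ,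
    if_true]

/-- A connection applied to a section with constant coordinates near a point. -/
theorem frameCoord_conn_of_const {D : E.Op} (hD : IsConnOp D) {σ : ∀ x, E.V x} {p x : M}
    {U : Opens M} (hx : x ∈ U) (hU : U ≤ E.dom p) (hσ : E.DiffAt σ x) {c : Fin E.rank → ℂ}
    (hc : ∀ y ∈ U, ∀ i, E.frameCoord p i y (σ y) = c i) (i : Fin E.rank)
    (v : TangentSpace (𝓡 n) x) :
    E.frameCoord p i x (D σ x v) = ∑ j, conn1 D p i j x v * c j := by
  rw [frameCoord_conn hD.cov hD.map_smul (hU hx) hσ]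
  have h : mvfderiv (𝓡 n) (fun y ↦ E.frameCoord p i y (σ y)) x = 0 := by
    rw [mvfderiv_congr (g := fun _ ↦ c i)]
    · exact mvfderiv_const _
    · filter_upwards [U.isOpen.mem_nhds hx] with y hy using hc y hy i
  rw [h]
  simp only [hc x hx, mul_comm]
  exact zero_add _

theorem sumFrame_conn1_inl {D : E.Op} (hD : IsConnOp D) (D' : E'.Op) {p x : M}
    (hx : x ∈ (E.sum E').dom p) (i : Fin E.rank) (j : Fin (E.sum E').rank) :
    ∑ k, sumFrame E E' (Sum.inl i) k • conn1 (sumOp D D') p k j x =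
      ∑ k, sumFrame E E' (Sum.inl k) j • conn1 D p i k x := by
  refine LinearMap.ext fun v ↦ ?_
  simp only [LinearMap.sum_apply, LinearMap.smul_apply, smul_eq_mul]
  refine (sum_sumFrame_inl hx i (sumOp D D' ((E.sum E').frame p j) x v)).trans ?_
  refine (frameCoord_conn_of_const hD hx (dom_sum_le_left p)
    (DiffAt.fst (diffAt_frame hx j)) (fun y hy i ↦ frameCoord_fst_frame hy i j) i v).trans ?_
  exact Finset.sum_congr rfl fun _ _ ↦ mul_comm _ _

theorem sumFrame_conn1_inr (D : E.Op) {D' : E'.Op} (hD' : IsConnOp D') {p x : M}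
    (hx : x ∈ (E.sum E').dom p) (i : Fin E'.rank) (j : Fin (E.sum E').rank) :
    ∑ k, sumFrame E E' (Sum.inr i) k • conn1 (sumOp D D') p k j x =
      ∑ k, sumFrame E E' (Sum.inr k) j • conn1 D' p i k x := by
  refine LinearMap.ext fun v ↦ ?_
  simp only [LinearMap.sum_apply, LinearMap.smul_apply, smul_eq_mul]
  refine (sum_sumFrame_inr hx i (sumOp D D' ((E.sum E').frame p j) x v)).trans ?_
  refine (frameCoord_conn_of_const hD' hx (dom_sum_le_right p)
    (DiffAt.snd (diffAt_frame hx j)) (fun y hy i ↦ frameCoord_snd_frame hy i j) i v).trans ?_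
  exact Finset.sum_congr rfl fun _ _ ↦ mul_comm _ _

variable {𝒟 : Params → E.Op} {𝒟' : Params → E'.Op} {𝒮 : Params → (E.sum E').Op}

/-- In the union of the two frames, the matrix of a direct sum is block diagonal. -/
theorem IsConnFam.sumFrame_mul_mat (h : IsConnFam 𝒟) (h' : IsConnFam 𝒟') (hS : IsConnFam 𝒮)
    (he : ∀ u, 𝒮 u = sumOp (𝒟 u) (𝒟' u)) {p : M} (hW : W ≤ (E.sum E').dom p) :
    (sumFrame E E').map (algebraMap ℂ (LocalForms n W)) * hS.mat hW =
      Matrix.fromBlocks (h.mat (hW.trans (dom_sum_le_left p))) 0 0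
        (h'.mat (hW.trans (dom_sum_le_right p))) *
        (sumFrame E E').map (algebraMap ℂ (LocalForms n W)) := by
  refine matrix_ext fun u x ↦ ?_
  rw [map_eval_mul, map_eval_mul]
  have e1 : ∀ (s : Fin E.rank ⊕ Fin E'.rank) (j : Fin (E.sum E').rank),
      ((((sumFrame E E').map (algebraMap ℂ (LocalForms n W))).map (eval u x)) *
        ((hS.mat hW).map (eval u x))) s j = CForms.toForm
          (∑ k, sumFrame E E' s k • conn1 (𝒮 u) p k j (x : M)) := by
    intro s j
    rw [Matrix.mul_apply, map_sum]
    refine Finset.sum_congr rfl fun k _ ↦ ?_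
    rw [map_smul, Algebra.smul_def]
    rfl
  have e2 : ∀ {ι : Type} [Fintype ι] (c : ι → ℂ) (a : ι → TangentSpace (𝓡 n) (x : M) →ₗ[ℝ] ℂ),
      ∑ k, CForms.toForm (a k) * algebraMap ℂ (CForms (TangentSpace (𝓡 n) (x : M))) (c k) =
        CForms.toForm (∑ k, c k • a k) := by
    intro ι _ c a
    rw [map_sum]
    refine Finset.sum_congr rfl fun k _ ↦ ?_
    rw [map_smul, Algebra.smul_def, Algebra.commutes]
  ext s j
  rw [e1, he, Matrix.mul_apply, Fintype.sum_sum_type]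
  rcases s with i | i
  · rw [sumFrame_conn1_inl (h.conn u) (𝒟' u) (hW x.2), ← e2]
    refine (add_zero _).symm.trans (congrArg₂ (· + ·) rfl (Finset.sum_eq_zero fun k _ ↦ ?_).symm)
    exact (congrArg (· * _) (map_zero (eval u x))).trans (zero_mul _)
  · rw [sumFrame_conn1_inr (𝒟 u) (h'.conn u) (hW x.2), ← e2]
    refine (zero_add _).symm.trans (congrArg₂ (· + ·) (Finset.sum_eq_zero fun k _ ↦ ?_).symm rfl)
    exact (congrArg (· * _) (map_zero (eval u x))).trans (zero_mul _)

theorem trace_sumFrame {X : Matrix (Fin (E.sum E').rank) (Fin (E.sum E').rank) (LocalForms n W)}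
    {Y : Matrix (Fin E.rank) (Fin E.rank) (LocalForms n W)}
    {Z : Matrix (Fin E'.rank) (Fin E'.rank) (LocalForms n W)}
    (h : (sumFrame E E').map (algebraMap ℂ (LocalForms n W)) * X =
      Matrix.fromBlocks Y 0 0 Z * (sumFrame E E').map (algebraMap ℂ (LocalForms n W))) :
    X.trace = Y.trace + Z.trace := by
  refine (Matrix.trace_eq_of_intertwine (isEven_map_algebraMap (P := Params) _).central
    (K := (sumFrameInv E E').map (algebraMap ℂ (LocalForms n W))) ?_ ?_ h).trans
    (Fintype.sum_sum_type _)
  · rw [← Matrix.map_mul, sumFrameInv_mul, Matrix.map_one _ (map_zero _) (map_one _)]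
  · rw [← Matrix.map_mul, sumFrame_mul_inv, Matrix.map_one _ (map_zero _) (map_one _)]

theorem IsConnFam.sumFrame_mul_curv_pow (h : IsConnFam 𝒟) (h' : IsConnFam 𝒟') (hS : IsConnFam 𝒮)
    (he : ∀ u, 𝒮 u = sumOp (𝒟 u) (𝒟' u)) {p : M} (hW : W ≤ (E.sum E').dom p) (k : ℕ) :
    (sumFrame E E').map (algebraMap ℂ (LocalForms n W)) * curv Params (hS.mat hW) ^ k =
      Matrix.fromBlocks (curv Params (h.mat (hW.trans (dom_sum_le_left p))) ^ k) 0 0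
        (curv Params (h'.mat (hW.trans (dom_sum_le_right p))) ^ k) *
        (sumFrame E E').map (algebraMap ℂ (LocalForms n W)) := by
  have hodd : IsOdd Params (Matrix.fromBlocks (h.mat (hW.trans (dom_sum_le_left p))) 0 0
        (h'.mat (hW.trans (dom_sum_le_right p)))) := by
    have hz : eps Params (0 : LocalForms n W) = -0 := by rw [map_zero, neg_zero]
    rintro (i | i) (j | j)
    exacts [h.isOdd (hW.trans (dom_sum_le_left p)) i j, hz, hz,
      h'.isOdd (hW.trans (dom_sum_le_right p)) i j]
  rw [← Matrix.fromBlocks_diagonal_pow, ← curv_fromBlocks]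
  refine Matrix.intertwine_pow (curv_intertwine (isEven_map_algebraMap _) hodd ?_) k
  rw [dM_map_algebraMap, add_zero, h.sumFrame_mul_mat h' hS he]

/-- The Chern-Simons integrand of a direct sum, by conjugating with the constant matrix `sumFrame`.
-/
theorem IsConnFam.transgr_sum (h : IsConnFam 𝒟) (h' : IsConnFam 𝒟') (hS : IsConnFam 𝒮)
    (he : ∀ u, 𝒮 u = sumOp (𝒟 u) (𝒟' u)) (v : Params) (k : ℕ) (u : Params) :
    transgr 𝒮 v k u = transgr 𝒟 v k u + transgr 𝒟' v k u := by
  funext x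
  have hW := le_refl ((E.sum E').dom x)
  have hx := (E.sum E').mem_dom_self x
  have h1 := congrArg (pdM v) (h.sumFrame_mul_mat h' hS he hW)
  rw [pdM_mul, pdM_mul, pdM_map_algebraMap, Matrix.zero_mul, Matrix.mul_zero, zero_add, add_zero,
    pdM_fromBlocks] at h1
  have h2 := Matrix.intertwine_mul h1 (h.sumFrame_mul_curv_pow h' hS he hW k)
  rw [Matrix.fromBlocks_multiply] at h2
  simp only [Matrix.mul_zero, Matrix.zero_mul, add_zero, zero_add] at h2
  have h3 := congrArg (eval u ⟨x, hx⟩) (trace_sumFrame h2)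
  rw [map_add, hS.eval_transgr, h.eval_transgr, h'.eval_transgr] at h3
  exact h3

theorem IsConnOp.chernPow_sum {D : E.Op} {D' : E'.Op} (h : IsConnOp D) (h' : IsConnOp D')
    (hS : IsConnOp (sumOp D D')) (k : ℕ) :
    chernPow (sumOp D D') k = chernPow D k + chernPow D' k := by
  funext x
  have hW := le_refl ((E.sum E').dom x)
  have hx := (E.sum E').mem_dom_self x
  have h3 := congrArg (eval (0, 0) ⟨x, hx⟩) (trace_sumFrame
    (h.const.sumFrame_mul_curv_pow h'.const hS.const (fun _ ↦ rfl) hW k))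
  rw [map_add, hS.const.eval_trace_curv_pow, h.const.eval_trace_curv_pow,
    h'.const.eval_trace_curv_pow] at h3
  exact h3

theorem IsConnOp.csPow_sum {D₀ D₁ : E.Op} {D₀' D₁' : E'.Op} (h₀ : IsConnOp D₀) (h₁ : IsConnOp D₁)
    (h₀' : IsConnOp D₀') (h₁' : IsConnOp D₁') (hS₀ : IsConnOp (sumOp D₀ D₀'))
    (hS₁ : IsConnOp (sumOp D₁ D₁')) (k : ℕ) :
    csPow (sumOp D₀ D₀') (sumOp D₁ D₁') k = csPow D₀ D₁ k + csPow D₀' D₁' k := by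
  rw [hS₀.csPow_eq_edge hS₁, h₀.csPow_eq_edge h₁, h₀'.csPow_eq_edge h₁']
  funext x
  have hc : ∀ {E : CBundle n M} {D₀ D₁ : E.Op}, IsConnOp D₀ → IsConnOp D₁ →
      IntervalIntegrable (fun σ ↦ transgr (fun u ↦ seg D₀ D₁ u.1) (1, 0) k (rho₁ (σ, (0, 0))) x)
        MeasureTheory.volume 0 1 := by
    intro E D₀ D₁ h₀ h₁
    have h := h₀.segFam h₁
    simp only [h.transgr_eq _ k _ ⟨x, E.mem_dom_self x⟩]
    exact (continuous_path contDiff_rho₁ _ _ _).intervalIntegrable _ _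
  refine (intervalIntegral.integral_congr fun σ _ ↦ ?_).trans
    (intervalIntegral.integral_add (hc h₀ h₁) (hc h₀' h₁'))
  exact congrFun ((h₀.segFam h₁).transgr_sum (h₀'.segFam h₁') (hS₀.segFam hS₁)
    (fun u ↦ seg_sumOp _ _ _ _ _) _ _ _) x

end CBundle

namespace HermitianMetric

open CBundle

theorem _root_.CBundle.contMDiffAt_fst {σ : ∀ x, (E.sum E').V x} {x : M}
    (h : ContMDiffAt (𝓡 n) ((𝓡 n).prod 𝓘(ℝ, (E.sum E').F)) ∞ ((E.sum E').toTotal σ) x) :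
    ContMDiffAt (𝓡 n) ((𝓡 n).prod 𝓘(ℝ, E.F)) ∞ (E.toTotal fun y ↦ (σ y).1) x :=
  ((trivializationAt E.F E.V x).contMDiffAt_section_iff
    (FiberBundle.mem_baseSet_trivializationAt' x)).2
    ((ContinuousLinearMap.fst ℝ E.F E'.F).contMDiff.contMDiffAt.comp x
      (((trivializationAt (E.F × E'.F) (E.V ×ᵇ E'.V) x).contMDiffAt_section_iff
        (FiberBundle.mem_baseSet_trivializationAt' x)).1 h))

theorem _root_.CBundle.contMDiffAt_snd {σ : ∀ x, (E.sum E').V x} {x : M}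
    (h : ContMDiffAt (𝓡 n) ((𝓡 n).prod 𝓘(ℝ, (E.sum E').F)) ∞ ((E.sum E').toTotal σ) x) :
    ContMDiffAt (𝓡 n) ((𝓡 n).prod 𝓘(ℝ, E'.F)) ∞ (E'.toTotal fun y ↦ (σ y).2) x :=
  ((trivializationAt E'.F E'.V x).contMDiffAt_section_iff
    (FiberBundle.mem_baseSet_trivializationAt' x)).2
    ((ContinuousLinearMap.snd ℝ E.F E'.F).contMDiff.contMDiffAt.comp x
      (((trivializationAt (E.F × E'.F) (E.V ×ᵇ E'.V) x).contMDiffAt_section_iff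
        (FiberBundle.mem_baseSet_trivializationAt' x)).1 h))

theorem form_self_nonneg (h : HermitianMetric E) (x : M) (u : E.V x) :
    0 ≤ (h.form x u u).re := by
  rcases eq_or_ne u 0 with rfl | hu
  · rw [map_zero]; exact le_rfl
  · exact (h.pos x u hu).le

/-- The orthogonal direct sum of two sesquilinear forms. -/
def _root_.LinearMap.prodForm {V V' : Type*} [AddCommGroup V] [Module ℂ V] [AddCommGroup V']
    [Module ℂ V'] (a : V →ₗ[ℂ] V →ₗ⋆[ℂ] ℂ) (b : V' →ₗ[ℂ] V' →ₗ⋆[ℂ] ℂ) :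
    (V × V') →ₗ[ℂ] (V × V') →ₗ⋆[ℂ] ℂ :=
  LinearMap.mk₂'ₛₗ (RingHom.id ℂ) (starRingEnd ℂ) (fun u w ↦ a u.1 w.1 + b u.2 w.2)
    (fun u u' w ↦ by
      rw [Prod.fst_add, Prod.snd_add, map_add, map_add, LinearMap.add_apply, LinearMap.add_apply,
        add_add_add_comm])
    (fun c u w ↦ by
      rw [Prod.smul_fst, Prod.smul_snd, map_smul, map_smul, LinearMap.smul_apply,
        LinearMap.smul_apply, ← smul_add]; rfl)
    (fun u w w' ↦ by rw [Prod.fst_add, Prod.snd_add, map_add, map_add, add_add_add_comm])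
    (fun c u w ↦ by
      rw [Prod.smul_fst, Prod.smul_snd, (a _).map_smulₛₗ, (b _).map_smulₛₗ, smul_add])

/-- The orthogonal direct sum of two metrics. -/
def sum (h : HermitianMetric E) (h' : HermitianMetric E') : HermitianMetric (E.sum E') where
  form x := LinearMap.prodForm (h.form x) (h'.form x)
  conj_symm x u w := (congrArg₂ (· + ·) (h.conj_symm x u.1 w.1) (h'.conj_symm x u.2 w.2)).trans
    (map_add _ _ _).symm
  pos x u hu := by
    change 0 < (h.form x u.1 u.1 + h'.form x u.2 u.2).re
    rw [Complex.add_re]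
    by_cases h1 : u.1 = 0
    · have h2 : u.2 ≠ 0 := fun h2 ↦ hu (Prod.ext h1 h2)
      exact add_pos_of_nonneg_of_pos (h.form_self_nonneg x _) (h'.pos x _ h2)
    · exact add_pos_of_pos_of_nonneg (h.pos x _ h1) (h'.form_self_nonneg x _)
  smooth U σ τ hU hσ hτ := by
    have h1 := fun x (hx : x ∈ U) ↦ (hσ x hx).contMDiffAt (hU.mem_nhds hx)
    have h2 := fun x (hx : x ∈ U) ↦ (hτ x hx).contMDiffAt (hU.mem_nhds hx)
    exact (h.smooth U _ _ hU (fun x hx ↦ (contMDiffAt_fst (h1 x hx)).contMDiffWithinAt)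
      (fun x hx ↦ (contMDiffAt_fst (h2 x hx)).contMDiffWithinAt)).add
      (h'.smooth U _ _ hU (fun x hx ↦ (contMDiffAt_snd (h1 x hx)).contMDiffWithinAt)
      (fun x hx ↦ (contMDiffAt_snd (h2 x hx)).contMDiffWithinAt))

theorem IsAdjointOp.sum {h : HermitianMetric E} {h' : HermitianMetric E'} {D D₁ : E.Op}
    {D' D₁' : E'.Op} (ha : h.IsAdjointOp D D₁) (ha' : h'.IsAdjointOp D' D₁') :
    (h.sum h').IsAdjointOp (sumOp D D') (sumOp D₁ D₁') := by
  intro x σ θ v hσ hθ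
  have h1 := ha x _ _ v (DiffAt.fst hσ) (DiffAt.fst hθ)
  have h2 := ha' x _ _ v (DiffAt.snd hσ) (DiffAt.snd hθ)
  rw [adjLin_apply] at h1 h2 ⊢
  have h3 : mvfderiv (𝓡 n) (fun y ↦ (h.sum h').form y (σ y) (θ y)) x v =
      mvfderiv (𝓡 n) (fun y ↦ h.form y (σ y).1 (θ y).1) x v +
      mvfderiv (𝓡 n) (fun y ↦ h'.form y (σ y).2 (θ y).2) x v :=
    congrArg (· v) (mvfderiv_add (h.mdifferentiableAt_form (DiffAt.fst hσ) (DiffAt.fst hθ))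
      (h'.mdifferentiableAt_form (DiffAt.snd hσ) (DiffAt.snd hθ)))
  rw [h3]
  refine (congrArg₂ (· + ·) h1 h2).trans ?_
  exact add_sub_add_comm _ _ _ _ |>.symm

end HermitianMetric

end DirectSums

/-! ### Chern character and Chern-Simons classes -/

section Classes

open TopologicalSpace LocalForms

variable {n : ℕ} {M : Type*} [TopologicalSpace M] [ChartedSpace (EuclideanSpace ℝ (Fin n)) M]

namespace FormField

theorem isSmooth_sum {ι : Type*} {s : Finset ι} {α : ι → FormField n M}
    (h : ∀ i ∈ s, (α i).IsSmooth) : (∑ i ∈ s, α i).IsSmooth := by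
  classical
  induction s using Finset.induction_on with
  | empty => exact isSmooth_zero
  | insert i s hi ih =>
    rw [Finset.sum_insert hi]
    exact (h i (Finset.mem_insert_self i s)).add (ih fun j hj ↦ h j (Finset.mem_insert_of_mem hj))

theorem extD_sum {ι : Type*} {s : Finset ι} {α : ι → FormField n M}
    (h : ∀ i ∈ s, (α i).IsSmooth) : (∑ i ∈ s, α i).extD = ∑ i ∈ s, (α i).extD := by
  classical
  induction s using Finset.induction_on with
  | empty => exact extD_zero
  | insert i s hi ih =>
    have h2 := fun j (hj : j ∈ s) ↦ h j (Finset.mem_insert_of_mem hj)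
    rw [Finset.sum_insert hi, Finset.sum_insert hi, extD_add (h i (Finset.mem_insert_self i s))
      (isSmooth_sum h2), ih h2]

theorem extD_neg {α : FormField n M} (h : α.IsSmooth) : (-α).extD = -α.extD := by
  simpa using extD_smul (-1 : ℂ) h

theorem extD_sub {α β : FormField n M} (h : α.IsSmooth) (h' : β.IsSmooth) :
    (α - β).extD = α.extD - β.extD := by
  have h2 : (-β).IsSmooth := by simpa using h'.smul (-1)
  rw [sub_eq_add_neg, extD_add h h2, extD_neg h', ← sub_eq_add_neg]

theorem conj_conj (α : FormField n M) : conj (conj α) = α := by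
  funext x
  change CForms.conj (CForms.conj (α x)) = α x
  induction α x using TensorProduct.induction_on with
  | zero => simp
  | tmul a b => simp [CForms.conj_tmul]
  | add a b ha hb => rw [map_add, map_add, ha, hb]

variable [IsManifold (𝓡 n) ∞ M]

/-- A smooth form, as a constant family on all of `M`. -/
def IsSmooth.toLocal {α : FormField n M} (h : α.IsSmooth) : LocalForms n (⊤ : Opens M) :=
  ofField (fun _ ↦ α) fun u x _ ↦ (isSmooth_iff_famSmoothAt u).1 h x

theorem IsSmooth.dL_toLocal {α : FormField n M} (h : α.IsSmooth) (u : Params)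
    (x : (⊤ : Opens M)) : (dL h.toLocal).1 u x = α.extD x :=
  dL_val_of_eq h.toLocal (fun _ ↦ rfl) x

theorem extD_extD {α : FormField n M} (h : α.IsSmooth) : α.extD.extD = 0 := by
  funext x
  have h1 := dL_val_of_eq (dL h.toLocal) (u := (0, 0)) (α := α.extD)
    (fun x ↦ (h.dL_toLocal (0, 0) x).symm) ⟨x, trivial⟩
  rw [← h1, dL_dL]
  rfl

theorem IsSmooth.extD {α : FormField n M} (h : α.IsSmooth) : α.extD.IsSmooth :=
  isSmooth_of_local (0, 0) fun _ ↦ ⟨⊤, trivial, dL h.toLocal, fun x ↦ (h.dL_toLocal (0, 0) x).symm⟩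

/-- The exterior derivative reverses the parity. -/
theorem eps_extD {α : FormField n M} (h : α.IsSmooth) {c : ℂ} (hc : ∀ x, CForms.eps (α x) = c • α x)
    (x : M) : CForms.eps (α.extD x) = -(c • α.extD x) := by
  have h1 : epsL h.toLocal = c • h.toLocal := ext_iff'.2 fun u x ↦ hc x
  have h2 := congrArg (fun a ↦ a.1 (0, 0) ⟨x, trivial⟩) (dL_epsL h.toLocal)
  simp only [h1, map_smul] at h2
  have h3 : c • α.extD x = -CForms.eps (α.extD x) := by
    rw [← h.dL_toLocal (0, 0) ⟨x, trivial⟩]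
    exact h2
  rw [h3, neg_neg]

theorem extD_mem_evenForms {α : FormField n M} (h : α ∈ oddForms n M) :
    α.extD ∈ evenForms n M := by
  refine ⟨h.1.extD, fun x ↦ CForms.mem_even_iff.2 ?_⟩
  rw [eps_extD h.1 (c := -1) (fun x ↦ (CForms.mem_odd_iff.1 (h.2 x)).trans (neg_one_smul ℂ _).symm),
    neg_one_smul, neg_neg]

end FormField

theorem conj_mem_oddForms {α : FormField n M} (h : α ∈ oddForms n M) :
    FormField.conj α ∈ oddForms n M := ⟨h.1.conj, fun x ↦ CForms.conj_mem_odd (h.2 x)⟩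

theorem formClass_eq_iff {α β : FormField n M} :
    formClass α = formClass β ↔ α - β ∈ exactOddForms n M :=
  Submodule.Quotient.eq _

theorem formClass_conj (α : FormField n M) :
    FormsModExact.conj (formClass α) = formClass (FormField.conj α) := rfl

variable [IsManifold (𝓡 n) ∞ M]

/-- The exterior derivative is well defined on forms modulo exact forms. -/
theorem extD_eq_of_formClass_eq {α β : FormField n M} (hα : α ∈ oddForms n M)
    (hβ : β ∈ oddForms n M) (h : formClass α = formClass β) : α.extD = β.extD := by
  obtain ⟨η, hη, he⟩ := formClass_eq_iff.1 h
  rw [← sub_eq_zero, ← FormField.extD_sub hα.1 hβ.1, ← he, FormField.extD_extD hη.1]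

namespace CBundle

variable {E E' : CBundle n M} {D D' D₀ D₁ D₂ D₀' D₁' : E.Op}

theorem conj_chernConst : starRingEnd ℂ chernConst = -chernConst := by
  simp [chernConst, neg_div, map_ofNat]

theorem IsConnOp.ch_mem (h : IsConnOp D) : E.ch D ∈ evenForms n M := by
  rw [ch_eq]
  exact Submodule.sum_mem _ fun k _ ↦ Submodule.smul_mem _ _ (h.chernPow_mem k)

theorem IsConnOp.chernSimons_mem (h₀ : IsConnOp D₀) (h₁ : IsConnOp D₁) :
    E.chernSimons D₀ D₁ ∈ oddForms n M := by
  rw [h₀.chernSimons_eq h₁]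
  exact Submodule.sum_mem _ fun k _ ↦ Submodule.smul_mem _ _ (h₀.csPow_mem h₁ k)

/-- The transgression formula `d c̃h(∇₀, ∇₁) = ch(∇₁) - ch(∇₀)`. -/
theorem IsConnOp.extD_chernSimons (h₀ : IsConnOp D₀) (h₁ : IsConnOp D₁) :
    (E.chernSimons D₀ D₁).extD = E.ch D₁ - E.ch D₀ := by
  have hs := fun k ↦ (h₀.csPow_mem h₁ k).1
  rw [h₀.chernSimons_eq h₁, FormField.extD_sum fun k _ ↦ (hs k).smul _, ch_eq, ch_eq,
    ← Finset.sum_sub_distrib]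
  have h0 : (chernPow D₁ 0 : FormField n M) = chernPow D₀ 0 := by
    rw [chernPow_zero, chernPow_zero]
  have hterm : ∀ k, ((chernConst ^ (k + 1) / (k.factorial : ℂ)) • csPow D₀ D₁ k).extD =
      (chernConst ^ (k + 1) / ((k + 1).factorial : ℂ)) • chernPow D₁ (k + 1) -
        (chernConst ^ (k + 1) / ((k + 1).factorial : ℂ)) • chernPow D₀ (k + 1) := by
    intro k
    rw [FormField.extD_smul _ (hs k), ← smul_sub, ← h₀.extD_csPow h₁ k, smul_smul]
    congr 1
    have h1 : ((k.factorial : ℕ) : ℂ) ≠ 0 := Nat.cast_ne_zero.2 (Nat.factorial_ne_zero k)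
    have h2 : (k : ℂ) + 1 ≠ 0 := Nat.cast_add_one_ne_zero k
    rw [Nat.factorial_succ]
    push_cast
    field_simp
  simp only [hterm]
  -- the terms of degree zero cancel, and the top terms vanish for reasons of degree
  rw [Finset.sum_range_succ, Finset.sum_range_succ' _ n, h0, sub_self, chernPow_eq_zero,
    chernPow_eq_zero, sub_self]

theorem IsConnOp.formClass_chernSimons (h₀ : IsConnOp D₀) (h₁ : IsConnOp D₁) :
    formClass (E.chernSimons D₀ D₁) = ∑ k ∈ Finset.range (n + 1),
      (chernConst ^ (k + 1) / (k.factorial : ℂ)) • formClass (csPow D₀ D₁ k) := by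
  rw [h₀.chernSimons_eq h₁, map_sum]
  exact Finset.sum_congr rfl fun k _ ↦ _root_.map_smul _ _ _

/-- The triangle identity `c̃h(∇₀, ∇₂) = c̃h(∇₀, ∇₁) + c̃h(∇₁, ∇₂)` modulo exact forms. -/
theorem IsConnOp.formClass_triangle (h₀ : IsConnOp D₀) (h₁ : IsConnOp D₁) (h₂ : IsConnOp D₂) :
    formClass (E.chernSimons D₀ D₂) =
      formClass (E.chernSimons D₀ D₁) + formClass (E.chernSimons D₁ D₂) := by
  rw [h₀.formClass_chernSimons h₂, h₀.formClass_chernSimons h₁, h₁.formClass_chernSimons h₂,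
    ← Finset.sum_add_distrib]
  refine Finset.sum_congr rfl fun k _ ↦ ?_
  rw [← smul_add, ← map_add]
  refine congrArg _ (formClass_eq_iff.2 ?_)
  rw [← Submodule.neg_mem_iff]
  convert h₀.csPow_triangle h₁ h₂ k using 1
  abel

theorem IsConnOp.formClass_symm (h₀ : IsConnOp D₀) (h₁ : IsConnOp D₁) :
    formClass (E.chernSimons D₁ D₀) = -formClass (E.chernSimons D₀ D₁) := by
  have h := h₀.formClass_triangle h₁ h₀
  have h2 : E.chernSimons D₀ D₀ = 0 := by
    rw [h₀.chernSimons_eq h₀]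
    exact Finset.sum_eq_zero fun k _ ↦ by rw [csPow_self, smul_zero]
  rw [h2, map_zero] at h
  exact eq_neg_of_add_eq_zero_right h.symm

/-- The total Chern-Simons form is invariant under isomorphisms of bundles. -/
theorem Iso.chernSimons_pullOp (f : E.Iso E') {D₀ D₁ : E'.Op} (h₀ : IsConnOp D₀)
    (h₁ : IsConnOp D₁) : E.chernSimons (f.pullOp D₀) (f.pullOp D₁) = E'.chernSimons D₀ D₁ := by
  rw [h₀.chernSimons_eq h₁, (h₀.pullOp f).chernSimons_eq (h₁.pullOp f)]
  simp only [f.csPow_pullOp h₀ h₁]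

theorem Iso.ch_pullOp (f : E.Iso E') {D : E'.Op} (h : IsConnOp D) :
    E.ch (f.pullOp D) = E'.ch D := by
  simp only [ch_eq, f.chernPow_pullOp h]

theorem IsConnOp.ch_sum {D : E.Op} {D' : E'.Op} (h : IsConnOp D) (h' : IsConnOp D')
    (hS : IsConnOp (sumOp D D')) : (E.sum E').ch (sumOp D D') = E.ch D + E'.ch D' := by
  simp only [ch_eq, h.chernPow_sum h' hS, smul_add, Finset.sum_add_distrib]

theorem IsConnOp.chernSimons_sum {D₀ D₁ : E.Op} {D₀' D₁' : E'.Op} (h₀ : IsConnOp D₀)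
    (h₁ : IsConnOp D₁) (h₀' : IsConnOp D₀') (h₁' : IsConnOp D₁') (hS₀ : IsConnOp (sumOp D₀ D₀'))
    (hS₁ : IsConnOp (sumOp D₁ D₁')) : (E.sum E').chernSimons (sumOp D₀ D₀') (sumOp D₁ D₁') =
      E.chernSimons D₀ D₁ + E'.chernSimons D₀' D₁' := by
  simp only [h₀.chernSimons_eq h₁, h₀'.chernSimons_eq h₁', hS₀.chernSimons_eq hS₁,
    h₀.csPow_sum h₁ h₀' h₁' hS₀ hS₁, smul_add, Finset.sum_add_distrib]

end CBundle

namespace HermitianMetric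

open CBundle

variable {E : CBundle n M} {h : HermitianMetric E} {D D' D₀ D₁ D₂ D₀' D₁' : E.Op}

/-- The conjugate of `ch(∇)` is `ch(∇*)`: the signs of `conj_chernPow` and of the conjugate of `-1 /
2πi` cancel. -/
theorem conj_ch (hD : IsConnOp D) (ha : h.IsAdjointOp D D') :
    FormField.conj (E.ch D) = E.ch D' := by
  rw [ch_eq, ch_eq, map_sum]
  refine Finset.sum_congr rfl fun k _ ↦ ?_
  rw [LinearMap.map_smulₛₗ, conj_chernPow hD (ha.isConnOp hD) ha, smul_smul, map_div₀, map_pow,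
    conj_chernConst, Complex.conj_natCast, neg_pow, div_mul_eq_mul_div, mul_assoc, mul_comm, mul_assoc,
    ← mul_pow]
  norm_num

/-- The conjugate of `c̃h(∇₀, ∇₁)` is `c̃h(∇₀*, ∇₁*)`. -/
theorem conj_chernSimons (hD₀ : IsConnOp D₀) (hD₁ : IsConnOp D₁) (h₀ : h.IsAdjointOp D₀ D₀')
    (h₁ : h.IsAdjointOp D₁ D₁') :
    FormField.conj (E.chernSimons D₀ D₁) = E.chernSimons D₀' D₁' := by
  have hD₀' := h₀.isConnOp hD₀
  have hD₁' := h₁.isConnOp hD₁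
  rw [hD₀.chernSimons_eq hD₁, hD₀'.chernSimons_eq hD₁', map_sum]
  refine Finset.sum_congr rfl fun k _ ↦ ?_
  rw [LinearMap.map_smulₛₗ, conj_csPow hD₀ hD₁ hD₀' hD₁' h₀ h₁, smul_smul, map_div₀, map_pow,
    conj_chernConst, Complex.conj_natCast, neg_pow, div_mul_eq_mul_div, mul_assoc, mul_comm, mul_assoc,
    ← mul_pow]
  norm_num

theorem formClass_csPow_eq {h₁ h₂ : HermitianMetric E} (hD : IsConnOp D)
    (ha₁ : h₁.IsAdjointOp D D₁) (ha₂ : h₂.IsAdjointOp D D₂) (k : ℕ) :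
    formClass (csPow D₁ D k) = formClass (csPow D₂ D k) := by
  refine formClass_eq_iff.2 ?_
  have e1 := hD.csPow_symm (ha₁.isConnOp hD) k
  have e2 := hD.csPow_symm (ha₂.isConnOp hD) k
  have e3 := csPow_sub_mem_exact hD ha₁ ha₂ k
  convert Submodule.sub_mem _ (Submodule.sub_mem _ e1 e2) e3 using 1
  abel

/-- The class of `c̃h(∇*, ∇)` does not depend on the metric. -/
theorem formClass_chernSimons_eq {h₁ h₂ : HermitianMetric E} (hD : IsConnOp D)
    (ha₁ : h₁.IsAdjointOp D D₁) (ha₂ : h₂.IsAdjointOp D D₂) :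
    formClass (E.chernSimons D₁ D) = formClass (E.chernSimons D₂ D) := by
  rw [(ha₁.isConnOp hD).formClass_chernSimons hD, (ha₂.isConnOp hD).formClass_chernSimons hD]
  exact Finset.sum_congr rfl fun k _ ↦ congrArg _ (formClass_csPow_eq hD ha₁ ha₂ k)

end HermitianMetric

end Classes

/-! ### The homomorphisms on free multiplicative K-theory -/

section KTheoryMaps

open CBundle

variable {n : ℕ} {M : Type*} [TopologicalSpace M] [ChartedSpace (EuclideanSpace ℝ (Fin n)) M]
  [IsManifold (𝓡 n) ∞ M]

theorem formClass_add (α β : FormField n M) :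
    formClass (α + β) = formClass α + formClass β := map_add formClass α β

theorem formClass_sub (α β : FormField n M) :
    formClass (α - β) = formClass α - formClass β := map_sub formClass α β

theorem formClass_zero : formClass (0 : FormField n M) = 0 := map_zero formClass

theorem formClass_neg (α : FormField n M) : formClass (-α) = -formClass α := map_neg formClass α

theorem FormsModExact.conj_add (a b : FormsModExact n M) :
    FormsModExact.conj (a + b) = FormsModExact.conj a + FormsModExact.conj b :=
  map_add FormsModExact.conj a b

section Representatives

variable {E E' : CBundle n M} {D D₁ : E.Op} {D' D₁' : E'.Op}

/-- The computation behind the invariance under equivalence: `a = c̃h(∇₁*, ∇₁)`, `c = c̃h(f^*∇₂*,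
f^*∇₂)`, and `w`, `w'` are the Chern-Simons classes between `∇₁`, `f^*∇₂` and between their
adjoints, related by two triangles. -/
theorem borel_invariance {G : Type*} [AddCommGroup G] (a w w' c α β : G) (h : a + w = w' + c) :
    a - α + β = c - (α + w) + (β + w') := by
  rw [eq_sub_of_add_eq h]
  abel

/-- The invariance of `c̃h(∇*, ∇) - α + ᾱ` under the equivalence of triples. -/
theorem HermitianMetric.formClass_equivalent {g : HermitianMetric E'} (f : E.Iso E')
    (hD : IsConnOp D) (hD' : IsConnOp D') (ha : g.IsAdjointOp D' D₁')
    (hb : (g.pull f).IsAdjointOp D D₁) (α : FormsModExact n M) :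
    formClass (E.chernSimons D₁ D) - α + FormsModExact.conj α =
      formClass (E'.chernSimons D₁' D') - (α + formClass (E.chernSimons D (f.pullOp D'))) +
        FormsModExact.conj (α + formClass (E.chernSimons D (f.pullOp D'))) := by
  have hD₁ := hb.isConnOp hD
  have hD₁' := ha.isConnOp hD'
  have hf := hD'.pullOp f
  have h1 := hD₁.formClass_triangle hD hf
  have h2 := hD₁.formClass_triangle (hD₁'.pullOp f) hf
  have h3 := HermitianMetric.conj_chernSimons hD hf hb (ha.pull f)
  have h4 := (formClass_conj (E.chernSimons D (f.pullOp D'))).trans (congrArg formClass h3)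
  have h5 := congrArg formClass (f.chernSimons_pullOp hD₁' hD')
  have h6 := borel_invariance _ _ _ _ α (FormsModExact.conj α) (h1.symm.trans h2)
  rw [h5, ← h4, ← FormsModExact.conj_add] at h6
  exact h6

/-- The computation behind the additivity of `c̃h(∇*, ∇) - α + ᾱ`. -/
theorem borel_additivity {G : Type*} [AddCommGroup G] {a b c α β α' β' γ : G} (h : a = b + c)
    (h' : γ = α' + β') : a - (α + β) + γ = b - α + α' + (c - β + β') := by
  rw [h, h']
  abel

theorem sub_zero_add_of_eq_zero {G : Type*} [AddCommGroup G] (a : G) {b : G} (h : b = 0) :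
    a - 0 + b = a := by
  rw [h, sub_zero, add_zero]

/-- The computation behind the anti-invariance of `c̃h(∇*, ∇) - α + ᾱ` under conjugation. -/
theorem borel_conj {G : Type*} [AddCommGroup G] (a α β : G) :
    -a - β + α = -(a - α + β) := by abel

/-- The class `c̃h(∇*, ∇) - α + ᾱ` is purely imaginary: conjugation exchanges `∇` and `∇*`. -/
theorem HermitianMetric.formClass_conj_representative {g : HermitianMetric E} (hD : IsConnOp D)
    (ha : g.IsAdjointOp D D₁) (α : FormField n M) :
    formClass (FormField.conj (E.chernSimons D₁ D - α + FormField.conj α)) =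
      -formClass (E.chernSimons D₁ D - α + FormField.conj α) := by
  have hD₁ := ha.isConnOp hD
  have h2 : FormField.conj (E.chernSimons D₁ D - α + FormField.conj α) =
      E.chernSimons D D₁ - FormField.conj α + α := by
    rw [map_add, map_sub, FormField.conj_conj, HermitianMetric.conj_chernSimons hD₁ hD ha.symm ha]
  have h3 := borel_conj (formClass (E.chernSimons D₁ D)) (formClass α)
    (formClass (FormField.conj α))
  rw [← hD₁.formClass_symm hD] at h3
  simp only [h2, formClass_add, formClass_sub]
  exact h3

/-- The form `c̃h(∇*, ∇) - α + ᾱ` has differential `ω - ω̄` with `ω = ch(∇) - dα`: by transgression,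
`d c̃h(∇*, ∇) = ch(∇) - ch(∇*)`, and `ch(∇*)` is the conjugate of `ch(∇)`. -/
theorem HermitianMetric.extD_representative {g : HermitianMetric E} (hD : IsConnOp D)
    (ha : g.IsAdjointOp D D₁) {α : FormField n M} (hα : α ∈ oddForms n M) :
    (E.chernSimons D₁ D - α + FormField.conj α).extD =
      (E.ch D - α.extD) - FormField.conj (E.ch D - α.extD) := by
  have hD₁ := ha.isConnOp hD
  have hcs := hD₁.chernSimons_mem hD
  have hα' := conj_mem_oddForms hα
  rw [FormField.extD_add (Submodule.sub_mem (oddForms n M) hcs hα).1 hα'.1,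
    FormField.extD_sub hcs.1 hα.1, hD₁.extD_chernSimons hD, map_sub,
    HermitianMetric.conj_ch hD ha, FormField.extD_conj hα.1]
  abel

end Representatives

namespace KTriple

/-- The classes of triples generate the K-group. -/
theorem mem_of_toK (H : AddSubgroup (FreeMultK n M)) (h : ∀ T : KTriple n M, T.toK ∈ H)
    (x : FreeMultK n M) : x ∈ H := by
  induction x using QuotientAddGroup.induction_on with
  | H z =>
    induction z using FreeAbelianGroup.induction_on with
    | zero => exact H.zero_mem
    | of T => exact h T
    | neg T _ => exact H.neg_mem (h T)
    | add a b ha hb => exact H.add_mem ha hb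

theorem hom_ext {A : Type*} [AddCommGroup A] {φ ψ : FreeMultK n M →+ A}
    (h : ∀ T : KTriple n M, φ T.toK = ψ T.toK) : φ = ψ :=
  AddMonoidHom.ext fun x ↦ mem_of_toK (φ.eqLocus ψ) h x

/-- The homomorphism on K-theory defined by an additive invariant of triples. -/
def liftK {A : Type*} [AddCommGroup A] (f : KTriple n M → A)
    (he : ∀ S T : KTriple n M, S.Equivalent T → f S = f T)
    (hs : ∀ S T : KTriple n M, f (S.sum T) = f S + f T) : FreeMultK n M →+ A :=
  QuotientAddGroup.lift _ (FreeAbelianGroup.lift f) (by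
    refine (AddSubgroup.closure_le _).2 ?_
    rintro z (⟨S, T, hST, rfl⟩ | ⟨S, T, rfl⟩)
    · change FreeAbelianGroup.lift f _ = 0
      rw [map_sub, FreeAbelianGroup.lift_apply_of, FreeAbelianGroup.lift_apply_of, he S T hST,
        sub_self]
    · change FreeAbelianGroup.lift f _ = 0
      rw [map_sub, map_add, FreeAbelianGroup.lift_apply_of, FreeAbelianGroup.lift_apply_of,
        FreeAbelianGroup.lift_apply_of, hs, sub_self])

theorem liftK_toK {A : Type*} [AddCommGroup A] (f : KTriple n M → A)
    (he : ∀ S T : KTriple n M, S.Equivalent T → f S = f T)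
    (hs : ∀ S T : KTriple n M, f (S.sum T) = f S + f T) (T : KTriple n M) :
    liftK f he hs T.toK = f T := FreeAbelianGroup.lift_apply_of f T

theorem exists_form (T : KTriple n M) :
    ∃ α ∈ oddForms n M, formClass α = (T.form : FormsModExact n M) := T.form.2

/-- The invariant `ch(∇) - dα` of a triple, for some representative `α`. -/
def chForm (T : KTriple n M) : FormField n M :=
  T.bundle.ch T.conn.toFun - FormField.extD T.exists_form.choose

theorem chForm_eq (T : KTriple n M) {α : FormField n M} (hα : α ∈ oddForms n M)
    (h : formClass α = T.form) :
    T.chForm = T.bundle.ch T.conn.toFun - FormField.extD α := by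
  have h1 := T.exists_form.choose_spec
  rw [chForm, extD_eq_of_formClass_eq h1.1 hα (h1.2.trans h.symm)]

variable [T2Space M]

theorem chForm_mem (T : KTriple n M) : T.chForm ∈ evenForms n M :=
  Submodule.sub_mem _ T.conn.isConnOp.ch_mem
    (FormField.extD_mem_evenForms T.exists_form.choose_spec.1)

theorem chForm_eq_of_equivalent {S T : KTriple n M} (h : S.Equivalent T) :
    S.chForm = T.chForm := by
  obtain ⟨f, hf⟩ := h
  obtain ⟨α, hα, hα'⟩ := S.exists_form
  have hS := S.conn.isConnOp
  have hT := T.conn.isConnOp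
  have hcs := hS.chernSimons_mem (hT.pullOp f)
  rw [S.chForm_eq hα hα', T.chForm_eq (Submodule.add_mem _ hα hcs)
    (by rw [map_add, hα', hf]), FormField.extD_add hα.1 hcs.1, hS.extD_chernSimons (hT.pullOp f),
    f.ch_pullOp hT]
  abel

theorem isConnOp_sumOp (S T : KTriple n M) :
    IsConnOp (sumOp S.conn.toFun T.conn.toFun) := (S.conn.sum T.conn).isConnOp

theorem chForm_sum (S T : KTriple n M) : (S.sum T).chForm = S.chForm + T.chForm := by
  obtain ⟨α, hα, hα'⟩ := S.exists_form
  obtain ⟨β, hβ, hβ'⟩ := T.exists_form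
  have h1 := (S.sum T).chForm_eq (Submodule.add_mem _ hα hβ)
    ((map_add formClass α β).trans (congrArg₂ (· + ·) hα' hβ'))
  have h2 := S.conn.isConnOp.ch_sum T.conn.isConnOp (isConnOp_sumOp S T)
  rw [h1, S.chForm_eq hα hα', T.chForm_eq hβ hβ', FormField.extD_add hα.1 hβ.1]
  exact (congrArg (· - _) h2).trans (add_sub_add_comm _ _ _ _)

variable [SigmaCompactSpace M]

/-- The invariant `c̃h(∇*, ∇) - α + ᾱ` of a triple, for some hermitian metric. -/
def borelForm (T : KTriple n M) : FormsModExact n M :=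
  formClass (T.bundle.chernSimons
    ((HermitianMetric.nonempty T.bundle).some.adjOp T.conn.toFun) T.conn.toFun)
    - (T.form : FormsModExact n M) + FormsModExact.conj (T.form : FormsModExact n M)

theorem borelForm_eq (T : KTriple n M) {h : HermitianMetric T.bundle} {D' : T.bundle.Op}
    (ha : h.IsAdjointOp T.conn.toFun D') :
    T.borelForm = formClass (T.bundle.chernSimons D' T.conn.toFun)
      - (T.form : FormsModExact n M) + FormsModExact.conj (T.form : FormsModExact n M) := by
  have hD := T.conn.isConnOp
  rw [borelForm, HermitianMetric.formClass_chernSimons_eq hD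
    (HermitianMetric.isAdjointOp_adjOp _ hD) ha]

theorem borelForm_eq_of_equivalent {S T : KTriple n M} (h : S.Equivalent T) :
    S.borelForm = T.borelForm := by
  obtain ⟨f, hf⟩ := h
  have hS := S.conn.isConnOp
  have hT := T.conn.isConnOp
  obtain ⟨g⟩ := HermitianMetric.nonempty T.bundle
  have ha := g.isAdjointOp_adjOp hT
  have hb := (g.pull f).isAdjointOp_adjOp hS
  rw [T.borelForm_eq ha, S.borelForm_eq hb, hf]
  exact HermitianMetric.formClass_equivalent f hS hT ha hb _

theorem borelForm_sum (S T : KTriple n M) : (S.sum T).borelForm = S.borelForm + T.borelForm := by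
  obtain ⟨g⟩ := HermitianMetric.nonempty S.bundle
  obtain ⟨g'⟩ := HermitianMetric.nonempty T.bundle
  have hS := S.conn.isConnOp
  have hT := T.conn.isConnOp
  have ha := g.isAdjointOp_adjOp hS
  have ha' := g'.isAdjointOp_adjOp hT
  have hs := ha.sum ha'
  have hST := isConnOp_sumOp S T
  have h1 := (ha.isConnOp hS).chernSimons_sum hS (ha'.isConnOp hT) hT (hs.isConnOp hST) hST
  have h2 := (S.sum T).borelForm_eq (D' := sumOp _ _) hs
  have h3 : ((S.sum T).form : FormsModExact n M) = S.form + T.form := rfl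
  have h4 : formClass ((S.sum T).bundle.chernSimons (sumOp (g.adjOp S.conn.toFun)
      (g'.adjOp T.conn.toFun)) (S.sum T).conn.toFun) = _ :=
    (congrArg formClass h1).trans (formClass_add _ _)
  rw [h2, S.borelForm_eq ha, T.borelForm_eq ha', h3]
  exact borel_additivity h4 (FormsModExact.conj_add _ _)

end KTriple

section

variable [T2Space M]

theorem existsUnique_chernCharacter : ∃! φ : FreeMultK n M →+ FormField n M, IsChernCharacter φ := by
  refine ⟨KTriple.liftK KTriple.chForm (fun _ _ h ↦ KTriple.chForm_eq_of_equivalent h)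
    KTriple.chForm_sum, fun T α hα h ↦ ?_, fun ψ hψ ↦ KTriple.hom_ext fun T ↦ ?_⟩
  · rw [KTriple.liftK_toK, T.chForm_eq hα h]
  · obtain ⟨α, hα, h⟩ := T.exists_form
    rw [KTriple.liftK_toK, T.chForm_eq hα h, hψ T α hα h]

theorem IsChernCharacter.apply_toK {φ : FreeMultK n M →+ FormField n M} (hφ : IsChernCharacter φ)
    (T : KTriple n M) : φ T.toK = T.chForm := by
  obtain ⟨α, hα, h⟩ := T.exists_form
  rw [T.chForm_eq hα h, hφ T α hα h]

theorem IsChernCharacter.mem_evenForms {φ : FreeMultK n M →+ FormField n M}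
    (hφ : IsChernCharacter φ) (x : FreeMultK n M) : φ x ∈ evenForms n M :=
  KTriple.mem_of_toK ((evenForms n M).toAddSubgroup.comap φ)
    (fun T ↦ by
      change φ T.toK ∈ evenForms n M
      rw [hφ.apply_toK]; exact T.chForm_mem) x

variable [SigmaCompactSpace M]

theorem existsUnique_borelClass : ∃! B : FreeMultK n M →+ FormsModExact n M, IsBorelClass B := by
  refine ⟨KTriple.liftK KTriple.borelForm (fun _ _ h ↦ KTriple.borelForm_eq_of_equivalent h)
    KTriple.borelForm_sum, fun T h D' ha ↦ ?_, fun C hC ↦ KTriple.hom_ext fun T ↦ ?_⟩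
  · rw [KTriple.liftK_toK]
    exact T.borelForm_eq ha
  · obtain ⟨g⟩ := HermitianMetric.nonempty T.bundle
    obtain ⟨D', ha⟩ := exists_isAdjointConnection g T.conn
    rw [KTriple.liftK_toK, hC T g D' ha]
    exact (T.borelForm_eq ha).symm

variable {φ : FreeMultK n M →+ FormField n M} {B : FreeMultK n M →+ FormsModExact n M}

/-- A representative of the Borel class of a triple. -/
theorem IsBorelClass.exists_representative (hφ : IsChernCharacter φ) (hB : IsBorelClass B)
    (T : KTriple n M) : ∃ γ ∈ oddForms n M, formClass γ = B T.toK ∧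
      formClass (FormField.conj γ) = -formClass γ ∧
      γ.extD = φ T.toK - FormField.conj (φ T.toK) := by
  obtain ⟨α, hα, h⟩ := T.exists_form
  obtain ⟨g⟩ := HermitianMetric.nonempty T.bundle
  obtain ⟨D', ha⟩ := exists_isAdjointConnection g T.conn
  have hD := T.conn.isConnOp
  have hD' := D'.isConnOp
  have ha' : g.IsAdjointOp T.conn.toFun D'.toFun := ha
  have hcs := hD'.chernSimons_mem hD
  have hα' := conj_mem_oddForms hα
  refine ⟨T.bundle.chernSimons D'.toFun T.conn.toFun - α + FormField.conj α,
    Submodule.add_mem _ (Submodule.sub_mem _ hcs hα) hα', ?_, ?_, ?_⟩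
  · simp only [hB T g D' ha, ← h, formClass_conj, formClass_add, formClass_sub]
  · exact HermitianMetric.formClass_conj_representative hD ha' α
  · rw [hφ T α hα h]
    exact HermitianMetric.extD_representative hD ha' hα

/-- The values are purely imaginary: a representative `γ` can be replaced by `(γ - γ̄) / 2`. -/
theorem IsBorelClass.mem_imaginary (hφ : IsChernCharacter φ) (hB : IsBorelClass B)
    (x : FreeMultK n M) : B x ∈ imaginaryOddClasses n M := by
  refine KTriple.mem_of_toK ((imaginaryOddClasses n M).comap B) (fun T ↦ ?_) x
  obtain ⟨γ, hγ, h1, h2, -⟩ := hB.exists_representative hφ T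
  refine ⟨(2 * Complex.I)⁻¹ • (γ - FormField.conj γ),
    ⟨Submodule.smul_mem _ _ (Submodule.sub_mem _ hγ (conj_mem_oddForms hγ)), ?_⟩, ?_⟩
  · rw [LinearMap.map_smulₛₗ, map_sub, FormField.conj_conj, ← neg_sub γ, smul_neg, ← neg_smul]
    congr 1
    simp [map_ofNat]
  · change Complex.I • formClass ((2 * Complex.I)⁻¹ • (γ - FormField.conj γ)) = B T.toK
    rw [map_smul, map_sub, h2, sub_neg_eq_add, ← two_smul ℂ (formClass γ), smul_smul, smul_smul,
      ← h1]
    have : Complex.I * (2 * Complex.I)⁻¹ * 2 = 1 := by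
      field_simp [Complex.I_ne_zero]
    rw [this, one_smul]

theorem FormField.two_I_smul_im (α : FormField n M) :
    (2 * Complex.I) • α.im = α - FormField.conj α := by
  rw [FormField.im, smul_smul, mul_one_div_cancel (by simp), one_smul]

/-- The differential of the Borel class is `2i` times the imaginary part of the Chern character. -/
theorem IsBorelClass.extD_eq (hφ : IsChernCharacter φ) (hB : IsBorelClass B) (x : FreeMultK n M)
    {β : FormField n M} (hβ : β ∈ oddForms n M) (h : formClass β = B x) :
    β.extD = (2 * Complex.I) • FormField.im (φ x) := by
  -- the elements for which some odd representative has the right differential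
  let H : AddSubgroup (FreeMultK n M) :=
    { carrier := {x | ∃ γ ∈ oddForms n M, formClass γ = B x ∧
        γ.extD = φ x - FormField.conj (φ x)}
      add_mem' := by
        rintro a b ⟨γ, hγ, h1, h2⟩ ⟨δ, hδ, h3, h4⟩
        refine ⟨γ + δ, Submodule.add_mem _ hγ hδ,
          (formClass_add γ δ).trans ((congrArg₂ (· + ·) h1 h3).trans (B.map_add _ _).symm), ?_⟩
        rw [FormField.extD_add hγ.1 hδ.1, h2, h4, φ.map_add, map_add FormField.conj, add_sub_add_comm]
      zero_mem' := ⟨0, Submodule.zero_mem _, formClass_zero.trans B.map_zero.symm, by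
        rw [FormField.extD_zero, φ.map_zero, map_zero (FormField.conj (n := n) (M := M)), sub_zero]⟩
      neg_mem' := by
        rintro a ⟨γ, hγ, h1, h2⟩
        refine ⟨-γ, Submodule.neg_mem _ hγ, (formClass_neg γ).trans ((congrArg _ h1).trans (B.map_neg _).symm), ?_⟩
        rw [FormField.extD_neg hγ.1, h2, φ.map_neg, map_neg FormField.conj, neg_sub_neg, neg_sub] }
  obtain ⟨γ, hγ, h1, h2⟩ := KTriple.mem_of_toK H (fun T ↦ by
    obtain ⟨γ, hγ, h1, -, h2⟩ := hB.exists_representative hφ T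
    exact ⟨γ, hγ, h1, h2⟩) x
  rw [FormField.two_I_smul_im, ← h2]
  exact extD_eq_of_formClass_eq hβ hγ (h.trans h1.symm)

theorem FormField.conj_intCast (m : ℤ) : FormField.conj (m : FormField n M) = m := by
  funext x
  change CForms.conj ((m : CForms (TangentSpace (𝓡 n) x))) = (m : CForms (TangentSpace (𝓡 n) x))
  rw [← zsmul_one, map_zsmul, CForms.conj_one]

theorem CBundle.ch_of_isFlat {E : CBundle n M} {D : E.Op} (hF : E.IsFlat D) : E.ch D = ((E.rank : ℤ) : FormField n M) := by
  rw [ch_eq, Finset.sum_range_succ', Finset.sum_eq_zero fun k _ ↦ by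
    rw [chernPow_flat hF, smul_zero], zero_add, chernPow_zero]
  funext x
  change (chernConst ^ 0 / (Nat.factorial 0 : ℂ)) •
    algebraMap ℂ (CForms (TangentSpace (𝓡 n) x)) (E.rank : ℂ) =
    ((E.rank : ℤ) : CForms (TangentSpace (𝓡 n) x))
  simp

theorem IsChernCharacter.toK_mem_MK0 {E : CBundle n M} (hφ : IsChernCharacter φ)
    (D : Connection E) (hF : E.IsFlat D.toFun) : (⟨E, D, 0⟩ : KTriple n M).toK ∈ MK0 φ := by
  have h1 := hφ ⟨E, D, 0⟩ 0 (Submodule.zero_mem _) formClass_zero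
  have h2 : E.ch D.toFun - (0 : FormField n M).extD = ((E.rank : ℤ) : FormField n M) :=
    (congrArg (E.ch D.toFun - ·) FormField.extD_zero).trans
      ((sub_zero _).trans (CBundle.ch_of_isFlat hF))
  exact ⟨(E.rank : ℤ), (h1.trans h2).symm⟩

/-- On multiplicative K-theory the Chern character is a real constant, hence the imaginary
representative is closed. -/
theorem IsBorelClass.mem_iRealOddCohomology (hφ : IsChernCharacter φ) (hB : IsBorelClass B)
    {x : FreeMultK n M} (hx : x ∈ MK0 φ) : B x ∈ iRealOddCohomology n M := by
  obtain ⟨β, hβ, h⟩ := hB.mem_imaginary hφ x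
  obtain ⟨m, hm⟩ := hx
  refine ⟨β, ⟨hβ, ?_⟩, h⟩
  have h1 : formClass (Complex.I • β) = B x := (_root_.map_smul _ _ _).trans h
  have h2 := hB.extD_eq hφ x (Submodule.smul_mem _ _ hβ.1) h1
  have hm' : φ x = (m : FormField n M) := hm.symm
  rw [FormField.two_I_smul_im, hm', FormField.conj_intCast, sub_self,
    FormField.extD_smul _ hβ.1.1] at h2
  exact (smul_eq_zero.1 h2).resolve_left Complex.I_ne_zero

end

/-! ### Bismut-Lott classes -/

section BismutLott

variable {E : CBundle n M} {D D' : E.Op}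

/-- The constant relating a Bismut-Lott form to a Chern-Simons form. -/
def bismutLottConst (j : ℕ) : ℂ :=
  ((2 * Real.pi * Complex.I) ^ j * 2 ^ (2 * j + 1))⁻¹ *
    -((-1) ^ j * (((2 * j + 1).factorial : ℂ) / (j.factorial : ℂ) ^ 2))

/-- The adjoint of a flat connection is flat, and the Chern-Simons forms of a segment between flat
connections are multiples of `Tr (θ^(2j+1))`. -/
theorem CBundle.IsConnOp.bismutLott_eq_smul (hD : IsConnOp D) (hD' : IsConnOp D')
    (hF : E.IsFlat D) (hF' : E.IsFlat D') (j : ℕ) :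
    E.bismutLott D D' j = bismutLottConst j • csPow D' D j := by
  rw [bismutLott_eq, csPow_flat hD' hD hF' hF, tracePow_symm D D', smul_neg, smul_neg, smul_smul,
    ← neg_smul]
  refine congrArg (· • tracePow D D' j) ?_
  have h1 : ((j.factorial : ℕ) : ℂ) ≠ 0 := Nat.cast_ne_zero.2 (Nat.factorial_ne_zero j)
  have h2 : (((2 * j + 1).factorial : ℕ) : ℂ) ≠ 0 := Nat.cast_ne_zero.2 (Nat.factorial_ne_zero _)
  have h3 : ((-1 : ℂ) ^ j) * (-1) ^ j = 1 := by rw [← mul_pow]; norm_num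
  rw [bismutLottConst]
  have h4 : -((-1 : ℂ) ^ j * (((2 * j + 1).factorial : ℂ) / (j.factorial : ℂ) ^ 2)) *
      ((-1) ^ j * ((j.factorial : ℂ) ^ 2 / ((2 * j + 1).factorial : ℂ))) =
      -(((-1 : ℂ) ^ j) * (-1) ^ j) := by field_simp
  rw [mul_assoc (_⁻¹), h4, h3, mul_neg_one, neg_neg]

theorem conj_bismutLottConst (j : ℕ) :
    starRingEnd ℂ (bismutLottConst j) = (-1) ^ j * bismutLottConst j := by
  simp only [bismutLottConst, map_mul, map_inv₀, map_pow, map_neg, map_div₀, Complex.conj_natCast,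
    Complex.conj_I, Complex.conj_ofReal, map_ofNat, map_one, mul_neg, neg_pow (2 * (Real.pi : ℂ) * Complex.I)]
  rw [mul_inv, mul_inv, mul_inv, show ((-1 : ℂ) ^ j)⁻¹ = (-1) ^ j by
    rw [← inv_pow, inv_neg, inv_one]]
  ring

variable {h : HermitianMetric E}

/-- The Bismut-Lott forms are real, because conjugation exchanges `∇` and `∇*`, and closed, because
they transgress Chern-Weil forms which vanish. -/
theorem bismutLott_mem (hD : IsConnOp D) (ha : h.IsAdjointOp D D') (hF : E.IsFlat D) (j : ℕ) :
    E.bismutLott D D' j ∈ closedRealOddForms n M := by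
  have hD' := ha.isConnOp hD
  have hF' := ha.isFlat hD hF
  have hm := hD'.csPow_mem hD j
  have he := hD.bismutLott_eq_smul hD' hF hF' j
  have hanti : csPow D D' j = -csPow D' D j := by
    rw [csPow_flat hD hD' hF hF', csPow_flat hD' hD hF' hF, tracePow_symm D' D, smul_neg]
  rw [he]
  refine ⟨⟨Submodule.smul_mem _ _ hm, ?_⟩, ?_⟩
  · rw [LinearMap.map_smulₛₗ, HermitianMetric.conj_csPow hD' hD hD hD' ha.symm ha, hanti, smul_neg,
      smul_neg, conj_bismutLottConst, smul_smul, ← neg_smul]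
    congr 1
    have h3 : ((-1 : ℂ) ^ j) * (-1) ^ j = 1 := by rw [← mul_pow]; norm_num
    rw [pow_succ]
    linear_combination (bismutLottConst j) * h3
  · have h1 := hD'.extD_csPow hD j
    rw [chernPow_flat hF, chernPow_flat hF', sub_zero] at h1
    have h2 := (smul_eq_zero.1 h1).resolve_left (Nat.cast_add_one_ne_zero j)
    rw [FormField.extD_smul _ hm.1, h2, smul_zero]

theorem formClass_bismutLott_eq {h₁ h₂ : HermitianMetric E} {D₁ D₂ : E.Op} (hD : IsConnOp D)
    (ha₁ : h₁.IsAdjointOp D D₁) (ha₂ : h₂.IsAdjointOp D D₂) (hF : E.IsFlat D) (j : ℕ) :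
    formClass (E.bismutLott D D₁ j) = formClass (E.bismutLott D D₂ j) := by
  rw [hD.bismutLott_eq_smul (ha₁.isConnOp hD) hF (ha₁.isFlat hD hF),
    hD.bismutLott_eq_smul (ha₂.isConnOp hD) hF (ha₂.isFlat hD hF), map_smul, map_smul,
    HermitianMetric.formClass_csPow_eq hD ha₁ ha₂]

theorem formClass_chernSimons_bismutLott (hD : IsConnOp D) (ha : h.IsAdjointOp D D')
    (hF : E.IsFlat D) : formClass (E.chernSimons D' D) = ∑ j ∈ Finset.range (n + 1),
      ((2 ^ (2 * j) * j.factorial / (2 * j + 1).factorial : ℂ) / (Real.pi * Complex.I)) •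
        formClass (E.bismutLott D D' j) := by
  have hD' := ha.isConnOp hD
  rw [hD'.formClass_chernSimons hD]
  refine Finset.sum_congr rfl fun j _ ↦ ?_
  rw [hD.bismutLott_eq_smul hD' hF (ha.isFlat hD hF), map_smul, smul_smul]
  congr 1
  have h1 : ((j.factorial : ℕ) : ℂ) ≠ 0 := Nat.cast_ne_zero.2 (Nat.factorial_ne_zero j)
  have h2 : (((2 * j + 1).factorial : ℕ) : ℂ) ≠ 0 := Nat.cast_ne_zero.2 (Nat.factorial_ne_zero _)
  have h3 : (Real.pi : ℂ) ≠ 0 := Complex.ofReal_ne_zero.2 Real.pi_ne_zero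
  have h4 := Complex.I_ne_zero
  rw [bismutLottConst, chernConst, neg_div, neg_pow, div_pow, one_pow, pow_succ (-1 : ℂ),
    pow_succ (2 * (Real.pi : ℂ) * Complex.I), pow_succ (2 : ℂ) (2 * j)]
  field_simp

end BismutLott

end KTheoryMaps

end

theorem mainTheorem4 (n : ℕ) (M : Type*) [TopologicalSpace M] [T2Space M] [SigmaCompactSpace M]
    [ChartedSpace (EuclideanSpace ℝ (Fin n)) M] [IsManifold (𝓡 n) ∞ M] :
    -- every bundle has a hermitian metric, every connection an adjoint transpose
    (∀ E : CBundle n M, Nonempty (HermitianMetric E)) ∧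
    (∀ (E : CBundle n M) (h : HermitianMetric E) (D : Connection E),
      ∃ D' : Connection E, IsAdjointConnection h D D') ∧
    -- independence of the metric, modulo exact forms
    (∀ (E : CBundle n M) (D : Connection E) (h₁ h₂ : HermitianMetric E) (D₁ D₂ : Connection E),
      IsAdjointConnection h₁ D D₁ → IsAdjointConnection h₂ D D₂ →
        formClass (E.chernSimons D₁.toFun D.toFun) =
          formClass (E.chernSimons D₂.toFun D.toFun)) ∧
    -- the Chern character and the Borel-type class are well defined on the K-group
    (∃! φ : FreeMultK n M →+ FormField n M, IsChernCharacter φ) ∧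
    (∃! B : FreeMultK n M →+ FormsModExact n M, IsBorelClass B) ∧
    ∀ (φ : FreeMultK n M →+ FormField n M) (B : FreeMultK n M →+ FormsModExact n M),
      IsChernCharacter φ → IsBorelClass B →
      (∀ x, φ x ∈ evenForms n M) ∧
      -- values in the purely imaginary odd forms modulo exact forms
      (∀ x, B x ∈ imaginaryOddClasses n M) ∧
      -- `dB = 2i Im ch`
      (∀ x, ∀ β ∈ oddForms n M, formClass β = B x →
        FormField.extD β = (2 * Complex.I) • FormField.im (φ x)) ∧
      -- multiplicative K-theory is sent into `i H^odd(M, ℝ)`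
      (∀ x ∈ MK0 φ, B x ∈ iRealOddCohomology n M) ∧
      -- flat bundles: the Bismut-Lott classes
      (∀ (E : CBundle n M) (D : Connection E), E.IsFlat D.toFun →
        (⟨E, D, 0⟩ : KTriple n M).toK ∈ MK0 φ ∧
        (∀ (h : HermitianMetric E) (D' : Connection E), IsAdjointConnection h D D' →
          (∀ j : ℕ, E.bismutLott D.toFun D'.toFun j ∈ closedRealOddForms n M ∧
            ∀ x, E.bismutLott D.toFun D'.toFun j x ∈
              CForms.degree (TangentSpace (𝓡 n) x) (2 * j + 1)) ∧
          B (⟨E, D, 0⟩ : KTriple n M).toK = ∑ j ∈ Finset.range (n + 1),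
            ((2 ^ (2 * j) * j.factorial / (2 * j + 1).factorial : ℂ) /
              (Real.pi * Complex.I)) • formClass (E.bismutLott D.toFun D'.toFun j)) ∧
        (∀ (h₁ h₂ : HermitianMetric E) (D₁ D₂ : Connection E),
          IsAdjointConnection h₁ D D₁ → IsAdjointConnection h₂ D D₂ → ∀ j : ℕ,
            formClass (E.bismutLott D.toFun D₁.toFun j) =
              formClass (E.bismutLott D.toFun D₂.toFun j))) := by
  refine ⟨HermitianMetric.nonempty, fun E h D ↦ exists_isAdjointConnection h D,
    fun E D h₁ h₂ D₁ D₂ ha₁ ha₂ ↦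
      HermitianMetric.formClass_chernSimons_eq D.isConnOp (h₁ := h₁) (h₂ := h₂) ha₁ ha₂,
    existsUnique_chernCharacter, existsUnique_borelClass, fun φ B hφ hB ↦
    ⟨hφ.mem_evenForms, hB.mem_imaginary hφ, fun x β hβ h ↦ hB.extD_eq hφ x hβ h,
      fun x hx ↦ hB.mem_iRealOddCohomology hφ hx, fun E D hF ↦ ⟨?_, fun h D' ha ↦ ⟨fun j ↦ ⟨?_, ?_⟩,
      ?_⟩, fun h₁ h₂ D₁ D₂ ha₁ ha₂ j ↦
        formClass_bismutLott_eq D.isConnOp (h₁ := h₁) (h₂ := h₂) ha₁ ha₂ hF j⟩⟩⟩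
  · exact hφ.toK_mem_MK0 D hF
  · exact bismutLott_mem (h := h) D.isConnOp ha hF j
  · exact fun x ↦ Submodule.smul_mem _ _ (CBundle.tracePow_mem_degree D.toFun D'.toFun j x)
  · refine (hB ⟨E, D, 0⟩ h D' ha).trans
      (Eq.trans ?_ (formClass_chernSimons_bismutLott (h := h) D.isConnOp ha hF))
    exact sub_zero_add_of_eq_zero _ (map_zero (FormsModExact.conj (n := n) (M := M)))
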